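/- **Setting.** Let $\Gamma$ be a group, $B$ a commutative $*$-algebra over $\mathbb C$ with local units, on which $\Gamma$ acts by $*$-automorphisms, and let $A$ be a $(B,\Gamma)^{ev}$-algebra: a $*$-algebra with a $\Gamma\times\Gamma$-grading $A=\bigoplus A_{\gamma,\gamma'}$, $A_{\gamma,\gamma'}A_{\delta,\delta'}\subseteq A_{\gamma\delta,\gamma'\delta'}$, $A_{\gamma,\gamma'}^*=A_{\gamma^{-1},\gamma'^{-1}}$, with local units in $A_{e,e}$, and with commuting $*$-homomorphisms $r,s\colon B\to M(A)$ into the multiplier algebra such that $r(b),s(b)$ preserve the grading, $xr(b)=r(\gamma(b))x$ and $xs(b)=s(\gamma'(b))x$ for $x\in A_{\gamma,\gamma'}$, and $B$ contains local units for $A$. Let $A\tilde\otimes A$ be the quotient of $\sum_{\gamma,\gamma',\gamma''}A_{\gamma,\gamma'}\otimes A_{\gamma',\gamma''}$ by the relations $s(b)x\otimes y=x\otimes r(b)y$. Assume that $A$ underlies a measured multiplier $(B,\Gamma)$-Hopf $*$-algebroid, that is, that we are given: * a coassociative non-degenerate $*$-homomorphism $\Delta\colon A\to M(A\tilde\otimes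 A)$ that preserves degrees, satisfies $\Delta(r(b)a)=(r(b)\tilde\otimes1)\Delta(a)$ and $\Delta(s(b)a)=(1\tilde\otimes s(b))\Delta(a)$, and is such that $\Delta(a)(x\tilde\otimes1)$, $(x\tilde\otimes1)\Delta(a)$, $\Delta(a)(1\tilde\otimes y)$, $(1\tilde\otimes y)\Delta(a)$ lie in $A\tilde\otimes A$ for $x\in A_{\gamma,e}$, $y\in A_{e,\gamma}$; write $\Delta(a)=\sum a_{(1)}\otimes a_{(2)}$; * a counit $\epsilon\colon A\to B\rtimes\Gamma$ (a non-degenerate $*$-homomorphism with $\epsilon(A_{\gamma,\gamma'})\subseteq B\gamma$ if $\gamma=\gamma'$ and $\epsilon(A_{\gamma,\gamma'})=0$ otherwise, $\epsilon(r(b)x)=b\,\epsilon(x)=\epsilon(s(b)x)$ and $(\epsilon\tilde\otimes\mathrm{id})\Delta=\mathrm{id}=(\mathrm{id}\tilde\otimes\epsilon)\Delta$), and an antipode $S$, a linear bijection of $A$ that reverses products and coproducts, with $S(A_{\gamma,\gamma'})\subseteq A_{\gamma'^{-1},\gamma^{-1}}$, $S(r(b)x)=S(x)s(b)$, $S(s(b)x)=S(x)r(b)$,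 $\sum S(x_{(1)})x_{(2)}y=s(\epsilon^\flat(x))y$ and $\sum xy_{(1)}S(y_{(2)})=x\,r(\epsilon^\sharp(y))$, where $\epsilon^\sharp(x)=\sum_\gamma b_\gamma$ and $\epsilon^\flat(x)=\sum_\gamma\gamma^{-1}(b_\gamma)$ if $\epsilon(x)=\sum_\gamma b_\gamma\gamma$; * a faithful positive functional $\mu$ on $B$ with a family $(D_\gamma)_{\gamma\in\Gamma}$ in $M(B)$ such that $\mu(\gamma(bD_\gamma))=\mu(b)$ for all $b\in B$; * a surjective left integral $\phi\colon A\to B$ and a surjective right integral $\psi\colon A\to B$ (so $\phi(r(b)xr(c))=b\phi(x)c$, $\phi(A_{\gamma,\gamma'})=0$ for $\gamma\ne e$, $(\mathrm{id}\tilde\otimes\phi)\Delta=r\circ\phi$, and $\psi(s(b)xs(c))=b\psi(x)c$, $\psi(A_{\gamma,\gamma'})=0$ for $\gamma'\neq e$, $(\psi\tilde\otimes\mathrm{id})\Delta=s\circ\psi$) such that $\nu:=\mu\circ\phi=\mu\circ\psi$ is positive and faithful. Assume moreover that for every $b\in B$ there is $C\ge0$ with $\mu(c^*b^*bc)\le C\mu(c^*c)$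 for all $c\in B$, and let $(D_\gamma^{1/2})_{\gamma}$ be a family in $M(B)$ with $D^{1/2}_e=1$, $(D^{1/2}_\gamma)^*=D^{1/2}_\gamma$, $(D_\gamma^{1/2})^2=D_\gamma$, $D^{1/2}_{\gamma\gamma'}=\gamma'^{-1}(D^{1/2}_\gamma)D^{1/2}_{\gamma'}$ and $\mu(c^*D^{1/2}_\gamma c)\ge0$ for all $\gamma,\gamma'\in\Gamma$, $c\in B$. For $a\in A_{\gamma,\gamma'}$ put $D^{1/2}(a)=r(D^{1/2}_{\gamma^{-1}})a$ and $\bar D^{1/2}(a)=s(D^{1/2}_{\gamma'^{-1}})a$, and extend linearly. **Hilbert spaces and modules.** Let $\Lambda_\mu\colon B\to K$ and $\Lambda_\nu\colon A\to H$ be the canonical maps into the completions with respect to $\langle b|b'\rangle=\mu(b^*b')$ and $\langle a|a'\rangle=\nu(a^*a')$; let $\pi_\mu(b)\Lambda_\mu(c)=\Lambda_\mu(bc)$. Write $[\,\cdot\,]$ for closed linear spans and $\mathfrak B=[\pi_\mu(B)]\subseteq\mathcal L(K)$. Let $\Lambda_\phi(x),\Lambda_\psi(x),\Lambda_\phi^\dagger(x),\Lambda_\psi^\dagger(x)\in\mathcal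 L(K,H)$ be the operators that map $\Lambda_\mu(b)$ to $\Lambda_\nu(xr(b))$, $\Lambda_\nu(xs(b))$, $\Lambda_\nu(r(b)x)$, $\Lambda_\nu(s(b)x)$, respectively, and $E_\phi=[\Lambda_\phi(A)]$, $E_\psi=[\Lambda_\psi(A)]$, $E_\phi^\dagger=[\Lambda_\phi^\dagger(A)]$, $E_\psi^\dagger=[\Lambda_\psi^\dagger(A)]$. A $C^*$-module over $\mathfrak b=(K,\mathfrak B,\mathfrak B)$ is a Hilbert space $L$ with a closed subspace $E\subseteq\mathcal L(K,L)$ such that $[EK]=L$, $[E\mathfrak B]=E$, $[E^*E]=\mathfrak B$; let $\rho_E\colon\mathfrak B\to\mathcal L(L)$ be given by $\rho_E(b)\xi=\xi b$ for $\xi\in E$. Several module structures on $L$ are compatible if $[\rho_E(\mathfrak B)F]=F$ for any two distinct ones $E,F$. The relative tensor product $L\,{}_E\!\otimes_F M$ of $(L,E)$ and $(M,F)$ is the separated completion of $E\otimes K\otimes F$ for $\langle\xi\otimes\zeta\otimes\eta|\xi'\otimes\zeta'\otimes\eta'\rangle=\langle\zeta|(\xi^*\xi')(\eta^*\eta')\zeta'\rangle$,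 with operators $|\xi\rangle_1\colon M\to L\,{}_E\!\otimes_F M$, $\eta\zeta\mapsto\xi\otimes\zeta\otimes\eta$, and $|\eta\rangle_2\colon L\to L\,{}_E\!\otimes_F M$, $\xi\zeta\mapsto\xi\otimes\zeta\otimes\eta$, and adjoints $\langle\xi|_1,\langle\eta|_2$. A $C^*$-pseudo-multiplicative unitary over $\mathfrak b$ on $L$ with compatible modules $(\hat\beta,\alpha,\beta)$ is a unitary $U\colon L\,{}_{\hat\beta}\!\otimes_\alpha L\to L\,{}_\alpha\!\otimes_\beta L$ with $$U[|\alpha\rangle_2\alpha]=[|\alpha\rangle_1\alpha],\quad U[|\hat\beta\rangle_1\beta]=[|\beta\rangle_2\hat\beta],\quad U[|\hat\beta\rangle_1\hat\beta]=[|\alpha\rangle_1\hat\beta],\quad U[|\alpha\rangle_2\beta]=[|\beta\rangle_2\beta]$$ such that the resulting operators on threefold relative tensor products satisfy the pentagon equation $U_{12}U_{13}U_{23}=U_{23}U_{12}$. It is regular if $[\langle\alpha|_1U|\alpha\rangle_2]=[\alpha\alpha^*]$. **Theorem.** There are unitaries $$W\colon H\,{}_{E_\psi^\dagger}\!\otimes_{E_\phi^\dagger}H\to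 H\,{}_{E_\phi^\dagger}\!\otimes_{E_\phi}H,\qquad V\colon H\,{}_{E_\psi}\!\otimes_{E_\psi^\dagger}H\to H\,{}_{E_\psi^\dagger}\!\otimes_{E_\phi^\dagger}H$$ given, for all $x,y\in A$, by $$W^*|\Lambda_\phi^\dagger(x)\rangle_1\Lambda_\nu(y)=\sum|\Lambda_\psi^\dagger(y_{(1)}x)\rangle_1\Lambda_\nu(D^{1/2}(y_{(2)})),\qquad V|\Lambda_\psi(x)\rangle_1\Lambda_\nu(y)=\sum|\Lambda_\psi^\dagger(\bar D^{1/2}(x_{(1)}))\rangle_1\Lambda_\nu(x_{(2)}y).$$ $W$ is a $C^*$-pseudo-multiplicative unitary over $\mathfrak b$ with modules $(\hat\beta,\alpha,\beta)=(E_\psi^\dagger,E_\phi^\dagger,E_\phi)$, and $V$ is one with modules $(\hat\beta,\alpha,\beta)=(E_\psi,E_\psi^\dagger,E_\phi^\dagger)$. In particular $$W[|E_\psi^\dagger\rangle_1E_\phi]=[|E_\phi\rangle_2E_\psi^\dagger],\quad W[|E_\phi^\dagger\rangle_2E_\phi]=[|E_\phi\rangle_2E_\phi],\quad W[|E_\phi^\dagger\rangle_2E_\phi^\dagger]=[|E_\phi^\dagger\rangle_1E_\phi^\dagger],\quad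 W[|E_\psi^\dagger\rangle_1E_\psi^\dagger]=[|E_\phi^\dagger\rangle_1E_\psi^\dagger],$$ and moreover $$W[|E_\phi^\dagger\rangle_2E_\psi]=[|E_\phi\rangle_2E_\psi],\qquad W[|E_\psi^\dagger\rangle_1E_\psi]=[|E_\phi^\dagger\rangle_1E_\psi].$$ Both are regular: $[\langle E_\phi^\dagger|_1W|E_\phi^\dagger\rangle_2]=[E_\phi^\dagger(E_\phi^\dagger)^*]$ and $[\langle E_\psi^\dagger|_1V|E_\psi^\dagger\rangle_2]=[E_\psi^\dagger(E_\psi^\dagger)^*]$ in $\mathcal L(H)$. -/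

import Mathlib

open scoped TensorProduct ComplexOrder

set_option linter.unusedSectionVars false

noncomputable section

namespace DynQG

/-! ## Multipliers of a non-unital `ℂ`-algebra -/

section Multiplier

variable (C : Type*) [NonUnitalRing C] [Module ℂ C] [IsScalarTower ℂ C C] [SMulCommClass ℂ C C]

/-- The multiplier algebra `M(C)`: pairs `T = (a ↦ T a, a ↦ a T)` of a right and a left `C`-module
map such that `(a T) c = a (T c)`. The second component lives in the opposite algebra, because
`a (T T') = (a T) T'`. -/
def multSubalgebra : Subalgebra ℂ (Module.End ℂ C × (Module.End ℂ C)ᵐᵒᵖ) where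
  carrier := {T | (∀ x y, T.1 (x * y) = T.1 x * y) ∧
    (∀ x y, T.2.unop (x * y) = x * T.2.unop y) ∧ ∀ x y, T.2.unop x * y = x * T.1 y}
  mul_mem' := by
    rintro S T ⟨h1, h2, h3⟩ ⟨k1, k2, k3⟩
    refine ⟨fun x y => ?_, fun x y => ?_, fun x y => ?_⟩
    · simp [k1, h1]
    · simp [k2, h2]
    · simp [k3, h3]
  add_mem' := by
    rintro S T ⟨h1, h2, h3⟩ ⟨k1, k2, k3⟩
    refine ⟨fun x y => ?_, fun x y => ?_, fun x y => ?_⟩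
    · simp [k1, h1, add_mul]
    · simp [k2, h2, mul_add]
    · simp [k3, h3, add_mul, mul_add]
  algebraMap_mem' c := by
    refine ⟨fun x y => ?_, fun x y => ?_, fun x y => ?_⟩ <;>
      simp [Algebra.algebraMap_eq_smul_one, smul_mul_assoc, mul_smul_comm]

/-- The multiplier algebra as a type. -/
abbrev Mult : Type _ := ↥(multSubalgebra C)

variable {C}

/-- Left multiplication `lact T a = T a` by a multiplier. -/
def lact (T : Mult C) : C →ₗ[ℂ] C := T.1.1

/-- Right multiplication `ract T a = a T` by a multiplier. -/
def ract (T : Mult C) : C →ₗ[ℂ] C := T.1.2.unop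

theorem lact_mul (T : Mult C) (x y : C) : lact T (x * y) = lact T x * y := T.2.1 x y

theorem ract_mul (T : Mult C) (x y : C) : ract T x * y = x * lact T y := T.2.2.2 x y

variable [StarRing C] [StarModule ℂ C]

/-- The linear map `a ↦ f(a^*)^*`. -/
def starConj (f : C →ₗ[ℂ] C) : C →ₗ[ℂ] C where
  toFun a := star (f (star a))
  map_add' a c := by simp
  map_smul' z a := by simp

/-- The involution of `M(C)`: `T^* a = (a^* T)^*` and `a T^* = (T a^*)^*`. -/
instance : Star (Mult C) where
  star T := ⟨(starConj (ract T), MulOpposite.op (starConj (lact T))), by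
    obtain ⟨T, h1, h2, h3⟩ := T
    refine ⟨fun x y => ?_, fun x y => ?_, fun x y => ?_⟩
    · simp [starConj, ract, h2]
    · simp [starConj, lact, h1]
    · simp only [starConj, lact, ract, MulOpposite.unop_op, LinearMap.coe_mk, AddHom.coe_mk]
      apply star_injective
      simp [h3]⟩

theorem ract_star (T : Mult C) (x : C) : ract (star T) (star x) = star (lact T x) := by
  change star (lact T (star (star x))) = _
  rw [star_star]

end Multiplier

/-! ## Quotients of `*`-algebras -/

section Quotient

variable (R : Type*) [NonUnitalRing R] [Module ℂ R] [IsScalarTower ℂ R R] [SMulCommClass ℂ R R]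
  [StarRing R] [StarModule ℂ R]

/-- A two-sided `*`-ideal of a non-unital `*`-algebra. -/
structure StarIdeal where
  carrier : Submodule ℂ R
  mul_mem_left : ∀ x, ∀ j ∈ carrier, x * j ∈ carrier
  mul_mem_right : ∀ x, ∀ j ∈ carrier, j * x ∈ carrier
  star_mem : ∀ j ∈ carrier, star j ∈ carrier

variable {R}

/-- The quotient of a `*`-algebra by a `*`-ideal. -/
def StarIdeal.Quot (I : StarIdeal R) : Type _ := R ⧸ I.carrier

namespace StarIdeal

variable (I : StarIdeal R)

instance : AddCommGroup I.Quot := inferInstanceAs (AddCommGroup (R ⧸ I.carrier))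
instance : Module ℂ I.Quot := inferInstanceAs (Module ℂ (R ⧸ I.carrier))

/-- The quotient map. -/
def proj : R →ₗ[ℂ] I.Quot := I.carrier.mkQ

theorem proj_surjective : Function.Surjective I.proj := Submodule.mkQ_surjective _

theorem proj_eq_iff {x y : R} : I.proj x = I.proj y ↔ x - y ∈ I.carrier :=
  Submodule.Quotient.eq _

instance : Mul I.Quot where
  mul := Quotient.map₂ (· * ·) (by
    intro a b hab c d hcd
    have h1 : a - b ∈ I.carrier := (Submodule.quotientRel_def _).1 hab
    have h2 : c - d ∈ I.carrier := (Submodule.quotientRel_def _).1 hcd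
    refine (Submodule.quotientRel_def _).2 ?_
    have : a * c - b * d = (a - b) * c + b * (c - d) := by noncomm_ring
    rw [this]
    exact add_mem (I.mul_mem_right _ _ h1) (I.mul_mem_left _ _ h2))

instance : Star I.Quot where
  star := Quotient.map star (by
    intro a b hab
    have h1 : a - b ∈ I.carrier := (Submodule.quotientRel_def _).1 hab
    refine (Submodule.quotientRel_def _).2 ?_
    rw [← star_sub]
    exact I.star_mem _ h1)

theorem proj_mul (x y : R) : I.proj (x * y) = I.proj x * I.proj y := rfl

theorem proj_star (x : R) : I.proj (star x) = star (I.proj x) := rfl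

instance : NonUnitalRing I.Quot where
  left_distrib := by
    intro a b c
    obtain ⟨a, rfl⟩ := I.proj_surjective a
    obtain ⟨b, rfl⟩ := I.proj_surjective b
    obtain ⟨c, rfl⟩ := I.proj_surjective c
    simp only [← proj_mul, ← map_add, mul_add]
  right_distrib := by
    intro a b c
    obtain ⟨a, rfl⟩ := I.proj_surjective a
    obtain ⟨b, rfl⟩ := I.proj_surjective b
    obtain ⟨c, rfl⟩ := I.proj_surjective c
    simp only [← proj_mul, ← map_add, add_mul]
  zero_mul := by
    intro a
    obtain ⟨a, rfl⟩ := I.proj_surjective a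
    rw [← map_zero I.proj, ← proj_mul, zero_mul]
  mul_zero := by
    intro a
    obtain ⟨a, rfl⟩ := I.proj_surjective a
    rw [← map_zero I.proj, ← proj_mul, mul_zero]
  mul_assoc := by
    intro a b c
    obtain ⟨a, rfl⟩ := I.proj_surjective a
    obtain ⟨b, rfl⟩ := I.proj_surjective b
    obtain ⟨c, rfl⟩ := I.proj_surjective c
    simp only [← proj_mul, mul_assoc]

instance : IsScalarTower ℂ I.Quot I.Quot where
  smul_assoc := by
    intro z a b
    obtain ⟨a, rfl⟩ := I.proj_surjective a
    obtain ⟨b, rfl⟩ := I.proj_surjective b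
    simp only [smul_eq_mul, ← map_smul, ← proj_mul, smul_mul_assoc]

instance : SMulCommClass ℂ I.Quot I.Quot where
  smul_comm := by
    intro z a b
    obtain ⟨a, rfl⟩ := I.proj_surjective a
    obtain ⟨b, rfl⟩ := I.proj_surjective b
    simp only [smul_eq_mul, ← map_smul, ← proj_mul, mul_smul_comm]

instance : StarRing I.Quot where
  star_involutive := by
    intro a
    obtain ⟨a, rfl⟩ := I.proj_surjective a
    simp only [← proj_star, star_star]
  star_mul := by
    intro a b
    obtain ⟨a, rfl⟩ := I.proj_surjective a
    obtain ⟨b, rfl⟩ := I.proj_surjective b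
    simp only [← proj_star, ← proj_mul, star_mul]
  star_add := by
    intro a b
    obtain ⟨a, rfl⟩ := I.proj_surjective a
    obtain ⟨b, rfl⟩ := I.proj_surjective b
    simp only [← proj_star, ← map_add, star_add]

instance : StarModule ℂ I.Quot where
  star_smul := by
    intro z a
    obtain ⟨a, rfl⟩ := I.proj_surjective a
    simp only [← map_smul, ← proj_star, star_smul]

end StarIdeal

end Quotient

/-! ## `(B,Γ)^ev`-algebras and the fiber product `A ⊗~ A` -/

section EvAlgebra

variable {Γ B : Type*} [Group Γ] [NonUnitalCommRing B] [Module ℂ B] [IsScalarTower ℂ B B]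
  [SMulCommClass ℂ B B] [StarRing B] [StarModule ℂ B]

/-- A `(B,Γ)^ev`-algebra structure on the `*`-algebra `A`: a `Γ × Γ`-grading with local units in
degree `(e,e)` and a `*`-homomorphism `B ⊗ B → M(A)`, `b ⊗ c ↦ r(b) s(c)`, turning `A` into a
`(B ⊗ B, Γ × Γ)`-module. Such homomorphisms are given by their two (commuting) legs `r` and `s`. -/
structure EvAlgebra (act : Γ →* (B ≃⋆ₐ[ℂ] B)) (A : Type*) [NonUnitalRing A] [Module ℂ A]
    [IsScalarTower ℂ A A] [SMulCommClass ℂ A A] [StarRing A] [StarModule ℂ A] where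
  /-- the homogeneous component of degree `(γ, γ')` -/
  gr : Γ → Γ → Submodule ℂ A
  indep : iSupIndep fun p : Γ × Γ => gr p.1 p.2
  span_top : ⨆ p : Γ × Γ, gr p.1 p.2 = ⊤
  mul_mem : ∀ {γ γ' δ δ' x y}, x ∈ gr γ γ' → y ∈ gr δ δ' → x * y ∈ gr (γ * δ) (γ' * δ')
  star_mem : ∀ {γ γ' x}, x ∈ gr γ γ' → star x ∈ gr γ⁻¹ γ'⁻¹
  exists_left_unit : ∀ F : Finset A, ∃ u ∈ gr 1 1, ∀ x ∈ F, u * x = x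
  exists_right_unit : ∀ F : Finset A, ∃ u ∈ gr 1 1, ∀ x ∈ F, x * u = x
  r : B →⋆ₙₐ[ℂ] Mult A
  s : B →⋆ₙₐ[ℂ] Mult A
  r_s_comm : ∀ b c, r b * s c = s c * r b
  r_mem : ∀ {γ γ' x}, x ∈ gr γ γ' → ∀ b, lact (r b) x ∈ gr γ γ'
  s_mem : ∀ {γ γ' x}, x ∈ gr γ γ' → ∀ b, lact (s b) x ∈ gr γ γ'
  /-- `x r(b) = r(γ(b)) x` for `x ∈ A_{γ,γ'}` -/
  r_twist : ∀ {γ γ' x}, x ∈ gr γ γ' → ∀ b, ract (r b) x = lact (r (act γ b)) x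
  /-- `x s(b) = s(γ'(b)) x` for `x ∈ A_{γ,γ'}` -/
  s_twist : ∀ {γ γ' x}, x ∈ gr γ γ' → ∀ b, ract (s b) x = lact (s (act γ' b)) x
  /-- the base algebra has local units for `A` -/
  exists_base_unit : ∀ F : Finset A, ∃ b, ∀ x ∈ F, lact (r b) x = x ∧ lact (s b) x = x

namespace EvAlgebra

variable {act : Γ →* (B ≃⋆ₐ[ℂ] B)} {A : Type*} [NonUnitalRing A] [Module ℂ A]
  [IsScalarTower ℂ A A] [SMulCommClass ℂ A A] [StarRing A] [StarModule ℂ A]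
  (G : EvAlgebra act A)

/-- The elementary tensors `x ⊗ y` with `x ∈ A_{γ,γ'}` and `y ∈ A_{γ',γ''}`. -/
def pureMatched (γ γ'' : Γ) : Set (A ⊗[ℂ] A) :=
  {t | ∃ γ', ∃ x ∈ G.gr γ γ', ∃ y ∈ G.gr γ' γ'', t = x ⊗ₜ[ℂ] y}

/-- The subspace of `A ⊗ A` that is the sum of all `A_{γ,γ'} ⊗ A_{γ',γ''}`. -/
def matchedSpan : Submodule ℂ (A ⊗[ℂ] A) :=
  Submodule.span ℂ {t | ∃ γ γ'', t ∈ G.pureMatched γ γ''}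

theorem mul_mem_matchedSpan {m n : A ⊗[ℂ] A} (hm : m ∈ G.matchedSpan) (hn : n ∈ G.matchedSpan) :
    m * n ∈ G.matchedSpan := by
  induction hm using Submodule.span_induction with
  | zero => rw [zero_mul]; exact zero_mem _
  | add x y _ _ hx hy => rw [add_mul]; exact add_mem hx hy
  | smul c x _ hx => rw [smul_mul_assoc]; exact Submodule.smul_mem _ _ hx
  | mem m hm =>
    obtain ⟨γ, γ'', γ', x, hx, y, hy, rfl⟩ := hm
    induction hn using Submodule.span_induction with
    | zero => rw [mul_zero]; exact zero_mem _
    | add x y _ _ hx hy => rw [mul_add]; exact add_mem hx hy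
    | smul c x _ hx => rw [mul_smul_comm]; exact Submodule.smul_mem _ _ hx
    | mem n hn =>
      obtain ⟨δ, δ'', δ', z, hz, w, hw, rfl⟩ := hn
      rw [Algebra.TensorProduct.tmul_mul_tmul]
      exact Submodule.subset_span
        ⟨_, _, _, _, G.mul_mem hx hz, _, G.mul_mem hy hw, rfl⟩

theorem star_mem_matchedSpan {m : A ⊗[ℂ] A} (hm : m ∈ G.matchedSpan) :
    star m ∈ G.matchedSpan := by
  induction hm using Submodule.span_induction with
  | zero => rw [star_zero]; exact zero_mem _
  | add x y _ _ hx hy => rw [star_add]; exact add_mem hx hy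
  | smul c x _ hx => rw [star_smul]; exact Submodule.smul_mem _ _ hx
  | mem m hm =>
    obtain ⟨γ, γ'', γ', x, hx, y, hy, rfl⟩ := hm
    rw [TensorProduct.star_tmul]
    exact Submodule.subset_span ⟨_, _, _, _, G.star_mem hx, _, G.star_mem hy, rfl⟩

/-- The `*`-subalgebra `A ⊗^Γ A = ∑ A_{γ,γ'} ⊗ A_{γ',γ''}` of `A ⊗ A`. -/
def Matched : NonUnitalStarSubalgebra ℂ (A ⊗[ℂ] A) where
  carrier := G.matchedSpan
  add_mem' := add_mem
  zero_mem' := zero_mem _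
  mul_mem' := G.mul_mem_matchedSpan
  smul_mem' c _ h := Submodule.smul_mem _ c h
  star_mem' := G.star_mem_matchedSpan

/-- The span of all `s(b)x ⊗ y - x ⊗ r(b)y`, where `x ⊗ y` is matched; this is the product of the
ideal generated by all `s(b) ⊗ 1 - 1 ⊗ r(b)` with `A ⊗^Γ A`. -/
def balSpan : Submodule ℂ (A ⊗[ℂ] A) :=
  Submodule.span ℂ {t | ∃ γ γ' γ'', ∃ x ∈ G.gr γ γ', ∃ y ∈ G.gr γ' γ'', ∃ b,
    t = lact (G.s b) x ⊗ₜ[ℂ] y - x ⊗ₜ[ℂ] lact (G.r b) y}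

theorem balSpan_mul_left {m j : A ⊗[ℂ] A} (hm : m ∈ G.matchedSpan) (hj : j ∈ G.balSpan) :
    m * j ∈ G.balSpan := by
  induction hm using Submodule.span_induction with
  | zero => rw [zero_mul]; exact zero_mem _
  | add x y _ _ hx hy => rw [add_mul]; exact add_mem hx hy
  | smul c x _ hx => rw [smul_mul_assoc]; exact Submodule.smul_mem _ _ hx
  | mem m hm =>
    obtain ⟨γ, γ'', γ', a, ha, c, hc, rfl⟩ := hm
    induction hj using Submodule.span_induction with
    | zero => rw [mul_zero]; exact zero_mem _
    | add x y _ _ hx hy => rw [mul_add]; exact add_mem hx hy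
    | smul c x _ hx => rw [mul_smul_comm]; exact Submodule.smul_mem _ _ hx
    | mem n hn =>
      obtain ⟨δ, δ', δ'', x, hx, y, hy, b, rfl⟩ := hn
      rw [mul_sub, Algebra.TensorProduct.tmul_mul_tmul, Algebra.TensorProduct.tmul_mul_tmul]
      have h1 : a * lact (G.s b) x = lact (G.s (act γ' b)) (a * x) := by
        rw [← ract_mul, G.s_twist ha, lact_mul]
      have h2 : c * lact (G.r b) y = lact (G.r (act γ' b)) (c * y) := by
        rw [← ract_mul, G.r_twist hc, lact_mul]
      rw [h1, h2]
      exact Submodule.subset_span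
        ⟨_, _, _, _, G.mul_mem ha hx, _, G.mul_mem hc hy, _, rfl⟩

theorem balSpan_mul_right {m j : A ⊗[ℂ] A} (hm : m ∈ G.matchedSpan) (hj : j ∈ G.balSpan) :
    j * m ∈ G.balSpan := by
  induction hm using Submodule.span_induction with
  | zero => rw [mul_zero]; exact zero_mem _
  | add x y _ _ hx hy => rw [mul_add]; exact add_mem hx hy
  | smul c x _ hx => rw [mul_smul_comm]; exact Submodule.smul_mem _ _ hx
  | mem m hm =>
    obtain ⟨γ, γ'', γ', a, ha, c, hc, rfl⟩ := hm
    induction hj using Submodule.span_induction with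
    | zero => rw [zero_mul]; exact zero_mem _
    | add x y _ _ hx hy => rw [add_mul]; exact add_mem hx hy
    | smul c x _ hx => rw [smul_mul_assoc]; exact Submodule.smul_mem _ _ hx
    | mem n hn =>
      obtain ⟨δ, δ', δ'', x, hx, y, hy, b, rfl⟩ := hn
      rw [sub_mul, Algebra.TensorProduct.tmul_mul_tmul, Algebra.TensorProduct.tmul_mul_tmul,
        ← lact_mul, ← lact_mul]
      exact Submodule.subset_span
        ⟨_, _, _, _, G.mul_mem hx ha, _, G.mul_mem hy hc, _, rfl⟩

theorem star_mem_balSpan {j : A ⊗[ℂ] A} (hj : j ∈ G.balSpan) : star j ∈ G.balSpan := by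
  induction hj using Submodule.span_induction with
  | zero => rw [star_zero]; exact zero_mem _
  | add x y _ _ hx hy => rw [star_add]; exact add_mem hx hy
  | smul c x _ hx => rw [star_smul]; exact Submodule.smul_mem _ _ hx
  | mem m hm =>
    obtain ⟨γ, γ', γ'', x, hx, y, hy, b, rfl⟩ := hm
    rw [star_sub, TensorProduct.star_tmul, TensorProduct.star_tmul, ← ract_star, ← ract_star,
      ← map_star, ← map_star, G.s_twist (G.star_mem hx), G.r_twist (G.star_mem hy)]
    exact Submodule.subset_span ⟨_, _, _, _, G.star_mem hx, _, G.star_mem hy, _, rfl⟩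

/-- The span of the relations `s(b)x ⊗ y = x ⊗ r(b)y` as a `*`-ideal of `A ⊗^Γ A`. -/
def balIdeal : StarIdeal ↥G.Matched where
  carrier := G.balSpan.comap (NonUnitalSubalgebraClass.subtype G.Matched : G.Matched →ₗ[ℂ] A ⊗[ℂ] A)
  mul_mem_left x _ hj := G.balSpan_mul_left x.2 hj
  mul_mem_right x _ hj := G.balSpan_mul_right x.2 hj
  star_mem _ hj := G.star_mem_balSpan hj

/-- The fiber product `A ⊗~ A`, a `*`-algebra. -/
abbrev FP : Type _ := G.balIdeal.Quot

/-- The quotient map `A ⊗^Γ A → A ⊗~ A`. -/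
def cls (m : G.Matched) : G.FP := G.balIdeal.proj m

end EvAlgebra
end EvAlgebra

/-! ## Multiplier `(B,Γ)`-Hopf `*`-algebroids -/

section Hopf

variable {Γ B : Type*} [Group Γ] [NonUnitalCommRing B] [Module ℂ B] [IsScalarTower ℂ B B]
  [SMulCommClass ℂ B B] [StarRing B] [StarModule ℂ B] {act : Γ →* (B ≃⋆ₐ[ℂ] B)}
  {A : Type*} [NonUnitalRing A] [Module ℂ A] [IsScalarTower ℂ A A] [SMulCommClass ℂ A A]
  [StarRing A] [StarModule ℂ A]

/-- `(x ⊗ 1) w` -/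
def mulL1 (x : A) : A ⊗[ℂ] A →ₗ[ℂ] A ⊗[ℂ] A := (LinearMap.mulLeft ℂ x).rTensor A
/-- `(1 ⊗ y) w` -/
def mulL2 (y : A) : A ⊗[ℂ] A →ₗ[ℂ] A ⊗[ℂ] A := (LinearMap.mulLeft ℂ y).lTensor A
/-- `w (x ⊗ 1)` -/
def mulR1 (x : A) : A ⊗[ℂ] A →ₗ[ℂ] A ⊗[ℂ] A := (LinearMap.mulRight ℂ x).rTensor A
/-- `w (1 ⊗ y)` -/
def mulR2 (y : A) : A ⊗[ℂ] A →ₗ[ℂ] A ⊗[ℂ] A := (LinearMap.mulRight ℂ y).lTensor A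

namespace EvAlgebra

variable (G : EvAlgebra act A)

/-- The kernel of `A ⊗ A → ₛA ⊗_B ᵣA`. -/
def relLeft : Submodule ℂ (A ⊗[ℂ] A) :=
  Submodule.span ℂ {t | ∃ x y b, t = lact (G.s b) x ⊗ₜ[ℂ] y - x ⊗ₜ[ℂ] lact (G.r b) y}

/-- The kernel of `A ⊗ A → Aₛ ⊗_B Aᵣ`. -/
def relRight : Submodule ℂ (A ⊗[ℂ] A) :=
  Submodule.span ℂ {t | ∃ x y b, t = ract (G.s b) x ⊗ₜ[ℂ] y - x ⊗ₜ[ℂ] ract (G.r b) y}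

/-- The kernel of `A ⊗ A ⊗ A → Aₛ ⊗_B (Aᵣ = ₛA) ⊗_B ᵣA`, where the first two factors are balanced
with respect to right multiplication and the last two with respect to left multiplication. -/
def relTriple : Submodule ℂ (A ⊗[ℂ] (A ⊗[ℂ] A)) :=
  Submodule.span ℂ
    ({t | ∃ x y z b,
        t = ract (G.s b) x ⊗ₜ[ℂ] (y ⊗ₜ[ℂ] z) - x ⊗ₜ[ℂ] (ract (G.r b) y ⊗ₜ[ℂ] z)} ∪
      {t | ∃ x y z b,
        t = x ⊗ₜ[ℂ] (lact (G.s b) y ⊗ₜ[ℂ] z) - x ⊗ₜ[ℂ] (y ⊗ₜ[ℂ] lact (G.r b) z)})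

/-- `T (x ⊗~ 1) = [z]` as multipliers of `A ⊗~ A` -/
def EqR1 (T : Mult G.FP) (x : A) (z : G.Matched) : Prop :=
  ∀ m m' : G.Matched, (m' : A ⊗[ℂ] A) = mulL1 x m → lact T (G.cls m') = G.cls z * G.cls m
/-- `T (1 ⊗~ y) = [z]` as multipliers of `A ⊗~ A` -/
def EqR2 (T : Mult G.FP) (y : A) (z : G.Matched) : Prop :=
  ∀ m m' : G.Matched, (m' : A ⊗[ℂ] A) = mulL2 y m → lact T (G.cls m') = G.cls z * G.cls m
/-- `(x ⊗~ 1) T = [z]` as multipliers of `A ⊗~ A` -/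
def EqL1 (T : Mult G.FP) (x : A) (z : G.Matched) : Prop :=
  ∀ m m' : G.Matched, (m' : A ⊗[ℂ] A) = mulR1 x m → ract T (G.cls m') = G.cls m * G.cls z
/-- `(1 ⊗~ y) T = [z]` as multipliers of `A ⊗~ A` -/
def EqL2 (T : Mult G.FP) (y : A) (z : G.Matched) : Prop :=
  ∀ m m' : G.Matched, (m' : A ⊗[ℂ] A) = mulR2 y m → ract T (G.cls m') = G.cls m * G.cls z

/-- The subspace `M~(A ⊗~ A)` of all `T ∈ M(A ⊗~ A)` such that `T (x ⊗~ 1)`, `(x ⊗~ 1) T`,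
`T (1 ⊗~ y)`, `(1 ⊗~ y) T` lie in `A ⊗~ A` for all `x ∈ A_{γ,e}`, `y ∈ A_{e,γ}`. -/
def TildeM : Set (Mult G.FP) :=
  {T | ∀ γ, (∀ x ∈ G.gr γ 1, (∃ z, G.EqR1 T x z) ∧ ∃ z, G.EqL1 T x z) ∧
    ∀ y ∈ G.gr 1 γ, (∃ z, G.EqR2 T y z) ∧ ∃ z, G.EqL2 T y z}

variable (Δ : A →⋆ₙₐ[ℂ] Mult G.FP)

/-- `w ∈ A ⊗ A` represents `T₁(x ⊗ y) = Δ(x)(1 ⊗ y)` in `ₛA ⊗_B ᵣA`; for `y` of arbitrary degree,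
this product is `(Δ(x)(1 ⊗~ v))(1 ⊗ y)`, where `v ∈ A_{e,e}` and `v y = y`. -/
def IsT1 (x y : A) (w : A ⊗[ℂ] A) : Prop :=
  ∃ v ∈ G.gr 1 1, v * y = y ∧ ∃ z, G.EqR2 (Δ x) v z ∧ w - mulR2 y z ∈ G.relLeft
/-- `w ∈ A ⊗ A` represents `T₂(x ⊗ y) = (x ⊗ 1)Δ(y)` in `Aₛ ⊗_B Aᵣ`. -/
def IsT2 (x y : A) (w : A ⊗[ℂ] A) : Prop :=
  ∃ v ∈ G.gr 1 1, x * v = x ∧ ∃ z, G.EqL1 (Δ y) v z ∧ w - mulL1 x z ∈ G.relRight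
/-- `w ∈ A ⊗ A` represents `T₃(x ⊗ y) = (1 ⊗ y)Δ(x)` in `Aₛ ⊗_B Aᵣ`. -/
def IsT3 (x y : A) (w : A ⊗[ℂ] A) : Prop :=
  ∃ v ∈ G.gr 1 1, y * v = y ∧ ∃ z, G.EqL2 (Δ x) v z ∧ w - mulL2 y z ∈ G.relRight
/-- `w ∈ A ⊗ A` represents `T₄(x ⊗ y) = Δ(y)(x ⊗ 1)` in `ₛA ⊗_B ᵣA`. -/
def IsT4 (x y : A) (w : A ⊗[ℂ] A) : Prop :=
  ∃ v ∈ G.gr 1 1, v * x = x ∧ ∃ z, G.EqR1 (Δ y) v z ∧ w - mulR1 x z ∈ G.relLeft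

/-- `Δ` is a comultiplication: a morphism of `(B,Γ)^ev`-algebras from `A` to `A ⊗~ A` with image in
`M~(A ⊗~ A)` that is coassociative. -/
structure IsComultiplication : Prop where
  nondeg_left : Submodule.span ℂ {t | ∃ a m, t = lact (Δ a) m} = ⊤
  nondeg_right : Submodule.span ℂ {t | ∃ a m, t = ract (Δ a) m} = ⊤
  /-- `Δ(A_{γ,γ''}) ⊆ M(A ⊗~ A)_{γ,γ''}` -/
  degree : ∀ {γ γ'' a}, a ∈ G.gr γ γ'' → ∀ {δ δ''} (m : G.Matched),
    (m : A ⊗[ℂ] A) ∈ Submodule.span ℂ (G.pureMatched δ δ'') →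
    (∃ n : G.Matched, (n : A ⊗[ℂ] A) ∈ Submodule.span ℂ (G.pureMatched (γ * δ) (γ'' * δ'')) ∧
      lact (Δ a) (G.cls m) = G.cls n) ∧
    ∃ n : G.Matched, (n : A ⊗[ℂ] A) ∈ Submodule.span ℂ (G.pureMatched (δ * γ) (δ'' * γ'')) ∧
      ract (Δ a) (G.cls m) = G.cls n
  /-- `Δ(r(b)a) = (r(b) ⊗~ 1)Δ(a)` -/
  map_r : ∀ b a, ∀ m p p' : G.Matched, lact (Δ a) (G.cls m) = G.cls p →
    (p' : A ⊗[ℂ] A) = (lact (G.r b)).rTensor A (p : A ⊗[ℂ] A) →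
    lact (Δ (lact (G.r b) a)) (G.cls m) = G.cls p'
  /-- `Δ(s(b)a) = (1 ⊗~ s(b))Δ(a)` -/
  map_s : ∀ b a, ∀ m p p' : G.Matched, lact (Δ a) (G.cls m) = G.cls p →
    (p' : A ⊗[ℂ] A) = (lact (G.s b)).lTensor A (p : A ⊗[ℂ] A) →
    lact (Δ (lact (G.s b) a)) (G.cls m) = G.cls p'
  mem_tildeM : ∀ a, Δ a ∈ G.TildeM
  /-- `(a ⊗ 1 ⊗ 1)(Δ ⊗ id)(Δ(b)(1 ⊗ c)) = (id ⊗ Δ)((a ⊗ 1)Δ(b))(1 ⊗ 1 ⊗ c)` -/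
  coassoc : ∀ (a b c : A) (k l : ℕ) (p q : Fin k → A) (p' q' : Fin l → A)
    (u : Fin k → A ⊗[ℂ] A) (u' : Fin l → A ⊗[ℂ] A),
    G.IsT1 Δ b c (∑ i, p i ⊗ₜ[ℂ] q i) → G.IsT2 Δ a b (∑ j, p' j ⊗ₜ[ℂ] q' j) →
    (∀ i, G.IsT2 Δ a (p i) (u i)) → (∀ j, G.IsT1 Δ (q' j) c (u' j)) →
    (∑ i, TensorProduct.assoc ℂ A A A (u i ⊗ₜ[ℂ] q i)) - ∑ j, p' j ⊗ₜ[ℂ] u' j ∈ G.relTriple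

end EvAlgebra

/-- The multiplication of the crossed product `B ⋊ Γ`, whose elements `∑ b_γ γ` are regarded as
finitely supported functions: `(b γ)(c δ) = b γ(c) γδ`. -/
def crossMul (act : Γ →* (B ≃⋆ₐ[ℂ] B)) (f g : Γ →₀ B) : Γ →₀ B :=
  f.sum fun γ b => g.sum fun δ c => Finsupp.single (γ * δ) (b * act γ c)

/-- The involution of `B ⋊ Γ`: `(b γ)^* = γ⁻¹ b^*`. -/
def crossStar (act : Γ →* (B ≃⋆ₐ[ℂ] B)) (f : Γ →₀ B) : Γ →₀ B :=
  f.sum fun γ b => Finsupp.single γ⁻¹ (act γ⁻¹ (star b))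

/-- `♯ : B ⋊ Γ → B`, `∑ b_γ γ ↦ ∑ b_γ`. -/
def sharp (f : Γ →₀ B) : B := f.sum fun _ b => b

/-- `♭ : B ⋊ Γ → B`, `∑ γ b_γ ↦ ∑ b_γ`. -/
def flat (act : Γ →* (B ≃⋆ₐ[ℂ] B)) (f : Γ →₀ B) : B := f.sum fun γ b => act γ⁻¹ b

namespace EvAlgebra

variable (G : EvAlgebra act A) (Δ : A →⋆ₙₐ[ℂ] Mult G.FP)

/-- `ε` is a counit: a proper morphism of `(B,Γ)^ev`-algebras `A → B ⋊ Γ` such that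
`(ε ⊗~ id)Δ = id = (id ⊗~ ε)Δ`, where `(B ⋊ Γ) ⊗~ A ≅ A` via `bγ ⊗~ a ↦ r(b)a` and
`A ⊗~ (B ⋊ Γ) ≅ A` via `a ⊗~ bγ ↦ s(b)a = a s(γ⁻¹(b))` (for matching degrees). -/
structure IsCounit (ε : A →ₗ[ℂ] (Γ →₀ B)) : Prop where
  map_mul : ∀ x y, ε (x * y) = crossMul act (ε x) (ε y)
  map_star : ∀ x, ε (star x) = crossStar act (ε x)
  degree : ∀ {γ γ' x}, x ∈ G.gr γ γ' → ∀ δ, ε x δ ≠ 0 → δ = γ ∧ δ = γ'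
  map_r : ∀ b x δ, ε (lact (G.r b) x) δ = b * ε x δ
  map_s : ∀ b x δ, ε (lact (G.s b) x) δ = b * ε x δ
  nondeg_left : Submodule.span ℂ {f | ∃ x g, f = crossMul act (ε x) g} = ⊤
  nondeg_right : Submodule.span ℂ {f | ∃ x g, f = crossMul act g (ε x)} = ⊤
  /-- `∑ r(ε^♯(x₁)) x₂ y = x y` -/
  counit_left : ∀ (x y : A) (k : ℕ) (p q : Fin k → A), G.IsT1 Δ x y (∑ i, p i ⊗ₜ[ℂ] q i) →
    ∑ i, lact (G.r (sharp (ε (p i)))) (q i) = x * y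
  /-- `∑ x y₁ s(ε^♭(y₂)) = x y` -/
  counit_right : ∀ (x y : A) (k : ℕ) (p q : Fin k → A), G.IsT2 Δ x y (∑ i, p i ⊗ₜ[ℂ] q i) →
    ∑ i, ract (G.s (flat act (ε (q i)))) (p i) = x * y

/-- `S` is an antipode: an isomorphism `A → A^{co,op}` (not required to commute with the
involutions) with `∑ S(x₁) x₂ y = s(ε^♭(x)) y`, `∑ x y₁ S(y₂) = x r(ε^♯(y))` and
`∑ S(x₁) ⊗~ S(x₂) = ∑ S(x)₂ ⊗~ S(x)₁`. -/
structure IsAntipode (ε : A →ₗ[ℂ] (Γ →₀ B)) (S : A ≃ₗ[ℂ] A) : Prop where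
  map_mul : ∀ x y, S (x * y) = S y * S x
  degree : ∀ {γ γ' x}, x ∈ G.gr γ γ' → S x ∈ G.gr γ'⁻¹ γ⁻¹
  map_r : ∀ b x, S (lact (G.r b) x) = ract (G.s b) (S x)
  map_s : ∀ b x, S (lact (G.s b) x) = ract (G.r b) (S x)
  antipode_left : ∀ (x y : A) (k : ℕ) (p q : Fin k → A), G.IsT1 Δ x y (∑ i, p i ⊗ₜ[ℂ] q i) →
    ∑ i, S (p i) * q i = lact (G.s (flat act (ε x))) y
  antipode_right : ∀ (x y : A) (k : ℕ) (p q : Fin k → A), G.IsT2 Δ x y (∑ i, p i ⊗ₜ[ℂ] q i) →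
    ∑ i, p i * S (q i) = ract (G.r (sharp (ε y))) x
  /-- With the anti-automorphism `τ(x ⊗~ y) = S(y) ⊗~ S(x)` of `A ⊗~ A`:
  `τ(Δ(a)m) = τ(m)Δ(S(a))`. -/
  comul_antipode : ∀ a, ∀ m m' n n' : G.Matched, lact (Δ a) (G.cls m) = G.cls m' →
    (n : A ⊗[ℂ] A) = TensorProduct.comm ℂ A A
      (TensorProduct.map S.toLinearMap S.toLinearMap (m : A ⊗[ℂ] A)) →
    (n' : A ⊗[ℂ] A) = TensorProduct.comm ℂ A A
      (TensorProduct.map S.toLinearMap S.toLinearMap (m' : A ⊗[ℂ] A)) →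
    ract (Δ (S a)) (G.cls n) = G.cls n'

/-- `φ` is a left integral: a morphism `(A,r) → B` of `(B,Γ)`-modules (where `B` is trivially
graded) with `(id ⊗~ φ)Δ = r ∘ φ`. -/
structure IsLeftIntegral (φ : A →ₗ[ℂ] B) : Prop where
  map_left : ∀ b x, φ (lact (G.r b) x) = b * φ x
  map_right : ∀ b x, φ (ract (G.r b) x) = φ x * b
  degree : ∀ {γ γ' x}, x ∈ G.gr γ γ' → γ ≠ 1 → φ x = 0
  /-- `∑ s(φ(x₂)) x₁ a = r(φ(x)) a` -/
  invariant_left : ∀ (a x : A) (k : ℕ) (p q : Fin k → A), G.IsT4 Δ a x (∑ i, p i ⊗ₜ[ℂ] q i) →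
    ∑ i, lact (G.s (φ (q i))) (p i) = lact (G.r (φ x)) a
  /-- `∑ a x₁ s(φ(x₂)) = a r(φ(x))` -/
  invariant_right : ∀ (a x : A) (k : ℕ) (p q : Fin k → A), G.IsT2 Δ a x (∑ i, p i ⊗ₜ[ℂ] q i) →
    ∑ i, ract (G.s (φ (q i))) (p i) = ract (G.r (φ x)) a

/-- `ψ` is a right integral: a morphism `(A,s) → B` of `(B,Γ)`-modules with
`(ψ ⊗~ id)Δ = s ∘ ψ`. -/
structure IsRightIntegral (ψ : A →ₗ[ℂ] B) : Prop where
  map_left : ∀ b x, ψ (lact (G.s b) x) = b * ψ x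
  map_right : ∀ b x, ψ (ract (G.s b) x) = ψ x * b
  degree : ∀ {γ γ' x}, x ∈ G.gr γ γ' → γ' ≠ 1 → ψ x = 0
  /-- `∑ r(ψ(x₁)) x₂ a = s(ψ(x)) a` -/
  invariant_left : ∀ (a x : A) (k : ℕ) (p q : Fin k → A), G.IsT1 Δ x a (∑ i, p i ⊗ₜ[ℂ] q i) →
    ∑ i, lact (G.r (ψ (p i))) (q i) = lact (G.s (ψ x)) a
  /-- `∑ a x₂ r(ψ(x₁)) = a s(ψ(x))` -/
  invariant_right : ∀ (a x : A) (k : ℕ) (p q : Fin k → A), G.IsT3 Δ x a (∑ i, p i ⊗ₜ[ℂ] q i) →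
    ∑ i, ract (G.r (ψ (p i))) (q i) = ract (G.s (ψ x)) a

end EvAlgebra

/-- A measured multiplier `(B,Γ)`-Hopf `*`-algebroid with underlying `(B,Γ)^ev`-algebra `(A, G)`. -/
structure MeasuredHopf (G : EvAlgebra act A) where
  Δ : A →⋆ₙₐ[ℂ] Mult G.FP
  ε : A →ₗ[ℂ] (Γ →₀ B)
  S : A ≃ₗ[ℂ] A
  /-- the weight on the base -/
  μ : B →ₗ[ℂ] ℂ
  /-- the left integral -/
  φ : A →ₗ[ℂ] B
  /-- the right integral -/
  ψ : A →ₗ[ℂ] B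
  /-- the cocycle `(D_γ)_γ` of Radon-Nikodym derivatives of `μ` -/
  D : Γ → Mult B
  comul : G.IsComultiplication Δ
  counit : G.IsCounit Δ ε
  antipode : G.IsAntipode Δ ε S
  μ_pos : ∀ b, 0 ≤ μ (star b * b)
  μ_faithful : ∀ b, (∀ c, μ (c * b) = 0) → b = 0
  /-- `μ(γ(b D_γ)) = μ(b)` -/
  μ_quasi_invariant : ∀ γ b, μ (act γ (ract (D γ) b)) = μ b
  left_integral : G.IsLeftIntegral Δ φ
  right_integral : G.IsRightIntegral Δ ψ
  ν_pos : ∀ x, 0 ≤ μ (φ (star x * x))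
  ν_faithful : ∀ x, (∀ y, μ (φ (y * x)) = 0) → x = 0
  ν_eq : ∀ x, μ (ψ x) = μ (φ x)
  φ_surjective : Function.Surjective φ
  ψ_surjective : Function.Surjective ψ

end Hopf

/-! ## Separated completions with respect to sesquilinear forms -/

section Kernel

variable {ι : Type*}

/-- `(k i j)` is a positive matrix, that is, `∑ conj(z i) k i j z j ≥ 0` for every finite family. -/
def PosKer (k : ι → ι → ℂ) : Prop := (Matrix.of k).PosSemidef

open Classical in
/-- `k` if it is positive, and the zero kernel otherwise. -/
def truncKer (k : ι → ι → ℂ) : ι → ι → ℂ := if PosKer k then k else 0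

theorem posKer_zero : PosKer (0 : ι → ι → ℂ) :=
  ⟨by ext; simp, fun x => by simp [Finsupp.sum]⟩

theorem posKer_truncKer (k : ι → ι → ℂ) : PosKer (truncKer k) := by
  unfold truncKer
  split_ifs with h
  · exact h
  · exact posKer_zero

set_option linter.unusedVariables false in
/-- The vector space with basis `ι`, on which `k` defines a sesquilinear form. -/
@[nolint unusedArguments]
def PreKer (k : ι → ι → ℂ) : Type _ := ι →₀ ℂ

variable (k : ι → ι → ℂ)

instance : AddCommGroup (PreKer k) := inferInstanceAs (AddCommGroup (ι →₀ ℂ))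
instance : Module ℂ (PreKer k) := inferInstanceAs (Module ℂ (ι →₀ ℂ))

/-- The sesquilinear form `⟨f, g⟩ = ∑ conj(f i) k i j g j`. -/
def kerForm (f g : ι →₀ ℂ) : ℂ := f.sum fun i z => g.sum fun j w => star z * truncKer k i j * w

theorem kerForm_symm (f g : ι →₀ ℂ) : star (kerForm k g f) = kerForm k f g := by
  unfold kerForm
  rw [Finsupp.sum_comm]
  simp only [← starRingEnd_apply, map_finsuppSum]
  congr! 6 with i z j w
  have h : starRingEnd ℂ (truncKer k j i) = truncKer k i j := (posKer_truncKer k).1.apply i j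
  simp only [map_mul, starRingEnd_apply, star_star] at h ⊢
  rw [h]
  ring

theorem kerForm_add (f g h : ι →₀ ℂ) : kerForm k (f + g) h = kerForm k f h + kerForm k g h := by
  unfold kerForm
  rw [Finsupp.sum_add_index'] <;> simp [← Finsupp.sum_add, add_mul]

theorem kerForm_smul (f g : ι →₀ ℂ) (z : ℂ) : kerForm k (z • f) g = star z * kerForm k f g := by
  unfold kerForm
  rw [Finsupp.sum_smul_index] <;> simp [Finsupp.mul_sum, ← mul_assoc]

instance : PreInnerProductSpace.Core ℂ (PreKer k) where
  inner f g := kerForm k f g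
  conj_inner_symm f g := kerForm_symm k f g
  re_inner_nonneg f := (Complex.le_def.1 ((posKer_truncKer k).2 f)).1
  add_left f g h := kerForm_add k f g h
  smul_left f g z := kerForm_smul k f g z

instance : SeminormedAddCommGroup (PreKer k) :=
  InnerProductSpace.Core.toSeminormedAddCommGroup (𝕜 := ℂ)

instance : InnerProductSpace ℂ (PreKer k) := .ofCore _

/-- The Hilbert space generated by vectors `vec k i` with `⟨vec k i, vec k j⟩ = k i j`: the
separated completion of the vector space with basis `ι` with respect to the form defined by `k`
(or by the zero form if `k` is not positive). If `k` comes from a positive form on a quotient of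
this vector space, for example on a vector space `ι` or on a tensor product, this is the separated
completion of that quotient. -/
abbrev KerHilb : Type _ := UniformSpace.Completion (PreKer k)

/-- The canonical vectors. -/
def vec (i : ι) : KerHilb k :=
  ((show PreKer k from Finsupp.single i (1 : ℂ) : PreKer k) : UniformSpace.Completion (PreKer k))

theorem inner_vec {k : ι → ι → ℂ} (hk : PosKer k) (i j : ι) :
    inner ℂ (vec k i) (vec k j) = k i j := by
  unfold vec
  rw [UniformSpace.Completion.inner_coe]
  change kerForm k (Finsupp.single i 1) (Finsupp.single j 1) = _
  simp [kerForm, truncKer, hk]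

end Kernel

/-! ## Concrete `C^*`-modules, relative tensor products, `C^*`-pseudo-multiplicative unitaries -/

section CModules

variable {K L M X Y : Type*}
  [NormedAddCommGroup K] [InnerProductSpace ℂ K] [CompleteSpace K]
  [NormedAddCommGroup L] [InnerProductSpace ℂ L] [CompleteSpace L]
  [NormedAddCommGroup M] [InnerProductSpace ℂ M] [CompleteSpace M]
  [NormedAddCommGroup X] [NormedSpace ℂ X] [NormedAddCommGroup Y] [NormedSpace ℂ Y]

open Classical in
/-- The bounded operator with property `P` (or zero if there is none). It is only used for
properties `P` that prescribe an operator on a total subset. -/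
def theOp (P : (X →L[ℂ] Y) → Prop) : X →L[ℂ] Y := if h : ∃ T, P T then h.choose else 0

/-- The closed linear span `[S]` of a set of bounded operators. -/
def clspan (S : Set (X →L[ℂ] Y)) : Submodule ℂ (X →L[ℂ] Y) :=
  (Submodule.span ℂ S).topologicalClosure

/-- The adjoint. -/
abbrev adj (T : K →L[ℂ] L) : L →L[ℂ] K := ContinuousLinearMap.adjoint T

/-- `(K, 𝔅, 𝔅)` is a (commutative) `C^*`-base: `𝔅 ⊆ L(K)` is a commutative `C^*`-algebra that acts
non-degenerately. -/
structure IsCBase (𝔅 : Submodule ℂ (K →L[ℂ] K)) : Prop where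
  closed : IsClosed (𝔅 : Set (K →L[ℂ] K))
  mul_mem : ∀ b ∈ 𝔅, ∀ c ∈ 𝔅, b ∘L c ∈ 𝔅
  mul_comm : ∀ b ∈ 𝔅, ∀ c ∈ 𝔅, b ∘L c = c ∘L b
  adj_mem : ∀ b ∈ 𝔅, adj b ∈ 𝔅
  nondegenerate : (Submodule.span ℂ {v | ∃ b ∈ 𝔅, ∃ ζ, v = b ζ}).topologicalClosure = ⊤

/-- `(L, E)` is a `C^*`-module over the `C^*`-base `(K, 𝔅, 𝔅)`: `E ⊆ L(K, L)` is a closed subspace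
with `[E K] = L`, `[E 𝔅] = E` and `[E^* E] = 𝔅`. -/
structure IsCModule (𝔅 : Submodule ℂ (K →L[ℂ] K)) (E : Submodule ℂ (K →L[ℂ] L)) : Prop where
  closed : IsClosed (E : Set (K →L[ℂ] L))
  nondegenerate : (Submodule.span ℂ {v | ∃ ξ ∈ E, ∃ ζ, v = ξ ζ}).topologicalClosure = ⊤
  mul_base : clspan {T | ∃ ξ ∈ E, ∃ b ∈ 𝔅, T = ξ ∘L b} = E
  adj_mul : clspan {T | ∃ ξ ∈ E, ∃ ξ' ∈ E, T = adj ξ ∘L ξ'} = 𝔅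

/-- The operator `ρ_E(b)` on `L`, determined by `ρ_E(b) ξ = ξ b` for all `ξ ∈ E`. -/
def rep (E : Submodule ℂ (K →L[ℂ] L)) (b : K →L[ℂ] K) : L →L[ℂ] L :=
  theOp fun R => ∀ ξ ∈ E, R ∘L ξ = ξ ∘L b

/-- `[ρ_E(𝔅) F] = F` -/
def Compat (𝔅 : Submodule ℂ (K →L[ℂ] K)) (E F : Submodule ℂ (K →L[ℂ] L)) : Prop :=
  clspan {T | ∃ b ∈ 𝔅, ∃ η ∈ F, T = rep E b ∘L η} = F

section RTP

variable (E : Submodule ℂ (K →L[ℂ] L)) (F : Submodule ℂ (K →L[ℂ] M))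

/-- The inner products `⟨ξ ⊗ ζ ⊗ η, ξ' ⊗ ζ' ⊗ η'⟩ = ⟨ζ, (ξ^* ξ')(η^* η') ζ'⟩`. -/
def rtpKer (u v : ↥E × K × ↥F) : ℂ :=
  inner ℂ u.2.1 ((adj u.1.1 ∘L v.1.1) ((adj u.2.2.1 ∘L v.2.2.1) v.2.1))

/-- The relative tensor product of the `C^*`-modules `(L, E)` and `(M, F)`: the separated completion
of `E ⊗ K ⊗ F` with respect to the form defined by `rtpKer`. -/
abbrev RTP : Type _ := KerHilb (rtpKer E F)

variable {E F}

/-- `|ξ⟩₁ : M → RTP E F`, `η ζ ↦ ξ ⊗ ζ ⊗ η` -/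
def ket₁ (ξ : ↥E) : M →L[ℂ] RTP E F :=
  theOp fun T => ∀ (η : ↥F) (ζ : K), T (η.1 ζ) = vec (rtpKer E F) (ξ, ζ, η)

/-- `|η⟩₂ : L → RTP E F`, `ξ ζ ↦ ξ ⊗ ζ ⊗ η` -/
def ket₂ (η : ↥F) : L →L[ℂ] RTP E F :=
  theOp fun T => ∀ (ξ : ↥E) (ζ : K), T (ξ.1 ζ) = vec (rtpKer E F) (ξ, ζ, η)

variable (E F)

/-- `[|E⟩₁ G] ⊆ L(K, RTP E F)` for `G ⊆ L(K, M)` -/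
def ketSp₁ (G : Submodule ℂ (K →L[ℂ] M)) : Submodule ℂ (K →L[ℂ] RTP E F) :=
  clspan {T | ∃ ξ : ↥E, ∃ g ∈ G, T = ket₁ ξ ∘L g}

/-- `[|F⟩₂ G] ⊆ L(K, RTP E F)` for `G ⊆ L(K, L)` -/
def ketSp₂ (G : Submodule ℂ (K →L[ℂ] L)) : Submodule ℂ (K →L[ℂ] RTP E F) :=
  clspan {T | ∃ η : ↥F, ∃ g ∈ G, T = ket₂ η ∘L g}

end RTP

/-- The image `V[…]` of a space of operators under composition with `V`. -/
def imgSp {R R' : Type*} [NormedAddCommGroup R] [InnerProductSpace ℂ R] [NormedAddCommGroup R']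
    [InnerProductSpace ℂ R'] (V : R ≃ₗᵢ[ℂ] R') (S : Submodule ℂ (K →L[ℂ] R)) :
    Set (K →L[ℂ] R') :=
  {T | ∃ s ∈ S, T = (V.toContinuousLinearEquiv : R →L[ℂ] R') ∘L s}

section Chain

variable (E P Q G : Submodule ℂ (K →L[ℂ] L))

/-- The inner products `⟨ξ ⊗ h ⊗ η, ξ' ⊗ h' ⊗ η'⟩ = ⟨h, ρ_P(ξ^* ξ') ρ_Q(η^* η') h'⟩`. -/
def chKer (u v : ↥E × L × ↥G) : ℂ :=
  inner ℂ u.2.1 (rep P (adj u.1.1 ∘L v.1.1) (rep Q (adj u.2.2.1 ∘L v.2.2.1) v.2.1))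

/-- The threefold relative tensor product `L ⊗ L ⊗ L` in which a central leg, carrying the modules
`P` and `Q`, is joined to a second leg by means of `E`, `P` and to a third leg by means of `Q`, `G`,
realized as the separated completion of `E ⊗ L ⊗ G`. The vector `ξ ⊗ h ⊗ η` has `h` in the
central leg. -/
abbrev Ch : Type _ := KerHilb (chKer E P Q G)

variable {E P Q G}

/-- `RTP E P → Ch E P Q G`, `|ξ⟩₁ h ↦ ξ ⊗ h ⊗ η` -/
def addR₁ (η : ↥G) : RTP E P →L[ℂ] Ch E P Q G :=
  theOp fun T => ∀ (ξ : ↥E) (h : L), T (ket₁ ξ h) = vec (chKer E P Q G) (ξ, h, η)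

/-- `RTP P E → Ch E P Q G`, `|ξ⟩₂ h ↦ ξ ⊗ h ⊗ η` -/
def addR₂ (η : ↥G) : RTP P E →L[ℂ] Ch E P Q G :=
  theOp fun T => ∀ (ξ : ↥E) (h : L), T (ket₂ ξ h) = vec (chKer E P Q G) (ξ, h, η)

/-- `RTP Q G → Ch E P Q G`, `|η⟩₂ h ↦ ξ ⊗ h ⊗ η` -/
def addL₂ (ξ : ↥E) : RTP Q G →L[ℂ] Ch E P Q G :=
  theOp fun T => ∀ (η : ↥G) (h : L), T (ket₂ η h) = vec (chKer E P Q G) (ξ, h, η)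

/-- `RTP G Q → Ch E P Q G`, `|η⟩₁ h ↦ ξ ⊗ h ⊗ η` -/
def addL₁ (ξ : ↥E) : RTP G Q →L[ℂ] Ch E P Q G :=
  theOp fun T => ∀ (η : ↥G) (h : L), T (ket₁ η h) = vec (chKer E P Q G) (ξ, h, η)

end Chain

section Unitary

variable {βh α β : Submodule ℂ (K →L[ℂ] L)}

/-- `V` as a bounded operator. -/
abbrev toOp (V : RTP βh α ≃ₗᵢ[ℂ] RTP α β) : RTP βh α →L[ℂ] RTP α β :=
  (V.toContinuousLinearEquiv : RTP βh α →L[ℂ] RTP α β)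

/-- The pentagon equation `V₂₃ V₁₂ = V₁₂ V₁₃ V₂₃`. The spaces through which the two sides pass are
* `Ch βh α βh α → Ch α β βh α → Ch α β α β` with second leg central, and
* `Ch βh α βh α → Ch βh α β α → Ch α βh α β → Ch α β α β`, where the third leg is central in
  `Ch βh α β α` (whose factors are the legs 1, 3, 2) and the first leg is central in `Ch α βh α β`
  (whose factors are the legs 2, 1, 3).

The leg operators act as `V` on the indicated two legs and trivially on the remaining one. -/
def Pentagon (V : RTP βh α ≃ₗᵢ[ℂ] RTP α β) : Prop :=
  ∃ (V12 : Ch βh α βh α →L[ℂ] Ch α β βh α) (V23 : Ch α β βh α →L[ℂ] Ch α β α β)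
    (V23' : Ch βh α βh α →L[ℂ] Ch βh α β α) (V13 : Ch βh α β α →L[ℂ] Ch α βh α β)
    (V12' : Ch α βh α β →L[ℂ] Ch α β α β),
    (∀ η : ↥α, V12 ∘L addR₁ η = addR₁ η ∘L toOp V) ∧
    (∀ ξ : ↥α, V23 ∘L addL₂ ξ = addL₂ ξ ∘L toOp V) ∧
    (∀ ξ : ↥βh, V23' ∘L addL₂ ξ = addL₁ ξ ∘L toOp V) ∧
    (∀ η : ↥α, V13 ∘L addR₁ η = addL₂ η ∘L toOp V) ∧
    (∀ η : ↥β, V12' ∘L addR₂ η = addR₁ η ∘L toOp V) ∧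
    V23 ∘L V12 = V12' ∘L V13 ∘L V23'

/-- `V` is a `C^*`-pseudo-multiplicative unitary over the commutative `C^*`-base `(K, 𝔅, 𝔅)` on the
Hilbert space `L` with modules `βh`, `α`, `β`. The positivity statements say that the inner products
which define the relative tensor products are positive. -/
structure IsCPMU (𝔅 : Submodule ℂ (K →L[ℂ] K)) (V : RTP βh α ≃ₗᵢ[ℂ] RTP α β) : Prop where
  base : IsCBase 𝔅
  module_βh : IsCModule 𝔅 βh
  module_α : IsCModule 𝔅 α
  module_β : IsCModule 𝔅 β
  compat_βh_α : Compat 𝔅 βh α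
  compat_α_βh : Compat 𝔅 α βh
  compat_βh_β : Compat 𝔅 βh β
  compat_β_βh : Compat 𝔅 β βh
  compat_α_β : Compat 𝔅 α β
  compat_β_α : Compat 𝔅 β α
  pos_dom : PosKer (rtpKer βh α)
  pos_ran : PosKer (rtpKer α β)
  pos_ch₁ : PosKer (chKer βh α βh α)
  pos_ch₂ : PosKer (chKer α β βh α)
  pos_ch₃ : PosKer (chKer α β α β)
  pos_ch₄ : PosKer (chKer βh α β α)
  pos_ch₅ : PosKer (chKer α βh α β)
  /-- `V[|α⟩₂ α] = [|α⟩₁ α]` -/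
  intertwine_α_α : imgSp V (ketSp₂ βh α α) = ketSp₁ α β α
  /-- `V[|βh⟩₁ β] = [|β⟩₂ βh]` -/
  intertwine_βh_β : imgSp V (ketSp₁ βh α β) = ketSp₂ α β βh
  /-- `V[|βh⟩₁ βh] = [|α⟩₁ βh]` -/
  intertwine_βh_βh : imgSp V (ketSp₁ βh α βh) = ketSp₁ α β βh
  /-- `V[|α⟩₂ β] = [|β⟩₂ β]` -/
  intertwine_α_β : imgSp V (ketSp₂ βh α β) = ketSp₂ α β β
  pentagon : Pentagon V

/-- `V` is regular: `[⟨α|₁ V |α⟩₂] = [α α^*]`. -/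
def IsRegular (V : RTP βh α ≃ₗᵢ[ℂ] RTP α β) : Prop :=
  clspan {T : L →L[ℂ] L | ∃ ξ η : ↥α, T = adj (ket₁ ξ) ∘L toOp V ∘L ket₂ η} =
    clspan {T : L →L[ℂ] L | ∃ ξ η : ↥α, T = ξ.1 ∘L adj η.1}

end Unitary

end CModules

/-! ## The Hilbert spaces, modules and fundamental unitaries of a measured Hopf algebroid -/

namespace MeasuredHopf

section Unitaries

variable {Γ B : Type*} [Group Γ] [NonUnitalCommRing B] [Module ℂ B] [IsScalarTower ℂ B B]
  [SMulCommClass ℂ B B] [StarRing B] [StarModule ℂ B] {act : Γ →* (B ≃⋆ₐ[ℂ] B)}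
  {A : Type*} [NonUnitalRing A] [Module ℂ A] [IsScalarTower ℂ A A] [SMulCommClass ℂ A A]
  [StarRing A] [StarModule ℂ A] {G : EvAlgebra act A} (H : MeasuredHopf G)

/-- The inner products `⟨b, c⟩ = μ(b^* c)`. -/
def kerK (b c : B) : ℂ := H.μ (star b * c)

/-- The inner products `⟨x, y⟩ = ν(x^* y)`, where `ν = μ ∘ φ = μ ∘ ψ`. -/
def kerH (x y : A) : ℂ := H.μ (H.φ (star x * y))

/-- The completion of `B`. -/
abbrev HilbK : Type _ := KerHilb H.kerK

/-- The completion of `A`. -/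
abbrev HilbH : Type _ := KerHilb H.kerH

/-- The canonical map `B → K`. -/
def Λμ (b : B) : H.HilbK := vec H.kerK b

/-- The canonical map `A → H`. -/
def Λν (x : A) : H.HilbH := vec H.kerH x

/-- `π_μ(b) Λ_μ(c) = Λ_μ(b c)` -/
def πμ (b : B) : H.HilbK →L[ℂ] H.HilbK := theOp fun T => ∀ c, T (H.Λμ c) = H.Λμ (b * c)

/-- `Λ_φ(x) Λ_μ(b) = Λ_ν(x r(b))` -/
def Λφ (x : A) : H.HilbK →L[ℂ] H.HilbH := theOp fun T => ∀ b, T (H.Λμ b) = H.Λν (ract (G.r b) x)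

/-- `Λ_ψ(x) Λ_μ(b) = Λ_ν(x s(b))` -/
def Λψ (x : A) : H.HilbK →L[ℂ] H.HilbH := theOp fun T => ∀ b, T (H.Λμ b) = H.Λν (ract (G.s b) x)

/-- `Λ_φ^†(x) Λ_μ(b) = Λ_ν(r(b) x)` -/
def Λφd (x : A) : H.HilbK →L[ℂ] H.HilbH := theOp fun T => ∀ b, T (H.Λμ b) = H.Λν (lact (G.r b) x)

/-- `Λ_ψ^†(x) Λ_μ(b) = Λ_ν(s(b) x)` -/
def Λψd (x : A) : H.HilbK →L[ℂ] H.HilbH := theOp fun T => ∀ b, T (H.Λμ b) = H.Λν (lact (G.s b) x)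

/-- `[π_μ(B)]` -/
def base : Submodule ℂ (H.HilbK →L[ℂ] H.HilbK) := clspan (Set.range H.πμ)

/-- `E_φ = [Λ_φ(A)]` -/
def Eφ : Submodule ℂ (H.HilbK →L[ℂ] H.HilbH) := clspan (Set.range H.Λφ)

/-- `E_ψ = [Λ_ψ(A)]` -/
def Eψ : Submodule ℂ (H.HilbK →L[ℂ] H.HilbH) := clspan (Set.range H.Λψ)

/-- `E_φ^† = [Λ_φ^†(A)]` -/
def Eφd : Submodule ℂ (H.HilbK →L[ℂ] H.HilbH) := clspan (Set.range H.Λφd)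

/-- `E_ψ^† = [Λ_ψ^†(A)]` -/
def Eψd : Submodule ℂ (H.HilbK →L[ℂ] H.HilbH) := clspan (Set.range H.Λψd)

theorem subset_clspan {X Y : Type*} [NormedAddCommGroup X] [NormedSpace ℂ X]
    [NormedAddCommGroup Y] [NormedSpace ℂ Y] (f : A → X →L[ℂ] Y) (x : A) :
    f x ∈ clspan (Set.range f) :=
  Submodule.le_topologicalClosure _ (Submodule.subset_span ⟨x, rfl⟩)

/-- `Λ_ψ(x)` as an element of `E_ψ` -/
def ψEl (x : A) : ↥H.Eψ := ⟨H.Λψ x, subset_clspan _ x⟩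

/-- `Λ_φ^†(x)` as an element of `E_φ^†` -/
def φdEl (x : A) : ↥H.Eφd := ⟨H.Λφd x, subset_clspan _ x⟩

/-- `Λ_ψ^†(x)` as an element of `E_ψ^†` -/
def ψdEl (x : A) : ↥H.Eψd := ⟨H.Λψd x, subset_clspan _ x⟩

/-- The weight `μ` admits a bounded GNS-representation: for every `b` there is a constant `C` with
`μ(c^* b^* b c) ≤ C μ(c^* c)` for all `c`. -/
def BoundedGNS : Prop :=
  ∀ b : B, ∃ C : ℝ, 0 ≤ C ∧
    ∀ c, H.μ (star c * star b * b * c) ≤ (C : ℂ) * H.μ (star c * c)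

/-- `Dh` is a family `(D_γ^{1/2})_γ` of square roots of the Radon-Nikodym cocycle `(D_γ)_γ`. -/
structure IsSqrtCocycle (Dh : Γ → Mult B) : Prop where
  one : Dh 1 = 1
  star_eq : ∀ γ, star (Dh γ) = Dh γ
  sq : ∀ γ, Dh γ * Dh γ = H.D γ
  /-- `D_{γγ'}^{1/2} = γ'⁻¹(D_γ^{1/2}) D_{γ'}^{1/2}` -/
  mul : ∀ γ γ' b, lact (Dh (γ * γ')) b = act γ'⁻¹ (lact (Dh γ) (act γ' (lact (Dh γ') b)))
  pos : ∀ γ c, 0 ≤ H.μ (star c * lact (Dh γ) c)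

variable (G) in
/-- `q` is homogeneous, of degree `(γ, γ')`, and `q' = D^{1/2}(q) = r(D_{γ⁻¹}^{1/2}) q`. (Here
`r(m) q = r(m b) q` for a multiplier `m` of `B` and any `b` with `r(b) q = q`.) -/
def IsDHalf (Dh : Γ → Mult B) (q q' : A) : Prop :=
  ∃ γ γ' b, q ∈ G.gr γ γ' ∧ lact (G.r b) q = q ∧ q' = lact (G.r (lact (Dh γ⁻¹) b)) q

variable (G) in
/-- `p` is homogeneous, of degree `(γ, γ')`, and `p' = D^{1/2}(p) = s(D_{γ'⁻¹}^{1/2}) p`, where this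
`D^{1/2}` is formed with the second degree and `s`. -/
def IsDBarHalf (Dh : Γ → Mult B) (p p' : A) : Prop :=
  ∃ γ γ' b, p ∈ G.gr γ γ' ∧ lact (G.s b) p = p ∧ p' = lact (G.s (lact (Dh γ'⁻¹) b)) p

/-- The defining formula of the fundamental unitary `W`:
`W^*(Λ_ν(x) ⊗ Λ_ν(y)) = ∑ Λ_ν(y₁ x) ⊗ Λ_ν(D^{1/2}(y₂))`. -/
def IsW (Dh : Γ → Mult B) (W : RTP H.Eψd H.Eφd ≃ₗᵢ[ℂ] RTP H.Eφd H.Eφ) : Prop :=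
  ∀ (x y : A) (k : ℕ) (p q q' : Fin k → A), G.IsT4 H.Δ x y (∑ i, p i ⊗ₜ[ℂ] q i) →
    (∀ i, IsDHalf G Dh (q i) (q' i)) →
    W.symm (ket₁ (H.φdEl x) (H.Λν y)) = ∑ i, ket₁ (H.ψdEl (p i)) (H.Λν (q' i))

/-- The defining formula of the fundamental unitary `V`:
`V(Λ_ν(x) ⊗ Λ_ν(y)) = ∑ Λ_ν(D^{1/2}(x₁)) ⊗ Λ_ν(x₂ y)`. -/
def IsV (Dh : Γ → Mult B) (V : RTP H.Eψ H.Eψd ≃ₗᵢ[ℂ] RTP H.Eψd H.Eφd) : Prop :=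
  ∀ (x y : A) (k : ℕ) (p p' q : Fin k → A), G.IsT1 H.Δ x y (∑ i, p i ⊗ₜ[ℂ] q i) →
    (∀ i, IsDBarHalf G Dh (p i) (p' i)) →
    V (ket₁ (H.ψEl x) (H.Λν y)) = ∑ i, ket₁ (H.ψdEl (p' i)) (H.Λν (q i))

end Unitaries

end MeasuredHopf

end DynQG

end

open scoped TensorProduct ComplexOrder

set_option linter.unusedSectionVars false

noncomputable section

namespace DynQG

/-! ## Shortcut instances -/

section Shortcuts

variable {ι X Y : Type*} (k : ι → ι → ℂ) [NormedAddCommGroup X] [NormedSpace ℂ X]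
  [NormedAddCommGroup Y] [NormedSpace ℂ Y]

-- Everything is proved for the inverse `U` of `W`, the explicit map x ⊗ y ↦ Σ y₁x ⊗ D^{1/2}(y₂).
-- The map that defines `V` has the same shape after flips, so one argument serves both unitaries.
-- `Core` collects what this argument needs. It is satisfied by the given algebroid
-- (`MeasuredHopf.core`) and by its co-opposite (`MeasuredHopf.coCore`), in which r and s, the two
-- degrees, φ and ψ, and S and S⁻¹ are exchanged. If U belongs to the co-opposite and Σ denotes
-- flips, then V = ΣUΣ. Conjugating the inverse of a pseudo-multiplicative unitary with modules (β̂,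
-- α, β) by flips gives one with modules (β, α, β̂), and regularity survives (`pentagon_flipU`,
-- `intertwines_flipU`, `isRegular_flipU`).
--
-- Isometry. For matched homogeneous tensors, the inner product of p ⊗ D^{1/2}(q) and p' ⊗
-- D^{1/2}(q') involves φ(q^*q') and ψ(p^*p'). The two factors D^{1/2} supply exactly the
-- Radon–Nikodym derivative that quasi-invariance of μ absorbs (`inner_JD_tmul`). Since μ∘φ = μ∘ψ,
-- the result can be written in terms of the product of Δ(y)^* and Δ(y'), that is Δ(y^*y'), and left
-- invariance of φ collapses it to the inner product of x ⊗ y and x' ⊗ y' (`inner_JD_d1`).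
--
-- Surjectivity. The antipode inverts (x, y) ↦ Δ(y)(x ⊗ 1): the sum Σ q₂S⁻¹(q₁)p ⊗ q₃ equals p ⊗ q
-- by coassociativity and the counit (`exists_T4`). Moreover D^{1/2} is onto.
--
-- Intertwining relations. Each of the spaces involved is generated by operators that send Λ_μ(b) to
-- a tensor in which b acts by multiplication with r(b) or s(b) on one factor. The relations
-- therefore reduce to identities such as Δ(r(b)y) = (r(b) ⊗ 1)Δ(y) and Δ(s(b)y) = (1 ⊗ s(b))Δ(y),
-- and to balancing (`imgSp_U`).
--
-- Pentagon. On x ⊗ y ⊗ z both composites are Σ z₁y₁x ⊗ D^{1/2}(z₂y₂) ⊗ D^{1/2}(z₃). This uses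
-- coassociativity (`coassoc_mul`), multiplicativity of D^{1/2} (`DHalf_mul`) and Δ∘D^{1/2} =
-- (D^{1/2} ⊗ id)Δ (`d1_D`).
--
-- Regularity. Strong left invariance, Σ S(l₁) r(φ(l₂z)) x = Σ s(γ(φ(l z₂))) z₁x for l of first
-- degree γ⁻¹, shows that the slices of W on generators are finite sums of operators ξη^* with ξ, η
-- in E_φ^† (`slice_U`). Surjectivity of Δ(y)(x ⊗ 1) shows that all such operators arise.
--
-- The analytic input is that a Gram matrix with entries in a C*-algebra 𝔅 of operators has a square
-- root with entries in 𝔅 (`exists_gram_sqrt`). With commutativity of 𝔅 this gives positivity of all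
-- kernels, boundedness of the representations ρ_E, and the operators acting on legs. The algebraic
-- difficulty is the lack of units: Δ(y) enters only through representatives of Δ(y)(v ⊗ 1) and
-- Δ(y)(1 ⊗ v) with v a local unit of degree (e, e), and identities hold only modulo balancing
-- relations. Coassociativity is given modulo relations of mixed type, which the projection onto
-- matched tensors turns into relations for left multiplication (`relTriple_matchProj₁₂`).

scoped instance : AddCommMonoid (X →L[ℂ] Y) := inferInstance
scoped instance : Module ℂ (X →L[ℂ] Y) := inferInstance
scoped instance : AddCommMonoid (KerHilb k) := inferInstance
scoped instance : Module ℂ (KerHilb k) := inferInstance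
scoped instance : SeminormedAddCommGroup (KerHilb k) := inferInstance
scoped instance : AddCommMonoid (X →L[ℂ] KerHilb k) := inferInstance
scoped instance : Module ℂ (X →L[ℂ] KerHilb k) := inferInstance

variable {M N : Type*} [AddCommMonoid M] [AddCommMonoid N] [Module ℂ M] [Module ℂ N]

scoped instance : ZeroHomClass (M →ₗ[ℂ] N) M N := inferInstance
scoped instance : ZeroHomClass (M ≃ₗ[ℂ] N) M N := inferInstance
scoped instance : AddHomClass (M →ₗ[ℂ] N) M N := inferInstance
scoped instance : AddHomClass (M ≃ₗ[ℂ] N) M N := inferInstance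

variable {C : Type*} [NonUnitalRing C] [Module ℂ C]

scoped instance : SMul ℂ C := Module.toDistribMulAction.toSMul

variable [IsScalarTower ℂ C C] [SMulCommClass ℂ C C]

scoped instance : NonUnitalNonAssocSemiring (Mult C) := inferInstance

variable {Γ B : Type*} [Group Γ] [NonUnitalCommRing B] [Module ℂ B] [IsScalarTower ℂ B B]
  [SMulCommClass ℂ B B] [StarRing B] [StarModule ℂ B] {act : Γ →* (B ≃⋆ₐ[ℂ] B)}
  [StarRing C] [StarModule ℂ C] (G : EvAlgebra act C)

scoped instance : NonUnitalRing G.FP := inferInstance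

end Shortcuts

/-! ## Hilbert spaces generated by positive kernels -/

section GramLemmas

variable {ι X Y : Type*} [NormedAddCommGroup X] [InnerProductSpace ℂ X] [CompleteSpace X]
  [NormedAddCommGroup Y] [InnerProductSpace ℂ Y] [CompleteSpace Y]

/-- The closed linear span of the family is the whole space. -/
def Total (u : ι → X) : Prop := (Submodule.span ℂ (Set.range u)).topologicalClosure = ⊤

theorem Total.mem_closed {u : ι → X} (hu : Total u) (S : Submodule ℂ X)
    (hS : IsClosed (S : Set X)) (h : ∀ i, u i ∈ S) (x : X) : x ∈ S := by
  have h1 : (Submodule.span ℂ (Set.range u)).topologicalClosure ≤ S :=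
    Submodule.topologicalClosure_minimal _ (Submodule.span_le.2 (by rintro _ ⟨i, rfl⟩; exact h i)) hS
  rw [hu] at h1
  exact h1 trivial

theorem Total.ext_op {Z : Type*} [NormedAddCommGroup Z] [NormedSpace ℂ Z] {u : ι → X}
    (hu : Total u) {S T : X →L[ℂ] Z} (h : ∀ i, S (u i) = T (u i)) : S = T := by
  ext x
  exact hu.mem_closed (LinearMap.eqLocus S.toLinearMap T.toLinearMap)
    (isClosed_eq S.continuous T.continuous) h x

theorem Total.ext_inner {u : ι → X} (hu : Total u) {x y : X}
    (h : ∀ i, inner ℂ (u i) x = inner ℂ (u i) y) : x = y := by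
  have : innerSL ℂ x = innerSL ℂ y := hu.ext_op fun i => by
    rw [innerSL_apply_apply, innerSL_apply_apply, ← inner_conj_symm, h, inner_conj_symm]
  have h2 := DFunLike.congr_fun this (x - y)
  rw [innerSL_apply_apply, innerSL_apply_apply, ← sub_eq_zero, ← inner_sub_left] at h2
  exact sub_eq_zero.1 (inner_self_eq_zero.1 h2)

theorem Total.dense_lin {u : ι → X} (hu : Total u) :
    DenseRange (Finsupp.linearCombination ℂ u) := by
  have h : Dense ((Submodule.span ℂ (Set.range u) : Submodule ℂ X) : Set X) :=
    Submodule.dense_iff_topologicalClosure_eq_top.2 hu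
  rw [← Finsupp.range_linearCombination] at h
  exact h

theorem Total.of_closed {u : ι → X}
    (h : ∀ S : Submodule ℂ X, IsClosed (S : Set X) → (∀ i, u i ∈ S) → S = ⊤) : Total u :=
  h _ (Submodule.isClosed_topologicalClosure _) fun i =>
    Submodule.le_topologicalClosure _ (Submodule.subset_span ⟨i, rfl⟩)

theorem inner_lin_lin (u : ι → X) (f : ι →₀ ℂ) :
    inner ℂ (Finsupp.linearCombination ℂ u f) (Finsupp.linearCombination ℂ u f) =
      ∑ i ∈ f.support, ∑ j ∈ f.support, star (f i) * f j * inner ℂ (u i) (u j) := by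
  rw [Finsupp.linearCombination_apply, Finsupp.sum, sum_inner]
  refine Finset.sum_congr rfl fun i _ => ?_
  rw [inner_sum]
  refine Finset.sum_congr rfl fun j _ => ?_
  rw [inner_smul_left, inner_smul_right, starRingEnd_apply]
  ring

/-- A bounded operator is determined by its values on a total family, provided that they satisfy a
norm estimate. -/
theorem Total.exists_op {u : ι → X} (hu : Total u) (v : ι → Y) (C : ℝ)
    (h : ∀ f : ι →₀ ℂ,
      ‖Finsupp.linearCombination ℂ v f‖ ≤ C * ‖Finsupp.linearCombination ℂ u f‖) :
    ∃ T : X →L[ℂ] Y, (∀ i, T (u i) = v i) ∧ ∀ x, ‖T x‖ ≤ C * ‖x‖ := by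
  refine ⟨(Finsupp.linearCombination ℂ v).extendOfNorm (Finsupp.linearCombination ℂ u), fun i => ?_,
    LinearMap.norm_extendOfNorm_apply_le hu.dense_lin C h⟩
  have := LinearMap.extendOfNorm_eq hu.dense_lin ⟨C, h⟩ (Finsupp.single i 1)
  simpa using this

/-- The same with a bound on the Gram matrices. -/
theorem Total.exists_op_gram {u : ι → X} (hu : Total u) (v : ι → Y) (C : ℝ) (hC : 0 ≤ C)
    (h : ∀ (s : Finset ι) (f : ι → ℂ),
      RCLike.re (∑ i ∈ s, ∑ j ∈ s, star (f i) * f j * inner ℂ (v i) (v j)) ≤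
        C ^ 2 * RCLike.re (∑ i ∈ s, ∑ j ∈ s, star (f i) * f j * inner ℂ (u i) (u j))) :
    ∃ T : X →L[ℂ] Y, (∀ i, T (u i) = v i) ∧ ∀ x, ‖T x‖ ≤ C * ‖x‖ := by
  refine hu.exists_op v C fun f => ?_
  have h1 := h f.support f
  rw [← inner_lin_lin, ← inner_lin_lin, inner_self_eq_norm_sq, inner_self_eq_norm_sq,
    ← mul_pow] at h1
  exact le_of_sq_le_sq h1 (by positivity)

/-- Total families with the same Gram matrix are related by a unitary. -/
theorem Total.exists_unitary {u : ι → X} {v : ι → Y} (hu : Total u) (hv : Total v)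
    (h : ∀ i j, inner ℂ (v i) (v j) = inner ℂ (u i) (u j)) :
    ∃ T : X ≃ₗᵢ[ℂ] Y, ∀ i, T (u i) = v i := by
  obtain ⟨T, hT, hT'⟩ := hu.exists_op_gram v 1 zero_le_one (by intro s f; simp [h])
  obtain ⟨R, hR, hR'⟩ := hv.exists_op_gram u 1 zero_le_one (by intro s f; simp [h])
  have h1 : R ∘L T = ContinuousLinearMap.id ℂ X := hu.ext_op fun i => by simp [hT, hR]
  have h2 : T ∘L R = ContinuousLinearMap.id ℂ Y := hv.ext_op fun i => by simp [hT, hR]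
  refine ⟨⟨LinearEquiv.ofLinearMap T.toLinearMap R.toLinearMap ?_ ?_, fun x => ?_⟩, hT⟩
  · ext x; exact DFunLike.congr_fun h2 x
  · ext x; exact DFunLike.congr_fun h1 x
  · refine le_antisymm (by simpa using hT' x) ?_
    have := hR' (T x)
    rw [← ContinuousLinearMap.comp_apply, h1] at this
    simpa using this

end GramLemmas

theorem theOp_spec {X Y : Type*} [NormedAddCommGroup X] [NormedSpace ℂ X] [NormedAddCommGroup Y]
    [NormedSpace ℂ Y] {P : (X →L[ℂ] Y) → Prop} (h : ∃ T, P T) : P (theOp P) := by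
  unfold theOp
  rw [dif_pos h]
  exact h.choose_spec

section KerHilb

variable {ι : Type*} {k : ι → ι → ℂ}

theorem total_vec (k : ι → ι → ℂ) : Total (vec k) := by
  refine Total.of_closed fun S hS h => ?_
  rw [eq_top_iff]
  rintro x -
  refine UniformSpace.Completion.induction_on x hS fun f => ?_
  change ι →₀ ℂ at f
  induction f using Finsupp.induction_linear with
  | zero => exact zero_mem S
  | add f g hf hg =>
    have h1 := S.add_mem hf hg
    have h2 := UniformSpace.Completion.coe_add (α := PreKer k) f g
    exact (congrArg (· ∈ S) h2).mpr h1
  | single i z =>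
    have h1 := S.smul_mem z (h i)
    have h2 : z • vec k i = ((show PreKer k from Finsupp.single i z : PreKer k) :
        UniformSpace.Completion (PreKer k)) := by
      unfold vec
      rw [← UniformSpace.Completion.coe_smul]
      congr 1
      change z • (Finsupp.single i (1 : ℂ)) = Finsupp.single i z
      simp
    rw [h2] at h1
    exact h1

/-- A kernel that is, on finite sets, a Gram matrix, is positive. -/
theorem posKer_of_finite
    (h : ∀ (s : Finset ι) (f : ι → ℂ), 0 ≤ ∑ i ∈ s, ∑ j ∈ s, star (f i) * f j * k i j)
    (hs : ∀ i j, star (k i j) = k j i) : PosKer k := by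
  refine ⟨?_, fun f => ?_⟩
  · ext i j
    simp [Matrix.conjTranspose_apply, hs]
  · have := h f.support f
    convert this using 1
    simp only [Finsupp.sum]
    refine Finset.sum_congr rfl fun i _ => Finset.sum_congr rfl fun j _ => ?_
    simp only [Matrix.of_apply]
    ring

/-- The canonical vectors are total, so relations between them can be read off the kernel.
Additivity, homogeneity and balancing of tensors are all obtained in this way. -/
theorem vec_eq_of_inner (hk : PosKer k) {x : KerHilb k} {i : ι} (h : ∀ j, inner ℂ (vec k j) x = k j i) :
    x = vec k i :=
  (total_vec k).ext_inner fun j => by rw [h, inner_vec hk]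

theorem vec_eq_vec (hk : PosKer k) {i j : ι} (h : ∀ l, k l i = k l j) : vec k i = vec k j :=
  vec_eq_of_inner hk fun l => by rw [inner_vec hk, h]

theorem vec_add (hk : PosKer k) {i j l : ι} (h : ∀ m, k m l = k m i + k m j) :
    vec k l = vec k i + vec k j :=
  (vec_eq_of_inner hk fun m => by rw [inner_add_right, inner_vec hk, inner_vec hk, h]).symm

theorem vec_smul (hk : PosKer k) {i l : ι} (z : ℂ) (h : ∀ m, k m l = z * k m i) : vec k l = z • vec k i :=
  (vec_eq_of_inner hk fun m => by rw [inner_smul_right, inner_vec hk, h]).symm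

/-- Reindexing preserves the Gram matrix and totality. The flips of twofold and threefold relative
tensor products come from here. -/
theorem exists_unitary_ker (hk : PosKer k) {κ : Type*} {k' : κ → κ → ℂ} (hk' : PosKer k') (e : ι ≃ κ)
    (h : ∀ i j, k' (e i) (e j) = k i j) :
    ∃ T : KerHilb k ≃ₗᵢ[ℂ] KerHilb k', ∀ i, T (vec k i) = vec k' (e i) := by
  refine Total.exists_unitary (total_vec k) ?_ fun i j => by rw [inner_vec hk, inner_vec hk', h]
  refine Total.of_closed fun S hS hi => ?_
  rw [eq_top_iff]
  rintro x -
  refine (total_vec k').mem_closed S hS (fun j => ?_) x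
  simpa using hi (e.symm j)

end KerHilb

/-! ## Matrices over a `C^*`-algebra of operators -/

section MatrixSqrt

variable {K L : Type*}
  [NormedAddCommGroup K] [InnerProductSpace ℂ K] [CompleteSpace K]
  [NormedAddCommGroup L] [InnerProductSpace ℂ L] [CompleteSpace L]

/-- The inclusion of a summand. -/
def sumIn (K : Type*) [NormedAddCommGroup K] [InnerProductSpace ℂ K] [CompleteSpace K]
    {ι : Type*} [Fintype ι] [DecidableEq ι] (i : ι) : K →L[ℂ] PiLp 2 fun _ : ι => K :=
  (PiLp.continuousLinearEquiv 2 ℂ fun _ : ι => K).symm.toContinuousLinearMap ∘L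
    ContinuousLinearMap.single ℂ (fun _ => K) i

variable {ι : Type*} [Fintype ι] [DecidableEq ι]

theorem adj_sumIn_apply (i : ι) (x : PiLp 2 fun _ : ι => K) : adj (sumIn K i) x = x i := by
  refine ext_inner_left ℂ fun ζ => ?_
  rw [ContinuousLinearMap.adjoint_inner_right, PiLp.inner_apply, Finset.sum_eq_single i]
  · simp [sumIn]
  · intro j _ hj
    simp [sumIn, hj]
  · simp

theorem adj_sumIn_comp (i j : ι) :
    adj (sumIn K i) ∘L sumIn K j = if i = j then ContinuousLinearMap.id ℂ K else 0 := by
  ext ζ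
  rw [ContinuousLinearMap.comp_apply, adj_sumIn_apply]
  split_ifs with h
  · subst h; simp [sumIn]
  · simp [sumIn, h]

theorem sum_sumIn_adj : ∑ i : ι, sumIn K i ∘L adj (sumIn K i) = 1 := by
  ext x j
  simp only [sum_apply, ContinuousLinearMap.comp_apply, adj_sumIn_apply]
  simp [sumIn]

theorem adj_comp {M : Type*} [NormedAddCommGroup M] [InnerProductSpace ℂ M] [CompleteSpace M]
    (S : L →L[ℂ] M) (T : K →L[ℂ] L) : adj (S ∘L T) = adj T ∘L adj S :=
  ContinuousLinearMap.adjoint_comp S T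

theorem adj_adj (T : K →L[ℂ] L) : adj (adj T) = T := ContinuousLinearMap.adjoint_adjoint T

variable {𝔅 : Submodule ℂ (K →L[ℂ] K)}

/-- The matrix coefficients of an operator on a finite direct sum. -/
def matCoeff (i j : ι) (R : (PiLp 2 fun _ : ι => K) →L[ℂ] PiLp 2 fun _ : ι => K) : K →L[ℂ] K :=
  adj (sumIn K i) ∘L R ∘L sumIn K j

theorem matCoeff_mul (i j : ι) (R S : (PiLp 2 fun _ : ι => K) →L[ℂ] PiLp 2 fun _ : ι => K) :
    matCoeff i j (R * S) = ∑ k, matCoeff i k R ∘L matCoeff k j S := by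
  have h : R * S = R ∘L (∑ k, sumIn K k ∘L adj (sumIn K k)) ∘L S := by
    rw [sum_sumIn_adj]
    rfl
  rw [h, ContinuousLinearMap.finsetSum_comp, ContinuousLinearMap.comp_finsetSum]
  unfold matCoeff
  rw [ContinuousLinearMap.finsetSum_comp, ContinuousLinearMap.comp_finsetSum]
  rfl

theorem matCoeff_star (i j : ι) (R : (PiLp 2 fun _ : ι => K) →L[ℂ] PiLp 2 fun _ : ι => K) :
    matCoeff i j (star R) = adj (matCoeff j i R) := by
  unfold matCoeff
  rw [adj_comp, adj_comp, adj_adj]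
  rfl

/-- The algebra of matrices with entries in `𝔅`. -/
def matAlg (hB : IsCBase 𝔅) (ι : Type*) [Fintype ι] [DecidableEq ι] :
    NonUnitalStarSubalgebra ℂ ((PiLp 2 fun _ : ι => K) →L[ℂ] PiLp 2 fun _ : ι => K) where
  carrier := {R | ∀ i j, matCoeff i j R ∈ 𝔅}
  add_mem' {R S} hR hS i j := by
    have : matCoeff i j (R + S) = matCoeff i j R + matCoeff i j S := by
      ext ζ; simp [matCoeff]
    rw [this]
    exact 𝔅.add_mem (hR i j) (hS i j)
  zero_mem' i j := by
    have : matCoeff i j (0 : (PiLp 2 fun _ : ι => K) →L[ℂ] PiLp 2 fun _ : ι => K) = 0 := by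
      ext ζ; simp [matCoeff]
    rw [this]
    exact 𝔅.zero_mem
  smul_mem' z R hR i j := by
    have : matCoeff i j (z • R) = z • matCoeff i j R := by
      ext ζ; simp [matCoeff]
    rw [this]
    exact 𝔅.smul_mem z (hR i j)
  mul_mem' {R S} hR hS i j := by
    rw [matCoeff_mul]
    exact 𝔅.sum_mem fun k _ => hB.mul_mem _ (hR i k) _ (hS k j)
  star_mem' {R} hR i j := by
    rw [matCoeff_star]
    exact hB.adj_mem _ (hR j i)

theorem isClosed_matAlg (hB : IsCBase 𝔅) :
    IsClosed (matAlg hB ι : Set ((PiLp 2 fun _ : ι => K) →L[ℂ] PiLp 2 fun _ : ι => K)) := by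
  have : (matAlg hB ι : Set ((PiLp 2 fun _ : ι => K) →L[ℂ] PiLp 2 fun _ : ι => K)) =
      ⋂ i, ⋂ j, matCoeff i j ⁻¹' (𝔅 : Set (K →L[ℂ] K)) := by
    ext R
    simp only [Set.mem_iInter]
    rfl
  rw [this]
  exact isClosed_iInter fun i => isClosed_iInter fun j => hB.closed.preimage (by unfold matCoeff; fun_prop)

/-- The square root vanishes at 0, so the non-unital functional calculus applies and stays in a
closed subalgebra that need not contain the identity. -/
theorem exists_sqrt_mem {P : Type*} [NormedAddCommGroup P] [InnerProductSpace ℂ P]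
    [CompleteSpace P] (S : NonUnitalStarSubalgebra ℂ (P →L[ℂ] P))
    (hS : IsClosed (S : Set (P →L[ℂ] P))) (T : P →L[ℂ] L) (hT : adj T ∘L T ∈ S) :
    ∃ R ∈ S, star R * R = adj T ∘L T := by
  have ha : 0 ≤ adj T ∘L T := (ContinuousLinearMap.nonneg_iff_isPositive _).2
    (ContinuousLinearMap.isPositive_adjoint_comp_self T)
  refine ⟨CFC.sqrt (adj T ∘L T), ?_, ?_⟩
  · rw [CFC.sqrt_eq_real_sqrt _ ha]
    exact cfcₙ_mem (𝕜 := ℝ) (𝕜' := ℂ) _ hT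
  · rw [(IsSelfAdjoint.of_nonneg (CFC.sqrt_nonneg (adj T ∘L T))).star_eq]
    exact CFC.sqrt_mul_sqrt_self _ ha

/-- Gram matrices with entries in a `C^*`-algebra `𝔅` of operators factorize over `𝔅`. -/
theorem exists_gram_sqrt (hB : IsCBase 𝔅) (ξ : ι → K →L[ℂ] L)
    (h : ∀ i j, adj (ξ i) ∘L ξ j ∈ 𝔅) :
    ∃ c : ι → ι → K →L[ℂ] K, (∀ k i, c k i ∈ 𝔅) ∧
      ∀ i j, adj (ξ i) ∘L ξ j = ∑ k, adj (c k i) ∘L c k j := by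
  -- The row operator (ξ_i)_i on the direct sum; the matrix of `adj T ∘L T` is the given Gram
  -- matrix, and the entries of its square root are the required c.
  let T : (PiLp 2 fun _ : ι => K) →L[ℂ] L := ∑ i, ξ i ∘L adj (sumIn K i)
  have hT : ∀ j, T ∘L sumIn K j = ξ j := fun j => by
    rw [ContinuousLinearMap.finsetSum_comp, Finset.sum_eq_single j]
    · rw [ContinuousLinearMap.comp_assoc, adj_sumIn_comp, if_pos rfl, ContinuousLinearMap.comp_id]
    · intro i _ hi
      rw [ContinuousLinearMap.comp_assoc, adj_sumIn_comp, if_neg hi, ContinuousLinearMap.comp_zero]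
    · simp
  have hij : ∀ i j, matCoeff i j (adj T ∘L T) = adj (ξ i) ∘L ξ j := fun i j => by
    rw [← hT i, ← hT j, adj_comp]
    rfl
  obtain ⟨R, hR, hRR⟩ := exists_sqrt_mem (matAlg hB ι) (isClosed_matAlg hB) T fun i j => by
    rw [hij]
    exact h i j
  refine ⟨fun k i => matCoeff k i R, fun k i => hR k i, fun i j => ?_⟩
  rw [← hij, ← hRR, matCoeff_mul]
  simp only [matCoeff_star]

end MatrixSqrt

/-! ## Representations associated to `C^*`-modules, relative tensor products -/

section Modules

variable {K L M : Type*}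
  [NormedAddCommGroup K] [InnerProductSpace ℂ K] [CompleteSpace K]
  [NormedAddCommGroup L] [InnerProductSpace ℂ L] [CompleteSpace L]
  [NormedAddCommGroup M] [InnerProductSpace ℂ M] [CompleteSpace M]

theorem subset_clspan' {X Y : Type*} [NormedAddCommGroup X] [NormedSpace ℂ X]
    [NormedAddCommGroup Y] [NormedSpace ℂ Y] {S : Set (X →L[ℂ] Y)} {T : X →L[ℂ] Y} (h : T ∈ S) :
    T ∈ clspan S :=
  Submodule.le_topologicalClosure _ (Submodule.subset_span h)

theorem clspan_le {X Y : Type*} [NormedAddCommGroup X] [NormedSpace ℂ X]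
    [NormedAddCommGroup Y] [NormedSpace ℂ Y] {S : Set (X →L[ℂ] Y)} {E : Submodule ℂ (X →L[ℂ] Y)}
    (hE : IsClosed (E : Set (X →L[ℂ] Y))) (h : S ⊆ E) : clspan S ≤ E :=
  Submodule.topologicalClosure_minimal _ (Submodule.span_le.2 h) hE

theorem isClosed_clspan {X Y : Type*} [NormedAddCommGroup X] [NormedSpace ℂ X]
    [NormedAddCommGroup Y] [NormedSpace ℂ Y] (S : Set (X →L[ℂ] Y)) :
    IsClosed (clspan S : Set (X →L[ℂ] Y)) :=
  Submodule.isClosed_topologicalClosure _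

theorem adj_inner_left (T : K →L[ℂ] L) (x : K) (y : L) :
    inner ℂ (adj T y) x = inner ℂ y (T x) := ContinuousLinearMap.adjoint_inner_left T x y

theorem adj_inner_right (T : K →L[ℂ] L) (x : K) (y : L) :
    inner ℂ x (adj T y) = inner ℂ (T x) y := ContinuousLinearMap.adjoint_inner_right T x y

variable {𝔅 : Submodule ℂ (K →L[ℂ] K)} {E : Submodule ℂ (K →L[ℂ] L)} {F : Submodule ℂ (K →L[ℂ] M)}

theorem IsCModule.adj_mem (hE : IsCModule 𝔅 E) {ξ ξ' : K →L[ℂ] L} (h : ξ ∈ E) (h' : ξ' ∈ E) :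
    adj ξ ∘L ξ' ∈ 𝔅 :=
  hE.adj_mul ▸ subset_clspan' ⟨ξ, h, ξ', h', rfl⟩

theorem IsCModule.mul_mem (hE : IsCModule 𝔅 E) {ξ : K →L[ℂ] L} {b : K →L[ℂ] K} (h : ξ ∈ E)
    (hb : b ∈ 𝔅) : ξ ∘L b ∈ E :=
  le_of_eq hE.mul_base (subset_clspan' ⟨ξ, h, b, hb, rfl⟩)

theorem IsCModule.total (hE : IsCModule 𝔅 E) : Total fun p : ↥E × K => p.1.1 p.2 := by
  unfold Total
  rw [← hE.nondegenerate]
  congr 2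
  ext v
  constructor
  · rintro ⟨p, rfl⟩
    exact ⟨p.1.1, p.1.2, p.2, rfl⟩
  · rintro ⟨ξ, hξ, ζ, rfl⟩
    exact ⟨(⟨ξ, hξ⟩, ζ), rfl⟩

/-- Factorization of the Gram matrix of a finite subfamily. -/
theorem IsCModule.exists_factor (hB : IsCBase 𝔅) (hE : IsCModule 𝔅 E) {ι : Type*} (s : Finset ι)
    (ξ : ι → ↥E) : ∃ c : ↥s → ι → K →L[ℂ] K, (∀ k i, c k i ∈ 𝔅) ∧
      ∀ i ∈ s, ∀ j ∈ s, adj (ξ i).1 ∘L (ξ j).1 = ∑ k, adj (c k i) ∘L c k j := by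
  classical
  obtain ⟨c, hc, h⟩ := exists_gram_sqrt hB (fun i : ↥s => (ξ i).1)
    fun i j => hE.adj_mem (ξ i).2 (ξ j).2
  -- Extension by zero outside s only serves to have c defined on the whole index type; the
  -- factorization is claimed on s alone.
  refine ⟨fun k i => if hi : i ∈ s then c k ⟨i, hi⟩ else 0, fun k i => ?_, fun i hi j hj => ?_⟩
  · dsimp only
    split_ifs with hi
    · exact hc _ _
    · exact 𝔅.zero_mem
  · simp only [dif_pos hi, dif_pos hj]
    exact h ⟨i, hi⟩ ⟨j, hj⟩

theorem sum_sum_inner {ι : Type*} (s : Finset ι) (f : ι → ℂ) (h h' : ι → M) :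
    ∑ i ∈ s, ∑ j ∈ s, star (f i) * f j * inner ℂ (h i) (h' j) =
      inner ℂ (∑ i ∈ s, f i • h i) (∑ j ∈ s, f j • h' j) := by
  rw [sum_inner]
  refine Finset.sum_congr rfl fun i _ => ?_
  rw [inner_sum]
  refine Finset.sum_congr rfl fun j _ => ?_
  rw [inner_smul_left, inner_smul_right, starRingEnd_apply]
  ring

/-- With ξ_i^*ξ_j = Σ_k c_{ki}^*c_{kj}, the squared norm of Σ f_i ξ_i b ζ_i becomes Σ_k ‖b Σ_i f_i
c_{ki}ζ_i‖², because b commutes with all c_{ki}. Each summand is at most ‖b‖² times the one without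
b. -/
theorem rep_exists (hB : IsCBase 𝔅) (hE : IsCModule 𝔅 E) {b : K →L[ℂ] K} (hb : b ∈ 𝔅) :
    ∃ R : L →L[ℂ] L, ((∀ p : ↥E × K, R (p.1.1 p.2) = p.1.1 (b p.2)) ∧
      ∀ x, ‖R x‖ ≤ ‖b‖ * ‖x‖) := by
  refine hE.total.exists_op_gram (fun p => p.1.1 (b p.2)) ‖b‖ (norm_nonneg _) fun s f => ?_
  obtain ⟨c, hc, hcs⟩ := hE.exists_factor hB s (fun p : ↥E × K => p.1)
  -- Used twice: for S = b, and for S = id to express the norm of the original vector by the same c.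
  have key : ∀ S : K →L[ℂ] K, (∀ a ∈ 𝔅, a ∘L S = S ∘L a) →
      RCLike.re (∑ i ∈ s, ∑ j ∈ s, star (f i) * f j * inner ℂ (i.1.1 (S i.2)) (j.1.1 (S j.2))) =
        ∑ k, ‖S (∑ i ∈ s, f i • c k i i.2)‖ ^ 2 := by
    intro S hS
    have h1 : ∀ i ∈ s, ∀ j ∈ s, star (f i) * f j * inner ℂ (i.1.1 (S i.2)) (j.1.1 (S j.2)) =
        ∑ k, star (f i) * f j * inner ℂ (S (c k i i.2)) (S (c k j j.2)) := by
      intro i hi j hj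
      rw [← Finset.mul_sum, ← adj_inner_right, ← ContinuousLinearMap.comp_apply (adj _), hcs i hi j hj,
        sum_apply, inner_sum]
      congr 1
      refine Finset.sum_congr rfl fun k _ => ?_
      rw [ContinuousLinearMap.comp_apply, adj_inner_right, ← ContinuousLinearMap.comp_apply (c k i),
        ← ContinuousLinearMap.comp_apply (c k j), hS _ (hc k i), hS _ (hc k j)]
      rfl
    rw [Finset.sum_congr rfl fun i hi => Finset.sum_congr rfl fun j hj => h1 i hi j hj]
    have h2 : ∀ i, ∑ j ∈ s, ∑ k, star (f i) * f j * inner ℂ (S (c k i i.2)) (S (c k j j.2)) =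
        ∑ k, ∑ j ∈ s, star (f i) * f j * inner ℂ (S (c k i i.2)) (S (c k j j.2)) :=
      fun i => Finset.sum_comm
    simp only [h2]
    rw [Finset.sum_comm, map_sum]
    refine Finset.sum_congr rfl fun k _ => ?_
    rw [sum_sum_inner s f (fun i => S (c k i i.2)) (fun i => S (c k i i.2)), ← inner_self_eq_norm_sq (𝕜 := ℂ),
      map_sum]
    simp only [map_smul]
  have h1 := key b fun a ha => hB.mul_comm a ha b hb
  have h2 := key (ContinuousLinearMap.id ℂ K) fun a _ => rfl
  simp only [ContinuousLinearMap.id_apply] at h2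
  rw [h1, h2, Finset.mul_sum]
  refine Finset.sum_le_sum fun k _ => ?_
  rw [← mul_pow]
  exact pow_le_pow_left₀ (norm_nonneg _) (b.le_opNorm _) 2

section Rep

variable (hB : IsCBase 𝔅) (hE : IsCModule 𝔅 E)

theorem rep_comp (hB : IsCBase 𝔅) (hE : IsCModule 𝔅 E) {b : K →L[ℂ] K} (hb : b ∈ 𝔅)
    {ξ : K →L[ℂ] L} (hξ : ξ ∈ E) : rep E b ∘L ξ = ξ ∘L b := by
  obtain ⟨R, hR, -⟩ := rep_exists hB hE hb
  exact theOp_spec (P := fun R : L →L[ℂ] L => ∀ ξ ∈ E, R ∘L ξ = ξ ∘L b)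
    ⟨R, fun ξ hξ => by ext ζ; exact hR (⟨ξ, hξ⟩, ζ)⟩ ξ hξ

theorem rep_apply (hB : IsCBase 𝔅) (hE : IsCModule 𝔅 E) {b : K →L[ℂ] K} (hb : b ∈ 𝔅)
    {ξ : K →L[ℂ] L} (hξ : ξ ∈ E) (ζ : K) : rep E b (ξ ζ) = ξ (b ζ) :=
  DFunLike.congr_fun (rep_comp hB hE hb hξ) ζ

theorem rep_unique (hB : IsCBase 𝔅) (hE : IsCModule 𝔅 E) {b : K →L[ℂ] K} (hb : b ∈ 𝔅)
    {R : L →L[ℂ] L} (h : ∀ ξ ∈ E, ∀ ζ, R (ξ ζ) = ξ (b ζ)) : rep E b = R :=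
  hE.total.ext_op fun p => by rw [rep_apply hB hE hb p.1.2, h _ p.1.2]

theorem rep_norm (hB : IsCBase 𝔅) (hE : IsCModule 𝔅 E) {b : K →L[ℂ] K} (hb : b ∈ 𝔅) (x : L) :
    ‖rep E b x‖ ≤ ‖b‖ * ‖x‖ := by
  obtain ⟨R, hR, hn⟩ := rep_exists hB hE hb
  rw [rep_unique hB hE hb fun ξ hξ ζ => hR (⟨ξ, hξ⟩, ζ)]
  exact hn x

theorem rep_add (hB : IsCBase 𝔅) (hE : IsCModule 𝔅 E) {b c : K →L[ℂ] K} (hb : b ∈ 𝔅)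
    (hc : c ∈ 𝔅) : rep E (b + c) = rep E b + rep E c :=
  rep_unique hB hE (𝔅.add_mem hb hc) fun ξ hξ ζ => by
    simp [rep_apply hB hE hb hξ, rep_apply hB hE hc hξ]

theorem rep_smul (hB : IsCBase 𝔅) (hE : IsCModule 𝔅 E) {b : K →L[ℂ] K} (hb : b ∈ 𝔅) (z : ℂ) :
    rep E (z • b) = z • rep E b :=
  rep_unique hB hE (𝔅.smul_mem z hb) fun ξ hξ ζ => by simp [rep_apply hB hE hb hξ]

theorem rep_mul (hB : IsCBase 𝔅) (hE : IsCModule 𝔅 E) {b c : K →L[ℂ] K} (hb : b ∈ 𝔅)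
    (hc : c ∈ 𝔅) : rep E (b ∘L c) = rep E b ∘L rep E c :=
  rep_unique hB hE (hB.mul_mem b hb c hc) fun ξ hξ ζ => by
    simp [rep_apply hB hE hb hξ, rep_apply hB hE hc hξ]

/-- Multiplicativity of the inner product on E would only give b ξ^*ξ' on one side and ξ^*ξ' b on
the other; commutativity of 𝔅 identifies them. -/
theorem rep_adj (hB : IsCBase 𝔅) (hE : IsCModule 𝔅 E) {b : K →L[ℂ] K} (hb : b ∈ 𝔅) :
    rep E (adj b) = adj (rep E b) := by
  refine rep_unique hB hE (hB.adj_mem b hb) fun ξ hξ ζ => ?_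
  refine hE.total.ext_inner fun p => ?_
  have h := DFunLike.congr_fun (hB.mul_comm _ (hE.adj_mem p.1.2 hξ) _ (hB.adj_mem b hb)) ζ
  simp only [ContinuousLinearMap.comp_apply] at h
  rw [adj_inner_right, rep_apply hB hE hb p.1.2, ← adj_inner_right, ← adj_inner_right p.1.1, h,
    adj_inner_right b]

theorem rep_sum (hB : IsCBase 𝔅) (hE : IsCModule 𝔅 E) {κ : Type*} (s : Finset κ)
    (b : κ → K →L[ℂ] K) (hb : ∀ k, b k ∈ 𝔅) : rep E (∑ k ∈ s, b k) = ∑ k ∈ s, rep E (b k) :=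
  rep_unique hB hE (𝔅.sum_mem fun k _ => hb k) fun ξ hξ ζ => by
    simp only [sum_apply, map_sum]
    exact Finset.sum_congr rfl fun k _ => rep_apply hB hE (hb k) hξ ζ

end Rep

/-- Sums defined by Gram matrices of elements of `E` are sums of squares. -/
theorem gram_sum (hB : IsCBase 𝔅) (hF : IsCModule 𝔅 F) {ι : Type*} {s : Finset ι} {ξ : ι → ↥E}
    {κ : Type*} [Fintype κ] {c : κ → ι → K →L[ℂ] K} (hc : ∀ k i, c k i ∈ 𝔅)
    (hcs : ∀ i ∈ s, ∀ j ∈ s, adj (ξ i).1 ∘L (ξ j).1 = ∑ k, adj (c k i) ∘L c k j)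
    (f : ι → ℂ) (h h' : ι → M) :
    ∑ i ∈ s, ∑ j ∈ s, star (f i) * f j * inner ℂ (h i) (rep F (adj (ξ i).1 ∘L (ξ j).1) (h' j)) =
      ∑ k, inner ℂ (∑ i ∈ s, f i • rep F (c k i) (h i)) (∑ i ∈ s, f i • rep F (c k i) (h' i)) := by
  have h1 : ∀ i ∈ s, ∀ j ∈ s,
      star (f i) * f j * inner ℂ (h i) (rep F (adj (ξ i).1 ∘L (ξ j).1) (h' j)) =
        ∑ k, star (f i) * f j * inner ℂ (rep F (c k i) (h i)) (rep F (c k j) (h' j)) := by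
    intro i hi j hj
    rw [hcs i hi j hj, rep_sum hB hF _ _ fun k => hB.mul_mem _ (hB.adj_mem _ (hc k i)) _ (hc k j),
      sum_apply, inner_sum, Finset.mul_sum]
    refine Finset.sum_congr rfl fun k _ => ?_
    rw [rep_mul hB hF (hB.adj_mem _ (hc k i)) (hc k j), rep_adj hB hF (hc k i),
      ContinuousLinearMap.comp_apply, adj_inner_right]
  rw [Finset.sum_congr rfl fun i hi => Finset.sum_congr rfl fun j hj => h1 i hi j hj]
  have h2 : ∀ i, ∑ j ∈ s, ∑ k, star (f i) * f j *
      inner ℂ (rep F (c k i) (h i)) (rep F (c k j) (h' j)) =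
        ∑ k, ∑ j ∈ s, star (f i) * f j * inner ℂ (rep F (c k i) (h i)) (rep F (c k j) (h' j)) :=
    fun i => Finset.sum_comm
  simp only [h2]
  rw [Finset.sum_comm]
  refine Finset.sum_congr rfl fun k _ => ?_
  rw [sum_sum_inner s f (fun i => rep F (c k i) (h i)) (fun i => rep F (c k i) (h' i))]

/-- Since ξ^*ξ' and η^*η' commute, the symmetric kernel can be read as a form on the second leg in
which the first factor enters only through ρ_F(ξ^*ξ'). In this form `gram_sum` applies and gives
positivity. -/
theorem rtpKer_eq (hB : IsCBase 𝔅) (hE : IsCModule 𝔅 E) (hF : IsCModule 𝔅 F) (u v : ↥E × K × ↥F) :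
    rtpKer E F u v = inner ℂ (u.2.2.1 u.2.1) (rep F (adj u.1.1 ∘L v.1.1) (v.2.2.1 v.2.1)) := by
  unfold rtpKer
  rw [rep_apply hB hF (hE.adj_mem u.1.2 v.1.2) v.2.2.2, ← adj_inner_right,
    ← ContinuousLinearMap.comp_apply, hB.mul_comm _ (hE.adj_mem u.1.2 v.1.2) _ (hF.adj_mem u.2.2.2 v.2.2.2)]
  rfl

theorem sum_inner_self_nonneg {κ : Type*} [Fintype κ] (w : κ → M) :
    0 ≤ ∑ k, inner ℂ (w k) (w k) :=
  Finset.sum_nonneg fun k _ => by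
    rw [inner_self_eq_norm_sq_to_K]
    rw [← RCLike.ofReal_pow]
    exact Complex.zero_le_real.2 (sq_nonneg _)

theorem posKer_rtp (hB : IsCBase 𝔅) (hE : IsCModule 𝔅 E) (hF : IsCModule 𝔅 F) :
    PosKer (rtpKer E F) := by
  refine posKer_of_finite (fun s f => ?_) fun u v => ?_
  · obtain ⟨c, hc, hcs⟩ := hE.exists_factor hB s (fun p : ↥E × K × ↥F => p.1)
    simp only [rtpKer_eq hB hE hF]
    rw [gram_sum hB hF hc hcs f (fun u => u.2.2.1 u.2.1) (fun u => u.2.2.1 u.2.1)]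
    exact sum_inner_self_nonneg _
  · rw [rtpKer_eq hB hE hF, rtpKer_eq hB hE hF, ← starRingEnd_apply, inner_conj_symm,
      ← adj_inner_right, ← rep_adj hB hF (hE.adj_mem u.1.2 v.1.2), adj_comp, adj_adj]

end Modules

/-! ### Kets, flips and operators on single legs of relative tensor products. -/

section RelativeTensor

variable {K L M : Type*}
  [NormedAddCommGroup K] [InnerProductSpace ℂ K] [CompleteSpace K]
  [NormedAddCommGroup L] [InnerProductSpace ℂ L] [CompleteSpace L]
  [NormedAddCommGroup M] [InnerProductSpace ℂ M] [CompleteSpace M]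
  {𝔅 : Submodule ℂ (K →L[ℂ] K)} {E : Submodule ℂ (K →L[ℂ] L)} {F : Submodule ℂ (K →L[ℂ] M)}

theorem re_inner_le_of_bound (T : M →L[ℂ] M) {C : ℝ} (hT : ∀ x, ‖T x‖ ≤ C * ‖x‖) (x : M) :
    RCLike.re (inner ℂ x (T x)) ≤ C * RCLike.re (inner ℂ x x) := by
  rw [inner_self_eq_norm_sq]
  calc RCLike.re (inner ℂ x (T x)) ≤ ‖x‖ * ‖T x‖ := re_inner_le_norm x (T x)
    _ ≤ ‖x‖ * (C * ‖x‖) := mul_le_mul_of_nonneg_left (hT x) (norm_nonneg _)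
    _ = C * ‖x‖ ^ 2 := by ring

theorem norm_adj_comp_self (ξ : K →L[ℂ] L) : ‖adj ξ ∘L ξ‖ = ‖ξ‖ ^ 2 := by
  rw [pow_two]
  exact ContinuousLinearMap.norm_adjoint_comp_self ξ

/-- The Gram matrix of the prescribed images is h ↦ ⟨h, ρ_F(ξ^*ξ)h⟩, and ρ_F is contractive, so the
bound is ‖ξ^*ξ‖ = ‖ξ‖². -/
theorem ket₁_exists (hB : IsCBase 𝔅) (hE : IsCModule 𝔅 E) (hF : IsCModule 𝔅 F) (ξ : ↥E) :
    ∃ T : M →L[ℂ] RTP E F, (∀ p : ↥F × K, T (p.1.1 p.2) = vec (rtpKer E F) (ξ, p.2, p.1)) ∧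
      ∀ x, ‖T x‖ ≤ ‖ξ‖ * ‖x‖ := by
  refine hF.total.exists_op_gram _ ‖ξ‖ (norm_nonneg _) fun s f => ?_
  simp only [inner_vec (posKer_rtp hB hE hF), rtpKer_eq hB hE hF]
  rw [sum_sum_inner s f (fun p => p.1.1 p.2) (fun p => p.1.1 p.2),
    sum_sum_inner s f (fun p => p.1.1 p.2) (fun p => rep F (adj ξ.1 ∘L ξ.1) (p.1.1 p.2))]
  simp only [← map_smul, ← map_sum]
  refine re_inner_le_of_bound _ (fun x => ?_) _
  have := rep_norm hB hF (hE.adj_mem ξ.2 ξ.2) x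
  rwa [norm_adj_comp_self] at this

theorem ket₁_apply (hB : IsCBase 𝔅) (hE : IsCModule 𝔅 E) (hF : IsCModule 𝔅 F) (ξ : ↥E) (η : ↥F)
    (ζ : K) : (ket₁ ξ : M →L[ℂ] RTP E F) (η.1 ζ) = vec (rtpKer E F) (ξ, ζ, η) := by
  obtain ⟨T, hT, -⟩ := ket₁_exists hB hE hF ξ
  exact theOp_spec (P := fun T : M →L[ℂ] RTP E F => ∀ (η : ↥F) (ζ : K),
    T (η.1 ζ) = vec (rtpKer E F) (ξ, ζ, η)) ⟨T, fun η ζ => hT (η, ζ)⟩ η ζ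

theorem ket₁_norm (hB : IsCBase 𝔅) (hE : IsCModule 𝔅 E) (hF : IsCModule 𝔅 F) (ξ : ↥E) (x : M) :
    ‖(ket₁ ξ : M →L[ℂ] RTP E F) x‖ ≤ ‖ξ‖ * ‖x‖ := by
  obtain ⟨T, hT, hn⟩ := ket₁_exists hB hE hF ξ
  have : (ket₁ ξ : M →L[ℂ] RTP E F) = T := hF.total.ext_op fun p => by
    rw [ket₁_apply hB hE hF, hT]
  rw [this]
  exact hn x

/-- The basic identity of the calculus: inner products in a relative tensor product reduce to the
representation of 𝔅 on one leg. -/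
theorem adj_ket₁_comp (hB : IsCBase 𝔅) (hE : IsCModule 𝔅 E) (hF : IsCModule 𝔅 F) (ξ ξ' : ↥E) :
    adj (ket₁ ξ : M →L[ℂ] RTP E F) ∘L ket₁ ξ' = rep F (adj ξ.1 ∘L ξ'.1) := by
  refine hF.total.ext_op fun p => hF.total.ext_inner fun q => ?_
  rw [ContinuousLinearMap.comp_apply, adj_inner_right, ket₁_apply hB hE hF, ket₁_apply hB hE hF,
    inner_vec (posKer_rtp hB hE hF), rtpKer_eq hB hE hF]

theorem inner_ket₁ (hB : IsCBase 𝔅) (hE : IsCModule 𝔅 E) (hF : IsCModule 𝔅 F) (ξ ξ' : ↥E)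
    (h h' : M) : inner ℂ ((ket₁ ξ : M →L[ℂ] RTP E F) h) (ket₁ ξ' h') =
      inner ℂ h (rep F (adj ξ.1 ∘L ξ'.1) h') := by
  rw [← adj_ket₁_comp hB hE hF, ContinuousLinearMap.comp_apply, adj_inner_right]

theorem total_ket₁ (hB : IsCBase 𝔅) (hE : IsCModule 𝔅 E) (hF : IsCModule 𝔅 F) :
    Total fun p : ↥E × M => (ket₁ p.1 : M →L[ℂ] RTP E F) p.2 := by
  refine Total.of_closed fun S hS h => ?_
  rw [eq_top_iff]
  rintro x -
  refine (total_vec _).mem_closed S hS (fun p => ?_) x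
  rw [show p = (p.1, p.2.1, p.2.2) from rfl, ← ket₁_apply hB hE hF]
  exact h (p.1, p.2.2.1 p.2.1)

theorem ket₁_unique (hB : IsCBase 𝔅) (hE : IsCModule 𝔅 E) (hF : IsCModule 𝔅 F) {ξ : ↥E}
    {T : M →L[ℂ] RTP E F} (h : ∀ (η : ↥F) ζ, T (η.1 ζ) = vec (rtpKer E F) (ξ, ζ, η)) :
    ket₁ ξ = T :=
  hF.total.ext_op fun p => by rw [ket₁_apply hB hE hF, h]

theorem ket₁_add (hB : IsCBase 𝔅) (hE : IsCModule 𝔅 E) (hF : IsCModule 𝔅 F) (ξ ξ' : ↥E) :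
    (ket₁ (ξ + ξ') : M →L[ℂ] RTP E F) = ket₁ ξ + ket₁ ξ' :=
  ket₁_unique hB hE hF fun η ζ => by
    rw [add_apply, ket₁_apply hB hE hF, ket₁_apply hB hE hF]
    exact (vec_add (posKer_rtp hB hE hF) fun m => by simp [rtpKer]).symm

theorem ket₁_smul (hB : IsCBase 𝔅) (hE : IsCModule 𝔅 E) (hF : IsCModule 𝔅 F) (z : ℂ) (ξ : ↥E) :
    (ket₁ (z • ξ) : M →L[ℂ] RTP E F) = z • ket₁ ξ :=
  ket₁_unique hB hE hF fun η ζ => by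
    rw [smul_apply, ket₁_apply hB hE hF]
    exact (vec_smul (posKer_rtp hB hE hF) z fun m => by simp [rtpKer]).symm

theorem ket₁_opNorm (hB : IsCBase 𝔅) (hE : IsCModule 𝔅 E) (hF : IsCModule 𝔅 F) (ξ : ↥E) :
    ‖(ket₁ ξ : M →L[ℂ] RTP E F)‖ ≤ ‖ξ‖ :=
  ContinuousLinearMap.opNorm_le_bound _ (norm_nonneg _) fun x => ket₁_norm hB hE hF ξ x

/-- `ξ ↦ |ξ⟩₁` as a linear map -/
def ketLin₁ (hB : IsCBase 𝔅) (hE : IsCModule 𝔅 E) (hF : IsCModule 𝔅 F) :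
    ↥E →ₗ[ℂ] (M →L[ℂ] RTP E F) where
  toFun ξ := ket₁ ξ
  map_add' := ket₁_add hB hE hF
  map_smul' := ket₁_smul hB hE hF

theorem continuous_ket₁ (hB : IsCBase 𝔅) (hE : IsCModule 𝔅 E) (hF : IsCModule 𝔅 F) :
    Continuous fun ξ : ↥E => (ket₁ ξ : M →L[ℂ] RTP E F) :=
  AddMonoidHomClass.continuous_of_bound (ketLin₁ hB hE hF) 1 fun ξ => by
    rw [one_mul]
    exact ket₁_opNorm hB hE hF ξ

/-- `ξ b ⊗ h = ξ ⊗ ρ(b) h` -/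
theorem ket₁_balanced (hB : IsCBase 𝔅) (hE : IsCModule 𝔅 E) (hF : IsCModule 𝔅 F) (ξ : ↥E)
    {b : K →L[ℂ] K} (hb : b ∈ 𝔅) :
    (ket₁ ⟨ξ.1 ∘L b, hE.mul_mem ξ.2 hb⟩ : M →L[ℂ] RTP E F) = ket₁ ξ ∘L rep F b := by
  refine ket₁_unique hB hE hF fun η ζ => ?_
  rw [ContinuousLinearMap.comp_apply, rep_apply hB hF hb η.2, ket₁_apply hB hE hF]
  refine vec_eq_vec (posKer_rtp hB hE hF) fun l => ?_
  have h := DFunLike.congr_fun (hB.mul_comm _ (hF.adj_mem l.2.2.2 η.2) _ hb) ζ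
  simp only [ContinuousLinearMap.comp_apply] at h
  simp only [rtpKer, ContinuousLinearMap.comp_apply, h]

section Flip

/-- The kernel is symmetric in the two factors because 𝔅 is commutative. Hence statements about
`ket₂` follow from those about `ket₁`. -/
theorem exists_rtpFlip (hB : IsCBase 𝔅) (hE : IsCModule 𝔅 E) (hF : IsCModule 𝔅 F) :
    ∃ T : RTP E F ≃ₗᵢ[ℂ] RTP F E, ∀ p : ↥E × K × ↥F,
      T (vec (rtpKer E F) p) = vec (rtpKer F E) (p.2.2, p.2.1, p.1) := by
  refine exists_unitary_ker (posKer_rtp hB hE hF) (posKer_rtp hB hF hE)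
    ⟨fun p => (p.2.2, p.2.1, p.1), fun p => (p.2.2, p.2.1, p.1), fun _ => rfl, fun _ => rfl⟩
    fun p q => ?_
  have h := DFunLike.congr_fun
    (hB.mul_comm _ (hE.adj_mem p.1.2 q.1.2) _ (hF.adj_mem p.2.2.2 q.2.2.2)) q.2.1
  change inner ℂ p.2.1 ((adj p.2.2.1 ∘L q.2.2.1) ((adj p.1.1 ∘L q.1.1) q.2.1)) = _
  rw [← ContinuousLinearMap.comp_apply, ← h]
  rfl

/-- The flip of a relative tensor product. -/
def rtpFlip (hB : IsCBase 𝔅) (hE : IsCModule 𝔅 E) (hF : IsCModule 𝔅 F) : RTP E F ≃ₗᵢ[ℂ] RTP F E :=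
  (exists_rtpFlip hB hE hF).choose

theorem rtpFlip_vec (hB : IsCBase 𝔅) (hE : IsCModule 𝔅 E) (hF : IsCModule 𝔅 F) (ξ : ↥E) (ζ : K)
    (η : ↥F) : rtpFlip hB hE hF (vec (rtpKer E F) (ξ, ζ, η)) = vec (rtpKer F E) (η, ζ, ξ) :=
  (exists_rtpFlip hB hE hF).choose_spec (ξ, ζ, η)

theorem ket₂_apply' (hB : IsCBase 𝔅) (hE : IsCModule 𝔅 E) (hF : IsCModule 𝔅 F) (η : ↥F) (ξ : ↥E)
    (ζ : K) : (ket₂ η : L →L[ℂ] RTP E F) (ξ.1 ζ) = vec (rtpKer E F) (ξ, ζ, η) := by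
  refine theOp_spec (P := fun T : L →L[ℂ] RTP E F => ∀ (ξ : ↥E) (ζ : K),
    T (ξ.1 ζ) = vec (rtpKer E F) (ξ, ζ, η))
    ⟨(rtpFlip hB hF hE).toContinuousLinearEquiv.toContinuousLinearMap ∘L ket₁ η,
      fun ξ ζ => ?_⟩ ξ ζ
  rw [ContinuousLinearMap.comp_apply, ket₁_apply hB hF hE]
  exact rtpFlip_vec hB hF hE η ζ ξ

theorem ket₂_eq (hB : IsCBase 𝔅) (hE : IsCModule 𝔅 E) (hF : IsCModule 𝔅 F) (η : ↥F) (h : L) :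
    (ket₂ η : L →L[ℂ] RTP E F) h = rtpFlip hB hF hE (ket₁ η h) := by
  have : (ket₂ η : L →L[ℂ] RTP E F) =
      (rtpFlip hB hF hE).toContinuousLinearEquiv.toContinuousLinearMap ∘L ket₁ η :=
    hE.total.ext_op fun p => by
      rw [ket₂_apply' hB hE hF, ContinuousLinearMap.comp_apply, ket₁_apply hB hF hE]
      exact (rtpFlip_vec hB hF hE η p.2 p.1).symm
  rw [this]
  rfl

theorem rtpFlip_rtpFlip (hB : IsCBase 𝔅) (hE : IsCModule 𝔅 E) (hF : IsCModule 𝔅 F) (x : RTP E F) :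
    rtpFlip hB hF hE (rtpFlip hB hE hF x) = x :=
  DFunLike.congr_fun ((total_vec _).ext_op
    (S := (rtpFlip hB hF hE).toContinuousLinearEquiv.toContinuousLinearMap ∘L
      (rtpFlip hB hE hF).toContinuousLinearEquiv.toContinuousLinearMap)
    (T := ContinuousLinearMap.id ℂ _) fun p => by
      change rtpFlip hB hF hE (rtpFlip hB hE hF (vec _ (p.1, p.2.1, p.2.2))) = _
      rw [rtpFlip_vec, rtpFlip_vec]
      rfl) x

theorem rtpFlip_ket₁ (hB : IsCBase 𝔅) (hE : IsCModule 𝔅 E) (hF : IsCModule 𝔅 F) (ξ : ↥E) (h : M) :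
    rtpFlip hB hE hF (ket₁ ξ h) = ket₂ ξ h := (ket₂_eq hB hF hE ξ h).symm

theorem rtpFlip_ket₂ (hB : IsCBase 𝔅) (hE : IsCModule 𝔅 E) (hF : IsCModule 𝔅 F) (η : ↥F) (h : L) :
    rtpFlip hB hE hF (ket₂ η h) = ket₁ η h := by
  rw [ket₂_eq hB hE hF, rtpFlip_rtpFlip]

theorem total_ket₂ (hB : IsCBase 𝔅) (hE : IsCModule 𝔅 E) (hF : IsCModule 𝔅 F) :
    Total fun p : ↥F × L => (ket₂ p.1 : L →L[ℂ] RTP E F) p.2 := by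
  refine Total.of_closed fun S hS h => ?_
  rw [eq_top_iff]
  rintro x -
  refine (total_vec _).mem_closed S hS (fun p => ?_) x
  rw [show p = (p.1, p.2.1, p.2.2) from rfl, ← ket₂_apply' hB hE hF]
  exact h (p.2.2, p.1.1 p.2.1)

end Flip

/-! ### Operators on one leg -/

/-- `S` commutes with the representation associated to `F`. -/
def CommRep (𝔅 : Submodule ℂ (K →L[ℂ] K)) (F : Submodule ℂ (K →L[ℂ] M)) (S : M →L[ℂ] M) : Prop :=
  ∀ b ∈ 𝔅, rep F b ∘L S = S ∘L rep F b

/-- `1 ⊗ S`, acting on the second leg -/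
def act₁ (E : Submodule ℂ (K →L[ℂ] L)) (F : Submodule ℂ (K →L[ℂ] M)) (S : M →L[ℂ] M) :
    RTP E F →L[ℂ] RTP E F :=
  theOp fun T => ∀ p : ↥E × M, T (ket₁ p.1 p.2) = ket₁ p.1 (S p.2)

/-- After factorizing the Gram matrix of the first factors, the squared norm is a sum of terms built
from ρ_F(c_{ki}). An operator S that commutes with ρ_F can be pulled out of each of them, at the
cost of a factor ‖S‖. -/
theorem act₁_apply (hB : IsCBase 𝔅) (hE : IsCModule 𝔅 E) (hF : IsCModule 𝔅 F) {S : M →L[ℂ] M}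
    (hS : CommRep 𝔅 F S) (ξ : ↥E) (h : M) : act₁ E F S (ket₁ ξ h) = ket₁ ξ (S h) := by
  refine theOp_spec (P := fun T : RTP E F →L[ℂ] RTP E F => ∀ p : ↥E × M,
    T (ket₁ p.1 p.2) = ket₁ p.1 (S p.2)) ?_ (ξ, h)
  suffices h : _ from ⟨_, ((total_ket₁ hB hE hF).exists_op_gram
    (fun p : ↥E × M => (ket₁ p.1 : M →L[ℂ] RTP E F) (S p.2)) ‖S‖ (norm_nonneg _) h).choose_spec.1⟩
  intro s f
  obtain ⟨c, hc, hcs⟩ := hE.exists_factor hB s (fun p : ↥E × M => p.1)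
  simp only [inner_ket₁ hB hE hF]
  rw [gram_sum hB hF hc hcs f (fun p => S p.2) (fun p => S p.2),
    gram_sum hB hF hc hcs f (fun p => p.2) (fun p => p.2), map_sum, map_sum, Finset.mul_sum]
  refine Finset.sum_le_sum fun k _ => ?_
  have h1 : ∀ p : ↥E × M, rep F (c k p) (S p.2) = S (rep F (c k p) p.2) := fun p =>
    DFunLike.congr_fun (hS _ (hc k p)) p.2
  simp only [h1, ← map_smul]
  rw [← map_sum, inner_self_eq_norm_sq, inner_self_eq_norm_sq, ← mul_pow]
  exact pow_le_pow_left₀ (norm_nonneg _) (S.le_opNorm _) 2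

/-- `S ⊗ 1`, acting on the first leg -/
def act₂ (E : Submodule ℂ (K →L[ℂ] L)) (F : Submodule ℂ (K →L[ℂ] M)) (S : L →L[ℂ] L) :
    RTP E F →L[ℂ] RTP E F :=
  theOp fun T => ∀ p : ↥F × L, T (ket₂ p.1 p.2) = ket₂ p.1 (S p.2)

theorem act₂_apply (hB : IsCBase 𝔅) (hE : IsCModule 𝔅 E) (hF : IsCModule 𝔅 F) {S : L →L[ℂ] L}
    (hS : CommRep 𝔅 E S) (η : ↥F) (h : L) : act₂ E F S (ket₂ η h) = ket₂ η (S h) := by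
  refine theOp_spec (P := fun T : RTP E F →L[ℂ] RTP E F => ∀ p : ↥F × L,
    T (ket₂ p.1 p.2) = ket₂ p.1 (S p.2)) ?_ (η, h)
  refine ⟨(rtpFlip hB hF hE).toContinuousLinearEquiv.toContinuousLinearMap ∘L act₁ F E S ∘L
    (rtpFlip hB hE hF).toContinuousLinearEquiv.toContinuousLinearMap, fun p => ?_⟩
  change rtpFlip hB hF hE (act₁ F E S (rtpFlip hB hE hF (ket₂ p.1 p.2))) = _
  rw [rtpFlip_ket₂, act₁_apply hB hF hE hS, rtpFlip_ket₁]

variable {E' : Submodule ℂ (K →L[ℂ] L)} {F' : Submodule ℂ (K →L[ℂ] M)}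

/-- On `[|E⟩₁ G]`, the operator `1 ⊗ ρ_G(b)` is right multiplication by `b`. -/
theorem act₁_ketSp₁ (hB : IsCBase 𝔅) (hE : IsCModule 𝔅 E) (hF : IsCModule 𝔅 F)
    (hF' : IsCModule 𝔅 F') {b : K →L[ℂ] K} (hb : b ∈ 𝔅) (hc : CommRep 𝔅 F (rep F' b))
    {T : K →L[ℂ] RTP E F} (hT : T ∈ ketSp₁ E F F') : act₁ E F (rep F' b) ∘L T = T ∘L b := by
  let S : Submodule ℂ (K →L[ℂ] RTP E F) :=
    { carrier := {T | act₁ E F (rep F' b) ∘L T = T ∘L b}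
      add_mem' := fun {T T'} h h' => by
        change _ = _ at h h'
        change _ = _
        rw [ContinuousLinearMap.comp_add, ContinuousLinearMap.add_comp, h, h']
      zero_mem' := by simp
      smul_mem' := fun z T h => by
        change _ = _ at h
        change _ = _
        rw [ContinuousLinearMap.comp_smul, ContinuousLinearMap.smul_comp, h] }
  have hS : IsClosed (S : Set (K →L[ℂ] RTP E F)) :=
    isClosed_eq (f := fun T : K →L[ℂ] RTP E F => act₁ E F (rep F' b) ∘L T) (g := fun T => T ∘L b)
      (by fun_prop) (by fun_prop)
  refine clspan_le hS ?_ hT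
  rintro _ ⟨ξ, g, hg, rfl⟩
  change _ = _
  ext ζ
  simp only [ContinuousLinearMap.comp_apply]
  rw [act₁_apply hB hE hF hc, rep_apply hB hF' hb hg]

theorem act₂_ketSp₂ (hB : IsCBase 𝔅) (hE : IsCModule 𝔅 E) (hF : IsCModule 𝔅 F)
    (hE' : IsCModule 𝔅 E') {b : K →L[ℂ] K} (hb : b ∈ 𝔅) (hc : CommRep 𝔅 E (rep E' b))
    {T : K →L[ℂ] RTP E F} (hT : T ∈ ketSp₂ E F E') : act₂ E F (rep E' b) ∘L T = T ∘L b := by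
  let S : Submodule ℂ (K →L[ℂ] RTP E F) :=
    { carrier := {T | act₂ E F (rep E' b) ∘L T = T ∘L b}
      add_mem' := fun {T T'} h h' => by
        change _ = _ at h h'
        change _ = _
        rw [ContinuousLinearMap.comp_add, ContinuousLinearMap.add_comp, h, h']
      zero_mem' := by simp
      smul_mem' := fun z T h => by
        change _ = _ at h
        change _ = _
        rw [ContinuousLinearMap.comp_smul, ContinuousLinearMap.smul_comp, h] }
  have hS : IsClosed (S : Set (K →L[ℂ] RTP E F)) :=
    isClosed_eq (f := fun T : K →L[ℂ] RTP E F => act₂ E F (rep E' b) ∘L T) (g := fun T => T ∘L b)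
      (by fun_prop) (by fun_prop)
  refine clspan_le hS ?_ hT
  rintro _ ⟨η, g, hg, rfl⟩
  change _ = _
  ext ζ
  simp only [ContinuousLinearMap.comp_apply]
  rw [act₂_apply hB hE hF hc, rep_apply hB hE' hb hg]

theorem total_ketSp₁ (hB : IsCBase 𝔅) (hE : IsCModule 𝔅 E) (hF : IsCModule 𝔅 F)
    (hF' : IsCModule 𝔅 F') : Total fun p : ↥(ketSp₁ E F F') × K => p.1.1 p.2 := by
  refine Total.of_closed fun S hS h => ?_
  rw [eq_top_iff]
  rintro x -
  refine (total_ket₁ hB hE hF).mem_closed S hS (fun p => ?_) x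
  refine hF'.total.mem_closed (S.comap (ket₁ p.1 : M →L[ℂ] RTP E F).toLinearMap)
    (hS.preimage (ket₁ p.1 : M →L[ℂ] RTP E F).continuous) (fun q => ?_) p.2
  exact h (⟨ket₁ p.1 ∘L q.1.1, subset_clspan' ⟨p.1, q.1.1, q.1.2, rfl⟩⟩, q.2)

theorem total_ketSp₂ (hB : IsCBase 𝔅) (hE : IsCModule 𝔅 E) (hF : IsCModule 𝔅 F)
    (hE' : IsCModule 𝔅 E') : Total fun p : ↥(ketSp₂ E F E') × K => p.1.1 p.2 := by
  refine Total.of_closed fun S hS h => ?_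
  rw [eq_top_iff]
  rintro x -
  refine (total_ket₂ hB hE hF).mem_closed S hS (fun p => ?_) x
  refine hE'.total.mem_closed (S.comap (ket₂ p.1 : L →L[ℂ] RTP E F).toLinearMap)
    (hS.preimage (ket₂ p.1 : L →L[ℂ] RTP E F).continuous) (fun q => ?_) p.2
  exact h (⟨ket₂ p.1 ∘L q.1.1, subset_clspan' ⟨p.1, q.1.1, q.1.2, rfl⟩⟩, q.2)

/-- A unitary that maps a space of operators to another one intertwines the operators which act on
these spaces by right multiplication. -/
theorem intertwine_of_imgSp {R R' : Type*} [NormedAddCommGroup R] [InnerProductSpace ℂ R]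
    [CompleteSpace R] [NormedAddCommGroup R'] [InnerProductSpace ℂ R'] {V : R ≃ₗᵢ[ℂ] R'}
    {X : Submodule ℂ (K →L[ℂ] R)} {Y : Submodule ℂ (K →L[ℂ] R')} (hV : imgSp V X = Y)
    (hX : Total fun p : ↥X × K => p.1.1 p.2) {b : K →L[ℂ] K} {S : R →L[ℂ] R} {S' : R' →L[ℂ] R'}
    (hS : ∀ T ∈ X, S ∘L T = T ∘L b) (hS' : ∀ T ∈ Y, S' ∘L T = T ∘L b) (x : R) :
    V (S x) = S' (V x) := by
  refine DFunLike.congr_fun (hX.ext_op (S := V.toContinuousLinearEquiv.toContinuousLinearMap ∘L S)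
    (T := S' ∘L V.toContinuousLinearEquiv.toContinuousLinearMap) fun p => ?_) x
  have h1 := DFunLike.congr_fun (hS p.1.1 p.1.2) p.2
  have h2 : (V.toContinuousLinearEquiv : R →L[ℂ] R') ∘L p.1.1 ∈ Y := by
    have : (V.toContinuousLinearEquiv : R →L[ℂ] R') ∘L p.1.1 ∈ imgSp V X := ⟨p.1.1, p.1.2, rfl⟩
    rw [hV] at this
    exact this
  have h3 := DFunLike.congr_fun (hS' _ h2) p.2
  simp only [ContinuousLinearMap.comp_apply] at h1 h3 ⊢
  rw [h1]
  exact h3.symm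

end RelativeTensor

/-! ## Threefold relative tensor products -/

section Threefold

variable {K L : Type*}
  [NormedAddCommGroup K] [InnerProductSpace ℂ K] [CompleteSpace K]
  [NormedAddCommGroup L] [InnerProductSpace ℂ L] [CompleteSpace L]
  {𝔅 : Submodule ℂ (K →L[ℂ] K)} {E P Q G : Submodule ℂ (K →L[ℂ] L)}

/-- The assumptions under which `Ch E P Q G` is a threefold relative tensor product. -/
structure ChData (𝔅 : Submodule ℂ (K →L[ℂ] K)) (E P Q G : Submodule ℂ (K →L[ℂ] L)) : Prop where
  base : IsCBase 𝔅
  left : IsCModule 𝔅 E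
  mid₁ : IsCModule 𝔅 P
  mid₂ : IsCModule 𝔅 Q
  right : IsCModule 𝔅 G
  comm : ∀ b ∈ 𝔅, CommRep 𝔅 P (rep Q b)

theorem ChData.flip (h : ChData 𝔅 E P Q G) : ChData 𝔅 G Q P E :=
  ⟨h.base, h.right, h.mid₂, h.mid₁, h.left, fun b hb c hc => (h.comm c hc b hb).symm⟩

theorem Compat.rep_mem (h : Compat 𝔅 E P) {b : K →L[ℂ] K} (hb : b ∈ 𝔅)
    {η : K →L[ℂ] L} (hη : η ∈ P) : rep E b ∘L η ∈ P :=
  le_of_eq h (subset_clspan' ⟨b, hb, η, hη, rfl⟩)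

/-- Compatibility makes ρ_E(b) map P into P, where ρ_P(c) acts by right multiplication with c;
composition on the left and on the right commute. -/
theorem Compat.commRep (hB : IsCBase 𝔅) (hP : IsCModule 𝔅 P)
    (h : Compat 𝔅 E P) {b : K →L[ℂ] K} (hb : b ∈ 𝔅) : CommRep 𝔅 P (rep E b) := by
  intro c hc
  refine hP.total.ext_op fun p => ?_
  have h1 := rep_apply hB hP hc (h.rep_mem hb p.1.2) p.2
  simp only [ContinuousLinearMap.comp_apply] at h1 ⊢
  rw [h1, rep_apply hB hP hc p.1.2]

namespace ChData

/-- Both outer Gram matrices are factorized. The factors of the right one move past ρ_P since ρ_P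
and ρ_Q commute, and for each of their indices `gram_sum` handles the left one. -/
theorem posKer (h : ChData 𝔅 E P Q G) : PosKer (chKer E P Q G) := by
  refine posKer_of_finite (fun s f => ?_) fun u v => ?_
  · obtain ⟨c, hc, hcs⟩ := h.left.exists_factor h.base s (fun p : ↥E × L × ↥G => p.1)
    obtain ⟨d, hd, hds⟩ := h.right.exists_factor h.base s (fun p : ↥E × L × ↥G => p.2.2)
    have h1 : ∀ i ∈ s, ∀ j ∈ s, star (f i) * f j * chKer E P Q G i j =
        ∑ l, star (f i) * f j * inner ℂ (rep Q (d l i) i.2.1)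
          (rep P (adj i.1.1 ∘L j.1.1) (rep Q (d l j) j.2.1)) := by
      intro i hi j hj
      unfold chKer
      rw [hds i hi j hj, rep_sum h.base h.mid₂ _ _ fun k =>
        h.base.mul_mem _ (h.base.adj_mem _ (hd k i)) _ (hd k j), sum_apply, map_sum, inner_sum,
        Finset.mul_sum]
      refine Finset.sum_congr rfl fun l _ => ?_
      rw [rep_mul h.base h.mid₂ (h.base.adj_mem _ (hd l i)) (hd l j),
        ContinuousLinearMap.comp_apply, ← ContinuousLinearMap.comp_apply (rep P _),
        h.comm _ (h.base.adj_mem _ (hd l i)) _ (h.left.adj_mem i.1.2 j.1.2),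
        rep_adj h.base h.mid₂ (hd l i), ContinuousLinearMap.comp_apply, adj_inner_right]
    rw [Finset.sum_congr rfl fun i hi => Finset.sum_congr rfl fun j hj => h1 i hi j hj]
    simp only [Finset.sum_comm (s := s) (t := Finset.univ)]
    refine Finset.sum_nonneg fun l _ => ?_
    rw [gram_sum h.base h.mid₁ hc hcs f (fun u => rep Q (d l u) u.2.1) fun u => rep Q (d l u) u.2.1]
    exact sum_inner_self_nonneg _
  · have e1 := h.left.adj_mem u.1.2 v.1.2
    have e2 := h.right.adj_mem u.2.2.2 v.2.2.2
    unfold chKer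
    rw [← starRingEnd_apply, inner_conj_symm, ← adj_inner_right, ← adj_inner_right,
      ← rep_adj h.base h.mid₁ e1, ← rep_adj h.base h.mid₂ e2, adj_comp, adj_comp, adj_adj, adj_adj,
      ← ContinuousLinearMap.comp_apply (rep P _), h.comm _ (h.right.adj_mem v.2.2.2 u.2.2.2) _
      (h.left.adj_mem v.1.2 u.1.2)]
    rfl

theorem inner_vec (h : ChData 𝔅 E P Q G) (u v : ↥E × L × ↥G) :
    inner ℂ (vec (chKer E P Q G) u) (vec (chKer E P Q G) v) =
      inner ℂ u.2.1 (rep P (adj u.1.1 ∘L v.1.1) (rep Q (adj u.2.2.1 ∘L v.2.2.1) v.2.1)) :=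
  DynQG.inner_vec h.posKer u v

theorem addR₁_exists (h : ChData 𝔅 E P Q G) (η : ↥G) :
    ∃ T : RTP E P →L[ℂ] Ch E P Q G, (∀ p : ↥E × L, T (ket₁ p.1 p.2) =
      vec (chKer E P Q G) (p.1, p.2, η)) ∧ ∀ x, ‖T x‖ ≤ ‖η‖ * ‖x‖ := by
  refine (total_ket₁ h.base h.left h.mid₁).exists_op_gram _ ‖η‖ (norm_nonneg _) fun s f => ?_
  obtain ⟨c, hc, hcs⟩ := h.left.exists_factor h.base s (fun p : ↥E × L => p.1)
  simp only [h.inner_vec, inner_ket₁ h.base h.left h.mid₁]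
  have hη := h.right.adj_mem η.2 η.2
  rw [gram_sum h.base h.mid₁ hc hcs f (fun p => p.2) (fun p => rep Q (adj η.1 ∘L η.1) p.2),
    gram_sum h.base h.mid₁ hc hcs f (fun p => p.2) (fun p => p.2), map_sum, map_sum, Finset.mul_sum]
  refine Finset.sum_le_sum fun k _ => ?_
  have h1 : ∀ p : ↥E × L, rep P (c k p) (rep Q (adj η.1 ∘L η.1) p.2) =
      rep Q (adj η.1 ∘L η.1) (rep P (c k p) p.2) := fun p =>
    DFunLike.congr_fun (h.comm _ hη _ (hc k p)) p.2
  simp only [h1, ← map_smul]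
  rw [← map_sum]
  refine re_inner_le_of_bound _ (fun x => ?_) _
  have := rep_norm h.base h.mid₂ hη x
  rwa [norm_adj_comp_self] at this

theorem addR₁_apply (h : ChData 𝔅 E P Q G) (η : ↥G) (ξ : ↥E) (x : L) :
    (addR₁ η : RTP E P →L[ℂ] Ch E P Q G) (ket₁ ξ x) = vec (chKer E P Q G) (ξ, x, η) := by
  obtain ⟨T, hT, -⟩ := h.addR₁_exists η
  exact theOp_spec (P := fun T : RTP E P →L[ℂ] Ch E P Q G => ∀ (ξ : ↥E) (x : L),
    T (ket₁ ξ x) = vec (chKer E P Q G) (ξ, x, η)) ⟨T, fun ξ x => hT (ξ, x)⟩ ξ x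

theorem exists_chFlip (h : ChData 𝔅 E P Q G) :
    ∃ T : Ch E P Q G ≃ₗᵢ[ℂ] Ch G Q P E, ∀ p : ↥E × L × ↥G,
      T (vec (chKer E P Q G) p) = vec (chKer G Q P E) (p.2.2, p.2.1, p.1) := by
  refine exists_unitary_ker h.posKer h.flip.posKer
    ⟨fun p => (p.2.2, p.2.1, p.1), fun p => (p.2.2, p.2.1, p.1), fun _ => rfl, fun _ => rfl⟩
    fun p q => ?_
  change inner ℂ p.2.1 (rep Q (adj p.2.2.1 ∘L q.2.2.1) (rep P (adj p.1.1 ∘L q.1.1) q.2.1)) = _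
  rw [← ContinuousLinearMap.comp_apply,
    ← h.comm _ (h.right.adj_mem p.2.2.2 q.2.2.2) _ (h.left.adj_mem p.1.2 q.1.2)]
  rfl

/-- The flip of a threefold relative tensor product. -/
def chFlip (h : ChData 𝔅 E P Q G) : Ch E P Q G ≃ₗᵢ[ℂ] Ch G Q P E := h.exists_chFlip.choose

theorem chFlip_vec (h : ChData 𝔅 E P Q G) (ξ : ↥E) (x : L) (η : ↥G) :
    h.chFlip (vec (chKer E P Q G) (ξ, x, η)) = vec (chKer G Q P E) (η, x, ξ) :=
  h.exists_chFlip.choose_spec (ξ, x, η)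

theorem chFlip_chFlip (h : ChData 𝔅 E P Q G) (x : Ch E P Q G) : h.flip.chFlip (h.chFlip x) = x :=
  DFunLike.congr_fun ((total_vec _).ext_op
    (S := h.flip.chFlip.toContinuousLinearEquiv.toContinuousLinearMap ∘L
      h.chFlip.toContinuousLinearEquiv.toContinuousLinearMap)
    (T := ContinuousLinearMap.id ℂ _) fun p => by
      change h.flip.chFlip (h.chFlip (vec _ (p.1, p.2.1, p.2.2))) = _
      rw [chFlip_vec, chFlip_vec]
      rfl) x

theorem addR₂_apply (h : ChData 𝔅 E P Q G) (η : ↥G) (ξ : ↥E) (x : L) :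
    (addR₂ η : RTP P E →L[ℂ] Ch E P Q G) (ket₂ ξ x) = vec (chKer E P Q G) (ξ, x, η) := by
  refine theOp_spec (P := fun T : RTP P E →L[ℂ] Ch E P Q G => ∀ (ξ : ↥E) (x : L),
    T (ket₂ ξ x) = vec (chKer E P Q G) (ξ, x, η)) ⟨addR₁ η ∘L
      (rtpFlip h.base h.mid₁ h.left).toContinuousLinearEquiv.toContinuousLinearMap, fun ξ x => ?_⟩ ξ x
  change addR₁ η (rtpFlip h.base h.mid₁ h.left (ket₂ ξ x)) = _
  rw [rtpFlip_ket₂, h.addR₁_apply]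

theorem addL₁_apply (h : ChData 𝔅 E P Q G) (ξ : ↥E) (η : ↥G) (x : L) :
    (addL₁ ξ : RTP G Q →L[ℂ] Ch E P Q G) (ket₁ η x) = vec (chKer E P Q G) (ξ, x, η) := by
  refine theOp_spec (P := fun T : RTP G Q →L[ℂ] Ch E P Q G => ∀ (η : ↥G) (x : L),
    T (ket₁ η x) = vec (chKer E P Q G) (ξ, x, η))
    ⟨h.flip.chFlip.toContinuousLinearEquiv.toContinuousLinearMap ∘L addR₁ ξ, fun η x => ?_⟩ η x
  change h.flip.chFlip (addR₁ ξ (ket₁ η x)) = _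
  rw [h.flip.addR₁_apply, chFlip_vec]

theorem addL₂_apply (h : ChData 𝔅 E P Q G) (ξ : ↥E) (η : ↥G) (x : L) :
    (addL₂ ξ : RTP Q G →L[ℂ] Ch E P Q G) (ket₂ η x) = vec (chKer E P Q G) (ξ, x, η) := by
  refine theOp_spec (P := fun T : RTP Q G →L[ℂ] Ch E P Q G => ∀ (η : ↥G) (x : L),
    T (ket₂ η x) = vec (chKer E P Q G) (ξ, x, η))
    ⟨h.flip.chFlip.toContinuousLinearEquiv.toContinuousLinearMap ∘L addR₂ ξ, fun η x => ?_⟩ η x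
  change h.flip.chFlip (addR₂ ξ (ket₂ η x)) = _
  rw [h.flip.addR₂_apply, chFlip_vec]

/-- This exhibits `Ch E P Q G` as the relative tensor product of `RTP E P`, on which 𝔅 acts through
ρ_Q on the central leg, with G. Together with its three variants below it is the input of
`exists_leg`. -/
theorem adj_addR₁ (h : ChData 𝔅 E P Q G) (η η' : ↥G) :
    adj (addR₁ η : RTP E P →L[ℂ] Ch E P Q G) ∘L addR₁ η' =
      act₁ E P (rep Q (adj η.1 ∘L η'.1)) := by
  have hη := h.right.adj_mem η.2 η'.2
  refine (total_ket₁ h.base h.left h.mid₁).ext_op fun p =>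
    (total_ket₁ h.base h.left h.mid₁).ext_inner fun q => ?_
  rw [ContinuousLinearMap.comp_apply, adj_inner_right, h.addR₁_apply, h.addR₁_apply, h.inner_vec,
    act₁_apply h.base h.left h.mid₁ (h.comm _ hη), inner_ket₁ h.base h.left h.mid₁]

theorem adj_addR₂ (h : ChData 𝔅 E P Q G) (η η' : ↥G) :
    adj (addR₂ η : RTP P E →L[ℂ] Ch E P Q G) ∘L addR₂ η' =
      act₂ P E (rep Q (adj η.1 ∘L η'.1)) := by
  have hη := h.right.adj_mem η.2 η'.2
  refine (total_ket₂ h.base h.mid₁ h.left).ext_op fun p =>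
    (total_ket₂ h.base h.mid₁ h.left).ext_inner fun q => ?_
  rw [ContinuousLinearMap.comp_apply, adj_inner_right, h.addR₂_apply, h.addR₂_apply, h.inner_vec,
    act₂_apply h.base h.mid₁ h.left (h.comm _ hη), ket₂_eq h.base h.mid₁ h.left,
    ket₂_eq h.base h.mid₁ h.left, LinearIsometryEquiv.inner_map_map, inner_ket₁ h.base h.left h.mid₁]

theorem adj_addL₁ (h : ChData 𝔅 E P Q G) (ξ ξ' : ↥E) :
    adj (addL₁ ξ : RTP G Q →L[ℂ] Ch E P Q G) ∘L addL₁ ξ' =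
      act₁ G Q (rep P (adj ξ.1 ∘L ξ'.1)) := by
  have hξ := h.left.adj_mem ξ.2 ξ'.2
  refine (total_ket₁ h.base h.right h.mid₂).ext_op fun p =>
    (total_ket₁ h.base h.right h.mid₂).ext_inner fun q => ?_
  rw [ContinuousLinearMap.comp_apply, adj_inner_right, h.addL₁_apply, h.addL₁_apply, h.inner_vec,
    act₁_apply h.base h.right h.mid₂ (h.flip.comm _ hξ), inner_ket₁ h.base h.right h.mid₂]
  simp only
  rw [← ContinuousLinearMap.comp_apply (rep P _), ← ContinuousLinearMap.comp_apply (rep Q _),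
    h.comm _ (h.right.adj_mem q.1.2 p.1.2) _ hξ]

theorem adj_addL₂ (h : ChData 𝔅 E P Q G) (ξ ξ' : ↥E) :
    adj (addL₂ ξ : RTP Q G →L[ℂ] Ch E P Q G) ∘L addL₂ ξ' =
      act₂ Q G (rep P (adj ξ.1 ∘L ξ'.1)) := by
  have hξ := h.left.adj_mem ξ.2 ξ'.2
  refine (total_ket₂ h.base h.mid₂ h.right).ext_op fun p =>
    (total_ket₂ h.base h.mid₂ h.right).ext_inner fun q => ?_
  rw [ContinuousLinearMap.comp_apply, adj_inner_right, h.addL₂_apply, h.addL₂_apply, h.inner_vec,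
    act₂_apply h.base h.mid₂ h.right (h.flip.comm _ hξ), ket₂_eq h.base h.mid₂ h.right,
    ket₂_eq h.base h.mid₂ h.right, LinearIsometryEquiv.inner_map_map,
    inner_ket₁ h.base h.right h.mid₂]
  simp only
  rw [← ContinuousLinearMap.comp_apply (rep P _), ← ContinuousLinearMap.comp_apply (rep Q _),
    h.comm _ (h.right.adj_mem q.1.2 p.1.2) _ hξ]

theorem total_of_vec (_ : ChData 𝔅 E P Q G) {ι : Type*} {u : ι → Ch E P Q G}
    (hu : ∀ p, ∃ i, u i = vec (chKer E P Q G) p) : Total u := by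
  refine Total.of_closed fun S hS hi => ?_
  rw [eq_top_iff]
  rintro x -
  refine (total_vec _).mem_closed S hS (fun p => ?_) x
  obtain ⟨i, hi'⟩ := hu p
  exact hi' ▸ hi i

end ChData

/-- A unitary between Hilbert spaces `R`, `R'` with representations of `𝔅` that are intertwined
induces a unitary between the relative tensor products with a module. -/
theorem exists_leg {R R' C C' : Type*}
    [NormedAddCommGroup R] [InnerProductSpace ℂ R] [CompleteSpace R]
    [NormedAddCommGroup R'] [InnerProductSpace ℂ R'] [CompleteSpace R']
    [NormedAddCommGroup C] [InnerProductSpace ℂ C] [CompleteSpace C]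
    [NormedAddCommGroup C'] [InnerProductSpace ℂ C'] [CompleteSpace C']
    (U : R ≃ₗᵢ[ℂ] R') {add : ↥G → R →L[ℂ] C} {add' : ↥G → R' →L[ℂ] C'}
    {σ : (K →L[ℂ] K) → R →L[ℂ] R} {σ' : (K →L[ℂ] K) → R' →L[ℂ] R'}
    (h : ∀ η η', adj (add η) ∘L add η' = σ (adj η.1 ∘L η'.1))
    (h' : ∀ η η', adj (add' η) ∘L add' η' = σ' (adj η.1 ∘L η'.1))
    (ht : Total fun p : ↥G × R => add p.1 p.2) (ht' : Total fun p : ↥G × R' => add' p.1 p.2)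
    (hU : ∀ η η' : ↥G, ∀ x, U (σ (adj η.1 ∘L η'.1) x) = σ' (adj η.1 ∘L η'.1) (U x)) :
    ∃ T : C ≃ₗᵢ[ℂ] C', ∀ η x, T (add η x) = add' η (U x) := by
  have h1 : Total fun p : ↥G × R => add' p.1 (U p.2) := by
    refine Total.of_closed fun S hS hi => ?_
    rw [eq_top_iff]
    rintro x -
    refine ht'.mem_closed S hS (fun p => ?_) x
    simpa using hi (p.1, U.symm p.2)
  have h2 : ∀ p q : ↥G × R, inner ℂ (add' p.1 (U p.2)) (add' q.1 (U q.2)) =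
      inner ℂ (add p.1 p.2) (add q.1 q.2) := by
    intro p q
    rw [← adj_inner_right, ← adj_inner_right, ← ContinuousLinearMap.comp_apply,
      ← ContinuousLinearMap.comp_apply, h, h', ← hU, LinearIsometryEquiv.inner_map_map]
  obtain ⟨T, hT⟩ := ht.exists_unitary h1 h2
  exact ⟨T, fun η x => hT (η, x)⟩

end Threefold

/-! ## Pseudo-multiplicative unitaries from their inverse legs -/

section Assembly

variable {K L : Type*}
  [NormedAddCommGroup K] [InnerProductSpace ℂ K] [CompleteSpace K]
  [NormedAddCommGroup L] [InnerProductSpace ℂ L] [CompleteSpace L]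
  {𝔅 : Submodule ℂ (K →L[ℂ] K)} {βh α β : Submodule ℂ (K →L[ℂ] L)}

theorem ChData.chFlip_addR₁ {E P Q G : Submodule ℂ (K →L[ℂ] L)} (h : ChData 𝔅 E P Q G) (η : ↥G)
    (x : RTP E P) : h.chFlip (addR₁ η x) = addL₂ η (rtpFlip h.base h.left h.mid₁ x) := by
  refine DFunLike.congr_fun ((total_ket₁ h.base h.left h.mid₁).ext_op
    (S := h.chFlip.toContinuousLinearEquiv.toContinuousLinearMap ∘L addR₁ η)
    (T := addL₂ η ∘L (rtpFlip h.base h.left h.mid₁).toContinuousLinearEquiv.toContinuousLinearMap)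
    fun p => ?_) x
  change h.chFlip (addR₁ η (ket₁ p.1 p.2)) = addL₂ η (rtpFlip h.base h.left h.mid₁ (ket₁ p.1 p.2))
  rw [h.addR₁_apply, h.chFlip_vec, rtpFlip_ket₁, h.flip.addL₂_apply]

theorem ChData.chFlip_addR₂ {E P Q G : Submodule ℂ (K →L[ℂ] L)} (h : ChData 𝔅 E P Q G) (η : ↥G)
    (x : RTP P E) : h.chFlip (addR₂ η x) = addL₁ η (rtpFlip h.base h.mid₁ h.left x) := by
  refine DFunLike.congr_fun ((total_ket₂ h.base h.mid₁ h.left).ext_op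
    (S := h.chFlip.toContinuousLinearEquiv.toContinuousLinearMap ∘L addR₂ η)
    (T := addL₁ η ∘L (rtpFlip h.base h.mid₁ h.left).toContinuousLinearEquiv.toContinuousLinearMap)
    fun p => ?_) x
  change h.chFlip (addR₂ η (ket₂ p.1 p.2)) = addL₁ η (rtpFlip h.base h.mid₁ h.left (ket₂ p.1 p.2))
  rw [h.addR₂_apply, h.chFlip_vec, rtpFlip_ket₂, h.flip.addL₁_apply]

theorem ChData.chFlip_addL₂ {E P Q G : Submodule ℂ (K →L[ℂ] L)} (h : ChData 𝔅 E P Q G) (ξ : ↥E)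
    (x : RTP Q G) : h.chFlip (addL₂ ξ x) = addR₁ ξ (rtpFlip h.base h.mid₂ h.right x) := by
  rw [← h.flip.chFlip_chFlip (addR₁ ξ _)]
  congr 1
  rw [h.flip.chFlip_addR₁, rtpFlip_rtpFlip]

/-- Three compatible `C^*`-modules on one Hilbert space. -/
structure CompatTriple (𝔅 : Submodule ℂ (K →L[ℂ] K)) (βh α β : Submodule ℂ (K →L[ℂ] L)) :
    Prop where
  base : IsCBase 𝔅
  module_βh : IsCModule 𝔅 βh
  module_α : IsCModule 𝔅 α
  module_β : IsCModule 𝔅 β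
  compat_βh_α : Compat 𝔅 βh α
  compat_α_βh : Compat 𝔅 α βh
  compat_βh_β : Compat 𝔅 βh β
  compat_β_βh : Compat 𝔅 β βh
  compat_α_β : Compat 𝔅 α β
  compat_β_α : Compat 𝔅 β α

/-- The intertwining relations of a pseudo-multiplicative unitary. -/
structure Intertwines (V : RTP βh α ≃ₗᵢ[ℂ] RTP α β) : Prop where
  α_α : imgSp V (ketSp₂ βh α α) = ketSp₁ α β α
  βh_β : imgSp V (ketSp₁ βh α β) = ketSp₂ α β βh
  βh_βh : imgSp V (ketSp₁ βh α βh) = ketSp₁ α β βh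
  α_β : imgSp V (ketSp₂ βh α β) = ketSp₂ α β β

/-- The leg operators of the inverse of a pseudo-multiplicative unitary. -/
structure InvLegs (U : RTP α β ≃ₗᵢ[ℂ] RTP βh α) where
  U12 : Ch α β βh α ≃ₗᵢ[ℂ] Ch βh α βh α
  U23 : Ch α β α β ≃ₗᵢ[ℂ] Ch α β βh α
  U23' : Ch βh α β α ≃ₗᵢ[ℂ] Ch βh α βh α
  U13 : Ch α βh α β ≃ₗᵢ[ℂ] Ch βh α β α
  U12' : Ch α β α β ≃ₗᵢ[ℂ] Ch α βh α β
  h12 : ∀ (η : ↥α) x, U12 (addR₁ η x) = addR₁ η (U x)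
  h23 : ∀ (ξ : ↥α) x, U23 (addL₂ ξ x) = addL₂ ξ (U x)
  h23' : ∀ (ξ : ↥βh) x, U23' (addL₁ ξ x) = addL₂ ξ (U x)
  h13 : ∀ (η : ↥α) x, U13 (addL₂ η x) = addR₁ η (U x)
  h12' : ∀ (η : ↥β) x, U12' (addR₁ η x) = addR₂ η (U x)

namespace CompatTriple

theorem flip (M : CompatTriple 𝔅 βh α β) : CompatTriple 𝔅 β α βh :=
  ⟨M.base, M.module_β, M.module_α, M.module_βh, M.compat_β_α, M.compat_α_β, M.compat_β_βh,
    M.compat_βh_β, M.compat_α_βh, M.compat_βh_α⟩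

theorem ch₁ (M : CompatTriple 𝔅 βh α β) : ChData 𝔅 βh α βh α :=
  ⟨M.base, M.module_βh, M.module_α, M.module_βh, M.module_α, fun _ hb =>
    M.compat_βh_α.commRep M.base M.module_α hb⟩

theorem ch₂ (M : CompatTriple 𝔅 βh α β) : ChData 𝔅 α β βh α :=
  ⟨M.base, M.module_α, M.module_β, M.module_βh, M.module_α, fun _ hb =>
    M.compat_βh_β.commRep M.base M.module_β hb⟩

theorem ch₃ (M : CompatTriple 𝔅 βh α β) : ChData 𝔅 α β α β :=
  ⟨M.base, M.module_α, M.module_β, M.module_α, M.module_β, fun _ hb =>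
    M.compat_α_β.commRep M.base M.module_β hb⟩

theorem ch₄ (M : CompatTriple 𝔅 βh α β) : ChData 𝔅 βh α β α :=
  ⟨M.base, M.module_βh, M.module_α, M.module_β, M.module_α, fun _ hb =>
    M.compat_β_α.commRep M.base M.module_α hb⟩

theorem ch₅ (M : CompatTriple 𝔅 βh α β) : ChData 𝔅 α βh α β :=
  ⟨M.base, M.module_α, M.module_βh, M.module_α, M.module_β, fun _ hb =>
    M.compat_α_βh.commRep M.base M.module_βh hb⟩

theorem total_addR₁ {E P Q G : Submodule ℂ (K →L[ℂ] L)} (h : ChData 𝔅 E P Q G) :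
    Total fun p : ↥G × RTP E P => (addR₁ p.1 : RTP E P →L[ℂ] Ch E P Q G) p.2 :=
  h.total_of_vec fun p => ⟨(p.2.2, ket₁ p.1 p.2.1), h.addR₁_apply _ _ _⟩

theorem total_addR₂ {E P Q G : Submodule ℂ (K →L[ℂ] L)} (h : ChData 𝔅 E P Q G) :
    Total fun p : ↥G × RTP P E => (addR₂ p.1 : RTP P E →L[ℂ] Ch E P Q G) p.2 :=
  h.total_of_vec fun p => ⟨(p.2.2, ket₂ p.1 p.2.1), h.addR₂_apply _ _ _⟩

theorem total_addL₁ {E P Q G : Submodule ℂ (K →L[ℂ] L)} (h : ChData 𝔅 E P Q G) :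
    Total fun p : ↥E × RTP G Q => (addL₁ p.1 : RTP G Q →L[ℂ] Ch E P Q G) p.2 :=
  h.total_of_vec fun p => ⟨(p.1, ket₁ p.2.2 p.2.1), h.addL₁_apply _ _ _⟩

theorem total_addL₂ {E P Q G : Submodule ℂ (K →L[ℂ] L)} (h : ChData 𝔅 E P Q G) :
    Total fun p : ↥E × RTP Q G => (addL₂ p.1 : RTP Q G →L[ℂ] Ch E P Q G) p.2 :=
  h.total_of_vec fun p => ⟨(p.1, ket₂ p.2.2 p.2.1), h.addL₂_apply _ _ _⟩

theorem symm_intertwine {R R' : Type*} [NormedAddCommGroup R] [InnerProductSpace ℂ R]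
    [NormedAddCommGroup R'] [InnerProductSpace ℂ R'] {U : R' ≃ₗᵢ[ℂ] R}
    {S : R →L[ℂ] R} {S' : R' →L[ℂ] R'} (h : ∀ x, U.symm (S x) = S' (U.symm x)) (x : R') :
    U (S' x) = S (U x) := by
  have := h (U x)
  rw [LinearIsometryEquiv.symm_apply_apply] at this
  rw [← this, LinearIsometryEquiv.apply_symm_apply]

/-- On each side of an intertwining relation, some ρ(b) on one leg acts as right multiplication by
b. So each of the four relations says that `U` intertwines two such representations of 𝔅, which is
the hypothesis of `exists_leg`. The relation of type α, α is used for two of the five legs. -/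
theorem exists_invLegs (M : CompatTriple 𝔅 βh α β) (U : RTP α β ≃ₗᵢ[ℂ] RTP βh α) (h : Intertwines U.symm) :
    Nonempty (InvLegs U) := by
  have i1 : ∀ b ∈ 𝔅, ∀ x, U (act₁ α β (rep α b) x) = act₂ βh α (rep α b) (U x) := fun b hb =>
    symm_intertwine (intertwine_of_imgSp h.α_α
      (total_ketSp₂ M.base M.module_βh M.module_α M.module_α)
      (fun T hT => act₂_ketSp₂ M.base M.module_βh M.module_α M.module_α hb
        (M.compat_α_βh.commRep M.base M.module_βh hb) hT)
      fun T hT => act₁_ketSp₁ M.base M.module_α M.module_β M.module_α hb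
        (M.compat_α_β.commRep M.base M.module_β hb) hT)
  have i2 : ∀ b ∈ 𝔅, ∀ x, U (act₂ α β (rep βh b) x) = act₁ βh α (rep β b) (U x) := fun b hb =>
    symm_intertwine (intertwine_of_imgSp h.βh_β
      (total_ketSp₁ M.base M.module_βh M.module_α M.module_β)
      (fun T hT => act₁_ketSp₁ M.base M.module_βh M.module_α M.module_β hb
        (M.compat_β_α.commRep M.base M.module_α hb) hT)
      fun T hT => act₂_ketSp₂ M.base M.module_α M.module_β M.module_βh hb
        (M.compat_βh_α.commRep M.base M.module_α hb) hT)
  have i3 : ∀ b ∈ 𝔅, ∀ x, U (act₁ α β (rep βh b) x) = act₁ βh α (rep βh b) (U x) := fun b hb =>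
    symm_intertwine (intertwine_of_imgSp h.βh_βh
      (total_ketSp₁ M.base M.module_βh M.module_α M.module_βh)
      (fun T hT => act₁_ketSp₁ M.base M.module_βh M.module_α M.module_βh hb
        (M.compat_βh_α.commRep M.base M.module_α hb) hT)
      fun T hT => act₁_ketSp₁ M.base M.module_α M.module_β M.module_βh hb
        (M.compat_βh_β.commRep M.base M.module_β hb) hT)
  have i4 : ∀ b ∈ 𝔅, ∀ x, U (act₂ α β (rep β b) x) = act₂ βh α (rep β b) (U x) := fun b hb =>
    symm_intertwine (intertwine_of_imgSp h.α_β
      (total_ketSp₂ M.base M.module_βh M.module_α M.module_β)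
      (fun T hT => act₂_ketSp₂ M.base M.module_βh M.module_α M.module_β hb
        (M.compat_β_βh.commRep M.base M.module_βh hb) hT)
      fun T hT => act₂_ketSp₂ M.base M.module_α M.module_β M.module_β hb
        (M.compat_β_α.commRep M.base M.module_α hb) hT)
  obtain ⟨U12, h12⟩ := exists_leg U (fun η η' => M.ch₂.adj_addR₁ η η')
    (fun η η' => M.ch₁.adj_addR₁ η η') (total_addR₁ M.ch₂) (total_addR₁ M.ch₁)
    (σ := fun b => act₁ α β (rep βh b)) (σ' := fun b => act₁ βh α (rep βh b))
    fun η η' => i3 _ (M.module_α.adj_mem η.2 η'.2)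
  obtain ⟨U23, h23⟩ := exists_leg U (fun η η' => M.ch₃.adj_addL₂ η η')
    (fun η η' => M.ch₂.adj_addL₂ η η') (total_addL₂ M.ch₃) (total_addL₂ M.ch₂)
    (σ := fun b => act₂ α β (rep β b)) (σ' := fun b => act₂ βh α (rep β b))
    fun η η' => i4 _ (M.module_α.adj_mem η.2 η'.2)
  obtain ⟨U23', h23'⟩ := exists_leg U (fun η η' => M.ch₄.adj_addL₁ η η')
    (fun η η' => M.ch₁.adj_addL₂ η η') (total_addL₁ M.ch₄) (total_addL₂ M.ch₁)
    (σ := fun b => act₁ α β (rep α b)) (σ' := fun b => act₂ βh α (rep α b))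
    fun η η' => i1 _ (M.module_βh.adj_mem η.2 η'.2)
  obtain ⟨U13, h13⟩ := exists_leg U (fun η η' => M.ch₅.adj_addL₂ η η')
    (fun η η' => M.ch₄.adj_addR₁ η η') (total_addL₂ M.ch₅) (total_addR₁ M.ch₄)
    (σ := fun b => act₂ α β (rep βh b)) (σ' := fun b => act₁ βh α (rep β b))
    fun η η' => i2 _ (M.module_α.adj_mem η.2 η'.2)
  obtain ⟨U12', h12'⟩ := exists_leg U (fun η η' => M.ch₃.adj_addR₁ η η')
    (fun η η' => M.ch₅.adj_addR₂ η η') (total_addR₁ M.ch₃) (total_addR₂ M.ch₅)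
    (σ := fun b => act₁ α β (rep α b)) (σ' := fun b => act₂ βh α (rep α b))
    fun η η' => i1 _ (M.module_β.adj_mem η.2 η'.2)
  exact ⟨⟨U12, U23, U23', U13, U12', h12, h23, h23', h13, h12'⟩⟩

end CompatTriple

/-- The pentagon equation for the inverse legs. -/
def InvLegs.Pentagon {U : RTP α β ≃ₗᵢ[ℂ] RTP βh α} (l : InvLegs U) : Prop :=
  ∀ x, l.U12 (l.U23 x) = l.U23' (l.U13 (l.U12' x))

theorem isCPMU_of_pentagon (M : CompatTriple 𝔅 βh α β) {V : RTP βh α ≃ₗᵢ[ℂ] RTP α β}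
    (h : Intertwines V) (hp : Pentagon V) : IsCPMU 𝔅 V where
  base := M.base
  module_βh := M.module_βh
  module_α := M.module_α
  module_β := M.module_β
  compat_βh_α := M.compat_βh_α
  compat_α_βh := M.compat_α_βh
  compat_βh_β := M.compat_βh_β
  compat_β_βh := M.compat_β_βh
  compat_α_β := M.compat_α_β
  compat_β_α := M.compat_β_α
  pos_dom := posKer_rtp M.base M.module_βh M.module_α
  pos_ran := posKer_rtp M.base M.module_α M.module_β
  pos_ch₁ := M.ch₁.posKer
  pos_ch₂ := M.ch₂.posKer
  pos_ch₃ := M.ch₃.posKer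
  pos_ch₄ := M.ch₄.posKer
  pos_ch₅ := M.ch₅.posKer
  intertwine_α_α := h.α_α
  intertwine_βh_β := h.βh_β
  intertwine_βh_βh := h.βh_βh
  intertwine_α_β := h.α_β
  pentagon := hp

theorem InvLegs.Pentagon.symm {U : RTP α β ≃ₗᵢ[ℂ] RTP βh α} {l : InvLegs U} (hl : l.Pentagon) :
    DynQG.Pentagon U.symm := by
  refine ⟨l.U12.symm.toContinuousLinearEquiv, l.U23.symm.toContinuousLinearEquiv,
    l.U23'.symm.toContinuousLinearEquiv, l.U13.symm.toContinuousLinearEquiv,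
    l.U12'.symm.toContinuousLinearEquiv, fun η => ?_, fun ξ => ?_, fun ξ => ?_, fun η => ?_,
    fun η => ?_, ?_⟩
  · refine ContinuousLinearMap.ext fun x => ?_
    change l.U12.symm (addR₁ η x) = addR₁ η (U.symm x)
    rw [LinearIsometryEquiv.symm_apply_eq, l.h12, LinearIsometryEquiv.apply_symm_apply]
  · refine ContinuousLinearMap.ext fun x => ?_
    change l.U23.symm (addL₂ ξ x) = addL₂ ξ (U.symm x)
    rw [LinearIsometryEquiv.symm_apply_eq, l.h23, LinearIsometryEquiv.apply_symm_apply]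
  · refine ContinuousLinearMap.ext fun x => ?_
    change l.U23'.symm (addL₂ ξ x) = addL₁ ξ (U.symm x)
    rw [LinearIsometryEquiv.symm_apply_eq, l.h23', LinearIsometryEquiv.apply_symm_apply]
  · refine ContinuousLinearMap.ext fun x => ?_
    change l.U13.symm (addR₁ η x) = addL₂ η (U.symm x)
    rw [LinearIsometryEquiv.symm_apply_eq, l.h13, LinearIsometryEquiv.apply_symm_apply]
  · refine ContinuousLinearMap.ext fun x => ?_
    change l.U12'.symm (addR₂ η x) = addR₁ η (U.symm x)
    rw [LinearIsometryEquiv.symm_apply_eq, l.h12', LinearIsometryEquiv.apply_symm_apply]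
  · refine ContinuousLinearMap.ext fun x => ?_
    change l.U23.symm (l.U12.symm x) = l.U12'.symm (l.U13.symm (l.U23'.symm x))
    rw [LinearIsometryEquiv.symm_apply_eq, LinearIsometryEquiv.symm_apply_eq, hl,
      LinearIsometryEquiv.apply_symm_apply, LinearIsometryEquiv.apply_symm_apply,
      LinearIsometryEquiv.apply_symm_apply]

namespace CompatTriple

/-- The unitary `Σ U Σ`, where `Σ` denotes flips. -/
def flipU (M : CompatTriple 𝔅 βh α β) (U : RTP α β ≃ₗᵢ[ℂ] RTP βh α) : RTP β α ≃ₗᵢ[ℂ] RTP α βh :=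
  (rtpFlip M.base M.module_β M.module_α).trans
    (U.trans (rtpFlip M.base M.module_βh M.module_α))

theorem flipU_apply (M : CompatTriple 𝔅 βh α β) (U : RTP α β ≃ₗᵢ[ℂ] RTP βh α) (x : RTP β α) :
    M.flipU U x = rtpFlip M.base M.module_βh M.module_α
      (U (rtpFlip M.base M.module_β M.module_α x)) := rfl

-- Reversing the order of the three legs exchanges 12 with 23 and fixes 13. As flipping the unitary
-- and inverting it both reverse the order of composition in the pentagon, the inverse legs,
-- conjugated by `chFlip`, solve the pentagon equation for `flipU`.
set_option maxHeartbeats 1000000 in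
theorem pentagon_flipU (M : CompatTriple 𝔅 βh α β) {U : RTP α β ≃ₗᵢ[ℂ] RTP βh α} {l : InvLegs U}
    (hl : l.Pentagon) : DynQG.Pentagon (M.flipU U) := by
  have m := M.flip
  have h1 : ∀ (η : ↥α) x, M.ch₂.chFlip (l.U23 (m.ch₁.chFlip (addR₁ η x))) =
      addR₁ η (M.flipU U x) := fun η x => by
    rw [m.ch₁.chFlip_addR₁, l.h23, M.ch₂.chFlip_addL₂, flipU_apply]
  have h2 : ∀ (ξ : ↥α) x, M.ch₁.chFlip (l.U12 (m.ch₂.chFlip (addL₂ ξ x))) =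
      addL₂ ξ (M.flipU U x) := fun ξ x => by
    rw [m.ch₂.chFlip_addL₂, l.h12, M.ch₁.chFlip_addR₁, flipU_apply]
  have h3 : ∀ (ξ : ↥β) x, M.ch₅.chFlip (l.U12' (m.ch₁.chFlip (addL₂ ξ x))) =
      addL₁ ξ (M.flipU U x) := fun ξ x => by
    rw [m.ch₁.chFlip_addL₂, l.h12', M.ch₅.chFlip_addR₂, flipU_apply]
  have h4 : ∀ (η : ↥α) x, M.ch₄.chFlip (l.U13 (m.ch₄.chFlip (addR₁ η x))) =
      addL₂ η (M.flipU U x) := fun η x => by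
    rw [m.ch₄.chFlip_addR₁, l.h13, M.ch₄.chFlip_addR₁, flipU_apply]
  have h5 : ∀ (η : ↥βh) x, M.ch₁.chFlip (l.U23' (m.ch₅.chFlip (addR₂ η x))) =
      addR₁ η (M.flipU U x) := fun η x => by
    rw [m.ch₅.chFlip_addR₂, l.h23', M.ch₁.chFlip_addL₂, flipU_apply]
  have e2 : ∀ x, m.ch₂.chFlip (M.ch₂.chFlip x) = x := M.ch₂.chFlip_chFlip
  have e4 : ∀ x, m.ch₄.chFlip (M.ch₅.chFlip x) = x := M.ch₅.chFlip_chFlip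
  have e5 : ∀ x, m.ch₅.chFlip (M.ch₄.chFlip x) = x := M.ch₄.chFlip_chFlip
  have h6 : ∀ x, M.ch₁.chFlip (l.U12 (m.ch₂.chFlip (M.ch₂.chFlip (l.U23 (m.ch₁.chFlip x))))) =
      M.ch₁.chFlip (l.U23' (m.ch₅.chFlip (M.ch₄.chFlip (l.U13 (m.ch₄.chFlip
        (M.ch₅.chFlip (l.U12' (m.ch₁.chFlip x)))))))) := fun x => by
    rw [e2, e4, e5, hl]
  exact ⟨(m.ch₁.chFlip.trans (l.U23.trans M.ch₂.chFlip)).toContinuousLinearEquiv,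
    (m.ch₂.chFlip.trans (l.U12.trans M.ch₁.chFlip)).toContinuousLinearEquiv,
    (m.ch₁.chFlip.trans (l.U12'.trans M.ch₅.chFlip)).toContinuousLinearEquiv,
    (m.ch₄.chFlip.trans (l.U13.trans M.ch₄.chFlip)).toContinuousLinearEquiv,
    (m.ch₅.chFlip.trans (l.U23'.trans M.ch₁.chFlip)).toContinuousLinearEquiv,
    fun η => ContinuousLinearMap.ext (h1 η), fun ξ => ContinuousLinearMap.ext (h2 ξ),
    fun ξ => ContinuousLinearMap.ext (h3 ξ), fun η => ContinuousLinearMap.ext (h4 η),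
    fun η => ContinuousLinearMap.ext (h5 η), ContinuousLinearMap.ext h6⟩

theorem imgSp_trans {R R' R'' : Type*} [NormedAddCommGroup R] [InnerProductSpace ℂ R]
    [NormedAddCommGroup R'] [InnerProductSpace ℂ R'] [NormedAddCommGroup R'']
    [InnerProductSpace ℂ R''] {V : R ≃ₗᵢ[ℂ] R'} {V' : R' ≃ₗᵢ[ℂ] R''}
    {X : Submodule ℂ (K →L[ℂ] R)} {Y : Submodule ℂ (K →L[ℂ] R')} {Z : Submodule ℂ (K →L[ℂ] R'')}
    (h : imgSp V X = Y) (h' : imgSp V' Y = Z) : imgSp (V.trans V') X = Z := by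
  rw [← h']
  ext T
  constructor
  · rintro ⟨s, hs, rfl⟩
    exact ⟨_, h.le ⟨s, hs, rfl⟩, rfl⟩
  · rintro ⟨t, ht, rfl⟩
    obtain ⟨s, hs, rfl⟩ := h.ge ht
    exact ⟨s, hs, rfl⟩

theorem imgSp_symm {R R' : Type*} [NormedAddCommGroup R] [InnerProductSpace ℂ R]
    [NormedAddCommGroup R'] [InnerProductSpace ℂ R'] {V : R ≃ₗᵢ[ℂ] R'}
    {X : Submodule ℂ (K →L[ℂ] R)} {Y : Submodule ℂ (K →L[ℂ] R')}
    (h : imgSp V X = Y) : imgSp V.symm Y = X := by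
  have e : ∀ s : K →L[ℂ] R, V.symm.toContinuousLinearEquiv.toContinuousLinearMap ∘L
      V.toContinuousLinearEquiv.toContinuousLinearMap ∘L s = s := fun s =>
    ContinuousLinearMap.ext fun x => V.symm_apply_apply _
  refine Set.Subset.antisymm ?_ fun T hT => ⟨_, h.le ⟨T, hT, rfl⟩, (e T).symm⟩
  rintro _ ⟨t, ht, rfl⟩
  obtain ⟨s, hs, rfl⟩ := h.ge ht
  exact (e s).symm ▸ hs

theorem comp_mem_clspan {R R' : Type*} [NormedAddCommGroup R] [InnerProductSpace ℂ R]
    [NormedAddCommGroup R'] [InnerProductSpace ℂ R'] (V : R →L[ℂ] R')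
    {X : Set (K →L[ℂ] R)} {Y : Set (K →L[ℂ] R')} (h : ∀ T ∈ X, V ∘L T ∈ clspan Y)
    {T : K →L[ℂ] R} (hT : T ∈ clspan X) : V ∘L T ∈ clspan Y := by
  have : clspan X ≤ (clspan Y).comap (ContinuousLinearMap.compL ℂ K R R' V).toLinearMap :=
    clspan_le ((isClosed_clspan Y).preimage (ContinuousLinearMap.compL ℂ K R R' V).continuous) h
  exact this hT

/-- A unitary maps one closed span of operators onto another one if it does so on generators. -/
theorem imgSp_clspan {R R' : Type*} [NormedAddCommGroup R] [InnerProductSpace ℂ R]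
    [NormedAddCommGroup R'] [InnerProductSpace ℂ R'] {V : R ≃ₗᵢ[ℂ] R'}
    {X : Set (K →L[ℂ] R)} {Y : Set (K →L[ℂ] R')}
    (h : ∀ T ∈ X, V.toContinuousLinearEquiv.toContinuousLinearMap ∘L T ∈ clspan Y)
    (h' : ∀ T ∈ Y, V.symm.toContinuousLinearEquiv.toContinuousLinearMap ∘L T ∈ clspan X) :
    imgSp V (clspan X) = clspan Y := by
  ext T
  constructor
  · rintro ⟨s, hs, rfl⟩
    exact comp_mem_clspan _ h hs
  · intro hT
    refine ⟨_, comp_mem_clspan _ h' hT, ?_⟩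
    ext x
    exact (V.apply_symm_apply _).symm

theorem imgSp_flip₁ {E F G : Submodule ℂ (K →L[ℂ] L)} (hB : IsCBase 𝔅) (hE : IsCModule 𝔅 E)
    (hF : IsCModule 𝔅 F) : imgSp (rtpFlip hB hE hF) (ketSp₁ E F G) = ketSp₂ F E G := by
  refine imgSp_clspan ?_ ?_
  · rintro _ ⟨ξ, g, hg, rfl⟩
    refine subset_clspan' ⟨ξ, g, hg, ?_⟩
    ext x
    exact rtpFlip_ket₁ hB hE hF ξ (g x)
  · rintro _ ⟨ξ, g, hg, rfl⟩
    refine subset_clspan' ⟨ξ, g, hg, ?_⟩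
    ext x
    change (rtpFlip hB hE hF).symm (ket₂ ξ (g x)) = ket₁ ξ (g x)
    rw [LinearIsometryEquiv.symm_apply_eq, rtpFlip_ket₁]

theorem imgSp_flip₂ {E F G : Submodule ℂ (K →L[ℂ] L)} (hB : IsCBase 𝔅) (hE : IsCModule 𝔅 E)
    (hF : IsCModule 𝔅 F) : imgSp (rtpFlip hB hE hF) (ketSp₂ E F G) = ketSp₁ F E G := by
  refine imgSp_clspan ?_ ?_
  · rintro _ ⟨ξ, g, hg, rfl⟩
    refine subset_clspan' ⟨ξ, g, hg, ?_⟩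
    ext x
    exact rtpFlip_ket₂ hB hE hF ξ (g x)
  · rintro _ ⟨ξ, g, hg, rfl⟩
    refine subset_clspan' ⟨ξ, g, hg, ?_⟩
    ext x
    change (rtpFlip hB hE hF).symm (ket₁ ξ (g x)) = ket₂ ξ (g x)
    rw [LinearIsometryEquiv.symm_apply_eq, rtpFlip_ket₂]

/-- The flip exchanges β̂ and β. The relations of type (α, α) and (β̂, β) are carried to themselves,
while (β̂, β̂) and (α, β) change places. -/
theorem intertwines_flipU (M : CompatTriple 𝔅 βh α β) {U : RTP α β ≃ₗᵢ[ℂ] RTP βh α}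
    (h : Intertwines U.symm) : Intertwines (M.flipU U) := by
  have f₁ : ∀ {E : Submodule ℂ (K →L[ℂ] L)}, _ := fun {E} =>
    imgSp_flip₁ (G := E) M.base M.module_β M.module_α
  have f₂ : ∀ {E : Submodule ℂ (K →L[ℂ] L)}, _ := fun {E} =>
    imgSp_flip₂ (G := E) M.base M.module_β M.module_α
  have g₁ : ∀ {E : Submodule ℂ (K →L[ℂ] L)}, _ := fun {E} =>
    imgSp_flip₁ (G := E) M.base M.module_βh M.module_α
  have g₂ : ∀ {E : Submodule ℂ (K →L[ℂ] L)}, _ := fun {E} =>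
    imgSp_flip₂ (G := E) M.base M.module_βh M.module_α
  have h1 := imgSp_trans f₂ (imgSp_trans (imgSp_symm h.α_α) g₂)
  have h2 := imgSp_trans f₁ (imgSp_trans (imgSp_symm h.βh_β) g₁)
  have h3 := imgSp_trans f₁ (imgSp_trans (imgSp_symm h.α_β) g₂)
  have h4 := imgSp_trans f₂ (imgSp_trans (imgSp_symm h.βh_βh) g₁)
  exact ⟨h1, h2, h3, h4⟩

theorem adj_mem_clspan {X Y : Set (L →L[ℂ] L)} (h : ∀ T ∈ X, adj T ∈ clspan Y) {T : L →L[ℂ] L}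
    (hT : T ∈ clspan X) : adj T ∈ clspan Y := by
  have : clspan X ≤ (clspan Y).comap
      (ContinuousLinearMap.adjoint (𝕜 := ℂ) (E := L) (F := L)).toLinearEquiv.toLinearMap :=
    clspan_le ((isClosed_clspan Y).preimage ContinuousLinearMap.adjoint.continuous) h
  exact this hT

/-- A slice of `flipU` is the adjoint of a slice of the inverse of `U`, with the two vectors
exchanged, and the closed span of the operators ξη^* is invariant under adjoints. -/
theorem isRegular_flipU (M : CompatTriple 𝔅 βh α β) {U : RTP α β ≃ₗᵢ[ℂ] RTP βh α}
    (h : IsRegular U.symm) : IsRegular (M.flipU U) := by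
  have key : ∀ ξ η : ↥α, adj (ket₁ ξ) ∘L toOp (M.flipU U) ∘L ket₂ η =
      adj (adj (ket₁ η) ∘L toOp U.symm ∘L ket₂ ξ) := by
    intro ξ η
    refine ContinuousLinearMap.ext fun x => ext_inner_left ℂ fun y => ?_
    rw [adj_inner_right, ContinuousLinearMap.comp_apply, ContinuousLinearMap.comp_apply,
      ContinuousLinearMap.comp_apply, ContinuousLinearMap.comp_apply, adj_inner_right,
      adj_inner_left]
    change inner ℂ (ket₁ ξ y) (M.flipU U (ket₂ η x)) = inner ℂ (U.symm (ket₂ ξ y)) (ket₁ η x)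
    rw [flipU_apply, rtpFlip_ket₂, ← rtpFlip_ket₂ M.base M.module_βh M.module_α,
      LinearIsometryEquiv.inner_map_map, ← LinearIsometryEquiv.inner_map_map U.symm,
      LinearIsometryEquiv.symm_apply_apply]
  unfold IsRegular at h ⊢
  refine le_antisymm (clspan_le (isClosed_clspan _) ?_) (clspan_le (isClosed_clspan _) ?_)
  · rintro _ ⟨ξ, η, rfl⟩
    rw [SetLike.mem_coe, key]
    refine adj_mem_clspan ?_ (h.le (subset_clspan' ⟨η, ξ, rfl⟩))
    rintro _ ⟨a, b, rfl⟩
    exact subset_clspan' ⟨b, a, by rw [adj_comp, adj_adj]⟩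
  · rintro _ ⟨ξ, η, rfl⟩
    have : ξ.1 ∘L adj η.1 = adj (η.1 ∘L adj ξ.1) := by rw [adj_comp, adj_adj]
    rw [SetLike.mem_coe, this]
    refine adj_mem_clspan ?_ (h.ge (subset_clspan' ⟨η, ξ, rfl⟩))
    rintro _ ⟨a, b, rfl⟩
    exact subset_clspan' ⟨b, a, (key b a).symm⟩

end CompatTriple

end Assembly

/-! ## Calculus in `(B,Γ)^ev`-algebras -/

theorem SModEq.mapTo {M N : Type*} [AddCommGroup M] [AddCommGroup N] [Module ℂ M] [Module ℂ N]
    {U : Submodule ℂ M} {V : Submodule ℂ N} {x y : M} (f : M →ₗ[ℂ] N) (h : x ≡ y [SMOD U])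
    (hf : U ≤ V.comap f) : f x ≡ f y [SMOD V] :=
  (h.map f).mono (Submodule.map_le_iff_le_comap.2 hf)

theorem SModEq.lift_eq {M N : Type*} [AddCommGroup M] [AddCommGroup N] [Module ℂ M] [Module ℂ N]
    {U : Submodule ℂ M} {x y : M} (f : M →ₗ[ℂ] N) (h : x ≡ y [SMOD U])
    (hf : U ≤ LinearMap.ker f) : f x = f y := by
  rw [← sub_eq_zero, ← map_sub]
  exact hf (SModEq.sub_mem.1 h)

section Calculus

variable {C : Type*} [NonUnitalRing C] [Module ℂ C] [IsScalarTower ℂ C C] [SMulCommClass ℂ C C]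

theorem mul_ract (T : Mult C) (x y : C) : ract T (x * y) = x * ract T y := T.2.2.1 x y

theorem lact_mult_mul (T T' : Mult C) (x : C) : lact (T * T') x = lact T (lact T' x) := rfl

theorem ract_mult_mul (T T' : Mult C) (x : C) : ract (T * T') x = ract T' (ract T x) := rfl

theorem star_lact [StarRing C] [StarModule ℂ C] (T : Mult C) (x : C) :
    star (lact T x) = ract (star T) (star x) := (ract_star T x).symm

theorem star_ract [StarRing C] [StarModule ℂ C] (T : Mult C) (x : C) :
    star (ract T x) = lact (star T) (star x) := by
  change _ = star (ract T (star (star x)))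
  rw [star_star]

end Calculus

namespace EvAlgebra

variable {Γ B : Type*} [Group Γ] [NonUnitalCommRing B] [Module ℂ B] [IsScalarTower ℂ B B]
  [SMulCommClass ℂ B B] [StarRing B] [StarModule ℂ B] {act : Γ →* (B ≃⋆ₐ[ℂ] B)}
  {A : Type*} [NonUnitalRing A] [Module ℂ A] [IsScalarTower ℂ A A] [SMulCommClass ℂ A A]
  [StarRing A] [StarModule ℂ A] (G : EvAlgebra act A)

/-- The filter of two-sided local units of degree `(1, 1)`. -/
def units : Filter A where
  sets := {P | ∃ T : Finset A, ∀ u ∈ G.gr 1 1, (∀ x ∈ T, u * x = x ∧ x * u = x) → u ∈ P}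
  univ_sets := ⟨∅, fun _ _ _ => trivial⟩
  sets_of_superset := by
    rintro P Q ⟨T, hT⟩ h
    exact ⟨T, fun u hu hx => h (hT u hu hx)⟩
  inter_sets := by
    classical
    rintro P Q ⟨T, hT⟩ ⟨T', hT'⟩
    exact ⟨T ∪ T', fun u hu hx => ⟨hT u hu fun x h => hx x (Finset.mem_union_left _ h),
      hT' u hu fun x h => hx x (Finset.mem_union_right _ h)⟩⟩

theorem one_mem_mul {x y : A} (hx : x ∈ G.gr 1 1) (hy : y ∈ G.gr 1 1) : x * y ∈ G.gr 1 1 := by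
  simpa using G.mul_mem hx hy

theorem one_mem_star {x : A} (hx : x ∈ G.gr 1 1) : star x ∈ G.gr 1 1 := by
  simpa using G.star_mem hx

instance : G.units.NeBot := by
  rw [Filter.neBot_iff]
  intro h
  obtain ⟨T, hT⟩ := (Filter.empty_mem_iff_bot.2 h : ∅ ∈ G.units)
  obtain ⟨e, he, he'⟩ := G.exists_left_unit T
  obtain ⟨f, hf, hf'⟩ := G.exists_right_unit T
  -- From a left unit e and a right unit f one obtains the two-sided unit e + f - fe.
  refine hT (e + f - f * e) (sub_mem (add_mem he hf) (G.one_mem_mul hf he)) fun x hx => ⟨?_, ?_⟩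
  · rw [sub_mul, add_mul, mul_assoc, he' x hx, add_sub_cancel_right]
  · rw [mul_sub, mul_add, ← mul_assoc, hf' x hx, add_comm, add_sub_cancel_right]

theorem units_mem : ∀ᶠ u in G.units, u ∈ G.gr 1 1 := ⟨∅, fun _ hu _ => hu⟩

theorem units_mul (x : A) : ∀ᶠ u in G.units, u * x = x :=
  ⟨{x}, fun _ _ h => (h x (Finset.mem_singleton_self x)).1⟩

theorem mul_units (x : A) : ∀ᶠ u in G.units, x * u = x :=
  ⟨{x}, fun _ _ h => (h x (Finset.mem_singleton_self x)).2⟩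

variable {M : Type*} [AddCommGroup M] [Module ℂ M]

theorem units_rTensor_mulLeft (w : A ⊗[ℂ] M) :
    ∀ᶠ u in G.units, (LinearMap.mulLeft ℂ u).rTensor M w = w := by
  induction w with
  | zero => simp
  | tmul x y => filter_upwards [G.units_mul x] with u hu; simp [hu]
  | add x y hx hy => filter_upwards [hx, hy] with u h h'; rw [map_add, h, h']

theorem units_rTensor_mulRight (w : A ⊗[ℂ] M) :
    ∀ᶠ u in G.units, (LinearMap.mulRight ℂ u).rTensor M w = w := by
  induction w with
  | zero => simp
  | tmul x y => filter_upwards [G.mul_units x] with u hu; simp [hu]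
  | add x y hx hy => filter_upwards [hx, hy] with u h h'; rw [map_add, h, h']

theorem units_lTensor_mulLeft (w : M ⊗[ℂ] A) :
    ∀ᶠ u in G.units, (LinearMap.mulLeft ℂ u).lTensor M w = w := by
  induction w with
  | zero => simp
  | tmul x y => filter_upwards [G.units_mul y] with u hu; simp [hu]
  | add x y hx hy => filter_upwards [hx, hy] with u h h'; rw [map_add, h, h']

theorem units_lTensor_mulRight (w : M ⊗[ℂ] A) :
    ∀ᶠ u in G.units, (LinearMap.mulRight ℂ u).lTensor M w = w := by
  induction w with
  | zero => simp
  | tmul x y => filter_upwards [G.mul_units y] with u hu; simp [hu]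
  | add x y hx hy => filter_upwards [hx, hy] with u h h'; rw [map_add, h, h']

theorem units_mulL1 (w : A ⊗[ℂ] A) : ∀ᶠ u in G.units, mulL1 u w = w := G.units_rTensor_mulLeft w

theorem units_mulL2 (w : A ⊗[ℂ] A) : ∀ᶠ u in G.units, mulL2 u w = w := G.units_lTensor_mulLeft w

theorem units_mulR1 (w : A ⊗[ℂ] A) : ∀ᶠ u in G.units, mulR1 u w = w := G.units_rTensor_mulRight w

theorem units_mulR2 (w : A ⊗[ℂ] A) : ∀ᶠ u in G.units, mulR2 u w = w := G.units_lTensor_mulRight w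

theorem hom_mem (U : Submodule ℂ A) (h : ∀ γ γ', G.gr γ γ' ≤ U) (x : A) : x ∈ U := by
  have : ⨆ p : Γ × Γ, G.gr p.1 p.2 ≤ U := iSup_le fun p => h p.1 p.2
  exact this (G.span_top ▸ Submodule.mem_top)

theorem hom_ext {f g : A →ₗ[ℂ] M} (h : ∀ γ γ', ∀ x ∈ G.gr γ γ', f x = g x) (x : A) : f x = g x :=
  G.hom_mem (LinearMap.eqLocus f g) (fun γ γ' x hx => h γ γ' x hx) x

/-- Writing x = xu and T x = (T x)u with a local unit u reduces the claim to the module properties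
of T and T'. -/
theorem lact_ract (G : EvAlgebra act A) (T T' : Mult A) (x : A) : lact T (ract T' x) = ract T' (lact T x) := by
  obtain ⟨u, h1, h2⟩ := ((G.mul_units x).and (G.mul_units (lact T x))).exists
  rw [← h2, mul_ract, ← lact_mul, ← mul_ract, h1]

theorem r_mul (b c : B) (x : A) : lact (G.r (b * c)) x = lact (G.r b) (lact (G.r c) x) := by
  rw [map_mul, lact_mult_mul]

theorem s_mul (b c : B) (x : A) : lact (G.s (b * c)) x = lact (G.s b) (lact (G.s c) x) := by
  rw [map_mul, lact_mult_mul]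

theorem r_mul' (b c : B) (x : A) : ract (G.r (b * c)) x = ract (G.r c) (ract (G.r b) x) := by
  rw [map_mul, ract_mult_mul]

theorem r_s (b c : B) (x : A) :
    lact (G.r b) (lact (G.s c) x) = lact (G.s c) (lact (G.r b) x) := by
  rw [← lact_mult_mul, G.r_s_comm, lact_mult_mul]

theorem r_r (b c : B) (x : A) :
    lact (G.r b) (lact (G.r c) x) = lact (G.r c) (lact (G.r b) x) := by
  rw [← r_mul, mul_comm, r_mul]

theorem s_s (b c : B) (x : A) :
    lact (G.s b) (lact (G.s c) x) = lact (G.s c) (lact (G.s b) x) := by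
  rw [← s_mul, mul_comm, s_mul]

theorem r_one {u : A} (hu : u ∈ G.gr 1 1) (b : B) : ract (G.r b) u = lact (G.r b) u := by
  rw [G.r_twist hu, map_one]; rfl

theorem s_one {u : A} (hu : u ∈ G.gr 1 1) (b : B) : ract (G.s b) u = lact (G.s b) u := by
  rw [G.s_twist hu, map_one]; rfl

/-- `u r(b) x = r(b) u x` for `u` of degree `(1, 1)` -/
theorem mul_r {u : A} (hu : u ∈ G.gr 1 1) (b : B) (x : A) :
    u * lact (G.r b) x = lact (G.r b) (u * x) := by
  rw [← ract_mul, G.r_one hu, lact_mul]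

theorem mul_s {u : A} (hu : u ∈ G.gr 1 1) (b : B) (x : A) :
    u * lact (G.s b) x = lact (G.s b) (u * x) := by
  rw [← ract_mul, G.s_one hu, lact_mul]

theorem ract_s_mul {u : A} (hu : u ∈ G.gr 1 1) (b : B) (x : A) :
    ract (G.s b) x * u = ract (G.s b) (x * u) := by
  rw [mul_ract, G.s_one hu, ract_mul]

/-! ### Balanced tensors -/

theorem balSpan_le {U : Submodule ℂ (A ⊗[ℂ] A)}
    (h : ∀ γ γ' γ'', ∀ x ∈ G.gr γ γ', ∀ y ∈ G.gr γ' γ'', ∀ b,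
      lact (G.s b) x ⊗ₜ[ℂ] y - x ⊗ₜ[ℂ] lact (G.r b) y ∈ U) : G.balSpan ≤ U := by
  refine Submodule.span_le.2 ?_
  rintro _ ⟨γ, γ', γ'', x, hx, y, hy, b, rfl⟩
  exact h γ γ' γ'' x hx y hy b

theorem balSpan_le_relLeft : G.balSpan ≤ G.relLeft :=
  G.balSpan_le fun _ _ _ x _ y _ b => Submodule.subset_span ⟨x, y, b, rfl⟩

theorem relLeft_le {U : Submodule ℂ (A ⊗[ℂ] A)}
    (h : ∀ x y b, lact (G.s b) x ⊗ₜ[ℂ] y - x ⊗ₜ[ℂ] lact (G.r b) y ∈ U) : G.relLeft ≤ U := by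
  refine Submodule.span_le.2 ?_
  rintro _ ⟨x, y, b, rfl⟩
  exact h x y b

theorem relLeft_le_ker {f : A ⊗[ℂ] A →ₗ[ℂ] M}
    (h : ∀ x y b, f (lact (G.s b) x ⊗ₜ[ℂ] y) = f (x ⊗ₜ[ℂ] lact (G.r b) y)) :
    G.relLeft ≤ LinearMap.ker f :=
  G.relLeft_le fun x y b => by rw [LinearMap.mem_ker, map_sub, h, sub_self]

/-- For x of degree (γ, γ') and y of degree (γ', γ'') one has s(b)x = x s(γ'⁻¹(b)) and r(b)y = y
r(γ'⁻¹(b)). The twist is the same on both sides because the tensor is matched. -/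
theorem balSpan_le_relRight : G.balSpan ≤ G.relRight := by
  refine G.balSpan_le fun γ γ' γ'' x hx y hy b => Submodule.subset_span ⟨x, y, act γ'⁻¹ b, ?_⟩
  rw [G.s_twist hx, G.r_twist hy, ← StarAlgEquiv.mul_apply, ← map_mul, mul_inv_cancel, map_one]
  rfl

theorem relLeft_mulR1 (x : A) : G.relLeft ≤ G.relLeft.comap (mulR1 x) := by
  refine G.relLeft_le fun p q b => Submodule.subset_span ⟨p * x, q, b, ?_⟩
  simp [mulR1, lact_mul]

theorem relLeft_mulR2 (x : A) : G.relLeft ≤ G.relLeft.comap (mulR2 x) := by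
  refine G.relLeft_le fun p q b => Submodule.subset_span ⟨p, q * x, b, ?_⟩
  simp [mulR2, lact_mul]

theorem balSpan_mulL1 {v : A} (hv : v ∈ G.gr 1 1) : G.balSpan ≤ G.balSpan.comap (mulL1 v) := by
  refine G.balSpan_le fun γ γ' γ'' x hx y hy b => Submodule.subset_span
    ⟨γ, γ', γ'', v * x, by simpa using G.mul_mem hv hx, y, hy, b, ?_⟩
  simp [mulL1, G.mul_s hv]

/-- The kernel of `A ⊗ A ⊗ A → ₛA ⊗_B (ᵣA = ₛA) ⊗_B ᵣA`. -/
def relT : Submodule ℂ (A ⊗[ℂ] (A ⊗[ℂ] A)) :=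
  Submodule.span ℂ
    ({t | ∃ x y z b,
        t = lact (G.s b) x ⊗ₜ[ℂ] (y ⊗ₜ[ℂ] z) - x ⊗ₜ[ℂ] (lact (G.r b) y ⊗ₜ[ℂ] z)} ∪
      {t | ∃ x y z b,
        t = x ⊗ₜ[ℂ] (lact (G.s b) y ⊗ₜ[ℂ] z) - x ⊗ₜ[ℂ] (y ⊗ₜ[ℂ] lact (G.r b) z)})

theorem relT_le {U : Submodule ℂ (A ⊗[ℂ] (A ⊗[ℂ] A))}
    (h₁ : ∀ x y z b, lact (G.s b) x ⊗ₜ[ℂ] (y ⊗ₜ[ℂ] z) - x ⊗ₜ[ℂ] (lact (G.r b) y ⊗ₜ[ℂ] z) ∈ U)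
    (h₂ : ∀ x y z b, x ⊗ₜ[ℂ] (lact (G.s b) y ⊗ₜ[ℂ] z) - x ⊗ₜ[ℂ] (y ⊗ₜ[ℂ] lact (G.r b) z) ∈ U) :
    G.relT ≤ U := by
  refine Submodule.span_le.2 (Set.union_subset ?_ ?_)
  · rintro _ ⟨x, y, z, b, rfl⟩
    exact h₁ x y z b
  · rintro _ ⟨x, y, z, b, rfl⟩
    exact h₂ x y z b

theorem relT_le_ker {f : A ⊗[ℂ] (A ⊗[ℂ] A) →ₗ[ℂ] M}
    (h₁ : ∀ x y z b, f (lact (G.s b) x ⊗ₜ[ℂ] (y ⊗ₜ[ℂ] z)) = f (x ⊗ₜ[ℂ] (lact (G.r b) y ⊗ₜ[ℂ] z)))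
    (h₂ : ∀ x y z b, f (x ⊗ₜ[ℂ] (lact (G.s b) y ⊗ₜ[ℂ] z)) =
      f (x ⊗ₜ[ℂ] (y ⊗ₜ[ℂ] lact (G.r b) z))) : G.relT ≤ LinearMap.ker f :=
  G.relT_le (fun x y z b => by rw [LinearMap.mem_ker, map_sub, h₁, sub_self])
    fun x y z b => by rw [LinearMap.mem_ker, map_sub, h₂, sub_self]

theorem assoc_tmul_mem_relT {w : A ⊗[ℂ] A} (hw : w ∈ G.relLeft) (z : A) :
    TensorProduct.assoc ℂ A A A (w ⊗ₜ[ℂ] z) ∈ G.relT := by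
  have : G.relLeft ≤ G.relT.comap ((TensorProduct.assoc ℂ A A A).toLinearMap ∘ₗ
      (TensorProduct.mk ℂ (A ⊗[ℂ] A) A).flip z) :=
    G.relLeft_le fun x y b => Submodule.subset_span
      (.inl ⟨x, y, z, b, by simp⟩)
  exact this hw

theorem tmul_mem_relT (x : A) {w : A ⊗[ℂ] A} (hw : w ∈ G.relLeft) : x ⊗ₜ[ℂ] w ∈ G.relT := by
  have : G.relLeft ≤ G.relT.comap (TensorProduct.mk ℂ A (A ⊗[ℂ] A) x) :=
    G.relLeft_le fun y z b => Submodule.subset_span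
      (.inr ⟨x, y, z, b, by simp [TensorProduct.tmul_sub]⟩)
  exact this hw

/-- Maps that agree modulo `relLeft` agree modulo `relT` after tensoring. -/
theorem assoc_rTensor_congr {f g : A →ₗ[ℂ] A ⊗[ℂ] A} (h : ∀ x, f x ≡ g x [SMOD G.relLeft])
    (w : A ⊗[ℂ] A) : TensorProduct.assoc ℂ A A A (f.rTensor A w) ≡
      TensorProduct.assoc ℂ A A A (g.rTensor A w) [SMOD G.relT] := by
  induction w with
  | zero => simp
  | tmul x y =>
    rw [SModEq.sub_mem, LinearMap.rTensor_tmul, LinearMap.rTensor_tmul, ← map_sub,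
      ← TensorProduct.sub_tmul]
    exact G.assoc_tmul_mem_relT (SModEq.sub_mem.1 (h x)) y
  | add x y hx hy => simpa only [map_add] using hx.add hy

theorem lTensor_congr {f g : A →ₗ[ℂ] A ⊗[ℂ] A} (h : ∀ x, f x ≡ g x [SMOD G.relLeft])
    (w : A ⊗[ℂ] A) : f.lTensor A w ≡ g.lTensor A w [SMOD G.relT] := by
  induction w with
  | zero => simp
  | tmul x y =>
    rw [SModEq.sub_mem, LinearMap.lTensor_tmul, LinearMap.lTensor_tmul, ← TensorProduct.tmul_sub]
    exact G.tmul_mem_relT x (SModEq.sub_mem.1 (h y))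
  | add x y hx hy => simpa only [map_add] using hx.add hy

/-! ### The projection onto matched tensors -/

theorem exists_grading (f : Γ × Γ → Γ) :
    ∃ c : A →ₗ[ℂ] (Γ →₀ A), ∀ γ γ', ∀ x ∈ G.gr γ γ', c x = Finsupp.single (f (γ, γ')) x := by
  classical
  have hi : DirectSum.IsInternal fun p : Γ × Γ => G.gr p.1 p.2 :=
    DirectSum.isInternal_submodule_of_iSupIndep_of_iSup_eq_top G.indep G.span_top
  let e := LinearEquiv.ofBijective (DirectSum.coeLinearMap fun p : Γ × Γ => G.gr p.1 p.2) hi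
  refine ⟨DirectSum.toModule ℂ (Γ × Γ) (Γ →₀ A)
    (fun p => Finsupp.lsingle (f p) ∘ₗ (G.gr p.1 p.2).subtype) ∘ₗ e.symm.toLinearMap,
    fun γ γ' x hx => ?_⟩
  have : e.symm x = DirectSum.lof ℂ (Γ × Γ) (fun p : Γ × Γ => G.gr p.1 p.2) (γ, γ') ⟨x, hx⟩ := by
    rw [LinearEquiv.symm_apply_eq]
    exact (DirectSum.coeLinearMap_lof (fun p : Γ × Γ => G.gr p.1 p.2) (γ, γ') ⟨x, hx⟩).symm
  simp [this]

/-- `f₁` of the degree of homogeneous elements, with values. -/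
def deg₁ : A →ₗ[ℂ] (Γ →₀ A) := (G.exists_grading Prod.fst).choose

def deg₂ : A →ₗ[ℂ] (Γ →₀ A) := (G.exists_grading Prod.snd).choose

theorem deg₁_apply {γ γ' : Γ} {x : A} (hx : x ∈ G.gr γ γ') : G.deg₁ x = Finsupp.single γ x :=
  (G.exists_grading Prod.fst).choose_spec γ γ' x hx

theorem deg₂_apply {γ γ' : Γ} {x : A} (hx : x ∈ G.gr γ γ') : G.deg₂ x = Finsupp.single γ' x :=
  (G.exists_grading Prod.snd).choose_spec γ γ' x hx

/-- The projection of `A ⊗ A` onto the matched tensors. -/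
def matchProj : A ⊗[ℂ] A →ₗ[ℂ] A ⊗[ℂ] A :=
  TensorProduct.lift ((Finsupp.lsum ℂ fun γ => LinearMap.lcomp ℂ _ (Finsupp.lapply γ) ∘ₗ
    TensorProduct.mk ℂ A A : (Γ →₀ A) →ₗ[ℂ] (Γ →₀ A) →ₗ[ℂ] A ⊗[ℂ] A).compl₁₂ G.deg₂ G.deg₁)

theorem matchProj_tmul [DecidableEq Γ] {γ γ' δ δ' : Γ} {x y : A} (hx : x ∈ G.gr γ γ')
    (hy : y ∈ G.gr δ δ') :
    G.matchProj (x ⊗ₜ[ℂ] y) = if δ = γ' then x ⊗ₜ[ℂ] y else 0 := by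
  simp only [matchProj, TensorProduct.lift.tmul, LinearMap.compl₁₂_apply, G.deg₂_apply hx,
    G.deg₁_apply hy, Finsupp.lsum_single, LinearMap.comp_apply, LinearMap.lcomp_apply,
    Finsupp.lapply_apply, TensorProduct.mk_apply, Finsupp.single_apply]
  split_ifs <;> simp

theorem matchProj_matched {w : A ⊗[ℂ] A} (hw : w ∈ G.matchedSpan) : G.matchProj w = w := by
  classical
  have : G.matchedSpan ≤ LinearMap.eqLocus G.matchProj LinearMap.id := by
    refine Submodule.span_le.2 ?_
    rintro _ ⟨γ, γ'', γ', x, hx, y, hy, rfl⟩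
    simp [G.matchProj_tmul hx hy]
  exact this hw

theorem matchProj_bal (x y : A) (b : B) :
    G.matchProj (lact (G.s b) x ⊗ₜ[ℂ] y - x ⊗ₜ[ℂ] lact (G.r b) y) ∈ G.relLeft := by
  classical
  refine G.hom_mem (G.relLeft.comap (G.matchProj ∘ₗ ((TensorProduct.mk ℂ A A).flip y ∘ₗ
    lact (G.s b) - (TensorProduct.mk ℂ A A).flip (lact (G.r b) y)))) (fun γ γ' x hx => ?_) x
  refine G.hom_mem (G.relLeft.comap (G.matchProj ∘ₗ (TensorProduct.mk ℂ A A (lact (G.s b) x) -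
    TensorProduct.mk ℂ A A x ∘ₗ lact (G.r b)))) (fun δ δ' y hy => ?_) y
  change G.matchProj (lact (G.s b) x ⊗ₜ[ℂ] y - x ⊗ₜ[ℂ] lact (G.r b) y) ∈ G.relLeft
  rw [map_sub, G.matchProj_tmul (G.s_mem hx b) hy, G.matchProj_tmul hx (G.r_mem hy b)]
  split_ifs
  · exact Submodule.subset_span ⟨x, y, b, rfl⟩
  · simp

/-- On unmatched tensors the twists of x s(b) and y r(b) involve different group elements, so the
relation for right multiplication does not follow from the one for left multiplication. The
projection kills these tensors, and on matched ones both relations agree up to replacing b by γ'(b).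
-/
theorem matchProj_bal' (x y : A) (b : B) :
    G.matchProj (ract (G.s b) x ⊗ₜ[ℂ] y - x ⊗ₜ[ℂ] ract (G.r b) y) ∈ G.relLeft := by
  classical
  refine G.hom_mem (G.relLeft.comap (G.matchProj ∘ₗ ((TensorProduct.mk ℂ A A).flip y ∘ₗ
    ract (G.s b) - (TensorProduct.mk ℂ A A).flip (ract (G.r b) y)))) (fun γ γ' x hx => ?_) x
  refine G.hom_mem (G.relLeft.comap (G.matchProj ∘ₗ (TensorProduct.mk ℂ A A (ract (G.s b) x) -
    TensorProduct.mk ℂ A A x ∘ₗ ract (G.r b)))) (fun δ δ' y hy => ?_) y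
  change G.matchProj (ract (G.s b) x ⊗ₜ[ℂ] y - x ⊗ₜ[ℂ] ract (G.r b) y) ∈ G.relLeft
  rw [G.s_twist hx, G.r_twist hy, map_sub, G.matchProj_tmul (G.s_mem hx _) hy,
    G.matchProj_tmul hx (G.r_mem hy _)]
  split_ifs with h
  · subst h
    exact Submodule.subset_span ⟨x, y, _, rfl⟩
  · simp

/-- The projection of `A ⊗ A ⊗ A` onto the tensors that are matched in the first two factors. -/
def matchProj₁₂ : A ⊗[ℂ] (A ⊗[ℂ] A) →ₗ[ℂ] A ⊗[ℂ] (A ⊗[ℂ] A) :=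
  (TensorProduct.assoc ℂ A A A).toLinearMap ∘ₗ G.matchProj.rTensor A ∘ₗ
    (TensorProduct.assoc ℂ A A A).symm.toLinearMap

theorem matchProj₁₂_assoc (w : A ⊗[ℂ] A) (z : A) :
    G.matchProj₁₂ (TensorProduct.assoc ℂ A A A (w ⊗ₜ[ℂ] z)) =
      TensorProduct.assoc ℂ A A A (G.matchProj w ⊗ₜ[ℂ] z) := by
  simp [matchProj₁₂]

theorem matchProj₁₂_tmul (x y z : A) : G.matchProj₁₂ (x ⊗ₜ[ℂ] (y ⊗ₜ[ℂ] z)) =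
    TensorProduct.assoc ℂ A A A (G.matchProj (x ⊗ₜ[ℂ] y) ⊗ₜ[ℂ] z) := by
  simp [matchProj₁₂]

theorem matchProj₁₂_bal₂ (x y z : A) (b : B) :
    G.matchProj₁₂ (x ⊗ₜ[ℂ] (lact (G.s b) y ⊗ₜ[ℂ] z) - x ⊗ₜ[ℂ] (y ⊗ₜ[ℂ] lact (G.r b) z)) ∈
      G.relT := by
  classical
  refine G.hom_mem (G.relT.comap (G.matchProj₁₂ ∘ₗ ((TensorProduct.mk ℂ A (A ⊗[ℂ] A)).flip
    (lact (G.s b) y ⊗ₜ[ℂ] z) - (TensorProduct.mk ℂ A (A ⊗[ℂ] A)).flip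
    (y ⊗ₜ[ℂ] lact (G.r b) z)))) (fun γ γ' x hx => ?_) x
  refine G.hom_mem (G.relT.comap (G.matchProj₁₂ ∘ₗ (TensorProduct.mk ℂ A (A ⊗[ℂ] A) x ∘ₗ
    (TensorProduct.mk ℂ A A).flip z ∘ₗ lact (G.s b) - TensorProduct.mk ℂ A (A ⊗[ℂ] A) x ∘ₗ
      (TensorProduct.mk ℂ A A).flip (lact (G.r b) z)))) (fun δ δ' y hy => ?_) y
  simp only [Submodule.mem_comap, LinearMap.comp_apply, LinearMap.sub_apply,
    LinearMap.flip_apply, TensorProduct.mk_apply]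
  rw [map_sub, matchProj₁₂_tmul, matchProj₁₂_tmul, G.matchProj_tmul hx (G.s_mem hy b),
    G.matchProj_tmul hx hy]
  split_ifs
  · exact Submodule.subset_span (.inr ⟨x, y, z, b, by simp⟩)
  · simp

theorem relT_matchProj₁₂ : G.relT ≤ G.relT.comap G.matchProj₁₂ := by
  refine G.relT_le (fun x y z b => ?_) fun x y z b => G.matchProj₁₂_bal₂ x y z b
  rw [Submodule.mem_comap, map_sub, matchProj₁₂_tmul, matchProj₁₂_tmul, ← map_sub,
    ← TensorProduct.sub_tmul, ← map_sub]
  exact G.assoc_tmul_mem_relT (G.matchProj_bal x y b) z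

/-- Coassociativity is only available modulo `relTriple`, where the first two factors are balanced
by right multiplications. Projecting onto tensors that are matched in these factors makes it
available modulo `relT`. -/
theorem relTriple_matchProj₁₂ : G.relTriple ≤ G.relT.comap G.matchProj₁₂ := by
  refine Submodule.span_le.2 (Set.union_subset ?_ ?_)
  · rintro _ ⟨x, y, z, b, rfl⟩
    rw [SetLike.mem_coe, Submodule.mem_comap, map_sub, matchProj₁₂_tmul, matchProj₁₂_tmul,
      ← map_sub, ← TensorProduct.sub_tmul, ← map_sub]
    exact G.assoc_tmul_mem_relT (G.matchProj_bal' x y b) z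
  · rintro _ ⟨x, y, z, b, rfl⟩
    exact G.matchProj₁₂_bal₂ x y z b

end EvAlgebra

/-! ## The calculus of a measured Hopf algebroid -/

section Core

variable {Γ B : Type*} [Group Γ] [NonUnitalCommRing B] [Module ℂ B] [IsScalarTower ℂ B B]
  [SMulCommClass ℂ B B] [StarRing B] [StarModule ℂ B] {act : Γ →* (B ≃⋆ₐ[ℂ] B)}
  {A : Type*} [NonUnitalRing A] [Module ℂ A] [IsScalarTower ℂ A A] [SMulCommClass ℂ A A]
  [StarRing A] [StarModule ℂ A]

namespace EvAlgebra

variable (G : EvAlgebra act A)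

/-- `b ↦ r(b)`, with values in the left multiplications -/
def rl : B →ₗ[ℂ] A →ₗ[ℂ] A where
  toFun b := lact (G.r b)
  map_add' b c := by rw [map_add]; rfl
  map_smul' z b := by rw [map_smul]; rfl

/-- `b ↦ s(b)`, with values in the left multiplications -/
def sl : B →ₗ[ℂ] A →ₗ[ℂ] A where
  toFun b := lact (G.s b)
  map_add' b c := by rw [map_add]; rfl
  map_smul' z b := by rw [map_smul]; rfl

end EvAlgebra

/-- `y ↦ (u ⊗ 1)Δ(y)` in terms of `y ↦ Δ(y)(v ⊗ 1)`, for `v = u^*`. -/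
def starT (f : A →ₗ[ℂ] A ⊗[ℂ] A) : A →ₗ[ℂ] A ⊗[ℂ] A where
  toFun y := star (f (star y))
  map_add' x y := by simp
  map_smul' z x := by simp

theorem starT_apply (f : A →ₗ[ℂ] A ⊗[ℂ] A) (y : A) : starT f y = star (f (star y)) := rfl

/-- The part of the structure of a measured Hopf algebroid that enters the construction of one of
the fundamental unitaries. Here, `d1 v y` and `d2 v y` represent `Δ(y)(v ⊗ 1)` and `Δ(y)(1 ⊗ v)`
for `v` of degree `(1, 1)`. -/
structure Core (G : EvAlgebra act A) where
  d1 : A → A →ₗ[ℂ] A ⊗[ℂ] A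
  d2 : A → A →ₗ[ℂ] A ⊗[ℂ] A
  es : A →ₗ[ℂ] B
  ef : A →ₗ[ℂ] B
  S : A ≃ₗ[ℂ] A
  φ : A →ₗ[ℂ] B
  ψ : A →ₗ[ℂ] B
  μ : B →ₗ[ℂ] ℂ
  D : Γ → Mult B
  base_unit : ∀ F : Finset B, ∃ u : B, ∀ b ∈ F, u * b = b
  d1_mem : ∀ v y, d1 v y ∈ G.matchedSpan
  d1_deg : ∀ {v}, v ∈ G.gr 1 1 → ∀ {γ γ'' y}, y ∈ G.gr γ γ'' →
    ∃ t ∈ Submodule.span ℂ (G.pureMatched γ γ''), d1 v y ≡ t [SMOD G.balSpan]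
  d2_deg : ∀ {v}, v ∈ G.gr 1 1 → ∀ {γ γ'' y}, y ∈ G.gr γ γ'' →
    ∃ t ∈ Submodule.span ℂ (G.pureMatched γ γ''), d2 v y ≡ t [SMOD G.balSpan]
  d1_mul : ∀ {v u}, v ∈ G.gr 1 1 → u ∈ G.gr 1 1 → ∀ {y}, mulL1 u (d1 v y) = d1 v y → ∀ x,
    d1 v (x * y) ≡ d1 u x * d1 v y [SMOD G.balSpan]
  d21_mul : ∀ {v u}, v ∈ G.gr 1 1 → u ∈ G.gr 1 1 → ∀ {y}, mulL2 u (d1 v y) = d1 v y → ∀ x,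
    d1 v (x * y) ≡ d2 u x * d1 v y [SMOD G.balSpan]
  mix : ∀ {v u}, v ∈ G.gr 1 1 → u ∈ G.gr 1 1 → ∀ y,
    mulR2 u (d1 v y) ≡ mulR1 v (d2 u y) [SMOD G.balSpan]
  mixLR : ∀ {v u}, v ∈ G.gr 1 1 → u ∈ G.gr 1 1 → ∀ y,
    mulL1 u (d1 v y) ≡ mulR1 v (starT (d1 (star u)) y) [SMOD G.balSpan]
  d1_r : ∀ {v}, v ∈ G.gr 1 1 → ∀ b y,
    d1 v (lact (G.r b) y) ≡ (lact (G.r b)).rTensor A (d1 v y) [SMOD G.balSpan]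
  d1_s : ∀ {v}, v ∈ G.gr 1 1 → ∀ b y,
    d1 v (lact (G.s b) y) ≡ (lact (G.s b)).lTensor A (d1 v y) [SMOD G.balSpan]
  d2_r : ∀ {v}, v ∈ G.gr 1 1 → ∀ b y,
    d2 v (lact (G.r b) y) ≡ (lact (G.r b)).rTensor A (d2 v y) [SMOD G.balSpan]
  coassoc : ∀ {a c}, a ∈ G.gr 1 1 → c ∈ G.gr 1 1 → ∀ y,
    TensorProduct.assoc ℂ A A A ((starT (d1 (star a))).rTensor A (d2 c y)) ≡
      (d2 c).lTensor A (starT (d1 (star a)) y) [SMOD G.relTriple]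
  es_r : ∀ b x, es (lact (G.r b) x) = b * es x
  es_s : ∀ b x, es (lact (G.s b) x) = b * es x
  ef_eq : ∀ {γ γ' x}, x ∈ G.gr γ γ' → ef x = act γ⁻¹ (es x)
  counit : ∀ {v}, v ∈ G.gr 1 1 → ∀ y, TensorProduct.lift (G.rl ∘ₗ es) (d2 v y) = y * v
  S_mul : ∀ x y, S (x * y) = S y * S x
  S_r : ∀ b x, S (lact (G.r b) x) = ract (G.s b) (S x)
  S_s : ∀ b x, S (lact (G.s b) x) = ract (G.r b) (S x)
  S_s' : ∀ b x, S (ract (G.s b) x) = lact (G.r b) (S x)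
  antipode_left : ∀ {v}, v ∈ G.gr 1 1 → ∀ y,
    TensorProduct.lift (LinearMap.mul ℂ A ∘ₗ S.toLinearMap) (d1 v y) = ract (G.s (ef y)) (S v)
  antipode_right : ∀ {v}, v ∈ G.gr 1 1 → ∀ y,
    TensorProduct.lift ((LinearMap.mul ℂ A).compl₂ S.toLinearMap) (starT (d1 (star v)) y) =
      ract (G.r (es y)) v
  φ_left : ∀ b x, φ (lact (G.r b) x) = b * φ x
  φ_right : ∀ b x, φ (ract (G.r b) x) = φ x * b
  φ_deg : ∀ {γ γ' x}, x ∈ G.gr γ γ' → γ ≠ 1 → φ x = 0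
  φ_inv : ∀ {v}, v ∈ G.gr 1 1 → ∀ y,
    TensorProduct.lift (G.sl ∘ₗ φ).flip (d1 v y) = lact (G.r (φ y)) v
  ψ_left : ∀ b x, ψ (lact (G.s b) x) = b * ψ x
  ψ_right : ∀ b x, ψ (ract (G.s b) x) = ψ x * b
  ψ_deg : ∀ {γ γ' x}, x ∈ G.gr γ γ' → γ' ≠ 1 → ψ x = 0
  μ_faithful : ∀ b, (∀ c, μ (c * b) = 0) → b = 0
  μ_quasi_invariant : ∀ γ b, μ (act γ (ract (D γ) b)) = μ b
  ν_eq : ∀ x, μ (ψ x) = μ (φ x)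
  φ_surjective : Function.Surjective φ
  ψ_surjective : Function.Surjective ψ

namespace Core

variable {G : EvAlgebra act A} (c : Core G)

/-- `(u ⊗ 1)Δ(y)` -/
def l1 (u : A) : A →ₗ[ℂ] A ⊗[ℂ] A := starT (c.d1 (star u))

/-- Right multiplication by `Y` on the first two factors. -/
def mulR₁₂ (Y : A ⊗[ℂ] A) : A ⊗[ℂ] (A ⊗[ℂ] A) →ₗ[ℂ] A ⊗[ℂ] (A ⊗[ℂ] A) :=
  (TensorProduct.assoc ℂ A A A).toLinearMap ∘ₗ (LinearMap.mulRight ℂ Y).rTensor A ∘ₗ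
    (TensorProduct.assoc ℂ A A A).symm.toLinearMap

theorem mulR₁₂_tmul (x y z : A) (Y : A ⊗[ℂ] A) : mulR₁₂ Y (x ⊗ₜ[ℂ] (y ⊗ₜ[ℂ] z)) =
    TensorProduct.assoc ℂ A A A ((x ⊗ₜ[ℂ] y * Y) ⊗ₜ[ℂ] z) := by
  simp [mulR₁₂]

theorem mul_relLeft {w : A ⊗[ℂ] A} (hw : w ∈ G.relLeft) (Y : A ⊗[ℂ] A) : w * Y ∈ G.relLeft := by
  induction Y with
  | zero => rw [mul_zero]; exact zero_mem _
  | add y z hy hz => rw [mul_add]; exact add_mem hy hz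
  | tmul p q =>
    have : G.relLeft ≤ G.relLeft.comap (LinearMap.mulRight ℂ (p ⊗ₜ[ℂ] q)) :=
      G.relLeft_le fun x y b => Submodule.subset_span ⟨x * p, y * q, b, by simp [sub_mul, lact_mul]⟩
    exact this hw

theorem relT_mulR₁₂ (Y : A ⊗[ℂ] A) : G.relT ≤ G.relT.comap (mulR₁₂ Y) := by
  refine G.relT_le (fun x y z b => ?_) fun x y z b => ?_
  · rw [Submodule.mem_comap, map_sub, mulR₁₂_tmul, mulR₁₂_tmul, ← map_sub,
      ← TensorProduct.sub_tmul, ← sub_mul]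
    exact G.assoc_tmul_mem_relT (mul_relLeft (Submodule.subset_span ⟨x, y, b, rfl⟩) Y) z
  · rw [Submodule.mem_comap, map_sub, mulR₁₂_tmul, mulR₁₂_tmul]
    induction Y with
    | zero => simp
    | add p q hp hq =>
      simp only [mul_add, TensorProduct.add_tmul, map_add]
      rw [add_sub_add_comm]
      exact add_mem hp hq
    | tmul p q =>
      refine Submodule.subset_span (.inr ⟨x * p, y * q, z, b, ?_⟩)
      simp [lact_mul]

theorem relTriple_mulR {v : A} (hv : v ∈ G.gr 1 1) :
    G.relTriple ≤ G.relTriple.comap ((LinearMap.mulRight ℂ v).rTensor (A ⊗[ℂ] A)) := by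
  refine Submodule.span_le.2 (Set.union_subset ?_ ?_)
  · rintro _ ⟨x, y, z, b, rfl⟩
    refine Submodule.subset_span (.inl ⟨x * v, y, z, b, ?_⟩)
    simp [G.ract_s_mul hv]
  · rintro _ ⟨x, y, z, b, rfl⟩
    exact Submodule.subset_span (.inr ⟨x * v, y, z, b, by simp⟩)

theorem bal_left {w w' : A ⊗[ℂ] A} (h : w ≡ w' [SMOD G.balSpan]) : w ≡ w' [SMOD G.relLeft] :=
  h.mono G.balSpan_le_relLeft

theorem l1_apply (u y : A) : c.l1 u y = star (c.d1 (star u) (star y)) := rfl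

/-- Since Δ(r(b)y) = (r(b) ⊗ 1)Δ(y), a relation between the two factors becomes one between the
first two of three factors. -/
theorem lTensor_d2_mem {a : A} (ha : a ∈ G.gr 1 1) :
    G.balSpan ≤ G.relT.comap ((c.d2 a).lTensor A) := by
  refine G.balSpan_le fun γ γ' γ'' x hx y hy b => ?_
  rw [Submodule.mem_comap, map_sub, LinearMap.lTensor_tmul, LinearMap.lTensor_tmul]
  have h1 : x ⊗ₜ[ℂ] c.d2 a (lact (G.r b) y) ≡ x ⊗ₜ[ℂ] (lact (G.r b)).rTensor A (c.d2 a y)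
      [SMOD G.relT] := by
    rw [SModEq.sub_mem, ← TensorProduct.tmul_sub]
    exact G.tmul_mem_relT x (G.balSpan_le_relLeft (SModEq.sub_mem.1 (c.d2_r ha b y)))
  refine SModEq.sub_mem.1 (SModEq.trans ?_ h1.symm)
  induction c.d2 a y with
  | zero => simp
  | add p q hp hq => simpa only [map_add, TensorProduct.tmul_add] using hp.add hq
  | tmul p q => exact SModEq.sub_mem.2 (Submodule.subset_span (.inl ⟨x, p, q, b, by simp⟩))

/-- Coassociativity, `(Δ ⊗ id)(Δ(Y)(1 ⊗ c))(a ⊗ 1 ⊗ 1) = (id ⊗ Δ)(Δ(Y)(a ⊗ 1))(1 ⊗ 1 ⊗ c)` -/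
theorem coassoc_left {a e : A} (ha : a ∈ G.gr 1 1) (he : e ∈ G.gr 1 1) (Y : A) :
    TensorProduct.assoc ℂ A A A ((c.d1 a).rTensor A (c.d2 e Y)) ≡
      (c.d2 e).lTensor A (c.d1 a Y) [SMOD G.relT] := by
  set X₁ := TensorProduct.assoc ℂ A A A ((c.d1 a).rTensor A (c.d2 e Y)) with hX₁
  set X₂ := (c.d2 e).lTensor A (c.d1 a Y) with hX₂
  -- As u is a left unit on the first factor of both sides, `mixLR` trades Δ(·)(a ⊗ 1) for ((u ⊗
  -- 1)Δ(·))(a ⊗ 1), the form in which coassociativity is given.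
  obtain ⟨u, hu, hu₁, hu₂⟩ := (G.units_mem.and
    ((G.units_rTensor_mulLeft X₁).and (G.units_rTensor_mulLeft X₂))).exists
  have e1 : ∀ w : A ⊗[ℂ] A, (LinearMap.mulLeft ℂ u).rTensor (A ⊗[ℂ] A)
      (TensorProduct.assoc ℂ A A A ((c.d1 a).rTensor A w)) =
      TensorProduct.assoc ℂ A A A ((mulL1 u ∘ₗ c.d1 a).rTensor A w) := by
    intro w
    induction w with
    | zero => simp
    | add p q hp hq => simp only [map_add, hp, hq]
    | tmul p q =>
      simp only [LinearMap.rTensor_tmul, LinearMap.comp_apply]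
      induction c.d1 a p with
      | zero => simp
      | add p q hp hq => simp only [map_add, TensorProduct.add_tmul, hp, hq]
      | tmul p q => simp [mulL1]
  have e2 : ∀ w : A ⊗[ℂ] A, (LinearMap.mulRight ℂ a).rTensor (A ⊗[ℂ] A)
      (TensorProduct.assoc ℂ A A A ((c.l1 u).rTensor A w)) =
      TensorProduct.assoc ℂ A A A ((mulR1 a ∘ₗ c.l1 u).rTensor A w) := by
    intro w
    induction w with
    | zero => simp
    | add p q hp hq => simp only [map_add, hp, hq]
    | tmul p q =>
      simp only [LinearMap.rTensor_tmul, LinearMap.comp_apply]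
      induction c.l1 u p with
      | zero => simp
      | add p q hp hq => simp only [map_add, TensorProduct.add_tmul, hp, hq]
      | tmul p q => simp [mulR1]
  have e3 : ∀ w : A ⊗[ℂ] A, (LinearMap.mulRight ℂ a).rTensor (A ⊗[ℂ] A) ((c.d2 e).lTensor A w) =
      (c.d2 e).lTensor A (mulR1 a w) := by
    intro w
    induction w with
    | zero => simp
    | add p q hp hq => simp only [map_add, hp, hq]
    | tmul p q => simp [mulR1]
  have e4 : ∀ w : A ⊗[ℂ] A, (LinearMap.mulLeft ℂ u).rTensor (A ⊗[ℂ] A) ((c.d2 e).lTensor A w) =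
      (c.d2 e).lTensor A (mulL1 u w) := by
    intro w
    induction w with
    | zero => simp
    | add p q hp hq => simp only [map_add, hp, hq]
    | tmul p q => simp [mulL1]
  have h1 : X₁ ≡ (LinearMap.mulRight ℂ a).rTensor (A ⊗[ℂ] A)
      (TensorProduct.assoc ℂ A A A ((c.l1 u).rTensor A (c.d2 e Y))) [SMOD G.relT] := by
    rw [← hu₁, hX₁, e1, e2]
    exact G.assoc_rTensor_congr (fun x => bal_left (c.mixLR ha hu x)) _
  have h2 := SModEq.mapTo ((LinearMap.mulRight ℂ a).rTensor (A ⊗[ℂ] A)) (c.coassoc hu he Y) (relTriple_mulR ha)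
  have h3 : (LinearMap.mulRight ℂ a).rTensor (A ⊗[ℂ] A) ((c.d2 e).lTensor A (c.l1 u Y)) ≡ X₂
      [SMOD G.relT] := by
    rw [e3, ← hu₂, hX₂, e4]
    exact SModEq.mapTo ((c.d2 e).lTensor A) (c.mixLR ha hu Y).symm (c.lTensor_d2_mem he)
  -- The projection removes the mixed relations. It remains to see that it does not change the two
  -- sides: X₁ is fixed because `d1` takes values in matched tensors.
  have h4 : G.matchProj₁₂ X₁ = X₁ := by
    rw [hX₁]
    induction c.d2 e Y with
    | zero => simp
    | add p q hp hq => simp only [map_add, hp, hq]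
    | tmul p q =>
      rw [LinearMap.rTensor_tmul, G.matchProj₁₂_assoc, G.matchProj_matched (c.d1_mem a p)]
  -- X₂ is fixed only modulo `relT`: for a matched x ⊗ y, the representative of Δ(y)(1 ⊗ e) has to
  -- be replaced by one whose first factors have first degree equal to that of y, hence matching x.
  have h5 : G.matchProj₁₂ X₂ ≡ X₂ [SMOD G.relT] := by
    rw [hX₂]
    have key : G.matchedSpan ≤ G.relT.comap (G.matchProj₁₂ ∘ₗ (c.d2 e).lTensor A -
        (c.d2 e).lTensor A) := by
      refine Submodule.span_le.2 ?_
      rintro _ ⟨γ, γ'', γ', x, hx, y, hy, rfl⟩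
      obtain ⟨t, ht, hyt⟩ := c.d2_deg he hy
      have h6 : x ⊗ₜ[ℂ] c.d2 e y ≡ x ⊗ₜ[ℂ] t [SMOD G.relT] := by
        rw [SModEq.sub_mem, ← TensorProduct.tmul_sub]
        exact G.tmul_mem_relT x (G.balSpan_le_relLeft (SModEq.sub_mem.1 hyt))
      have h7 : G.matchProj₁₂ (x ⊗ₜ[ℂ] t) = x ⊗ₜ[ℂ] t := by
        have : Submodule.span ℂ (G.pureMatched γ' γ'') ≤ LinearMap.eqLocus
            (G.matchProj₁₂ ∘ₗ TensorProduct.mk ℂ A (A ⊗[ℂ] A) x)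
            (TensorProduct.mk ℂ A (A ⊗[ℂ] A) x) := by
          refine Submodule.span_le.2 ?_
          rintro _ ⟨δ, p, hp, q, hq, rfl⟩
          change G.matchProj₁₂ (x ⊗ₜ[ℂ] (p ⊗ₜ[ℂ] q)) = x ⊗ₜ[ℂ] (p ⊗ₜ[ℂ] q)
          rw [G.matchProj₁₂_tmul, G.matchProj_matched, TensorProduct.assoc_tmul]
          exact Submodule.subset_span ⟨_, _, _, x, hx, p, hp, rfl⟩
        exact this ht
      change G.matchProj₁₂ ((c.d2 e).lTensor A (x ⊗ₜ[ℂ] y)) - (c.d2 e).lTensor A (x ⊗ₜ[ℂ] y) ∈ G.relT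
      rw [← SModEq.sub_mem, LinearMap.lTensor_tmul]
      exact ((SModEq.mapTo G.matchProj₁₂ h6 G.relT_matchProj₁₂).trans (by rw [h7])).trans h6.symm
    exact SModEq.sub_mem.2 (key (c.d1_mem a Y))
  have h6 := (SModEq.mapTo G.matchProj₁₂ h1 G.relT_matchProj₁₂).trans
    ((SModEq.mapTo G.matchProj₁₂ h2 G.relTriple_matchProj₁₂).trans (SModEq.mapTo G.matchProj₁₂ h3 G.relT_matchProj₁₂))
  rw [h4] at h6
  exact h6.trans h5

end Core

end Core

/-! ### Surjectivity of (x, y) ↦ Δ(y)(x ⊗ 1), and coassociativity for products. -/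

section CoreCalculus

variable {Γ B : Type*} [Group Γ] [NonUnitalCommRing B] [Module ℂ B] [IsScalarTower ℂ B B]
  [SMulCommClass ℂ B B] [StarRing B] [StarModule ℂ B] {act : Γ →* (B ≃⋆ₐ[ℂ] B)}
  {A : Type*} [NonUnitalRing A] [Module ℂ A] [IsScalarTower ℂ A A] [SMulCommClass ℂ A A]
  [StarRing A] [StarModule ℂ A] {G : EvAlgebra act A} (c : Core G)

theorem exists_fin_sum (w : A ⊗[ℂ] A) :
    ∃ (n : ℕ) (p q : Fin n → A), w = ∑ i, p i ⊗ₜ[ℂ] q i := by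
  induction w with
  | zero => exact ⟨0, Fin.elim0, Fin.elim0, by simp⟩
  | tmul x y => exact ⟨1, fun _ => x, fun _ => y, by simp⟩
  | add x y hx hy =>
    obtain ⟨n, p, q, rfl⟩ := hx
    obtain ⟨m, p', q', rfl⟩ := hy
    exact ⟨n + m, Fin.append p p', Fin.append q q', by simp [Fin.sum_univ_add]⟩

theorem mulR1_mulR1 (x y : A) (w : A ⊗[ℂ] A) : mulR1 x (mulR1 y w) = mulR1 (y * x) w := by
  induction w with
  | zero => simp
  | add p q hp hq => simp only [map_add, hp, hq]
  | tmul p q => simp [mulR1, mul_assoc]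

theorem mulR1_mulR2 (x y : A) (w : A ⊗[ℂ] A) : mulR1 x (mulR2 y w) = mulR2 y (mulR1 x w) := by
  induction w with
  | zero => simp
  | add p q hp hq => simp only [map_add, hp, hq]
  | tmul p q => simp [mulR1, mulR2]

theorem mulL1_mul (x : A) (w w' : A ⊗[ℂ] A) : mulL1 x (w * w') = mulL1 x w * w' := by
  induction w with
  | zero => simp
  | add p q hp hq => simp only [map_add, add_mul, hp, hq]
  | tmul p q =>
    induction w' with
    | zero => simp
    | add r s hr hs => simp only [map_add, mul_add, hr, hs]
    | tmul r s => simp [mulL1, mul_assoc]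

theorem mulR1_mul (x : A) (w w' : A ⊗[ℂ] A) : mulR1 x w * w' = w * mulL1 x w' := by
  induction w with
  | zero => simp
  | add p q hp hq => simp only [map_add, add_mul, hp, hq]
  | tmul p q =>
    induction w' with
    | zero => simp
    | add r s hr hs => simp only [map_add, mul_add, hr, hs]
    | tmul r s => simp [mulL1, mulR1, mul_assoc]

theorem star_mulR1 (x : A) (w : A ⊗[ℂ] A) : star (mulR1 x w) = mulL1 (star x) (star w) := by
  induction w with
  | zero => simp
  | add p q hp hq => simp only [map_add, star_add, hp, hq]
  | tmul p q => simp [mulL1, mulR1]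

namespace Core

/-- Both sides represent Δ(y)(x ⊗ 1). The units v and v' are compared through Δ(y)(1 ⊗ e) for a
common right unit e of the second factors. -/
theorem d1_congr {x v v' : A} (hv : v ∈ G.gr 1 1) (hv' : v' ∈ G.gr 1 1) (hx : v * x = x)
    (hx' : v' * x = x) (y : A) :
    mulR1 x (c.d1 v y) ≡ mulR1 x (c.d1 v' y) [SMOD G.relLeft] := by
  obtain ⟨e, he, h1, h2⟩ := (G.units_mem.and
    ((G.units_mulR2 (c.d1 v y)).and (G.units_mulR2 (c.d1 v' y)))).exists
  have key : ∀ v ∈ G.gr 1 1, v * x = x → mulR2 e (c.d1 v y) = c.d1 v y →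
      mulR1 x (c.d1 v y) ≡ mulR1 x (c.d2 e y) [SMOD G.relLeft] := by
    intro v hv hx h
    have := SModEq.mapTo (mulR1 x) (bal_left (c.mix hv he y)) (G.relLeft_mulR1 x)
    rwa [h, mulR1_mulR1, hx] at this
  exact (key v hv hx h1).trans (key v' hv' hx' h2).symm

/-- `((a ⊗ 1)Δ(y))(Δ(z)(v ⊗ 1)) = (a ⊗ 1)Δ(yz)(v ⊗ 1)` -/
theorem l1_mul_d1 {a v : A} (ha : a ∈ G.gr 1 1) (hv : v ∈ G.gr 1 1) (y z : A) :
    c.l1 a y * c.d1 v z ≡ mulL1 a (c.d1 v (y * z)) [SMOD G.balSpan] := by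
  obtain ⟨u, hu, h⟩ := (G.units_mem.and (G.units_mulL1 (c.d1 v z))).exists
  have h1 := SModEq.mapTo (mulL1 a) (c.d1_mul hv hu h y) (G.balSpan_mulL1 ha)
  have h2 : mulL1 a (c.d1 u y) * c.d1 v z ≡ mulR1 u (c.l1 a y) * c.d1 v z [SMOD G.balSpan] :=
    SModEq.mapTo (LinearMap.mulRight ℂ (c.d1 v z)) (c.mixLR hu ha y) fun j hj =>
      G.balSpan_mul_right (c.d1_mem v z) hj
  rw [mulL1_mul] at h1
  rw [mulR1_mul, h] at h2
  exact (h1.trans h2).symm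

/-- The map `(x, y) ↦ Δ(y)(x ⊗ 1)` is surjective. -/
theorem exists_T4 (p q : A) : ∃ (n : ℕ) (x y : Fin n → A) (u : A), u ∈ G.gr 1 1 ∧
    (∀ i, u * x i = x i) ∧ (∑ i, mulR1 (x i) (c.d1 u (y i))) ≡ p ⊗ₜ[ℂ] q [SMOD G.relLeft] := by
  obtain ⟨v, hv, hpv⟩ := (G.units_mem.and (G.mul_units (c.S p))).exists
  obtain ⟨n, a, b, hab⟩ := exists_fin_sum (c.l1 v q)
  have hu' : ∀ᶠ u in G.units, ∀ i, u * (c.S.symm (a i) * p) = c.S.symm (a i) * p :=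
    Filter.eventually_all.2 fun i => G.units_mul _
  obtain ⟨u, hu, hux⟩ := (G.units_mem.and hu').exists
  -- With (v ⊗ 1)Δ(q) = Σ a_i ⊗ b_i, the preimage of p ⊗ q is Σ S⁻¹(a_i)p ⊗ b_i, since Σ q₂S⁻¹(q₁)p
  -- ⊗ q₃ = p ⊗ q. The choice of v ensures S⁻¹(v)p = p.
  set x : Fin n → A := fun i => c.S.symm (a i) * p with hx
  refine ⟨n, x, b, u, hu, hux, ?_⟩
  set w := ∑ i, mulR1 (x i) (c.d1 u (b i)) with hw
  obtain ⟨e, he, hwe, hqe⟩ := (G.units_mem.and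
    ((G.units_mulR2 w).and (G.mul_units q))).exists
  -- `F (a ⊗ b ⊗ t) = b S⁻¹(a) p ⊗ t`
  let F : A ⊗[ℂ] (A ⊗[ℂ] A) →ₗ[ℂ] A ⊗[ℂ] A := TensorProduct.lift (LinearMap.rTensorHom A ∘ₗ
    (LinearMap.mul ℂ A).flip ∘ₗ LinearMap.mulRight ℂ p ∘ₗ c.S.symm.toLinearMap)
  have hF : ∀ g t, F (g ⊗ₜ[ℂ] t) = mulR1 (c.S.symm g * p) t := fun g t => rfl
  -- The mixed relations fit here: S⁻¹ turns right multiplication by s(b) into left multiplication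
  -- by r(b), which meets the factor r(b) on the right of the middle leg.
  have hF₀ : G.relTriple ≤ G.relLeft.comap F := by
    refine Submodule.span_le.2 (Set.union_subset ?_ ?_)
    · rintro _ ⟨g, h, t, b, rfl⟩
      have h1 : c.S.symm (ract (G.s b) g) = lact (G.r b) (c.S.symm g) := by
        rw [LinearEquiv.symm_apply_eq, c.S_r, LinearEquiv.apply_symm_apply]
      rw [SetLike.mem_coe, Submodule.mem_comap, map_sub, hF, hF, h1]
      simp only [mulR1, LinearMap.rTensor_tmul, LinearMap.mulRight_apply, lact_mul, ract_mul]
      rw [sub_self]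
      exact zero_mem _
    · rintro _ ⟨g, h, t, b, rfl⟩
      rw [SetLike.mem_coe, Submodule.mem_comap, map_sub, hF, hF]
      exact Submodule.subset_span ⟨h * (c.S.symm g * p), t, b, by simp [mulR1, lact_mul, mul_assoc]⟩
  have h1 := SModEq.mapTo F (c.coassoc hv he q) hF₀
  have h2 : F ((c.d2 e).lTensor A (c.l1 v q)) ≡ w [SMOD G.relLeft] := by
    rw [hab, map_sum, map_sum, ← hwe, hw, map_sum]
    refine SModEq.sum fun i _ => ?_
    rw [LinearMap.lTensor_tmul, hF, ← hux i, ← mulR1_mulR1, ← mulR1_mulR2]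
    exact SModEq.mapTo (mulR1 (x i)) (bal_left (c.mix hu he (b i)).symm) (G.relLeft_mulR1 _)
  -- The identity Σ y₂S⁻¹(y₁)p = s(ε^♯(y))p is the antipode axiom Σ y₁S(y₂) = r(ε^♯(y)) after
  -- applying S⁻¹. Balancing then moves s(ε^♯(q₁)) to r(ε^♯(q₁)) on the last leg, where the counit
  -- gives q.
  have h3 : ∀ y, TensorProduct.lift ((LinearMap.mul ℂ A).flip ∘ₗ c.S.symm.toLinearMap)
      (c.l1 v y) * p = lact (G.s (c.es y)) p := by
    intro y
    apply c.S.injective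
    rw [c.S_mul, c.S_s]
    have h4 : c.S p * _ = c.S p * _ := congrArg (fun t => c.S p * t) (c.antipode_right hv y)
    rw [← mul_ract, hpv] at h4
    rw [← h4]
    change _ = c.S p * TensorProduct.lift ((LinearMap.mul ℂ A).compl₂ c.S.toLinearMap) (c.l1 v y)
    congr 1
    induction c.l1 v y with
    | zero => simp
    | add p q hp hq => simp only [map_add, hp, hq]
    | tmul p q => simp [c.S_mul]
  have h5 : ∀ t : A ⊗[ℂ] A, F (TensorProduct.assoc ℂ A A A ((c.l1 v).rTensor A t)) ≡
      p ⊗ₜ[ℂ] TensorProduct.lift (G.rl ∘ₗ c.es) t [SMOD G.relLeft] := by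
    intro t
    induction t with
    | zero => simp
    | add r s hr hs => simpa only [map_add, TensorProduct.tmul_add] using hr.add hs
    | tmul r s =>
      have h6 : F (TensorProduct.assoc ℂ A A A (c.l1 v r ⊗ₜ[ℂ] s)) =
          (TensorProduct.lift ((LinearMap.mul ℂ A).flip ∘ₗ c.S.symm.toLinearMap)
            (c.l1 v r) * p) ⊗ₜ[ℂ] s := by
        induction c.l1 v r with
        | zero => simp
        | add p q hp hq => simp only [map_add, TensorProduct.add_tmul, add_mul, hp, hq]
        | tmul p q => simp [hF, mulR1, mul_assoc]
      rw [LinearMap.rTensor_tmul, h6, h3]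
      exact SModEq.sub_mem.2 (Submodule.subset_span ⟨p, s, c.es r, rfl⟩)
  have h7 := h5 (c.d2 e q)
  rw [c.counit he, hqe] at h7
  exact h2.symm.trans (h1.symm.trans h7)

theorem rTensor_d1_mem {a : A} (ha : a ∈ G.gr 1 1) {w w' : A ⊗[ℂ] A}
    (h : w ≡ w' [SMOD G.relLeft]) :
    TensorProduct.assoc ℂ A A A ((c.d1 a).rTensor A w) ≡
      TensorProduct.assoc ℂ A A A ((c.d1 a).rTensor A w') [SMOD G.relT] := by
  refine SModEq.mapTo ((TensorProduct.assoc ℂ A A A).toLinearMap ∘ₗ (c.d1 a).rTensor A) h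
    (G.relLeft_le fun x y b => ?_)
  rw [Submodule.mem_comap, LinearMap.comp_apply, LinearEquiv.coe_coe, map_sub, map_sub, LinearMap.rTensor_tmul, LinearMap.rTensor_tmul, ← SModEq.sub_mem]
  have h1 : TensorProduct.assoc ℂ A A A (c.d1 a (lact (G.s b) x) ⊗ₜ[ℂ] y) ≡
      TensorProduct.assoc ℂ A A A ((lact (G.s b)).lTensor A (c.d1 a x) ⊗ₜ[ℂ] y) [SMOD G.relT] := by
    rw [SModEq.sub_mem, ← map_sub, ← TensorProduct.sub_tmul]
    exact G.assoc_tmul_mem_relT (G.balSpan_le_relLeft (SModEq.sub_mem.1 (c.d1_s ha b x))) y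
  refine h1.trans ?_
  induction c.d1 a x with
  | zero => simp
  | add p q hp hq => simpa only [map_add, TensorProduct.add_tmul] using hp.add hq
  | tmul p q => exact SModEq.sub_mem.2 (Submodule.subset_span (.inr ⟨p, q, y, b, by simp⟩))

/-- `(Δ ⊗ id)(Δ(z)(y ⊗ 1))(v ⊗ 1 ⊗ 1)` in terms of `(id ⊗ Δ)(Δ(z))` and `Δ(y)(v ⊗ 1)`. -/
theorem coassoc_mul {u v w u' y : A} (hu : u ∈ G.gr 1 1) (huy : u * y = y) (hv : v ∈ G.gr 1 1)
    (hw : w ∈ G.gr 1 1) (hwy : mulL1 w (c.d1 v y) = c.d1 v y) (hu' : u' ∈ G.gr 1 1)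
    (huy' : mulL2 u' (c.d1 v y) = c.d1 v y) (z : A) :
    TensorProduct.assoc ℂ A A A ((c.d1 v).rTensor A (mulR1 y (c.d1 u z))) ≡
      mulR₁₂ (c.d1 v y) ((c.d1 u').lTensor A (c.d1 w z)) [SMOD G.relT] := by
  set R := mulR₁₂ (c.d1 v y) ((c.d1 u').lTensor A (c.d1 w z)) with hR
  have ht : ∀ X : A ⊗[ℂ] (A ⊗[ℂ] A), ∀ᶠ e in G.units, (mulR2 e).lTensor A X = X := by
    intro X
    induction X with
    | zero => simp
    | tmul x y => filter_upwards [G.units_mulR2 y] with u hu; simp [hu]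
    | add x y hx hy => filter_upwards [hx, hy] with u h h'; rw [map_add, h, h']
  -- A right unit e on the last factor allows Δ(z)(u ⊗ 1) to be replaced by Δ(z)(1 ⊗ e), on which
  -- `coassoc_left` operates.
  obtain ⟨e, he, he1, he2⟩ := (G.units_mem.and ((G.units_mulR2 (c.d1 u z)).and (ht R))).exists
  have h1 : mulR1 y (c.d1 u z) ≡ mulR1 y (c.d2 e z) [SMOD G.relLeft] := by
    have := SModEq.mapTo (mulR1 y) (bal_left (c.mix hu he z)) (G.relLeft_mulR1 y)
    rwa [he1, mulR1_mulR1, huy] at this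
  have h2 : TensorProduct.assoc ℂ A A A ((c.d1 v).rTensor A (mulR1 y (c.d2 e z))) ≡
      mulR₁₂ (c.d1 v y) (TensorProduct.assoc ℂ A A A ((c.d1 w).rTensor A (c.d2 e z)))
      [SMOD G.relT] := by
    have e1 : (c.d1 v).rTensor A (mulR1 y (c.d2 e z)) =
        (c.d1 v ∘ₗ LinearMap.mulRight ℂ y).rTensor A (c.d2 e z) := by
      rw [LinearMap.rTensor_comp]; rfl
    have e2 : mulR₁₂ (c.d1 v y) (TensorProduct.assoc ℂ A A A ((c.d1 w).rTensor A (c.d2 e z))) =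
        TensorProduct.assoc ℂ A A A
          ((LinearMap.mulRight ℂ (c.d1 v y) ∘ₗ c.d1 w).rTensor A (c.d2 e z)) := by
      rw [LinearMap.rTensor_comp]
      simp [mulR₁₂]
    rw [e1, e2]
    exact G.assoc_rTensor_congr (fun x => bal_left (c.d1_mul hv hw hwy x)) _
  have h3 := SModEq.mapTo (mulR₁₂ (c.d1 v y)) (c.coassoc_left hw he z) (relT_mulR₁₂ _)
  -- Because u' is a left unit for the second factors of Δ(y)(v ⊗ 1), it may be inserted to the
  -- right of the middle leg. This turns Δ(·)(1 ⊗ e) back into Δ(·)(u' ⊗ 1).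
  have e3 : ∀ X : A ⊗[ℂ] (A ⊗[ℂ] A),
      mulR₁₂ (c.d1 v y) ((mulR1 u').lTensor A X) = mulR₁₂ (c.d1 v y) X := by
    intro X
    induction X with
    | zero => simp
    | add p q hp hq => simp only [map_add, hp, hq]
    | tmul p t =>
      induction t with
      | zero => simp
      | add r s hr hs => simp only [map_add, TensorProduct.tmul_add, hr, hs]
      | tmul r s =>
        conv_rhs => rw [mulR₁₂_tmul, ← huy']
        rw [LinearMap.lTensor_tmul, mulR1, LinearMap.rTensor_tmul, mulR₁₂_tmul]
        congr 2
        induction c.d1 v y with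
        | zero => simp
        | add p q hp hq => simp only [map_add, mul_add, hp, hq]
        | tmul p q => simp [mulL2, mul_assoc]
  have e4 : ∀ X : A ⊗[ℂ] (A ⊗[ℂ] A), mulR₁₂ (c.d1 v y) ((mulR2 e).lTensor A X) =
      (mulR2 e).lTensor A (mulR₁₂ (c.d1 v y) X) := by
    intro X
    induction X with
    | zero => simp
    | add p q hp hq => simp only [map_add, hp, hq]
    | tmul p t =>
      induction t with
      | zero => simp
      | add r s hr hs => simp only [map_add, TensorProduct.tmul_add, hr, hs]
      | tmul r s =>
        rw [LinearMap.lTensor_tmul, mulR2, LinearMap.lTensor_tmul, mulR₁₂_tmul, mulR₁₂_tmul]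
        induction c.d1 v y with
        | zero => simp
        | add p q hp hq => simp only [map_add, mul_add, TensorProduct.add_tmul, hp, hq]
        | tmul p q => simp
  have h4 : mulR₁₂ (c.d1 v y) ((c.d2 e).lTensor A (c.d1 w z)) ≡ R [SMOD G.relT] := by
    rw [← e3, ← he2, hR, ← e4, ← LinearMap.comp_apply ((mulR1 u').lTensor A),
      ← LinearMap.comp_apply ((mulR2 e).lTensor A), ← LinearMap.lTensor_comp,
      ← LinearMap.lTensor_comp]
    exact SModEq.mapTo (mulR₁₂ (c.d1 v y)) (G.lTensor_congr (f := mulR1 u' ∘ₗ c.d2 e)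
      (g := mulR2 e ∘ₗ c.d1 u') (fun x => bal_left (c.mix hu' he x).symm) _) (relT_mulR₁₂ _)
  exact (c.rTensor_d1_mem hv h1).trans (h2.trans (h3.trans h4))

end Core

end CoreCalculus

/-! ### Strong left invariance of the integral φ. -/

section StrongInvariance

variable {Γ B : Type*} [Group Γ] [NonUnitalCommRing B] [Module ℂ B] [IsScalarTower ℂ B B]
  [SMulCommClass ℂ B B] [StarRing B] [StarModule ℂ B] {act : Γ →* (B ≃⋆ₐ[ℂ] B)}
  {A : Type*} [NonUnitalRing A] [Module ℂ A] [IsScalarTower ℂ A A] [SMulCommClass ℂ A A]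
  [StarRing A] [StarModule ℂ A] {G : EvAlgebra act A} (c : Core G)

namespace Core

/-- `p ⊗ q ↦ s(φ(q)) p x` -/
def invMap (x : A) : A ⊗[ℂ] A →ₗ[ℂ] A :=
  LinearMap.mulRight ℂ x ∘ₗ TensorProduct.lift (G.sl ∘ₗ c.φ).flip

theorem invMap_tmul (x p q : A) : c.invMap x (p ⊗ₜ[ℂ] q) = lact (G.s (c.φ q)) p * x := rfl

theorem invMap_relLeft (x : A) : G.relLeft ≤ LinearMap.ker (c.invMap x) :=
  G.relLeft_le_ker fun p q b => by
    rw [invMap_tmul, invMap_tmul, c.φ_left, G.s_mul, G.s_s]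

theorem invMap_d1 {v x : A} (hv : v ∈ G.gr 1 1) (hx : v * x = x) (y : A) :
    c.invMap x (c.d1 v y) = lact (G.r (c.φ y)) x := by
  change TensorProduct.lift (G.sl ∘ₗ c.φ).flip (c.d1 v y) * x = _
  rw [c.φ_inv hv, ← lact_mul, hx]

theorem invMap_mulL1 {v : A} (hv : v ∈ G.gr 1 1) (x : A) (w : A ⊗[ℂ] A) :
    c.invMap x (mulL1 v w) = v * c.invMap x w := by
  induction w with
  | zero => simp
  | add p q hp hq => simp only [map_add, mul_add, hp, hq]
  | tmul p q =>
    rw [mulL1, LinearMap.rTensor_tmul, LinearMap.mulLeft_apply, invMap_tmul, invMap_tmul,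
      ← mul_assoc, G.mul_s hv]

/-- The counit sends both r(b)x and s(b)x to b ε(x), so the two cannot be distinguished by ε^♭
either. -/
theorem ef_rs (b : B) (x : A) : c.ef (lact (G.s b) x) = c.ef (lact (G.r b) x) := by
  refine G.hom_ext (f := c.ef ∘ₗ lact (G.s b)) (g := c.ef ∘ₗ lact (G.r b)) (fun γ γ' x hx => ?_) x
  rw [LinearMap.comp_apply, LinearMap.comp_apply, c.ef_eq (G.s_mem hx b), c.ef_eq (G.r_mem hx b),
    c.es_r, c.es_s]

/-- `g ⊗ h ↦ S(g) r(φ(h z)) x` -/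
def invMapS (z x : A) : A ⊗[ℂ] A →ₗ[ℂ] A :=
  TensorProduct.lift ((LinearMap.mul ℂ A ∘ₗ c.S.toLinearMap).compl₂
    (G.rl.flip x ∘ₗ c.φ ∘ₗ LinearMap.mulRight ℂ z))

theorem invMapS_tmul (z x g h : A) :
    c.invMapS z x (g ⊗ₜ[ℂ] h) = c.S g * lact (G.r (c.φ (h * z))) x := rfl

theorem invMapS_relLeft (z x : A) : G.relLeft ≤ LinearMap.ker (c.invMapS z x) :=
  G.relLeft_le_ker fun p q b => by
    rw [invMapS_tmul, invMapS_tmul, c.S_s, ract_mul, ← G.r_mul, ← lact_mul, c.φ_left]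

/-- `p ⊗ q ↦ s(γ(φ(l q))) p x` -/
def invMapT (γ : Γ) (l x : A) : A ⊗[ℂ] A →ₗ[ℂ] A :=
  LinearMap.mulRight ℂ x ∘ₗ TensorProduct.lift (G.sl ∘ₗ (act γ : B →ₗ[ℂ] B) ∘ₗ c.φ ∘ₗ
    LinearMap.mulLeft ℂ l).flip

theorem invMapT_tmul (γ : Γ) (l x p q : A) :
    c.invMapT γ l x (p ⊗ₜ[ℂ] q) = lact (G.s (act γ (c.φ (l * q)))) p * x := rfl

/-- The antipode on `Δ(l)(a ⊗ 1)`, with coefficients. -/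
theorem antipode_coeff {a : A} (ha : a ∈ G.gr 1 1) (b : B) (e : A) :
    TensorProduct.lift ((LinearMap.mul ℂ A ∘ₗ ract (G.s b)) ∘ₗ c.S.toLinearMap) (c.d1 a e) =
      ract (G.s (c.ef (lact (G.r b) e))) (c.S a) := by
  rw [← c.antipode_left ha]
  have h := SModEq.lift_eq (TensorProduct.lift (LinearMap.mul ℂ A ∘ₗ c.S.toLinearMap))
    (bal_left (c.d1_r ha b e)) (G.relLeft_le_ker fun p q b => by simp [c.S_s, ract_mul])
  rw [h]
  induction c.d1 a e with
  | zero => simp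
  | add p q hp hq => simp only [map_add, hp, hq]
  | tmul p q => simp [c.S_r]

/-- Strong left invariance -/
theorem strong_invariance {γ γ' : Γ} {l : A} (hl : l ∈ G.gr γ⁻¹ γ') {x w v : A} (z : A)
    (hw : w ∈ G.gr 1 1) (hwx : w * x = x) (hv : v ∈ G.gr 1 1) (hvx : c.S.symm x * v = c.S.symm x) :
    c.invMapS z x (c.l1 v l) = c.invMapT γ l x (c.d1 w z) := by
  have hS : ∀ y, ∀ᶠ a in G.units, c.S a * y = y := fun y => by
    filter_upwards [G.mul_units (c.S.symm y)] with a ha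
    conv_lhs => rw [← LinearEquiv.apply_symm_apply c.S y, ← c.S_mul, ha]
    exact LinearEquiv.apply_symm_apply c.S y
  -- Since S(a)S(t) = S(ta), S(a) is a left unit for given elements when a is a suitable local unit.
  -- Hence the identity may be checked after multiplication with S(a), which brings in Δ(l)(a ⊗ 1).
  obtain ⟨a, ha, ha₁, ha₂⟩ := (G.units_mem.and ((hS (c.invMapS z x (c.l1 v l))).and
    (hS (c.invMapT γ l x (c.d1 w z))))).exists
  obtain ⟨e, he, he₁⟩ := (G.units_mem.and (G.units_mulL2 (c.d1 w z))).exists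
  have hSv : c.S v * x = x := by
    conv_lhs => rw [← LinearEquiv.apply_symm_apply c.S x, ← c.S_mul, hvx]
    exact LinearEquiv.apply_symm_apply c.S x
  have hSr : ∀ b, c.S v * lact (G.r b) x = lact (G.r b) x := fun b => by
    rw [← ract_mul, ← c.S_s, ← G.s_one hv, c.S_s', ← lact_mul, hSv]
  have h1 : c.S a * c.invMapS z x (c.l1 v l) = c.invMapS z x (c.d1 a l) := by
    have e1 : ∀ t, c.S a * c.invMapS z x t = c.invMapS z x (mulR1 a t) := by
      intro t
      induction t with
      | zero => simp
      | add p q hp hq => simp only [map_add, mul_add, hp, hq]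
      | tmul p q => simp [mulR1, invMapS_tmul, c.S_mul, mul_assoc]
    have e2 : ∀ t, c.invMapS z x (mulL1 v t) = c.invMapS z x t := by
      intro t
      induction t with
      | zero => simp
      | add p q hp hq => simp only [map_add, hp, hq]
      | tmul p q => simp [mulL1, invMapS_tmul, c.S_mul, mul_assoc, hSr]
    rw [e1, ← e2 (c.d1 a l)]
    exact (SModEq.lift_eq _ (bal_left (c.mixLR ha hv l)) (c.invMapS_relLeft z x)).symm
  -- F applied to the threefold coproduct of l is Σ S(l₁) s(φ(l₃z₂)) l₂z₁x, the expression evaluated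
  -- in two ways.
  let F : A ⊗[ℂ] (A ⊗[ℂ] A) →ₗ[ℂ] A := TensorProduct.lift
    ((LinearMap.mul ℂ A ∘ₗ c.S.toLinearMap).compl₂
      (c.invMap x ∘ₗ LinearMap.mulRight ℂ (c.d1 w z)))
  have hF : ∀ g t, F (g ⊗ₜ[ℂ] t) = c.S g * c.invMap x (t * c.d1 w z) := fun g t => rfl
  -- First evaluation: left invariance applied to the product hz, r(φ(hz))x = Σ s(φ(h₂z₂)) h₁z₁x.
  have h2 : ∀ t, c.invMapS z x t = F ((c.d2 e).lTensor A t) := by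
    intro t
    induction t with
    | zero => simp
    | add p q hp hq => simp only [map_add, hp, hq]
    | tmul g h =>
      rw [LinearMap.lTensor_tmul, hF, invMapS_tmul, ← c.invMap_d1 hw hwx]
      congr 1
      exact SModEq.lift_eq _ (bal_left (c.d21_mul hw he he₁ h)) (c.invMap_relLeft x)
  have hFk : G.relT ≤ LinearMap.ker F := by
    refine G.relT_le_ker (fun p q t b => ?_) fun p q t b => ?_
    · rw [hF, hF, c.S_s, ract_mul]
      congr 1
      induction c.d1 w z with
      | zero => simp
      | add p q hp hq => simp only [map_add, mul_add, hp, hq]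
      | tmul p q => simp [invMap_tmul, ← lact_mul, G.r_s]
    · rw [hF, hF]
      congr 1
      exact LinearMap.mem_ker.1 (c.invMap_relLeft x (mul_relLeft
        (Submodule.subset_span ⟨q, t, b, rfl⟩ :
          lact (G.s b) q ⊗ₜ[ℂ] t - q ⊗ₜ[ℂ] lact (G.r b) t ∈ G.relLeft) (c.d1 w z))) |>
        fun h => by rwa [sub_mul, map_sub, sub_eq_zero] at h
  have h3 : F ((c.d2 e).lTensor A (c.d1 a l)) =
      F (TensorProduct.assoc ℂ A A A ((c.d1 a).rTensor A (c.d2 e l))) :=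
    (SModEq.lift_eq F (c.coassoc_left ha he l) hFk).symm
  obtain ⟨n, z₁, z₂, hz⟩ := exists_fin_sum (c.d1 w z)
  let κ : Fin n → A ⊗[ℂ] A →ₗ[ℂ] B := fun i => TensorProduct.lift
    ((G.rl ∘ₗ c.φ ∘ₗ LinearMap.mulRight ℂ (z₂ i)).flip.compr₂ c.ef)
  have hκ : ∀ i p q, κ i (p ⊗ₜ[ℂ] q) = c.ef (lact (G.r (c.φ (q * z₂ i))) p) := fun i p q => rfl
  -- Second evaluation, after regrouping by coassociativity: Σ S(l₁)l₂ collapses to s(ε^♭(l₁)), with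
  -- the coefficient φ(l₂z₂) carried along.
  have h4 : ∀ t, F (TensorProduct.assoc ℂ A A A ((c.d1 a).rTensor A t)) =
      ∑ i, c.S a * lact (G.s (κ i t)) (z₁ i * x) := by
    intro t
    induction t with
    | zero =>
      have h0 : ∀ y : A, lact (0 : Mult A) y = 0 := fun y => rfl
      simp only [map_zero, h0, mul_zero, Finset.sum_const_zero]
    | add p q hp hq =>
      simp only [map_add, hp, hq, ← Finset.sum_add_distrib, ← mul_add]
      rfl
    | tmul p q =>
      have e1 : F (TensorProduct.assoc ℂ A A A (c.d1 a p ⊗ₜ[ℂ] q)) =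
          ∑ i, TensorProduct.lift ((LinearMap.mul ℂ A ∘ₗ ract (G.s (c.φ (q * z₂ i)))) ∘ₗ
            c.S.toLinearMap) (c.d1 a p) * (z₁ i * x) := by
        induction c.d1 a p with
        | zero => simp
        | add p q hp hq =>
          simp only [map_add, TensorProduct.add_tmul, add_mul, hp, hq, Finset.sum_add_distrib]
        | tmul f g =>
          rw [TensorProduct.assoc_tmul, hF, hz, Finset.mul_sum, map_sum, Finset.mul_sum]
          refine Finset.sum_congr rfl fun i _ => ?_
          rw [Algebra.TensorProduct.tmul_mul_tmul, invMap_tmul]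
          simp only [TensorProduct.lift.tmul, LinearMap.comp_apply, LinearMap.mul_apply',
            LinearEquiv.coe_coe]
          rw [ract_mul, mul_assoc, lact_mul, mul_assoc]
      rw [LinearMap.rTensor_tmul, e1]
      refine Finset.sum_congr rfl fun i _ => ?_
      rw [c.antipode_coeff ha, ract_mul, hκ]
  -- As l has first degree γ⁻¹, ε^♭ = γ∘ε^♯ on the first legs of Δ(l). So the coefficient is
  -- γ(φ(r(ε^♯(l₁))l₂ e z₂)), and the counit reduces it to γ(φ(l e z₂)).
  have h5 : ∀ i, κ i (c.d2 e l) = act γ (c.φ (l * (e * z₂ i))) := by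
    intro i
    have hk : G.relLeft ≤ LinearMap.ker (κ i) := G.relLeft_le_ker fun p q b => by
      rw [hκ, hκ, G.r_s, c.ef_rs, ← G.r_mul, ← lact_mul, c.φ_left]
    obtain ⟨t, ht, hlt⟩ := c.d2_deg he hl
    have hc : TensorProduct.lift (G.rl ∘ₗ c.es) t = l * e := by
      rw [← c.counit he]
      refine (SModEq.lift_eq _ (bal_left hlt) (G.relLeft_le_ker fun p q b => ?_)).symm
      change lact (G.r (c.es (lact (G.s b) p))) q = lact (G.r (c.es p)) (lact (G.r b) q)
      rw [c.es_s, G.r_mul, G.r_r]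
    rw [SModEq.lift_eq _ (bal_left hlt) hk, ← mul_assoc, ← hc]
    have : Submodule.span ℂ (G.pureMatched γ⁻¹ γ') ≤ LinearMap.eqLocus (κ i)
        ((act γ : B →ₗ[ℂ] B) ∘ₗ c.φ ∘ₗ LinearMap.mulRight ℂ (z₂ i) ∘ₗ
          TensorProduct.lift (G.rl ∘ₗ c.es)) := by
      refine Submodule.span_le.2 ?_
      rintro _ ⟨δ, p, hp, q, hq, rfl⟩
      change κ i (p ⊗ₜ[ℂ] q) = act γ (c.φ (lact (G.r (c.es p)) q * z₂ i))
      rw [hκ, c.ef_eq (G.r_mem hp _), inv_inv, c.es_r, ← lact_mul, c.φ_left, mul_comm]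
    exact this ht
  have h6 : c.S a * c.invMapT γ l x (c.d1 w z) =
      ∑ i, c.S a * lact (G.s (κ i (c.d2 e l))) (z₁ i * x) := by
    rw [← he₁, hz, map_sum, map_sum, Finset.mul_sum]
    refine Finset.sum_congr rfl fun i _ => ?_
    rw [h5, mulL2, LinearMap.lTensor_tmul, LinearMap.mulLeft_apply, invMapT_tmul, ← lact_mul]
  rw [← ha₁, ← ha₂, h1, h2, h3, h4, h6]

end Core

end StrongInvariance

/-! ## The comultiplication of a measured Hopf algebroid -/

section FromHopf

variable {Γ B : Type*} [Group Γ] [NonUnitalCommRing B] [Module ℂ B] [IsScalarTower ℂ B B]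
  [SMulCommClass ℂ B B] [StarRing B] [StarModule ℂ B] {act : Γ →* (B ≃⋆ₐ[ℂ] B)}
  {A : Type*} [NonUnitalRing A] [Module ℂ A] [IsScalarTower ℂ A A] [SMulCommClass ℂ A A]
  [StarRing A] [StarModule ℂ A]

/-- The left and right multiplications by elements of one tensor factor of `A ⊗ A`. -/
structure Leg (G : EvAlgebra act A) where
  L : A → A ⊗[ℂ] A →ₗ[ℂ] A ⊗[ℂ] A
  R : A → A ⊗[ℂ] A →ₗ[ℂ] A ⊗[ℂ] A
  L_mul : ∀ x w w', L x (w * w') = L x w * w'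
  R_mul : ∀ x w w', R x w * w' = w * L x w'
  star_R : ∀ x w, star (R x w) = L (star x) (star w)
  L_L : ∀ x y w, L x (L y w) = L (x * y) w
  L_tmul : ∀ {γ γ'' v}, v ∈ G.gr 1 1 → ∀ w ∈ G.pureMatched γ γ'', L v w ∈ G.pureMatched γ γ''
  R_tmul : ∀ {γ γ'' v}, v ∈ G.gr 1 1 → ∀ w ∈ G.pureMatched γ γ'', R v w ∈ G.pureMatched γ γ''

namespace EvAlgebra

variable (G : EvAlgebra act A)

/-- The first factor. -/
def leg₁ : Leg G where
  L := mulL1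
  R := mulR1
  L_mul := mulL1_mul
  R_mul := mulR1_mul
  star_R := star_mulR1
  L_L x y w := by
    induction w with
    | zero => simp
    | add p q hp hq => simp only [map_add, hp, hq]
    | tmul p q => simp [mulL1]
  L_tmul := by
    rintro γ γ'' v hv _ ⟨γ', x, hx, y, hy, rfl⟩
    exact ⟨γ', v * x, by simpa using G.mul_mem hv hx, y, hy, by simp [mulL1]⟩
  R_tmul := by
    rintro γ γ'' v hv _ ⟨γ', x, hx, y, hy, rfl⟩
    exact ⟨γ', x * v, by simpa using G.mul_mem hx hv, y, hy, by simp [mulR1]⟩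

/-- The second factor. -/
def leg₂ : Leg G where
  L := mulL2
  R := mulR2
  L_mul x w w' := by
    induction w with
    | zero => simp
    | add p q hp hq => simp only [map_add, add_mul, hp, hq]
    | tmul p q =>
      induction w' with
      | zero => simp
      | add r s hr hs => simp only [map_add, mul_add, hr, hs]
      | tmul r s => simp [mulL2, mul_assoc]
  R_mul x w w' := by
    induction w with
    | zero => simp
    | add p q hp hq => simp only [map_add, add_mul, hp, hq]
    | tmul p q =>
      induction w' with
      | zero => simp
      | add r s hr hs => simp only [map_add, mul_add, hr, hs]
      | tmul r s => simp [mulL2, mulR2, mul_assoc]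
  star_R x w := by
    induction w with
    | zero => simp
    | add p q hp hq => simp only [map_add, star_add, hp, hq]
    | tmul p q => simp [mulL2, mulR2]
  L_L x y w := by
    induction w with
    | zero => simp
    | add p q hp hq => simp only [map_add, hp, hq]
    | tmul p q => simp [mulL2]
  L_tmul := by
    rintro γ γ'' v hv _ ⟨γ', x, hx, y, hy, rfl⟩
    exact ⟨γ', x, hx, v * y, by simpa using G.mul_mem hv hy, by simp [mulL2]⟩
  R_tmul := by
    rintro γ γ'' v hv _ ⟨γ', x, hx, y, hy, rfl⟩
    exact ⟨γ', x, hx, y * v, by simpa using G.mul_mem hy hv, by simp [mulR2]⟩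

end EvAlgebra

namespace Leg

variable {G : EvAlgebra act A} (ℓ : Leg G)

theorem L_mem {v : A} (hv : v ∈ G.gr 1 1) {w : A ⊗[ℂ] A} (hw : w ∈ G.matchedSpan) :
    ℓ.L v w ∈ G.matchedSpan := by
  have : G.matchedSpan ≤ G.matchedSpan.comap (ℓ.L v) := Submodule.span_le.2 (by
    rintro w ⟨γ, γ'', h⟩
    exact Submodule.subset_span ⟨γ, γ'', ℓ.L_tmul hv w h⟩)
  exact this hw

theorem R_mem {v : A} (hv : v ∈ G.gr 1 1) {w : A ⊗[ℂ] A} (hw : w ∈ G.matchedSpan) :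
    ℓ.R v w ∈ G.matchedSpan := by
  have : G.matchedSpan ≤ G.matchedSpan.comap (ℓ.R v) := Submodule.span_le.2 (by
    rintro w ⟨γ, γ'', h⟩
    exact Submodule.subset_span ⟨γ, γ'', ℓ.R_tmul hv w h⟩)
  exact this hw

end Leg

namespace EvAlgebra

variable (G : EvAlgebra act A)

theorem cls_eq_iff (m n : G.Matched) :
    G.cls m = G.cls n ↔ (m : A ⊗[ℂ] A) ≡ n [SMOD G.balSpan] := by
  rw [SModEq.sub_mem]
  exact G.balIdeal.proj_eq_iff

theorem cls_mul (m n : G.Matched) : G.cls (m * n) = G.cls m * G.cls n := rfl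

theorem unit_mul (w : A ⊗[ℂ] A) : ∀ᶠ u in G.units, (u ⊗ₜ[ℂ] u) * w = w := by
  filter_upwards [G.units_mulL1 w, G.units_mulL2 w] with u h1 h2
  conv_rhs => rw [← h1, ← h2]
  induction w with
  | zero => simp
  | add p q hp hq =>
    clear h1 h2
    have : ∀ w : A ⊗[ℂ] A, (u ⊗ₜ[ℂ] u) * w = mulL1 u (mulL2 u w) := by
      intro w
      induction w with
      | zero => simp
      | add p q hp hq => simp only [map_add, mul_add, hp, hq]
      | tmul p q => simp [mulL1, mulL2]
    exact this _
  | tmul p q => simp [mulL1, mulL2]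

theorem mul_unit (w : A ⊗[ℂ] A) : ∀ᶠ u in G.units, w * (u ⊗ₜ[ℂ] u) = w := by
  filter_upwards [G.units_mulR1 w, G.units_mulR2 w] with u h1 h2
  conv_rhs => rw [← h1, ← h2]
  have : ∀ w : A ⊗[ℂ] A, w * (u ⊗ₜ[ℂ] u) = mulR1 u (mulR2 u w) := by
    intro w
    induction w with
    | zero => simp
    | add p q hp hq => simp only [map_add, add_mul, hp, hq]
    | tmul p q => simp [mulR1, mulR2]
  exact this _

theorem unit_mem {u : A} (hu : u ∈ G.gr 1 1) : u ⊗ₜ[ℂ] u ∈ G.pureMatched 1 1 :=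
  ⟨1, u, hu, u, hu, rfl⟩

theorem unit_mem' {u : A} (hu : u ∈ G.gr 1 1) : u ⊗ₜ[ℂ] u ∈ G.matchedSpan :=
  Submodule.subset_span ⟨1, 1, G.unit_mem hu⟩

variable {G}

/-- For a suitable local unit u, the matched element u ⊗ u acts as a right unit on both w and w'.
Representatives of multipliers are compared in this way. -/
theorem cancel_right {w w' : A ⊗[ℂ] A} (h : ∀ m ∈ G.matchedSpan, w * m ≡ w' * m [SMOD G.balSpan]) :
    w ≡ w' [SMOD G.balSpan] := by
  obtain ⟨u, hu, h1, h2⟩ := (G.units_mem.and ((G.mul_unit w).and (G.mul_unit w'))).exists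
  have := h _ (G.unit_mem' hu)
  rwa [h1, h2] at this

theorem cancel_left {w w' : A ⊗[ℂ] A} (h : ∀ m ∈ G.matchedSpan, m * w ≡ m * w' [SMOD G.balSpan]) :
    w ≡ w' [SMOD G.balSpan] := by
  obtain ⟨u, hu, h1, h2⟩ := (G.units_mem.and ((G.unit_mul w).and (G.unit_mul w'))).exists
  have := h _ (G.unit_mem' hu)
  rwa [h1, h2] at this

/-- `w` represents `T (v ⊗ 1)` or `T (1 ⊗ v)`. -/
def EqR (ℓ : Leg G) (T : Mult G.FP) (v : A) (w : G.Matched) : Prop :=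
  ∀ m m' : G.Matched, (m' : A ⊗[ℂ] A) = ℓ.L v m → lact T (G.cls m') = G.cls w * G.cls m

/-- `w` represents `(v ⊗ 1) T` or `(1 ⊗ v) T`. -/
def EqL (ℓ : Leg G) (T : Mult G.FP) (v : A) (w : G.Matched) : Prop :=
  ∀ m m' : G.Matched, (m' : A ⊗[ℂ] A) = ℓ.R v m → ract T (G.cls m') = G.cls m * G.cls w

variable {ℓ ℓ' : Leg G} {T T' : Mult G.FP} {v u : A} {w w' : G.Matched}

theorem EqR.unique (hv : v ∈ G.gr 1 1) (h : EqR ℓ T v w) (h' : EqR ℓ T v w') :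
    (w : A ⊗[ℂ] A) ≡ w' [SMOD G.balSpan] :=
  cancel_right fun m hm => (G.cls_eq_iff (w * ⟨m, hm⟩) (w' * ⟨m, hm⟩)).1 (by
    rw [cls_mul, cls_mul, ← h ⟨m, hm⟩ ⟨_, ℓ.L_mem hv hm⟩ rfl, h' ⟨m, hm⟩ ⟨_, ℓ.L_mem hv hm⟩ rfl])

theorem cls_star (m : G.Matched) : G.cls (star m) = star (G.cls m) := rfl

theorem EqR.star_eqL (h : EqR ℓ T v w) : EqL ℓ (star T) (star v) (star w) := by
  intro m m' hm
  have := h (star m) (star m') (by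
    change star (m' : A ⊗[ℂ] A) = _
    rw [hm, ℓ.star_R, star_star]; rfl)
  rw [← star_star (G.cls m'), ← star_lact, ← cls_star, this, star_mul, cls_star, cls_star, star_star]

theorem EqR.add (h : EqR ℓ T v w) (h' : EqR ℓ T' v w') : EqR ℓ (T + T') v (w + w') := by
  intro m m' hm
  have : G.cls (w + w') = G.cls w + G.cls w' := map_add G.balIdeal.proj w w'
  rw [this, add_mul, ← h m m' hm, ← h' m m' hm]
  rfl

theorem EqR.smul (z : ℂ) (h : EqR ℓ T v w) : EqR ℓ (z • T) v (z • w) := by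
  intro m m' hm
  have : G.cls (z • w) = z • G.cls w := map_smul G.balIdeal.proj z w
  rw [this, smul_mul_assoc, ← h m m' hm]
  rfl

theorem EqR.mul (h : EqR ℓ T v w) (h' : EqR ℓ' T' u w')
    (hw : ℓ'.L u w = w) : EqR ℓ (T' * T) v (w' * w) := by
  intro m m' hm
  rw [lact_mult_mul, h m m' hm, ← cls_mul, h' (w * m) (w * m) (by
    change (w : A ⊗[ℂ] A) * m = ℓ'.L u (w * m)
    rw [ℓ'.L_mul, hw]), cls_mul, cls_mul, mul_assoc]

theorem EqR.comp {n : A} (hn : n ∈ G.gr 1 1) (h : EqR ℓ T u w)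
    (hl : ∀ m, ℓ'.L v m = ℓ.L u (ℓ'.L n m)) : EqR ℓ' T v ⟨ℓ'.R n w, ℓ'.R_mem hn w.2⟩ := by
  intro m m' hm
  rw [h ⟨ℓ'.L n m, ℓ'.L_mem hn m.2⟩ m' (by rw [hm, hl]), ← cls_mul, ← cls_mul, G.cls_eq_iff]
  change (w : A ⊗[ℂ] A) * ℓ'.L n m ≡ ℓ'.R n w * m [SMOD G.balSpan]
  rw [ℓ'.R_mul]

/-- Both sides represent T(v ⊗ u). -/
theorem EqR.mix (hv : v ∈ G.gr 1 1) (hu : u ∈ G.gr 1 1) (hl : ∀ m, ℓ.L v (ℓ'.L u m) = ℓ'.L u (ℓ.L v m))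
    (h : EqR ℓ T v w) (h' : EqR ℓ' T u w') : ℓ'.R u w ≡ ℓ.R v w' [SMOD G.balSpan] := by
  refine cancel_right fun m hm => ?_
  rw [ℓ.R_mul, ℓ'.R_mul]
  refine (G.cls_eq_iff (w * ⟨ℓ'.L u m, ℓ'.L_mem hu hm⟩) (w' * ⟨ℓ.L v m, ℓ.L_mem hv hm⟩)).1 ?_
  rw [cls_mul, cls_mul, ← h ⟨_, ℓ'.L_mem hu hm⟩ ⟨_, ℓ.L_mem hv (ℓ'.L_mem hu hm)⟩ rfl,
    ← h' ⟨_, ℓ.L_mem hv hm⟩ ⟨_, ℓ.L_mem hv (ℓ'.L_mem hu hm)⟩ (hl m)]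

/-- This is the compatibility (mT)m' = m(Tm') of the two actions of a multiplier, tested on matched
m and m'. -/
theorem EqR.mixL (hv : v ∈ G.gr 1 1) (hu : u ∈ G.gr 1 1) (h : EqR ℓ T v w)
    (h' : EqL ℓ' T u w') : ℓ'.L u w ≡ ℓ.R v w' [SMOD G.balSpan] := by
  refine cancel_left fun m hm => cancel_right fun m' hm' => ?_
  rw [mul_assoc, mul_assoc, ← ℓ'.L_mul, ← ℓ'.R_mul, ℓ.R_mul, ← mul_assoc m]
  refine (G.cls_eq_iff (⟨ℓ'.R u m, ℓ'.R_mem hu hm⟩ * (w * ⟨m', hm'⟩)) (⟨m, hm⟩ * w' * ⟨ℓ.L v m', ℓ.L_mem hv hm'⟩)).1 ?_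
  rw [cls_mul, cls_mul, cls_mul, cls_mul, ← h ⟨m', hm'⟩ ⟨_, ℓ.L_mem hv hm'⟩ rfl,
    ← h' ⟨m, hm⟩ ⟨_, ℓ'.R_mem hu hm⟩ rfl, ract_mul]

/-- A linear choice of representatives of `Δ(y)(v ⊗ 1)` or `Δ(y)(1 ⊗ v)`. -/
theorem exists_linear_rep (Δ : A →⋆ₙₐ[ℂ] Mult G.FP) (hv : v ∈ G.gr 1 1)
    (h : ∀ y, ∃ w, EqR ℓ (Δ y) v w) : ∃ d : A →ₗ[ℂ] G.Matched, ∀ y, EqR ℓ (Δ y) v (d y) := by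
  choose f hf using h
  -- Representatives chosen one at a time are linear in y only modulo balancing. Their classes are
  -- linear, and a linear section of the quotient map lifts them.
  obtain ⟨σ, hσ⟩ := G.balIdeal.proj.exists_rightInverse_of_surjective
    (LinearMap.range_eq_top.2 G.balIdeal.proj_surjective)
  have hs : ∀ x, G.cls (σ x) = x := fun x => LinearMap.congr_fun hσ x
  refine ⟨σ ∘ₗ
    { toFun := fun y => G.cls (f y)
      map_add' := fun x y => ?_
      map_smul' := fun z x => ?_ }, fun y m m' hm => ?_⟩
  · have := ((hf x).add (hf y)).unique hv (by rw [← map_add]; exact hf (x + y))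
    exact ((G.cls_eq_iff _ _).2 this).symm.trans (map_add G.balIdeal.proj _ _)
  · have := ((hf x).smul z).unique hv (by rw [← map_smul]; exact hf (z • x))
    exact ((G.cls_eq_iff _ _).2 this).symm.trans (map_smul G.balIdeal.proj _ _)
  · rw [LinearMap.comp_apply, hs]
    exact hf y m m' hm

end EvAlgebra

end FromHopf

/-! ### Linear representatives of the comultiplication, and the co-opposite algebra. -/

section Comultiplication

variable {Γ B : Type*} [Group Γ] [NonUnitalCommRing B] [Module ℂ B] [IsScalarTower ℂ B B]
  [SMulCommClass ℂ B B] [StarRing B] [StarModule ℂ B] {act : Γ →* (B ≃⋆ₐ[ℂ] B)}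
  {A : Type*} [NonUnitalRing A] [Module ℂ A] [IsScalarTower ℂ A A] [SMulCommClass ℂ A A]
  [StarRing A] [StarModule ℂ A] {G : EvAlgebra act A}

namespace EvAlgebra

/-- Representatives for the products of `Δ(y)` with elements of degree `(1, 1)`. -/
structure IsComulRep (Δ : A →⋆ₙₐ[ℂ] Mult G.FP) (ℓ : Leg G) (d : A → A →ₗ[ℂ] A ⊗[ℂ] A) : Prop where
  mem : ∀ v y, d v y ∈ G.matchedSpan
  eqR : ∀ {v}, v ∈ G.gr 1 1 → ∀ y, EqR ℓ (Δ y) v ⟨d v y, mem v y⟩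

open Classical in
theorem exists_isComulRep {Δ : A →⋆ₙₐ[ℂ] Mult G.FP} {ℓ : Leg G}
    (h : ∀ {v}, v ∈ G.gr 1 1 → ∀ y, ∃ w, EqR ℓ (Δ y) v w) :
    ∃ d, IsComulRep Δ ℓ d := by
  have h' : ∀ v, ∃ d : A →ₗ[ℂ] G.Matched, v ∈ G.gr 1 1 → ∀ y, EqR ℓ (Δ y) v (d y) := by
    intro v
    by_cases hv : v ∈ G.gr 1 1
    · obtain ⟨d, hd⟩ := exists_linear_rep Δ hv (h hv)
      exact ⟨d, fun _ => hd⟩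
    -- Outside degree (e, e) the representative is the default 0, and nothing is claimed about it.
    · exact ⟨0, fun h => absurd h hv⟩
  choose d hd using h'
  exact ⟨fun v => (NonUnitalSubalgebraClass.subtype G.Matched : G.Matched →ₗ[ℂ] A ⊗[ℂ] A) ∘ₗ d v,
    fun v y => (d v y).2, fun hv y => hd _ hv y⟩

namespace IsComulRep

variable {Δ : A →⋆ₙₐ[ℂ] Mult G.FP} {ℓ ℓ' : Leg G} {d d' : A → A →ₗ[ℂ] A ⊗[ℂ] A}

theorem eq (h : IsComulRep Δ ℓ d) {v y : A} (hv : v ∈ G.gr 1 1) {z : G.Matched}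
    (hz : EqR ℓ (Δ y) v z) : (z : A ⊗[ℂ] A) ≡ d v y [SMOD G.balSpan] :=
  hz.unique hv (h.eqR hv y)

theorem eqL (h : IsComulRep Δ ℓ d) {v : A} (hv : v ∈ G.gr 1 1) (y : A) :
    EqL ℓ (Δ y) v ⟨starT (d (star v)) y, G.star_mem_matchedSpan (h.mem _ _)⟩ := by
  have := (h.eqR (G.one_mem_star hv) (star y)).star_eqL
  rw [← map_star Δ, star_star, star_star] at this
  exact this

theorem mul (h : IsComulRep Δ ℓ d) (h' : IsComulRep Δ ℓ' d') {v u : A} (hv : v ∈ G.gr 1 1)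
    (hu : u ∈ G.gr 1 1) {y : A} (hy : ℓ'.L u (d v y) = d v y) (x : A) :
    d v (x * y) ≡ d' u x * d v y [SMOD G.balSpan] :=
  (h.eq hv (by
    rw [map_mul]
    exact (h.eqR hv y).mul (h'.eqR hu x) hy)).symm

theorem mix (h : IsComulRep Δ ℓ d) (h' : IsComulRep Δ ℓ' d')
    (hl : ∀ v u m, ℓ.L v (ℓ'.L u m) = ℓ'.L u (ℓ.L v m)) {v u : A} (hv : v ∈ G.gr 1 1)
    (hu : u ∈ G.gr 1 1) (y : A) : ℓ'.R u (d v y) ≡ ℓ.R v (d' u y) [SMOD G.balSpan] :=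
  (h.eqR hv y).mix hv hu (hl v u) (h'.eqR hu y)

theorem mixL (h : IsComulRep Δ ℓ d) {v u : A} (hv : v ∈ G.gr 1 1) (hu : u ∈ G.gr 1 1) (y : A) :
    ℓ.L u (d v y) ≡ ℓ.R v (starT (d (star u)) y) [SMOD G.balSpan] :=
  (h.eqR hv y).mixL hv hu (h.eqL hu y)

theorem change (h : IsComulRep Δ ℓ d) {v u : A} (hv : v ∈ G.gr 1 1) (hu : u ∈ G.gr 1 1)
    (huv : u * v = v) (y : A) : ℓ.R v (d u y) ≡ d v y [SMOD G.balSpan] :=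
  h.eq hv ((h.eqR hu y).comp (ℓ' := ℓ) hv fun m => by rw [ℓ.L_L, huv])

theorem change_star (h : IsComulRep Δ ℓ d) {v u : A} (hv : v ∈ G.gr 1 1) (hu : u ∈ G.gr 1 1)
    (huv : v * u = v) (y : A) : ℓ.L v (starT (d (star u)) y) ≡ starT (d (star v)) y
      [SMOD G.balSpan] := by
  have h1 := h.change (G.one_mem_star hv) (G.one_mem_star hu) (by rw [← star_mul, huv]) (star y)
  have h2 : star (ℓ.R (star v) (d (star u) (star y))) - star (d (star v) (star y)) ∈ G.balSpan := by
    rw [← star_sub]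
    exact G.star_mem_balSpan (SModEq.sub_mem.1 h1)
  rw [ℓ.star_R, star_star] at h2
  exact SModEq.sub_mem.2 h2

/-- The degree axiom is tested on vu ⊗ u or u ⊗ vu, which has degree (e, e), so the product has the
degree of y. -/
theorem deg (hΔ : G.IsComultiplication Δ) (h : IsComulRep Δ ℓ d) {v : A} (hv : v ∈ G.gr 1 1) {γ γ'' : Γ} {y : A}
    (hy : y ∈ G.gr γ γ'') :
    ∃ t ∈ Submodule.span ℂ (G.pureMatched γ γ''), d v y ≡ t [SMOD G.balSpan] := by
  obtain ⟨u, hu, h1⟩ := (G.units_mem.and (G.mul_unit (d v y))).exists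
  have h2 := ℓ.L_tmul hv _ (G.unit_mem hu)
  obtain ⟨n, hn, hn'⟩ := (hΔ.degree hy ⟨ℓ.L v (u ⊗ₜ u), ℓ.L_mem hv (G.unit_mem' hu)⟩
    (Submodule.subset_span h2)).1
  rw [mul_one, mul_one] at hn
  refine ⟨n, hn, ?_⟩
  rw [h.eqR hv y ⟨u ⊗ₜ u, G.unit_mem' hu⟩ _ rfl, ← cls_mul, G.cls_eq_iff] at hn'
  rw [← h1]
  exact hn'

theorem map_r (hΔ : G.IsComultiplication Δ) (h : IsComulRep Δ ℓ d) {v : A} (hv : v ∈ G.gr 1 1) (b : B) (y : A) :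
    d v (lact (G.r b) y) ≡ (lact (G.r b)).rTensor A (d v y) [SMOD G.balSpan] := by
  have hm : (lact (G.r b)).rTensor A (d v y) ∈ G.matchedSpan := by
    have : G.matchedSpan ≤ G.matchedSpan.comap ((lact (G.r b)).rTensor A) := by
      refine Submodule.span_le.2 ?_
      rintro _ ⟨γ, γ'', γ', x, hx, y, hy, rfl⟩
      exact Submodule.subset_span ⟨γ, γ'', γ', _, G.r_mem hx b, y, hy, rfl⟩
    exact this (h.mem v y)
  refine (h.eq hv (z := ⟨_, hm⟩) fun m m' e => ?_).symm
  rw [← cls_mul]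
  refine hΔ.map_r b y m' _ _ (h.eqR hv y m m' e) ?_
  change (lact (G.r b)).rTensor A (d v y) * (m : A ⊗[ℂ] A) = (lact (G.r b)).rTensor A (d v y * m)
  clear hm
  induction d v y with
  | zero => simp
  | add p q hp hq => simp only [map_add, add_mul, hp, hq]
  | tmul p q =>
    induction (m : A ⊗[ℂ] A) with
    | zero => simp
    | add r s hr hs => simp only [map_add, mul_add, hr, hs]
    | tmul r s => simp [lact_mul]

theorem map_s (hΔ : G.IsComultiplication Δ) (h : IsComulRep Δ ℓ d) {v : A} (hv : v ∈ G.gr 1 1) (b : B) (y : A) :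
    d v (lact (G.s b) y) ≡ (lact (G.s b)).lTensor A (d v y) [SMOD G.balSpan] := by
  have hm : (lact (G.s b)).lTensor A (d v y) ∈ G.matchedSpan := by
    have : G.matchedSpan ≤ G.matchedSpan.comap ((lact (G.s b)).lTensor A) := by
      refine Submodule.span_le.2 ?_
      rintro _ ⟨γ, γ'', γ', x, hx, y, hy, rfl⟩
      exact Submodule.subset_span ⟨γ, γ'', γ', x, hx, _, G.s_mem hy b, rfl⟩
    exact this (h.mem v y)
  refine (h.eq hv (z := ⟨_, hm⟩) fun m m' e => ?_).symm
  rw [← cls_mul]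
  refine hΔ.map_s b y m' _ _ (h.eqR hv y m m' e) ?_
  change (lact (G.s b)).lTensor A (d v y) * (m : A ⊗[ℂ] A) = (lact (G.s b)).lTensor A (d v y * m)
  clear hm
  induction d v y with
  | zero => simp
  | add p q hp hq => simp only [map_add, add_mul, hp, hq]
  | tmul p q =>
    induction (m : A ⊗[ℂ] A) with
    | zero => simp
    | add r s hr hs => simp only [map_add, mul_add, hr, hs]
    | tmul r s => simp [lact_mul]

end IsComulRep

theorem mulL1_mulL2 (v u : A) (m : A ⊗[ℂ] A) : mulL1 v (mulL2 u m) = mulL2 u (mulL1 v m) := by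
  induction m with
  | zero => simp
  | add p q hp hq => simp only [map_add, hp, hq]
  | tmul p q => simp [mulL1, mulL2]

section Terms

variable {Δ : A →⋆ₙₐ[ℂ] Mult G.FP} {d₁ d₂ : A → A →ₗ[ℂ] A ⊗[ℂ] A}

theorem IsComulRep.isT1 (h : IsComulRep Δ G.leg₂ d₂) {v : A} (hv : v ∈ G.gr 1 1) (y : A) :
    G.IsT1 Δ y v (d₂ v y) := by
  obtain ⟨u, hu, huv⟩ := (G.units_mem.and (G.units_mul v)).exists
  exact ⟨u, hu, huv, _, h.eqR hu y,
    G.balSpan_le_relLeft (SModEq.sub_mem.1 (h.change hv hu huv y).symm)⟩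

theorem IsComulRep.isT4 (h : IsComulRep Δ G.leg₁ d₁) {v : A} (hv : v ∈ G.gr 1 1) (y : A) :
    G.IsT4 Δ v y (d₁ v y) := by
  obtain ⟨u, hu, huv⟩ := (G.units_mem.and (G.units_mul v)).exists
  exact ⟨u, hu, huv, _, h.eqR hu y,
    G.balSpan_le_relLeft (SModEq.sub_mem.1 (h.change hv hu huv y).symm)⟩

theorem IsComulRep.isT2 (h : IsComulRep Δ G.leg₁ d₁) {v : A} (hv : v ∈ G.gr 1 1) (y : A) :
    G.IsT2 Δ v y (starT (d₁ (star v)) y) := by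
  obtain ⟨u, hu, huv⟩ := (G.units_mem.and (G.mul_units v)).exists
  exact ⟨u, hu, huv, _, h.eqL hu y,
    G.balSpan_le_relRight (SModEq.sub_mem.1 (h.change_star hv hu huv y).symm)⟩

theorem IsComulRep.coassoc (hΔ : G.IsComultiplication Δ) (h₁ : IsComulRep Δ G.leg₁ d₁)
    (h₂ : IsComulRep Δ G.leg₂ d₂) {a c : A} (ha : a ∈ G.gr 1 1) (hc : c ∈ G.gr 1 1) (y : A) :
    TensorProduct.assoc ℂ A A A ((starT (d₁ (star a))).rTensor A (d₂ c y)) ≡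
      (d₂ c).lTensor A (starT (d₁ (star a)) y) [SMOD G.relTriple] := by
  obtain ⟨k, p, q, hpq⟩ := exists_fin_sum (d₂ c y)
  obtain ⟨l, p', q', hpq'⟩ := exists_fin_sum (starT (d₁ (star a)) y)
  have := hΔ.coassoc a y c k l p q p' q' _ _ (hpq ▸ h₂.isT1 hc y) (hpq' ▸ h₁.isT2 ha y)
    (fun i => h₁.isT2 ha (p i)) (fun j => h₂.isT1 hc (q' j))
  rw [SModEq.sub_mem, hpq, hpq']
  simpa only [map_sum, LinearMap.rTensor_tmul, LinearMap.lTensor_tmul] using this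

end Terms

/-! ### The co-opposite -/

/-- The algebra with `r` and `s` and the two gradings exchanged. -/
def co (G : EvAlgebra act A) : EvAlgebra act A where
  gr γ γ' := G.gr γ' γ
  indep := G.indep.comp (f := Prod.swap) Prod.swap_injective
  span_top := by
    rw [← G.span_top, ← (Equiv.prodComm Γ Γ).iSup_comp]
    rfl
  mul_mem hx hy := G.mul_mem hx hy
  star_mem hx := G.star_mem hx
  exists_left_unit := G.exists_left_unit
  exists_right_unit := G.exists_right_unit
  r := G.s
  s := G.r
  r_s_comm b c := (G.r_s_comm c b).symm
  r_mem hx b := G.s_mem hx b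
  s_mem hx b := G.r_mem hx b
  r_twist hx b := G.s_twist hx b
  s_twist hx b := G.r_twist hx b
  exists_base_unit F := by
    obtain ⟨b, hb⟩ := G.exists_base_unit F
    exact ⟨b, fun x hx => (hb x hx).symm⟩

/-- The flip. -/
abbrev τ : A ⊗[ℂ] A →ₗ[ℂ] A ⊗[ℂ] A := (TensorProduct.comm ℂ A A).toLinearMap

theorem τ_τ (w : A ⊗[ℂ] A) : τ (τ w) = w := by
  induction w with
  | zero => simp
  | add p q hp hq => simp only [map_add, hp, hq]
  | tmul p q => simp

theorem τ_mul (w w' : A ⊗[ℂ] A) : τ (w * w') = τ w * τ w' := by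
  induction w with
  | zero => simp
  | add p q hp hq => simp only [map_add, add_mul, hp, hq]
  | tmul p q =>
    induction w' with
    | zero => simp
    | add r s hr hs => simp only [map_add, mul_add, hr, hs]
    | tmul r s => simp

theorem τ_star (w : A ⊗[ℂ] A) : star (τ w) = τ (star w) := by
  induction w with
  | zero => simp
  | add p q hp hq => simp only [map_add, star_add, hp, hq]
  | tmul p q => simp

theorem τ_lTensor (f : A →ₗ[ℂ] A) (w : A ⊗[ℂ] A) : τ (f.lTensor A w) = f.rTensor A (τ w) := by
  induction w with
  | zero => simp
  | add p q hp hq => simp only [map_add, hp, hq]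
  | tmul p q => simp

theorem τ_rTensor (f : A →ₗ[ℂ] A) (w : A ⊗[ℂ] A) : τ (f.rTensor A w) = f.lTensor A (τ w) := by
  induction w with
  | zero => simp
  | add p q hp hq => simp only [map_add, hp, hq]
  | tmul p q => simp

theorem τ_balSpan : G.balSpan ≤ G.co.balSpan.comap τ :=
  G.balSpan_le fun γ γ' γ'' x hx y hy b => by
    rw [← neg_mem_iff]
    exact Submodule.subset_span ⟨γ'', γ', γ, y, hy, x, hx, b, by simp [co]⟩

theorem τ_smod {w w' : A ⊗[ℂ] A} (h : w ≡ w' [SMOD G.balSpan]) : τ w ≡ τ w' [SMOD G.co.balSpan] :=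
  SModEq.mapTo τ h τ_balSpan

theorem τ_pureMatched {γ γ'' : Γ} {w : A ⊗[ℂ] A} (hw : w ∈ G.pureMatched γ γ'') :
    τ w ∈ G.co.pureMatched γ'' γ := by
  obtain ⟨γ', x, hx, y, hy, rfl⟩ := hw
  exact ⟨γ', y, hy, x, hx, rfl⟩

theorem τ_span {γ γ'' : Γ} {w : A ⊗[ℂ] A} (hw : w ∈ Submodule.span ℂ (G.pureMatched γ γ'')) :
    τ w ∈ Submodule.span ℂ (G.co.pureMatched γ'' γ) := by
  have : Submodule.span ℂ (G.pureMatched γ γ'') ≤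
      (Submodule.span ℂ (G.co.pureMatched γ'' γ)).comap τ :=
    Submodule.span_le.2 fun w hw => Submodule.subset_span (τ_pureMatched hw)
  exact this hw

theorem τ_matched {w : A ⊗[ℂ] A} (hw : w ∈ G.matchedSpan) : τ w ∈ G.co.matchedSpan := by
  have : G.matchedSpan ≤ G.co.matchedSpan.comap τ := Submodule.span_le.2 (by
    rintro w ⟨γ, γ'', h⟩
    exact Submodule.subset_span ⟨γ'', γ, τ_pureMatched h⟩)
  exact this hw

/-- The reversal of three factors. -/
def τ₃ : A ⊗[ℂ] (A ⊗[ℂ] A) →ₗ[ℂ] A ⊗[ℂ] (A ⊗[ℂ] A) :=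
  (TensorProduct.assoc ℂ A A A).toLinearMap ∘ₗ τ.rTensor A ∘ₗ
    (TensorProduct.comm ℂ A (A ⊗[ℂ] A)).toLinearMap

theorem τ₃_tmul (x y z : A) : τ₃ (x ⊗ₜ[ℂ] (y ⊗ₜ[ℂ] z)) = z ⊗ₜ[ℂ] (y ⊗ₜ[ℂ] x) := by
  simp [τ₃]

/-- The involution exchanges left and right multiplications and the reversal exchanges the two ends.
Hence the relation between the first two factors and that between the last two change places, as
needed for the co-opposite. -/
theorem star_relTriple {w : A ⊗[ℂ] (A ⊗[ℂ] A)} (hw : w ∈ G.relTriple) :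
    τ₃ (star w) ∈ G.co.relTriple := by
  induction hw using Submodule.span_induction with
  | zero => simp
  | add x y _ _ hx hy => rw [star_add, map_add]; exact add_mem hx hy
  | smul c x _ hx => rw [star_smul, map_smul]; exact Submodule.smul_mem _ _ hx
  | mem m hm =>
    rw [← neg_mem_iff]
    rcases hm with ⟨x, y, z, b, rfl⟩ | ⟨x, y, z, b, rfl⟩
    · refine Submodule.subset_span (.inr ⟨star z, star y, star x, star b, ?_⟩)
      simp [τ₃_tmul, star_ract, co, map_star]
    · refine Submodule.subset_span (.inl ⟨star z, star y, star x, star b, ?_⟩)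
      simp [τ₃_tmul, star_lact, co, map_star]

end EvAlgebra

end Comultiplication

/-! ### The two instances of `Core` defined by a measured Hopf algebroid. -/

section Cores

variable {Γ B : Type*} [Group Γ] [NonUnitalCommRing B] [Module ℂ B] [IsScalarTower ℂ B B]
  [SMulCommClass ℂ B B] [StarRing B] [StarModule ℂ B] {act : Γ →* (B ≃⋆ₐ[ℂ] B)}
  {A : Type*} [NonUnitalRing A] [Module ℂ A] [IsScalarTower ℂ A A] [SMulCommClass ℂ A A]
  [StarRing A] [StarModule ℂ A] {G : EvAlgebra act A}

namespace MeasuredHopf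

open EvAlgebra

variable (H : MeasuredHopf G)

theorem exists_rep₁ : ∃ d, IsComulRep H.Δ G.leg₁ d :=
  exists_isComulRep fun hv y => ((H.comul.mem_tildeM y 1).1 _ hv).1

theorem exists_rep₂ : ∃ d, IsComulRep H.Δ G.leg₂ d :=
  exists_isComulRep fun hv y => ((H.comul.mem_tildeM y 1).2 _ hv).1

/-- Representatives of `Δ(y)(v ⊗ 1)`. -/
def d₁ : A → A →ₗ[ℂ] A ⊗[ℂ] A := H.exists_rep₁.choose

/-- Representatives of `Δ(y)(1 ⊗ v)`. -/
def d₂ : A → A →ₗ[ℂ] A ⊗[ℂ] A := H.exists_rep₂.choose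

theorem rep₁ : IsComulRep H.Δ G.leg₁ H.d₁ := H.exists_rep₁.choose_spec

theorem rep₂ : IsComulRep H.Δ G.leg₂ H.d₂ := H.exists_rep₂.choose_spec

theorem mix {v u : A} (hv : v ∈ G.gr 1 1) (hu : u ∈ G.gr 1 1) (y : A) :
    mulR2 u (H.d₁ v y) ≡ mulR1 v (H.d₂ u y) [SMOD G.balSpan] :=
  H.rep₁.mix H.rep₂ mulL1_mulL2 hv hu y

theorem mix_star {v u : A} (hv : v ∈ G.gr 1 1) (hu : u ∈ G.gr 1 1) (y : A) :
    mulL2 u (starT (H.d₁ (star v)) y) ≡ mulL1 v (starT (H.d₂ (star u)) y) [SMOD G.balSpan] := by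
  have h1 := H.mix (G.one_mem_star hv) (G.one_mem_star hu) (star y)
  have h2 := G.star_mem_balSpan (SModEq.sub_mem.1 h1)
  have h3 : ∀ w, star (mulR2 (star u) w) = mulL2 u (star w) := fun w => by
    have := G.leg₂.star_R (star u) w
    rwa [star_star] at this
  rw [star_sub, star_mulR1, h3, star_star] at h2
  exact SModEq.sub_mem.2 h2

/-- `ε^♯` -/
def es : A →ₗ[ℂ] B where
  toFun x := sharp (H.ε x)
  map_add' x y := by
    rw [map_add]
    exact Finsupp.sum_add_index' (fun _ => rfl) fun _ _ _ => rfl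
  map_smul' z x := by
    rw [map_smul]
    exact (Finsupp.sum_smul_index' fun _ => rfl).trans Finsupp.smul_sum.symm

/-- `ε^♭` -/
def ef : A →ₗ[ℂ] B where
  toFun x := flat act (H.ε x)
  map_add' x y := by
    rw [map_add]
    exact Finsupp.sum_add_index' (fun _ => map_zero _) fun _ _ _ => map_add _ _ _
  map_smul' z x := by
    rw [map_smul]
    refine (Finsupp.sum_smul_index' fun _ => map_zero _).trans ?_
    simp only [map_smul]
    exact Finsupp.smul_sum.symm

theorem es_r (b : B) (x : A) : H.es (lact (G.r b) x) = b * H.es x := by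
  have : H.ε (lact (G.r b) x) = (H.ε x).mapRange (b * ·) (mul_zero b) := by
    ext δ
    rw [H.counit.map_r, Finsupp.mapRange_apply]
  change sharp (H.ε (lact (G.r b) x)) = _
  rw [this]
  exact (Finsupp.sum_mapRange_index fun _ => rfl).trans (Finsupp.mul_sum _ _).symm

theorem es_s (b : B) (x : A) : H.es (lact (G.s b) x) = b * H.es x := by
  have : H.ε (lact (G.s b) x) = (H.ε x).mapRange (b * ·) (mul_zero b) := by
    ext δ
    rw [H.counit.map_s, Finsupp.mapRange_apply]
  change sharp (H.ε (lact (G.s b) x)) = _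
  rw [this]
  exact (Finsupp.sum_mapRange_index fun _ => rfl).trans (Finsupp.mul_sum _ _).symm

theorem ef_eq {γ γ' : Γ} {x : A} (hx : x ∈ G.gr γ γ') : H.ef x = act γ⁻¹ (H.es x) := by
  have : H.ε x = Finsupp.single γ (H.ε x γ) := by
    ext δ
    by_cases h : H.ε x δ = 0
    · by_cases h' : γ = δ
      · rw [h', Finsupp.single_eq_same]
      · rw [h, Finsupp.single_eq_of_ne' h']
    · obtain ⟨rfl, _⟩ := H.counit.degree hx δ h
      rw [Finsupp.single_eq_same]
  change flat act (H.ε x) = act γ⁻¹ (sharp (H.ε x))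
  rw [this]
  exact (Finsupp.sum_single_index (h := fun γ b => act γ⁻¹ b) (map_zero (act γ⁻¹))).trans
    (congrArg _ (Finsupp.sum_single_index (h := fun _ b => b) rfl).symm)

/-- The counit vanishes unless both degrees agree, so either one may be used for the twist. The
second is the first degree of the co-opposite. -/
theorem ef_eq' {γ γ' : Γ} {x : A} (hx : x ∈ G.gr γ γ') : H.ef x = act γ'⁻¹ (H.es x) := by
  rw [H.ef_eq hx]
  by_cases h : γ = γ'
  · rw [h]
  · have : H.ε x = 0 := by
      ext δ
      by_contra h'
      obtain ⟨h1, h2⟩ := H.counit.degree hx δ h'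
      exact h (h1 ▸ h2)
    have : H.es x = 0 := by
      change sharp (H.ε x) = 0
      rw [this]; rfl
    rw [this, map_zero, map_zero]

theorem counit₂ {v : A} (hv : v ∈ G.gr 1 1) (y : A) :
    TensorProduct.lift (G.rl ∘ₗ H.es) (H.d₂ v y) = y * v := by
  obtain ⟨k, p, q, h⟩ := exists_fin_sum (H.d₂ v y)
  rw [← H.counit.counit_left y v k p q (h ▸ H.rep₂.isT1 hv y), h, map_sum]
  rfl

/-- The counit axiom gives Σ u y₁ s(ε^♭(y₂)) = uy for the representatives of (u ⊗ 1)Δ(y).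
Commutation of the two-sided products transfers it to Δ(y)(v ⊗ 1), once the right multiplications
are written as left ones. -/
theorem counit₁ {v : A} (hv : v ∈ G.gr 1 1) (y : A) :
    TensorProduct.lift (G.sl ∘ₗ H.es).flip (H.d₁ v y) = y * v := by
  set F := TensorProduct.lift (G.sl ∘ₗ H.es).flip with hF
  have hFt : ∀ p q, F (p ⊗ₜ q) = lact (G.s (H.es q)) p := fun p q => rfl
  have h1 : ∀ u ∈ G.gr 1 1, F (starT (H.d₁ (star u)) y) = u * y := by
    intro u hu
    obtain ⟨k, p, q, h⟩ := exists_fin_sum (starT (H.d₁ (star u)) y)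
    rw [← H.counit.counit_right u y k p q (h ▸ H.rep₁.isT2 hu y)]
    -- For matched x ⊗ y with common degree γ', x s(ε^♭(y)) = s(γ'(ε^♭(y)))x, and γ'∘ε^♭ = ε^♯ on y.
    have key : G.matchedSpan ≤ LinearMap.eqLocus F (TensorProduct.lift
        (LinearMap.flip ((LinearMap.mk₂ ℂ (fun b x => ract (G.s b) x)
          (fun b c x => by rw [map_add]; rfl) (fun z b x => by rw [map_smul]; rfl)
          (fun b x y => map_add _ _ _) (fun z b x => map_smul _ _ _)) ∘ₗ H.ef))) := by
      refine Submodule.span_le.2 ?_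
      rintro _ ⟨γ, γ'', γ', x, hx, y, hy, rfl⟩
      change lact (G.s (H.es y)) x = ract (G.s (H.ef y)) x
      rw [G.s_twist hx, H.ef_eq hy, map_inv]
      congr 3
      exact ((act γ').apply_symm_apply (H.es y)).symm
    rw [show F (starT (H.d₁ (star u)) y) = _ from
      key (G.star_mem_matchedSpan (H.rep₁.mem (star u) (star y))), h, map_sum]
    rfl
  obtain ⟨u, hu, h2, h3⟩ := (G.units_mem.and ((G.units_mul (F (H.d₁ v y))).and
    (G.units_mul (y * v)))).exists
  have h4 : ∀ w, F (mulL1 u w) = u * F w := by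
    intro w
    induction w with
    | zero => simp
    | add p q hp hq => simp only [map_add, mul_add, hp, hq]
    | tmul p q => rw [mulL1, LinearMap.rTensor_tmul, hFt, hFt, LinearMap.mulLeft_apply, G.mul_s hu]
  have h5 : ∀ w, F (mulR1 v w) = F w * v := by
    intro w
    induction w with
    | zero => simp
    | add p q hp hq => simp only [map_add, add_mul, hp, hq]
    | tmul p q => rw [mulR1, LinearMap.rTensor_tmul, hFt, hFt, LinearMap.mulRight_apply, lact_mul]
  have h6 : G.balSpan ≤ LinearMap.ker F := G.balSpan_le_relLeft.trans (G.relLeft_le_ker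
    fun p q b => by rw [hFt, hFt, H.es_r, G.s_mul, G.s_s])
  have h7 := SModEq.lift_eq F (H.rep₁.mixL hv hu y) h6
  change F (mulL1 u _) = F (mulR1 v _) at h7
  rw [h4, h5, h1 u hu, h2, mul_assoc, h3] at h7
  exact h7

/-- Multiplying on the left by u = S(S⁻¹(u)) moves r(b) from the right of x to the left of S⁻¹(u),
where the defining property of S applies. -/
theorem S_r' (b : B) (x : A) : H.S (ract (G.r b) x) = lact (G.s b) (H.S x) := by
  obtain ⟨u, hu, h1, h2⟩ := (G.units_mem.and ((G.units_mul (H.S (ract (G.r b) x))).and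
    (G.units_mul (lact (G.s b) (H.S x))))).exists
  rw [← h1, ← h2, ← H.S.apply_symm_apply u, ← H.antipode.map_mul, ract_mul, H.antipode.map_mul,
    H.antipode.map_r, ract_mul]

theorem S_s' (b : B) (x : A) : H.S (ract (G.s b) x) = lact (G.r b) (H.S x) := by
  obtain ⟨u, hu, h1, h2⟩ := (G.units_mem.and ((G.units_mul (H.S (ract (G.s b) x))).and
    (G.units_mul (lact (G.r b) (H.S x))))).exists
  rw [← h1, ← h2, ← H.S.apply_symm_apply u, ← H.antipode.map_mul, ract_mul, H.antipode.map_mul,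
    H.antipode.map_s, ract_mul]

/-- `p ⊗ q ↦ S(p)q` -/
def antL : A ⊗[ℂ] A →ₗ[ℂ] A := TensorProduct.lift (LinearMap.mul ℂ A ∘ₗ H.S.toLinearMap)

/-- `p ⊗ q ↦ pS(q)` -/
def antR : A ⊗[ℂ] A →ₗ[ℂ] A := TensorProduct.lift ((LinearMap.mul ℂ A).compl₂ H.S.toLinearMap)

theorem antL_tmul (p q : A) : H.antL (p ⊗ₜ q) = H.S p * q := rfl

theorem antR_tmul (p q : A) : H.antR (p ⊗ₜ q) = p * H.S q := rfl

theorem antL_d₂ {v : A} (hv : v ∈ G.gr 1 1) (y : A) :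
    H.antL (H.d₂ v y) = lact (G.s (H.ef y)) v := by
  obtain ⟨k, p, q, h⟩ := exists_fin_sum (H.d₂ v y)
  have := H.antipode.antipode_left y v k p q (h ▸ H.rep₂.isT1 hv y)
  rw [h, map_sum]
  exact this

theorem antR_d₁ {v : A} (hv : v ∈ G.gr 1 1) (y : A) :
    H.antR (starT (H.d₁ (star v)) y) = ract (G.r (H.es y)) v := by
  obtain ⟨k, p, q, h⟩ := exists_fin_sum (starT (H.d₁ (star v)) y)
  have := H.antipode.antipode_right v y k p q (h ▸ H.rep₁.isT2 hv y)
  rw [h, map_sum]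
  exact this

/-- The axiom concerns Δ(y)(1 ⊗ u). Evaluating p ⊗ q ↦ S(p)q on Δ(y)(v ⊗ u) in both ways gives S(v)
on the left instead of u on the right. -/
theorem antL_d₁ {v : A} (hv : v ∈ G.gr 1 1) (y : A) :
    H.antL (H.d₁ v y) = ract (G.s (H.ef y)) (H.S v) := by
  obtain ⟨u, hu, h2, h3⟩ := (G.units_mem.and ((G.mul_units (H.antL (H.d₁ v y))).and
    (G.mul_units (ract (G.s (H.ef y)) (H.S v))))).exists
  have h4 : ∀ w, H.antL (mulR2 u w) = H.antL w * u := by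
    intro w
    induction w with
    | zero => simp
    | add p q hp hq => simp only [map_add, add_mul, hp, hq]
    | tmul p q => simp [mulR2, antL_tmul, mul_assoc]
  have h5 : ∀ w, H.antL (mulR1 v w) = H.S v * H.antL w := by
    intro w
    induction w with
    | zero => simp
    | add p q hp hq => simp only [map_add, mul_add, hp, hq]
    | tmul p q => simp [mulR1, antL_tmul, H.antipode.map_mul, mul_assoc]
  have h6 : G.balSpan ≤ LinearMap.ker H.antL := G.balSpan_le_relLeft.trans (G.relLeft_le_ker
    fun p q b => by rw [antL_tmul, antL_tmul, H.antipode.map_s, ract_mul])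
  have h7 := SModEq.lift_eq H.antL (H.mix hv hu y) h6
  rw [h4, h5, h2, H.antL_d₂ hu, ← ract_mul, h3] at h7
  exact h7

/-- The mirror image of `antL_d₁`: the axiom for (v ⊗ 1)Δ(y) is transferred to (1 ⊗ u)Δ(y). Here p ⊗
q ↦ pS(q) respects the relations for right multiplication, not those for left multiplication. -/
theorem antR_d₂ {u : A} (hu : u ∈ G.gr 1 1) (y : A) :
    H.antR (starT (H.d₂ (star u)) y) = lact (G.r (H.es y)) (H.S u) := by
  obtain ⟨v, hv, h2, h3⟩ := (G.units_mem.and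
    ((G.units_mul (H.antR (starT (H.d₂ (star u)) y))).and
    (G.units_mul (lact (G.r (H.es y)) (H.S u))))).exists
  have h4 : ∀ w, H.antR (mulL2 u w) = H.antR w * H.S u := by
    intro w
    induction w with
    | zero => simp
    | add p q hp hq => simp only [map_add, add_mul, hp, hq]
    | tmul p q => simp [mulL2, antR_tmul, H.antipode.map_mul, mul_assoc]
  have h5 : ∀ w, H.antR (mulL1 v w) = v * H.antR w := by
    intro w
    induction w with
    | zero => simp
    | add p q hp hq => simp only [map_add, mul_add, hp, hq]
    | tmul p q => simp [mulL1, antR_tmul, mul_assoc]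
  have h6 : G.balSpan ≤ LinearMap.ker H.antR := by
    refine G.balSpan_le_relRight.trans (Submodule.span_le.2 ?_)
    rintro _ ⟨p, q, b, rfl⟩
    rw [SetLike.mem_coe, LinearMap.mem_ker, map_sub, antR_tmul, antR_tmul, H.S_r', ract_mul,
      sub_self]
  have h7 := SModEq.lift_eq H.antR (H.mix_star hv hu y) h6
  rw [h4, h5, h2, H.antR_d₁ hv, ract_mul, h3] at h7
  exact h7.symm

theorem φ_inv {v : A} (hv : v ∈ G.gr 1 1) (y : A) :
    TensorProduct.lift (G.sl ∘ₗ H.φ).flip (H.d₁ v y) = lact (G.r (H.φ y)) v := by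
  obtain ⟨k, p, q, h⟩ := exists_fin_sum (H.d₁ v y)
  rw [← H.left_integral.invariant_left v y k p q (h ▸ H.rep₁.isT4 hv y), h, map_sum]
  rfl

theorem ψ_inv {v : A} (hv : v ∈ G.gr 1 1) (y : A) :
    TensorProduct.lift (G.rl ∘ₗ H.ψ) (H.d₂ v y) = lact (G.s (H.ψ y)) v := by
  obtain ⟨k, p, q, h⟩ := exists_fin_sum (H.d₂ v y)
  rw [← H.right_integral.invariant_left v y k p q (h ▸ H.rep₂.isT1 hv y), h, map_sum]
  rfl

/-- The data that define the first fundamental unitary. -/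
def core (hB : ∀ F : Finset B, ∃ u : B, ∀ b ∈ F, u * b = b) : Core G where
  d1 := H.d₁
  d2 := H.d₂
  es := H.es
  ef := H.ef
  S := H.S
  φ := H.φ
  ψ := H.ψ
  μ := H.μ
  D := H.D
  base_unit := hB
  d1_mem := H.rep₁.mem
  d1_deg hv _ _ _ hy := H.rep₁.deg H.comul hv hy
  d2_deg hv _ _ _ hy := H.rep₂.deg H.comul hv hy
  d1_mul hv hu _ hy x := H.rep₁.mul H.rep₁ hv hu hy x
  d21_mul hv hu _ hy x := H.rep₁.mul H.rep₂ hv hu hy x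
  mix hv hu y := H.mix hv hu y
  mixLR hv hu y := H.rep₁.mixL hv hu y
  d1_r hv b y := H.rep₁.map_r H.comul hv b y
  d1_s hv b y := H.rep₁.map_s H.comul hv b y
  d2_r hv b y := H.rep₂.map_r H.comul hv b y
  coassoc ha hc y := H.rep₁.coassoc H.comul H.rep₂ ha hc y
  es_r := H.es_r
  es_s := H.es_s
  ef_eq := H.ef_eq
  counit hv y := H.counit₂ hv y
  S_mul := H.antipode.map_mul
  S_r := H.antipode.map_r
  S_s := H.antipode.map_s
  S_s' := H.S_s'
  antipode_left hv y := H.antL_d₁ hv y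
  antipode_right hv y := H.antR_d₁ hv y
  φ_left := H.left_integral.map_left
  φ_right := H.left_integral.map_right
  φ_deg := H.left_integral.degree
  φ_inv hv y := H.φ_inv hv y
  ψ_left := H.right_integral.map_left
  ψ_right := H.right_integral.map_right
  ψ_deg := H.right_integral.degree
  μ_faithful := H.μ_faithful
  μ_quasi_invariant := H.μ_quasi_invariant
  ν_eq := H.ν_eq
  φ_surjective := H.φ_surjective
  ψ_surjective := H.ψ_surjective

theorem τ_inj {w w' : A ⊗[ℂ] A} (h : τ w = τ w') : w = w' := by rw [← τ_τ w, h, τ_τ]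

theorem starT_τ (f : A →ₗ[ℂ] A ⊗[ℂ] A) (y : A) : starT (τ ∘ₗ f) y = τ (starT f y) := τ_star _

theorem τ₃_star_assoc (f : A →ₗ[ℂ] A ⊗[ℂ] A) (w : A ⊗[ℂ] A) :
    τ₃ (star (TensorProduct.assoc ℂ A A A ((starT f).rTensor A w))) =
      (τ ∘ₗ f).lTensor A (τ (star w)) := by
  induction w with
  | zero => simp
  | add p q hp hq => simp only [map_add, star_add, hp, hq]
  | tmul p q =>
    have : ∀ t : A ⊗[ℂ] A, τ₃ (star (TensorProduct.assoc ℂ A A A (star t ⊗ₜ q))) =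
        star q ⊗ₜ τ t := by
      intro t
      induction t with
      | zero => simp
      | add r s hr hs =>
        simp only [map_add, star_add, TensorProduct.add_tmul, TensorProduct.tmul_add, hr, hs]
      | tmul r s => simp [τ₃_tmul]
    rw [LinearMap.rTensor_tmul, starT_apply, this]
    simp

theorem τ₃_star_lTensor (f : A →ₗ[ℂ] A ⊗[ℂ] A) (w : A ⊗[ℂ] A) :
    τ₃ (star (f.lTensor A w)) =
      TensorProduct.assoc ℂ A A A ((starT (τ ∘ₗ f)).rTensor A (τ (star w))) := by
  induction w with
  | zero => simp
  | add p q hp hq => simp only [map_add, star_add, hp, hq]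
  | tmul p q =>
    have : ∀ t : A ⊗[ℂ] A, τ₃ (star p ⊗ₜ t) = TensorProduct.assoc ℂ A A A (τ t ⊗ₜ star p) := by
      intro t
      induction t with
      | zero => simp
      | add r s hr hs =>
        simp only [map_add, TensorProduct.add_tmul, TensorProduct.tmul_add, hr, hs]
      | tmul r s => simp [τ₃_tmul]
    rw [LinearMap.lTensor_tmul, TensorProduct.star_tmul, this, TensorProduct.star_tmul, ← τ_star]
    simp [starT_apply]

/-- The data that define the second fundamental unitary. -/
def coCore (hB : ∀ F : Finset B, ∃ u : B, ∀ b ∈ F, u * b = b) : Core G.co where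
  d1 v := τ ∘ₗ H.d₂ v
  d2 v := τ ∘ₗ H.d₁ v
  es := H.es
  ef := H.ef
  -- The comultiplication is flipped but the product is kept, which replaces the antipode by its
  -- inverse.
  S := H.S.symm
  φ := H.ψ
  ψ := H.φ
  μ := H.μ
  D := H.D
  base_unit := hB
  d1_mem v y := τ_matched (H.rep₂.mem v y)
  d1_deg hv _ _ _ hy := by
    obtain ⟨t, ht, h⟩ := H.rep₂.deg H.comul hv hy
    exact ⟨τ t, τ_span ht, τ_smod h⟩
  d2_deg hv _ _ _ hy := by
    obtain ⟨t, ht, h⟩ := H.rep₁.deg H.comul hv hy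
    exact ⟨τ t, τ_span ht, τ_smod h⟩
  d1_mul {v u} hv hu y hy x := by
    have := τ_smod (H.rep₂.mul H.rep₂ hv hu (τ_inj ((τ_lTensor _ _).trans hy)) x)
    rwa [τ_mul] at this
  d21_mul {v u} hv hu y hy x := by
    have := τ_smod (H.rep₂.mul H.rep₁ hv hu (τ_inj ((τ_rTensor _ _).trans hy)) x)
    rwa [τ_mul] at this
  mix {v u} hv hu y := by
    have := τ_smod (H.mix hu hv y)
    rw [mulR1, mulR2, τ_lTensor, τ_rTensor] at this
    exact this.symm
  mixLR {v u} hv hu y := by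
    have := τ_smod (H.rep₂.mixL hv hu y)
    change τ (mulL2 u _) ≡ τ (mulR2 v _) [SMOD _] at this
    rwa [mulL2, mulR2, τ_lTensor, τ_lTensor, ← starT_τ] at this
  d1_r {v} hv b y := by
    have := τ_smod (H.rep₂.map_s H.comul hv b y)
    rwa [τ_lTensor] at this
  d1_s {v} hv b y := by
    have := τ_smod (H.rep₂.map_r H.comul hv b y)
    rwa [τ_rTensor] at this
  d2_r {v} hv b y := by
    have := τ_smod (H.rep₁.map_s H.comul hv b y)
    rwa [τ_lTensor] at this
  -- The multiplier a now belongs to the last leg and e to the first. Applying the given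
  -- coassociativity to the adjoints and then * followed by the reversal puts the multiplications on
  -- the required sides.
  coassoc {a e} ha he y := by
    have := star_relTriple (SModEq.sub_mem.1
      (H.rep₁.coassoc H.comul H.rep₂ (G.one_mem_star he) (G.one_mem_star ha) (star y)))
    rw [star_star, star_sub, map_sub, τ₃_star_assoc, τ₃_star_lTensor, starT_apply (H.d₁ e),
      star_star, star_star] at this
    have e : starT (τ ∘ₗ H.d₂ (star a)) y = τ (star (H.d₂ (star a) (star y))) := starT_τ _ _
    rw [e]
    exact (SModEq.sub_mem.2 this).symm
  es_r := H.es_s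
  es_s := H.es_r
  ef_eq hx := H.ef_eq' hx
  counit {v} hv y := by
    rw [← H.counit₁ hv y, LinearMap.comp_apply]
    induction H.d₁ v y with
    | zero => simp
    | add p q hp hq => simp only [map_add, hp, hq]
    | tmul p q => rfl
  S_mul x y := by
    rw [LinearEquiv.symm_apply_eq, H.antipode.map_mul, LinearEquiv.apply_symm_apply,
      LinearEquiv.apply_symm_apply]
  S_r b x := by
    rw [LinearEquiv.symm_apply_eq]
    exact ((H.S_r' b _).trans (by rw [LinearEquiv.apply_symm_apply]; rfl)).symm
  S_s b x := by
    rw [LinearEquiv.symm_apply_eq]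
    exact ((H.S_s' b _).trans (by rw [LinearEquiv.apply_symm_apply]; rfl)).symm
  S_s' b x := by
    rw [LinearEquiv.symm_apply_eq]
    exact ((H.antipode.map_s b _).trans (by rw [LinearEquiv.apply_symm_apply]; rfl)).symm
  antipode_left {v} hv y := by
    apply H.S.injective
    refine Eq.trans ?_ ((H.antL_d₂ hv y).trans ?_)
    · rw [LinearMap.comp_apply]
      induction H.d₂ v y with
      | zero => simp
      | add p q hp hq => simp only [map_add, hp, hq]
      | tmul p q => simp [antL_tmul, H.antipode.map_mul]
    · refine ((H.S_r' _ _).trans ?_).symm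
      rw [LinearEquiv.apply_symm_apply]
  antipode_right {v} hv y := by
    apply H.S.injective
    refine Eq.trans ?_ ((H.antR_d₂ hv y).trans (H.S_s' _ _).symm)
    rw [starT_τ]
    induction starT (H.d₂ (star v)) y with
    | zero => simp
    | add p q hp hq => simp only [map_add, hp, hq]
    | tmul p q => simp [antR_tmul, H.antipode.map_mul]
  φ_left := H.right_integral.map_left
  φ_right := H.right_integral.map_right
  φ_deg := H.right_integral.degree
  φ_inv {v} hv y := by
    refine Eq.trans ?_ (H.ψ_inv hv y)
    rw [LinearMap.comp_apply]
    induction H.d₂ v y with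
    | zero => simp
    | add p q hp hq => simp only [map_add, hp, hq]
    | tmul p q => rfl
  ψ_left := H.left_integral.map_left
  ψ_right := H.left_integral.map_right
  ψ_deg := H.left_integral.degree
  μ_faithful := H.μ_faithful
  μ_quasi_invariant := H.μ_quasi_invariant
  ν_eq x := (H.ν_eq x).symm
  φ_surjective := H.ψ_surjective
  ψ_surjective := H.φ_surjective

end MeasuredHopf

end Cores

/-! ## GNS-constructions for integrals -/

section Span

variable {K L M : Type*}
  [NormedAddCommGroup K] [InnerProductSpace ℂ K] [CompleteSpace K]
  [NormedAddCommGroup L] [InnerProductSpace ℂ L] [CompleteSpace L]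
  [NormedAddCommGroup M] [InnerProductSpace ℂ M] [CompleteSpace M]

theorem comp_mem_of_clspan {S : Set (L →L[ℂ] M)} {T : Set (K →L[ℂ] L)}
    {E : Submodule ℂ (K →L[ℂ] M)} (hE : IsClosed (E : Set (K →L[ℂ] M)))
    (h : ∀ s ∈ S, ∀ t ∈ T, s ∘L t ∈ E) {s : L →L[ℂ] M} (hs : s ∈ clspan S) {t : K →L[ℂ] L}
    (ht : t ∈ clspan T) : s ∘L t ∈ E := by
  have h1 : ∀ s ∈ S, clspan T ≤ E.comap (ContinuousLinearMap.compL ℂ K L M s).toLinearMap :=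
    fun s hs => clspan_le (hE.preimage (ContinuousLinearMap.compL ℂ K L M s).continuous)
      fun t ht => h s hs t ht
  have h2 : clspan S ≤ E.comap ((ContinuousLinearMap.compL ℂ K L M).flip t).toLinearMap :=
    clspan_le (hE.preimage ((ContinuousLinearMap.compL ℂ K L M).flip t).continuous)
      fun s hs => h1 s hs ht
  exact h2 hs

theorem adj_mem_of_clspan {S : Set (K →L[ℂ] L)} {E : Submodule ℂ (L →L[ℂ] K)}
    (hE : IsClosed (E : Set (L →L[ℂ] K))) (h : ∀ s ∈ S, adj s ∈ E) {s : K →L[ℂ] L}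
    (hs : s ∈ clspan S) : adj s ∈ E := by
  let F : Submodule ℂ (K →L[ℂ] L) :=
    { carrier := {s | adj s ∈ E}
      add_mem' := fun {a b} ha hb => by
        change adj (a + b) ∈ E
        rw [show adj (a + b) = adj a + adj b from map_add ContinuousLinearMap.adjoint a b]
        exact add_mem ha hb
      zero_mem' := by
        change adj 0 ∈ E
        rw [show adj (0 : K →L[ℂ] L) = 0 from map_zero ContinuousLinearMap.adjoint]
        exact zero_mem _
      smul_mem' := fun z a ha => by
        change adj (z • a) ∈ E
        rw [show adj (z • a) = star z • adj a from map_smulₛₗ ContinuousLinearMap.adjoint z a]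
        exact Submodule.smul_mem _ _ ha }
  have : clspan S ≤ F := clspan_le
    (hE.preimage (ContinuousLinearMap.adjoint (𝕜 := ℂ) (E := K) (F := L)).continuous) h
  exact this hs

theorem Total.closure_span {ι : Type*} {u : ι → K} (hu : Total u) {S : Set K} (h : ∀ i, u i ∈ S) :
    (Submodule.span ℂ S).topologicalClosure = ⊤ :=
  eq_top_iff.2 fun x _ => hu.mem_closed _ (Submodule.isClosed_topologicalClosure _)
    (fun i => Submodule.le_topologicalClosure _ (Submodule.subset_span (h i))) x

end Span

section Gns

variable {Γ B : Type*} [Group Γ] [NonUnitalCommRing B] [Module ℂ B] [IsScalarTower ℂ B B]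
  [SMulCommClass ℂ B B] [StarRing B] [StarModule ℂ B] {act : Γ →* (B ≃⋆ₐ[ℂ] B)}
  {A : Type*} [NonUnitalRing A] [Module ℂ A] [IsScalarTower ℂ A A] [SMulCommClass ℂ A A]
  [StarRing A] [StarModule ℂ A]

theorem EvAlgebra.exists_right_base_unit (G : EvAlgebra act A) (x : A) :
    ∃ b, ract (G.r b) x = x := by
  obtain ⟨b, hb⟩ := G.exists_base_unit {star x}
  refine ⟨star b, ?_⟩
  have := congrArg star (hb (star x) (Finset.mem_singleton_self _)).1
  rwa [star_lact, star_star, ← map_star] at this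

variable (G : EvAlgebra act A) (K L : Type*)
  [NormedAddCommGroup K] [InnerProductSpace ℂ K] [CompleteSpace K]
  [NormedAddCommGroup L] [InnerProductSpace ℂ L] [CompleteSpace L]

/-- The GNS-constructions for a weight `μ` on `B` and the composition with an integral `φ`. -/
structure Gns where
  φ : A →ₗ[ℂ] B
  μ : B →ₗ[ℂ] ℂ
  D : Γ → Mult B
  Λμ : B →ₗ[ℂ] K
  Λν : A →ₗ[ℂ] L
  base_unit : ∀ F : Finset B, ∃ u : B, ∀ b ∈ F, u * b = b
  φ_left : ∀ b x, φ (lact (G.r b) x) = b * φ x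
  φ_right : ∀ b x, φ (ract (G.r b) x) = φ x * b
  φ_deg : ∀ {γ γ' x}, x ∈ G.gr γ γ' → γ ≠ 1 → φ x = 0
  φ_surjective : Function.Surjective φ
  μ_faithful : ∀ b, (∀ c, μ (c * b) = 0) → b = 0
  μ_quasi_invariant : ∀ γ b, μ (act γ (ract (D γ) b)) = μ b
  inner_μ : ∀ b c, inner ℂ (Λμ b) (Λμ c) = μ (star b * c)
  inner_ν : ∀ x y, inner ℂ (Λν x) (Λν y) = μ (φ (star x * y))
  total_μ : Total Λμ
  total_ν : Total Λν
  bounded : ∀ b, ∃ C : ℝ, 0 ≤ C ∧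
    ∀ c, μ (star c * star b * b * c) ≤ (C : ℂ) * μ (star c * c)

namespace Gns

variable {G K L} (g : Gns G K L)

/-- `π(b) Λ_μ(c) = Λ_μ(bc)` -/
def π (b : B) : K →L[ℂ] K := theOp fun T => ∀ c, T (g.Λμ c) = g.Λμ (b * c)

/-- `Λ_φ(x)` -/
def R (x : A) : K →L[ℂ] L := theOp fun T => ∀ b, T (g.Λμ b) = g.Λν (ract (G.r b) x)

/-- `Λ_φ^†(x)` -/
def L' (x : A) : K →L[ℂ] L := theOp fun T => ∀ b, T (g.Λμ b) = g.Λν (lact (G.r b) x)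

theorem exists_op_of_le {N : Type*} [NormedAddCommGroup N] [InnerProductSpace ℂ N]
    [CompleteSpace N] (f : B →ₗ[ℂ] N) {C : ℝ} (h : ∀ b, ‖f b‖ ≤ C * ‖g.Λμ b‖) :
    ∃ T : K →L[ℂ] N, ∀ b, T (g.Λμ b) = f b := by
  obtain ⟨T, hT, _⟩ := g.total_μ.exists_op (fun b => f b) C (fun s => by
    have h1 : Finsupp.linearCombination ℂ (fun b => f b) s =
        f (Finsupp.linearCombination ℂ (fun b : B => b) s) := by
      simp [Finsupp.linearCombination_apply, map_finsuppSum]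
    have h2 : Finsupp.linearCombination ℂ g.Λμ s =
        g.Λμ (Finsupp.linearCombination ℂ (fun b : B => b) s) := by
      simp [Finsupp.linearCombination_apply, map_finsuppSum]
    rw [h1, h2]
    exact h _)
  exact ⟨T, hT⟩

theorem π_apply (b c : B) : g.π b (g.Λμ c) = g.Λμ (b * c) := by
  obtain ⟨C, hC, h⟩ := g.bounded b
  refine theOp_spec (P := fun T : K →L[ℂ] K => ∀ c, T (g.Λμ c) = g.Λμ (b * c))
    (g.exists_op_of_le (g.Λμ ∘ₗ LinearMap.mulLeft ℂ b) (C := √C) fun c => ?_) c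
  have h1 := h c
  rw [show star c * star b * b * c = star (b * c) * (b * c) by rw [star_mul, ← mul_assoc],
    ← g.inner_μ, ← g.inner_μ] at h1
  have h2 := (Complex.le_def.1 h1).1
  rw [Complex.re_ofReal_mul, ← RCLike.re_eq_complex_re,
    inner_self_eq_norm_sq, inner_self_eq_norm_sq] at h2
  rw [← abs_of_nonneg (norm_nonneg _), ← abs_of_nonneg (norm_nonneg (g.Λμ c)),
    ← abs_of_nonneg (Real.sqrt_nonneg C), ← abs_mul]
  refine sq_le_sq.1 ?_
  rw [mul_pow, Real.sq_sqrt hC]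
  exact h2

/-- By Cauchy–Schwarz, the form ⟨Λ_μ(b), Λ_μ(ab)⟩ is at most ‖π(a)‖‖Λ_μ(b)‖². This is how
boundedness of the GNS-representation of μ yields boundedness of both Λ_φ(x) and Λ_φ^†(x). -/
theorem exists_op_of_inner (f : B →ₗ[ℂ] L) (a : B)
    (h : ∀ b, inner ℂ (f b) (f b) = inner ℂ (g.Λμ b) (g.Λμ (a * b))) :
    ∃ T : K →L[ℂ] L, ∀ b, T (g.Λμ b) = f b := by
  refine g.exists_op_of_le f (C := √‖g.π a‖) fun b => ?_
  rw [← abs_of_nonneg (norm_nonneg (f b)), ← abs_of_nonneg (norm_nonneg (g.Λμ b)),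
    ← abs_of_nonneg (Real.sqrt_nonneg _), ← abs_mul]
  refine sq_le_sq.1 ?_
  rw [mul_pow, Real.sq_sqrt (norm_nonneg _), ← inner_self_eq_norm_sq (𝕜 := ℂ), h, ← g.π_apply]
  calc RCLike.re (inner ℂ (g.Λμ b) (g.π a (g.Λμ b))) ≤ ‖g.Λμ b‖ * ‖g.π a (g.Λμ b)‖ :=
        re_inner_le_norm _ _
    _ ≤ ‖g.Λμ b‖ * (‖g.π a‖ * ‖g.Λμ b‖) := by
        gcongr
        exact (g.π a).le_opNorm _
    _ = _ := by ring

theorem inner_R (x y : A) (b c : B) :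
    inner ℂ (g.Λν (ract (G.r b) x)) (g.Λν (ract (G.r c) y)) =
      inner ℂ (g.Λμ b) (g.Λμ (g.φ (star x * y) * c)) := by
  rw [g.inner_ν, g.inner_μ, ← mul_ract, g.φ_right, star_ract, ← lact_mul, ← map_star, g.φ_left,
    mul_assoc]

theorem R_apply (x : A) (b : B) : g.R x (g.Λμ b) = g.Λν (ract (G.r b) x) := by
  refine theOp_spec (P := fun T : K →L[ℂ] L => ∀ b, T (g.Λμ b) = g.Λν (ract (G.r b) x))
    (g.exists_op_of_inner (g.Λν ∘ₗ
      { toFun := fun b => ract (G.r b) x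
        map_add' := fun b c => by rw [map_add]; rfl
        map_smul' := fun z b => by rw [map_smul]; rfl }) (g.φ (star x * x))
      fun b => g.inner_R x x b b) b

/-- Moving b^*c to the left of x^* twists it by γ⁻¹. Quasi-invariance of μ undoes the twist and
leaves the factor D_γ. -/
theorem inner_L {γ γ' : Γ} {x : A} (hx : x ∈ G.gr γ γ') (y : A) (b c : B) :
    inner ℂ (g.Λν (lact (G.r b) x)) (g.Λν (lact (G.r c) y)) =
      inner ℂ (g.Λμ b) (g.Λμ (act γ (ract (g.D γ) (g.φ (star x * y))) * c)) := by
  rw [g.inner_ν, g.inner_μ, star_lact, ← map_star, ract_mul, ← G.r_mul, ← ract_mul,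
    G.r_twist (G.star_mem hx), ← lact_mul, g.φ_left, ← g.μ_quasi_invariant γ, mul_ract, map_mul,
    map_inv]
  congr 1
  rw [show act γ ((act γ)⁻¹ (star b * c)) = star b * c from (act γ).apply_symm_apply _]
  rw [mul_assoc, mul_comm c]

theorem L_apply (x : A) (b : B) : g.L' x (g.Λμ b) = g.Λν (lact (G.r b) x) := by
  refine theOp_spec (P := fun T : K →L[ℂ] L => ∀ b, T (g.Λμ b) = g.Λν (lact (G.r b) x)) ?_ b
  -- The Radon–Nikodym factor depends on the degree of x, so boundedness is shown for homogeneous x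
  -- and extended by linearity.
  let U : Submodule ℂ A :=
    { carrier := {x | ∃ T : K →L[ℂ] L, ∀ b, T (g.Λμ b) = g.Λν (lact (G.r b) x)}
      add_mem' := by
        rintro x y ⟨S, hS⟩ ⟨T, hT⟩
        exact ⟨S + T, fun b => by rw [add_apply, hS, hT, map_add, map_add]⟩
      zero_mem' := ⟨0, fun b => by simp⟩
      smul_mem' := by
        rintro z x ⟨S, hS⟩
        exact ⟨z • S, fun b => by rw [smul_apply, hS, map_smul, map_smul]⟩ }
  exact G.hom_mem U (fun γ γ' x hx => g.exists_op_of_inner (g.Λν ∘ₗ G.rl.flip x) _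
    fun b => g.inner_L hx x b b) x

theorem opK_ext {N : Type*} [NormedAddCommGroup N] [NormedSpace ℂ N] {S T : K →L[ℂ] N}
    (h : ∀ b, S (g.Λμ b) = T (g.Λμ b)) : S = T :=
  g.total_μ.ext_op h

theorem π_mul (b c : B) : g.π b ∘L g.π c = g.π (b * c) :=
  g.opK_ext fun d => by
    rw [ContinuousLinearMap.comp_apply, π_apply, π_apply, π_apply, mul_assoc]

theorem π_comm (b c : B) : g.π b ∘L g.π c = g.π c ∘L g.π b := by rw [π_mul, π_mul, mul_comm]

theorem adj_eq_of_inner {N N' : Type*} [NormedAddCommGroup N] [InnerProductSpace ℂ N]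
    [CompleteSpace N] [NormedAddCommGroup N'] [InnerProductSpace ℂ N'] [CompleteSpace N']
    {ι κ : Type*} {u : ι → N} {v : κ → N'} (hu : Total u) (hv : Total v)
    {S : N →L[ℂ] N'} {T : N' →L[ℂ] N} (h : ∀ i j, inner ℂ (S (u i)) (v j) = inner ℂ (u i) (T (v j))) :
    adj S = T :=
  hv.ext_op fun j => hu.ext_inner fun i => by rw [adj_inner_right, h]

theorem adj_π (b : B) : adj (g.π b) = g.π (star b) :=
  adj_eq_of_inner g.total_μ g.total_μ fun c d => by
    rw [π_apply, π_apply, g.inner_μ, g.inner_μ, star_mul, mul_assoc]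

theorem adj_R_comp (x y : A) : adj (g.R x) ∘L g.R y = g.π (g.φ (star x * y)) :=
  g.opK_ext fun c => g.total_μ.ext_inner fun b => by
    rw [ContinuousLinearMap.comp_apply, adj_inner_right, R_apply, R_apply, inner_R, π_apply]

theorem adj_L_comp {γ γ' : Γ} {x : A} (hx : x ∈ G.gr γ γ') (y : A) :
    adj (g.L' x) ∘L g.L' y = g.π (act γ (ract (g.D γ) (g.φ (star x * y)))) :=
  g.opK_ext fun c => g.total_μ.ext_inner fun b => by
    rw [ContinuousLinearMap.comp_apply, adj_inner_right, L_apply, L_apply, inner_L g hx, π_apply]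

theorem φ_deg_eq {γ γ' δ δ' : Γ} {x y : A} (hx : x ∈ G.gr γ γ') (hy : y ∈ G.gr δ δ') (h : γ ≠ δ) :
    g.φ (star x * y) = 0 :=
  g.φ_deg (G.mul_mem (G.star_mem hx) hy) fun e => h (inv_mul_eq_one.1 e)

/-- No normalization is assumed; it follows from quasi-invariance for the neutral element and
faithfulness of μ. -/
theorem D_one (b : B) : ract (g.D 1) b = b := by
  rw [← sub_eq_zero]
  refine g.μ_faithful _ fun c => ?_
  have := g.μ_quasi_invariant 1 (c * b)
  rw [map_one, mul_ract] at this
  rw [mul_sub, map_sub, sub_eq_zero]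
  exact this

/-- `Λ_φ^†` as a linear map -/
def Ll : A →ₗ[ℂ] (K →L[ℂ] L) where
  toFun := g.L'
  map_add' x y := g.opK_ext fun b => by rw [add_apply, L_apply, L_apply, L_apply, map_add, map_add]
  map_smul' z x := g.opK_ext fun b => by
    rw [smul_apply, L_apply, L_apply, map_smul, map_smul, RingHom.id_apply]

/-- `[π(B)]` -/
def base : Submodule ℂ (K →L[ℂ] K) := clspan (Set.range g.π)

/-- `[Λ_φ(A)]` -/
def ER : Submodule ℂ (K →L[ℂ] L) := clspan (Set.range g.R)

/-- `[Λ_φ^†(A)]` -/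
def EL : Submodule ℂ (K →L[ℂ] L) := clspan (Set.range g.L')

theorem π_mem (b : B) : g.π b ∈ g.base := subset_clspan' ⟨b, rfl⟩

theorem R_mem (x : A) : g.R x ∈ g.ER := subset_clspan' ⟨x, rfl⟩

theorem L_mem (x : A) : g.L' x ∈ g.EL := subset_clspan' ⟨x, rfl⟩

theorem isCBase : IsCBase g.base where
  closed := isClosed_clspan _
  mul_mem b hb c hc := comp_mem_of_clspan (isClosed_clspan _) (by
    rintro _ ⟨b, rfl⟩ _ ⟨c, rfl⟩
    rw [π_mul]
    exact g.π_mem _) hb hc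
  mul_comm b hb c hc := by
    have h1 : ∀ b : B, ∀ c ∈ g.base, g.π b ∘L c = c ∘L g.π b := by
      intro b
      have : g.base ≤ LinearMap.eqLocus (ContinuousLinearMap.compL ℂ K K K (g.π b)).toLinearMap
          ((ContinuousLinearMap.compL ℂ K K K).flip (g.π b)).toLinearMap := by
        refine clspan_le (isClosed_eq (ContinuousLinearMap.continuous _)
          (ContinuousLinearMap.continuous _)) ?_
        rintro _ ⟨c, rfl⟩
        exact g.π_comm b c
      exact fun c hc => this hc
    have : g.base ≤ LinearMap.eqLocus (ContinuousLinearMap.compL ℂ K K K c).toLinearMap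
        ((ContinuousLinearMap.compL ℂ K K K).flip c).toLinearMap := by
      refine clspan_le (isClosed_eq (ContinuousLinearMap.continuous _)
        (ContinuousLinearMap.continuous _)) ?_
      rintro _ ⟨b, rfl⟩
      exact (h1 b c hc).symm
    exact (this hb).symm
  adj_mem b hb := adj_mem_of_clspan (isClosed_clspan _) (by
    rintro _ ⟨b, rfl⟩
    rw [adj_π]
    exact g.π_mem _) hb
  nondegenerate := g.total_μ.closure_span fun c => by
    obtain ⟨u, hu⟩ := g.base_unit {c}
    exact ⟨g.π u, g.π_mem u, g.Λμ c, by rw [π_apply, hu c (Finset.mem_singleton_self _)]⟩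

theorem R_comp_π (x : A) (b : B) : g.R x ∘L g.π b = g.R (ract (G.r b) x) :=
  g.opK_ext fun c => by
    rw [ContinuousLinearMap.comp_apply, π_apply, R_apply, R_apply, G.r_mul']

theorem L_comp_π (x : A) (b : B) : g.L' x ∘L g.π b = g.L' (lact (G.r b) x) :=
  g.opK_ext fun c => by
    rw [ContinuousLinearMap.comp_apply, π_apply, L_apply, L_apply, mul_comm, G.r_mul]

/-- The closed span of all ξ^*ξ' is compared with 𝔅 on generators. The map ξ ↦ ξ^* is only
conjugate-linear, so the first variable is treated by passing to adjoints, under which 𝔅 is stable.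
-/
theorem adj_mul_eq {f : A → K →L[ℂ] L} (h : ∀ x y, adj (f x) ∘L f y ∈ g.base)
    (h' : ∀ b, g.π b ∈ clspan {T | ∃ ξ ∈ clspan (Set.range f), ∃ ξ' ∈ clspan (Set.range f),
      T = adj ξ ∘L ξ'}) :
    clspan {T | ∃ ξ ∈ clspan (Set.range f), ∃ ξ' ∈ clspan (Set.range f), T = adj ξ ∘L ξ'} =
      g.base := by
  refine le_antisymm (clspan_le (isClosed_clspan _) ?_) (clspan_le (isClosed_clspan _) ?_)
  · rintro _ ⟨ξ, hξ, ξ', hξ', rfl⟩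
    have h1 : ∀ x, adj (f x) ∘L ξ' ∈ g.base := fun x =>
      comp_mem_of_clspan (S := {adj (f x)}) (isClosed_clspan _) (by
        rintro _ rfl _ ⟨y, rfl⟩
        exact h x y) (subset_clspan' rfl) hξ'
    have h2 : adj ξ' ∘L ξ ∈ g.base := by
      refine comp_mem_of_clspan (S := {adj ξ'}) (isClosed_clspan _) ?_ (subset_clspan' rfl) hξ
      rintro _ rfl _ ⟨x, rfl⟩
      have := g.isCBase.adj_mem _ (h1 x)
      rwa [adj_comp, adj_adj] at this
    have := g.isCBase.adj_mem _ h2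
    rwa [adj_comp, adj_adj] at this
  · rintro _ ⟨b, rfl⟩
    exact h' b

theorem mul_base_eq {f : A → K →L[ℂ] L} {T : B → A → A} (h : ∀ x b, f x ∘L g.π b = f (T b x))
    (h' : ∀ x, ∃ b, T b x = x) :
    clspan {S | ∃ ξ ∈ clspan (Set.range f), ∃ b ∈ g.base, S = ξ ∘L b} = clspan (Set.range f) := by
  refine le_antisymm (clspan_le (isClosed_clspan _) ?_) (clspan_le (isClosed_clspan _) ?_)
  · rintro _ ⟨ξ, hξ, b, hb, rfl⟩
    refine comp_mem_of_clspan (isClosed_clspan _) ?_ hξ hb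
    rintro _ ⟨x, rfl⟩ _ ⟨b, rfl⟩
    rw [h]
    exact subset_clspan' ⟨_, rfl⟩
  · rintro _ ⟨x, rfl⟩
    obtain ⟨b, hb⟩ := h' x
    exact subset_clspan' ⟨f x, subset_clspan' ⟨x, rfl⟩, g.π b, g.π_mem b, by rw [h, hb]⟩

theorem isCModule_ER : IsCModule g.base g.ER where
  closed := isClosed_clspan _
  nondegenerate := g.total_ν.closure_span fun x => by
    obtain ⟨b, hb⟩ := G.exists_right_base_unit x
    exact ⟨g.R x, g.R_mem x, g.Λμ b, by rw [R_apply, hb]⟩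
  mul_base := g.mul_base_eq g.R_comp_π fun x => G.exists_right_base_unit x
  adj_mul := g.adj_mul_eq (fun x y => by rw [adj_R_comp]; exact g.π_mem _) fun b => by
    obtain ⟨a, rfl⟩ := g.φ_surjective b
    obtain ⟨u, hu⟩ := (G.units_mul a).exists
    refine subset_clspan' ⟨g.R (star u), g.R_mem _, g.R a, g.R_mem a, ?_⟩
    rw [adj_R_comp, star_star, hu]

theorem π_add (b c : B) : g.π (b + c) = g.π b + g.π c :=
  g.opK_ext fun d => by
    rw [add_apply, π_apply, π_apply, π_apply, add_mul, map_add]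

theorem π_smul (z : ℂ) (b : B) : g.π (z • b) = z • g.π b :=
  g.opK_ext fun d => by rw [smul_apply, π_apply, π_apply, smul_mul_assoc, map_smul]

theorem π_zero : g.π 0 = 0 :=
  g.opK_ext fun d => by rw [π_apply, zero_mul, map_zero]; rfl

/-- `b ↦ π(b)` as a linear map -/
def πl : B →ₗ[ℂ] (K →L[ℂ] K) where
  toFun := g.π
  map_add' := g.π_add
  map_smul' := g.π_smul

theorem isCModule_EL : IsCModule g.base g.EL where
  closed := isClosed_clspan _
  nondegenerate := g.total_ν.closure_span fun x => by
    obtain ⟨b, hb⟩ := G.exists_base_unit {x}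
    exact ⟨g.L' x, g.L_mem x, g.Λμ b, by rw [L_apply, (hb x (Finset.mem_singleton_self _)).1]⟩
  mul_base := g.mul_base_eq g.L_comp_π fun x => by
    obtain ⟨b, hb⟩ := G.exists_base_unit {x}
    exact ⟨b, (hb x (Finset.mem_singleton_self _)).1⟩
  adj_mul := by
    refine g.adj_mul_eq (fun x y => ?_) fun b => ?_
    · have h2 : adj (g.L' y) ∘L g.L' x ∈ g.base := by
        refine G.hom_mem (g.base.comap ((ContinuousLinearMap.compL ℂ K L K (adj (g.L' y))).toLinearMap
          ∘ₗ g.Ll)) (fun δ δ' x hx => ?_) x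
        change adj (g.L' y) ∘L g.L' x ∈ g.base
        have := g.isCBase.adj_mem _ (g.adj_L_comp hx y ▸ g.π_mem _)
        rwa [adj_comp, adj_adj] at this
      have := g.isCBase.adj_mem _ h2
      rwa [adj_comp, adj_adj] at this
    · obtain ⟨a, rfl⟩ := g.φ_surjective b
      refine G.hom_mem (Submodule.comap (g.πl ∘ₗ g.φ) (clspan {T | ∃ ξ ∈ clspan (Set.range g.L'),
        ∃ ξ' ∈ clspan (Set.range g.L'), T = adj ξ ∘L ξ'})) (fun γ γ' a ha => ?_) a
      rw [Submodule.mem_comap]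
      change g.π (g.φ a) ∈ _
      -- Only components of first degree e contribute to φ(a), and there the factor D_γ is trivial.
      by_cases h : γ = 1
      · subst h
        obtain ⟨u, hu₁, hu⟩ := (G.units_mem.and (G.units_mul a)).exists
        refine subset_clspan' ⟨g.L' (star u), g.L_mem _, g.L' a, g.L_mem a, ?_⟩
        rw [g.adj_L_comp (G.one_mem_star hu₁), star_star, hu, D_one, map_one]
        rfl
      · rw [g.φ_deg ha h, π_zero]
        exact zero_mem _

theorem rep_ER (b : B) (x : A) : rep g.ER (g.π b) (g.Λν x) = g.Λν (ract (G.r b) x) := by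
  obtain ⟨c, hc⟩ := G.exists_right_base_unit x
  rw [← hc, ← R_apply, rep_apply g.isCBase g.isCModule_ER (g.π_mem b) (g.R_mem x), π_apply, R_apply,
    mul_comm, G.r_mul']

theorem rep_EL (b : B) (x : A) : rep g.EL (g.π b) (g.Λν x) = g.Λν (lact (G.r b) x) := by
  obtain ⟨c, hc⟩ := G.exists_base_unit {x}
  rw [← (hc x (Finset.mem_singleton_self _)).1, ← L_apply, rep_apply g.isCBase g.isCModule_EL
    (g.π_mem b) (g.L_mem x), π_apply, L_apply, G.r_mul]

/-- The map b ↦ ρ_E(b) is linear and contractive on 𝔅, so it maps limits of elements π(b) to limits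
of elements ρ_E(π(b)). -/
theorem rep_mem_clspan {E : Submodule ℂ (K →L[ℂ] L)} (hE : IsCModule g.base E) {b : K →L[ℂ] K}
    (hb : b ∈ g.base) : rep E b ∈ clspan (Set.range fun b : B => rep E (g.π b)) := by
  have h1 : ∀ c ∈ Submodule.span ℂ (Set.range g.π),
      c ∈ g.base ∧ rep E c ∈ clspan (Set.range fun b : B => rep E (g.π b)) := by
    intro c hc
    induction hc using Submodule.span_induction with
    | zero =>
      rw [← g.π_zero]
      exact ⟨g.π_mem _, subset_clspan' ⟨0, rfl⟩⟩
    | add x y _ _ hx hy =>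
      rw [rep_add g.isCBase hE hx.1 hy.1]
      exact ⟨add_mem hx.1 hy.1, add_mem hx.2 hy.2⟩
    | smul z x _ hx =>
      rw [rep_smul g.isCBase hE hx.1]
      exact ⟨Submodule.smul_mem _ _ hx.1, Submodule.smul_mem _ _ hx.2⟩
    | mem x hx =>
      obtain ⟨b, rfl⟩ := hx
      exact ⟨g.π_mem b, subset_clspan' ⟨b, rfl⟩⟩
  rw [← SetLike.mem_coe, ← (isClosed_clspan _).closure_eq, Metric.mem_closure_iff]
  intro ε hε
  obtain ⟨c, hc, hbc⟩ := Metric.mem_closure_iff.1 (show b ∈ closure _ from hb) ε hε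
  refine ⟨rep E c, (h1 c hc).2, lt_of_le_of_lt ?_ hbc⟩
  have h2 := rep_add g.isCBase hE (g.base.sub_mem hb (h1 c hc).1) (h1 c hc).1
  rw [sub_add_cancel] at h2
  rw [dist_eq_norm, dist_eq_norm, h2, add_sub_cancel_right]
  exact ContinuousLinearMap.opNorm_le_bound _ (norm_nonneg _)
    (rep_norm g.isCBase hE (g.base.sub_mem hb (h1 c hc).1))

/-- A criterion for compatibility. -/
theorem compat_of_apply {E : Submodule ℂ (K →L[ℂ] L)} (hE : IsCModule g.base E)
    {f : A → K →L[ℂ] L} {T : B → A → A} (h : ∀ x b, rep E (g.π b) ∘L f x = f (T b x))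
    (h' : ∀ x, ∃ b, T b x = x) : Compat g.base E (clspan (Set.range f)) := by
  refine le_antisymm (clspan_le (isClosed_clspan _) ?_) (clspan_le (isClosed_clspan _) ?_)
  · rintro _ ⟨b, hb, η, hη, rfl⟩
    refine comp_mem_of_clspan (isClosed_clspan _) ?_ (g.rep_mem_clspan hE hb) hη
    rintro _ ⟨b, rfl⟩ _ ⟨x, rfl⟩
    rw [h]
    exact subset_clspan' ⟨_, rfl⟩
  · rintro _ ⟨x, rfl⟩
    obtain ⟨b, hb⟩ := h' x
    exact subset_clspan' ⟨g.π b, g.π_mem b, f x, subset_clspan' ⟨x, rfl⟩, by rw [h, hb]⟩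

end Gns

end Gns

/-! ## The action of the square roots of the Radon-Nikodym derivatives -/

section Mult

variable {B : Type*} [NonUnitalCommRing B] [Module ℂ B] [IsScalarTower ℂ B B]
  [SMulCommClass ℂ B B]

theorem lact_mul_right (T : Mult B) (b c : B) : lact T (b * c) = b * lact T c := by
  rw [mul_comm, lact_mul, mul_comm]

theorem ract_eq_lact (hB : ∀ F : Finset B, ∃ u : B, ∀ b ∈ F, u * b = b) (T : Mult B) (b : B) :
    ract T b = lact T b := by
  classical
  obtain ⟨u, hu⟩ := hB {b, ract T b}
  rw [← hu (ract T b) (by simp), mul_comm, ract_mul, ← lact_mul_right, mul_comm, hu b (by simp)]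

end Mult

section SqrtCocycle

variable {Γ B : Type*} [Group Γ] [NonUnitalCommRing B] [Module ℂ B] [IsScalarTower ℂ B B]
  [SMulCommClass ℂ B B] [StarRing B] [StarModule ℂ B] {act : Γ →* (B ≃⋆ₐ[ℂ] B)}
  {A : Type*} [NonUnitalRing A] [Module ℂ A] [IsScalarTower ℂ A A] [SMulCommClass ℂ A A]
  [StarRing A] [StarModule ℂ A]

namespace EvAlgebra

variable (G : EvAlgebra act A)

theorem exists_base_unit' (x y : A) : ∃ b, lact (G.r b) x = x ∧ lact (G.r b) y = y := by
  classical
  obtain ⟨b, hb⟩ := G.exists_base_unit {x, y}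
  exact ⟨b, (hb x (by simp)).1, (hb y (by simp)).1⟩

/-- If b and b' both act as the identity on x, then r(T b)x and r(T b')x both equal r((T b)b')x, by
commutativity of B. -/
theorem rExt_aux (T : Mult B) {x : A} {b b' : B} (h : lact (G.r b) x = x)
    (h' : lact (G.r b') x = x) : lact (G.r (lact T b)) x = lact (G.r (lact T b')) x := by
  conv_lhs => rw [← h', ← G.r_mul, ← lact_mul]
  conv_rhs => rw [← h, ← G.r_mul, ← lact_mul, mul_comm]

/-- The extension of `r` to multipliers of `B`. -/
def rExt (T : Mult B) : A →ₗ[ℂ] A where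
  toFun x := lact (G.r (lact T (G.exists_base_unit' x x).choose)) x
  map_add' x y := by
    obtain ⟨b, hx, hy⟩ := G.exists_base_unit' x y
    rw [G.rExt_aux T (G.exists_base_unit' x x).choose_spec.1 hx,
      G.rExt_aux T (G.exists_base_unit' y y).choose_spec.1 hy,
      G.rExt_aux T (b' := b) (G.exists_base_unit' (x + y) (x + y)).choose_spec.1
        (by rw [map_add, hx, hy]), map_add]
  map_smul' z x := by
    obtain ⟨b, hx, -⟩ := G.exists_base_unit' x x
    rw [G.rExt_aux T (G.exists_base_unit' x x).choose_spec.1 hx,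
      G.rExt_aux T (b' := b) (G.exists_base_unit' (z • x) (z • x)).choose_spec.1
        (by rw [map_smul, hx]), map_smul, RingHom.id_apply]

theorem rExt_apply (T : Mult B) {x : A} {b : B} (h : lact (G.r b) x = x) :
    G.rExt T x = lact (G.r (lact T b)) x :=
  G.rExt_aux T (G.exists_base_unit' x x).choose_spec.1 h

theorem rExt_mem (T : Mult B) {γ γ' : Γ} {x : A} (hx : x ∈ G.gr γ γ') : G.rExt T x ∈ G.gr γ γ' :=
  G.r_mem hx _

theorem rExt_r (T : Mult B) (b : B) (x : A) : G.rExt T (lact (G.r b) x) = lact (G.r (lact T b)) x := by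
  obtain ⟨e, he, -⟩ := G.exists_base_unit' x x
  rw [G.rExt_apply T (b := e) (by rw [G.r_r, he]), ← G.r_mul, ← lact_mul, mul_comm, lact_mul,
    G.r_mul, he]

theorem rExt_map (T : Mult B) {f : A →ₗ[ℂ] A}
    (hf : ∀ b x, f (lact (G.r b) x) = lact (G.r b) (f x)) (x : A) :
    G.rExt T (f x) = f (G.rExt T x) := by
  obtain ⟨e, he, -⟩ := G.exists_base_unit' x x
  rw [G.rExt_apply T he, hf, G.rExt_apply T (b := e) (by rw [← hf, he])]

/-- A self-adjoint multiplier of the commutative algebra B acts through r as a self-adjoint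
multiplication. A common base unit e of x and y replaces the missing element r(T). -/
theorem star_rExt_mul (hB : ∀ F : Finset B, ∃ u : B, ∀ b ∈ F, u * b = b) {T : Mult B}
    (hT : star T = T) (x y : A) : star (G.rExt T x) * y = star x * G.rExt T y := by
  obtain ⟨e, hx, hy⟩ := G.exists_base_unit' x y
  have h1 : star (lact T e) = lact T (star e) := by rw [star_lact, hT, ract_eq_lact hB]
  have h2 : ∀ z, star x * lact (G.r (star e)) z = star x * z := fun z => by
    rw [← ract_mul, map_star G.r, ract_star, hx]
  rw [G.rExt_apply T hx, G.rExt_apply T hy, star_lact, ← map_star G.r, ract_mul, h1]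
  conv_lhs => rw [← hy, ← G.r_mul, ← lact_mul, lact_mul_right, G.r_mul, h2]

end EvAlgebra

variable (act) in
/-- `Dh` is a family of square roots of the cocycle `D`. -/
structure IsSqrt (Dh D : Γ → Mult B) : Prop where
  one : Dh 1 = 1
  star_eq : ∀ γ, star (Dh γ) = Dh γ
  sq : ∀ γ, Dh γ * Dh γ = D γ
  mul : ∀ γ γ' b, lact (Dh (γ * γ')) b = act γ'⁻¹ (lact (Dh γ) (act γ' (lact (Dh γ') b)))

/-- The cocycle identity for the pair γ, γ⁻¹, where D_e^{1/2} = 1: γ(D_γ^{1/2}) is inverse to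
D_{γ⁻¹}^{1/2}. -/
theorem IsSqrt.inv {Dh D : Γ → Mult B} (h : IsSqrt act Dh D) (γ : Γ) (b : B) :
    act γ (lact (Dh γ) (act γ⁻¹ (lact (Dh γ⁻¹) b))) = b := by
  have := h.mul γ γ⁻¹ b
  rw [mul_inv_cancel, h.one, inv_inv] at this
  exact this.symm

theorem act_inv_act (γ : Γ) (b : B) : act γ⁻¹ (act γ b) = b := by
  rw [map_inv]
  exact (act γ).symm_apply_apply b

theorem act_act_inv (γ : Γ) (b : B) : act γ (act γ⁻¹ b) = b := by
  rw [map_inv]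
  exact (act γ).apply_symm_apply b

theorem IsSqrt.inv_sq {Dh D : Γ → Mult B} (h : IsSqrt act Dh D) (γ : Γ) (b : B) :
    act γ (lact (D γ) (act γ⁻¹ (lact (D γ⁻¹) b))) = b := by
  rw [← h.sq, ← h.sq, lact_mult_mul, lact_mult_mul]
  have := h.inv γ (lact (Dh γ⁻¹) b)
  rw [← act_inv_act γ (lact (Dh γ) (act γ⁻¹ (lact (Dh γ⁻¹) (lact (Dh γ⁻¹) b)))), this, h.inv]

namespace EvAlgebra

variable (G : EvAlgebra act A) (Dh : Γ → Mult B) 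

/-- `D^{1/2}` -/
def DHalf : A →ₗ[ℂ] A := (Finsupp.lsum ℂ fun γ => G.rExt (Dh γ⁻¹)) ∘ₗ G.deg₁

variable {Dh}

theorem DHalf_apply {γ γ' : Γ} {x : A} (hx : x ∈ G.gr γ γ') :
    G.DHalf Dh x = G.rExt (Dh γ⁻¹) x := by
  rw [DHalf, LinearMap.comp_apply, G.deg₁_apply hx]
  exact Finsupp.sum_single_index (map_zero _)

theorem DHalf_mem {γ γ' : Γ} {x : A} (hx : x ∈ G.gr γ γ') : G.DHalf Dh x ∈ G.gr γ γ' := by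
  rw [G.DHalf_apply hx]
  exact G.rExt_mem _ hx

theorem DHalf_map {f : A →ₗ[ℂ] A} (hf : ∀ b x, f (lact (G.r b) x) = lact (G.r b) (f x))
    (hg : ∀ γ γ', ∀ x ∈ G.gr γ γ', f x ∈ G.gr γ γ') (x : A) :
    G.DHalf Dh (f x) = f (G.DHalf Dh x) :=
  G.hom_ext (f := G.DHalf Dh ∘ₗ f) (g := f ∘ₗ G.DHalf Dh) (fun γ γ' x hx => by
    rw [LinearMap.comp_apply, LinearMap.comp_apply, G.DHalf_apply hx, G.DHalf_apply (hg γ γ' x hx),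
      G.rExt_map _ hf]) x

theorem DHalf_r (b : B) (x : A) : G.DHalf Dh (lact (G.r b) x) = lact (G.r b) (G.DHalf Dh x) :=
  G.DHalf_map (fun c x => G.r_r b c x) (fun _ _ _ hx => G.r_mem hx b) x

theorem DHalf_s (b : B) (x : A) : G.DHalf Dh (lact (G.s b) x) = lact (G.s b) (G.DHalf Dh x) :=
  G.DHalf_map (fun c x => (G.r_s c b x).symm) (fun _ _ _ hx => G.s_mem hx b) x

theorem DHalf_ract_r (b : B) (x : A) : G.DHalf Dh (ract (G.r b) x) = ract (G.r b) (G.DHalf Dh x) :=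
  G.DHalf_map (fun c x => (G.lact_ract _ _ x).symm)
    (fun _ _ _ hx => by rw [G.r_twist hx]; exact G.r_mem hx _) x

theorem DHalf_ract_s (b : B) (x : A) : G.DHalf Dh (ract (G.s b) x) = ract (G.s b) (G.DHalf Dh x) :=
  G.DHalf_map (fun c x => (G.lact_ract _ _ x).symm)
    (fun _ _ _ hx => by rw [G.s_twist hx]; exact G.s_mem hx _) x

theorem DHalf_unit_mul {u : A} (hu : u ∈ G.gr 1 1) (x : A) :
    G.DHalf Dh (u * x) = u * G.DHalf Dh x :=
  G.DHalf_map (f := LinearMap.mulLeft ℂ u) (fun c x => G.mul_r hu c x) (fun _ _ _ hx => by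
    simpa using G.mul_mem hu hx) x

theorem DHalf_surjective {D : Γ → Mult B} (h : IsSqrt act Dh D) : Function.Surjective (G.DHalf Dh) := by
  intro x
  refine G.hom_mem (LinearMap.range (G.DHalf Dh)) (fun γ γ' x hx => ?_) x
  obtain ⟨b, hb, -⟩ := G.exists_base_unit' x x
  -- On first degree γ the map D^{1/2} is multiplication by r(D_{γ⁻¹}^{1/2}), whose inverse comes
  -- from γ(D_γ^{1/2}) by `IsSqrt.inv`. The local unit b makes this an element of B.
  refine ⟨lact (G.r (act γ (lact (Dh γ) (act γ⁻¹ b)))) x, ?_⟩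
  rw [G.DHalf_r, G.DHalf_apply hx, G.rExt_apply _ hb, ← G.r_mul]
  have : act γ (lact (Dh γ) (act γ⁻¹ b)) * lact (Dh γ⁻¹) b = b * b := by
    conv_rhs => rw [← h.inv γ (b * b)]
    rw [lact_mul_right, map_mul, lact_mul, map_mul, act_act_inv]
  rw [this, G.r_mul, hb, hb]

/-- Moving r(D_{δ⁻¹}^{1/2}) to the left past x of first degree γ twists it by γ. The cocycle
identity for δ⁻¹γ⁻¹ says that the two factors combine to D_{(γδ)⁻¹}^{1/2}. -/
theorem DHalf_mul {D : Γ → Mult B} (h : IsSqrt act Dh D) (x y : A) :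
    G.DHalf Dh (x * y) = G.DHalf Dh x * G.DHalf Dh y := by
  refine G.hom_ext (f := G.DHalf Dh ∘ₗ LinearMap.mulRight ℂ y)
    (g := LinearMap.mulRight ℂ (G.DHalf Dh y) ∘ₗ G.DHalf Dh) (fun γ γ' x hx => ?_) x
  refine G.hom_ext (f := G.DHalf Dh ∘ₗ LinearMap.mulLeft ℂ x)
    (g := LinearMap.mulLeft ℂ (G.DHalf Dh x) ∘ₗ G.DHalf Dh) (fun δ δ' y hy => ?_) y
  change G.DHalf Dh (x * y) = G.DHalf Dh x * G.DHalf Dh y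
  obtain ⟨b, hb₁, hb₂⟩ := G.exists_base_unit' x (x * y)
  obtain ⟨e, he, -⟩ := G.exists_base_unit' y y
  have h1 : lact (G.r (act γ e)) (x * y) = x * y := by
    rw [lact_mul, ← G.r_twist hx, ract_mul, he]
  rw [G.DHalf_apply hx, G.DHalf_apply hy, G.DHalf_apply (G.mul_mem hx hy), G.rExt_apply _ hb₁,
    G.rExt_apply _ he, G.rExt_apply _ hb₂, mul_inv_rev, h.mul, inv_inv, ← lact_mul, ← ract_mul,
    G.r_twist hx, ← lact_mul, ← G.r_mul]
  have key : ∀ c, act γ (lact (Dh δ⁻¹) (act γ⁻¹ c)) * act γ e = c * act γ (lact (Dh δ⁻¹) e) :=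
    fun c => by rw [← map_mul, ← lact_mul, lact_mul_right, map_mul, act_act_inv]
  rw [← key, G.r_mul, h1]

end EvAlgebra

namespace Gns

variable {G : EvAlgebra act A} {K L : Type*}
  [NormedAddCommGroup K] [InnerProductSpace ℂ K] [CompleteSpace K]
  [NormedAddCommGroup L] [InnerProductSpace ℂ L] [CompleteSpace L] (g : Gns G K L)

/-- `φ(x r(T) y) = γ(T γ⁻¹(φ(xy)))` -/
theorem φ_mul_rExt (T : Mult B) {γ γ' : Γ} {x : A} (hx : x ∈ G.gr γ γ') (y : A) :
    g.φ (x * G.rExt T y) = act γ (lact T (act γ⁻¹ (g.φ (x * y)))) := by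
  obtain ⟨e, he, -⟩ := G.exists_base_unit' y y
  have h1 : lact (G.r (act γ e)) (x * y) = x * y := by
    rw [lact_mul, ← G.r_twist hx, ract_mul, he]
  conv_rhs => rw [← h1, g.φ_left, map_mul, act_inv_act, lact_mul, map_mul, act_act_inv]
  rw [G.rExt_apply T he, ← ract_mul, G.r_twist hx, ← lact_mul, g.φ_left]

theorem μ_act_mul (γ : Γ) (b c : B) :
    g.μ (b * act γ (ract (g.D γ) c)) = g.μ (act γ⁻¹ b * c) := by
  rw [← g.μ_quasi_invariant γ (act γ⁻¹ b * c), mul_ract, map_mul (act γ), act_act_inv]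

end Gns

end SqrtCocycle

/-! ## The inner product computation behind the fundamental unitary -/

section Model

variable {Γ B : Type*} [Group Γ] [NonUnitalCommRing B] [Module ℂ B] [IsScalarTower ℂ B B]
  [SMulCommClass ℂ B B] [StarRing B] [StarModule ℂ B] {act : Γ →* (B ≃⋆ₐ[ℂ] B)}
  {A : Type*} [NonUnitalRing A] [Module ℂ A] [IsScalarTower ℂ A A] [SMulCommClass ℂ A A]
  [StarRing A] [StarModule ℂ A] {G : EvAlgebra act A}

theorem mulR1_add (x y : A) (w : A ⊗[ℂ] A) : mulR1 (x + y) w = mulR1 x w + mulR1 y w := by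
  have : LinearMap.mulRight ℂ (x + y) = LinearMap.mulRight ℂ x + LinearMap.mulRight ℂ y :=
    LinearMap.ext fun z => mul_add z x y
  rw [mulR1, this, LinearMap.rTensor_add]
  rfl

namespace EvAlgebra

variable (G)

theorem hom_induction {P : A → Prop} (hom : ∀ γ γ', ∀ x ∈ G.gr γ γ', P x)
    (add : ∀ x y, P x → P y → P (x + y)) (x : A) : P x := by
  have hx : x ∈ ⨆ p : Γ × Γ, G.gr p.1 p.2 := by rw [G.span_top]; trivial
  exact Submodule.iSup_induction (motive := P) (fun p : Γ × Γ => G.gr p.1 p.2) hx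
    (fun p x hx => hom p.1 p.2 x hx) (hom 1 1 0 (zero_mem _)) add

/-- No clause for scalars is needed, as they are absorbed into the first factor. This suits
sesquilinear identities, which are additive in each variable but conjugate-linear in one. -/
theorem matched_induction {P : A ⊗[ℂ] A → Prop}
    (tmul : ∀ γ γ' γ'', ∀ x ∈ G.gr γ γ', ∀ y ∈ G.gr γ' γ'', P (x ⊗ₜ y))
    (add : ∀ x y, P x → P y → P (x + y)) {w : A ⊗[ℂ] A} (hw : w ∈ G.matchedSpan) : P w := by
  have h0 : P 0 := by
    have := tmul 1 1 1 0 (zero_mem _) 0 (zero_mem _)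
    rwa [TensorProduct.zero_tmul] at this
  have h : ∀ z : ℂ, P (z • w) := by
    induction hw using Submodule.span_induction with
    | zero => intro z; rwa [smul_zero]
    | add x y _ _ hx hy => intro z; rw [smul_add]; exact add _ _ (hx z) (hy z)
    | smul c x _ hx => intro z; rw [smul_smul]; exact hx _
    | mem m hm =>
      obtain ⟨γ, γ'', γ', x, hx, y, hy, rfl⟩ := hm
      intro z
      rw [TensorProduct.smul_tmul']
      exact tmul _ _ _ _ (Submodule.smul_mem _ z hx) _ hy
  simpa using h 1

end EvAlgebra

namespace Core

variable (c : Core G) (K L : Type*)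
  [NormedAddCommGroup K] [InnerProductSpace ℂ K] [CompleteSpace K]
  [NormedAddCommGroup L] [InnerProductSpace ℂ L] [CompleteSpace L]

/-- The GNS-constructions that enter the construction of one of the fundamental unitaries. -/
structure Model where
  Λμ : B →ₗ[ℂ] K
  Λν : A →ₗ[ℂ] L
  inner_μ : ∀ b b', inner ℂ (Λμ b) (Λμ b') = c.μ (star b * b')
  inner_ν : ∀ x y, inner ℂ (Λν x) (Λν y) = c.μ (c.φ (star x * y))
  total_μ : Total Λμ
  total_ν : Total Λν
  bounded : ∀ b, ∃ C : ℝ, 0 ≤ C ∧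
    ∀ b', c.μ (star b' * star b * b * b') ≤ (C : ℂ) * c.μ (star b' * b')
  Dh : Γ → Mult B
  sqrt : IsSqrt act Dh c.D

namespace Model

variable {c K L} (m : c.Model K L)

/-- The GNS-construction of the left integral. -/
def φo : Gns G K L :=
  { c, m with }

/-- The GNS-construction of the right integral. -/
def ψo : Gns G.co K L where
  φ := c.ψ
  μ := c.μ
  D := c.D
  Λμ := m.Λμ
  Λν := m.Λν
  base_unit := c.base_unit
  φ_left := c.ψ_left
  φ_right := c.ψ_right
  φ_deg hx := c.ψ_deg hx
  φ_surjective := c.ψ_surjective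
  μ_faithful := c.μ_faithful
  μ_quasi_invariant := c.μ_quasi_invariant
  inner_μ := m.inner_μ
  inner_ν x y := by rw [m.inner_ν, c.ν_eq]
  total_μ := m.total_μ
  total_ν := m.total_ν
  bounded := m.bounded

/-- `Λ_φ` -/
abbrev φR (x : A) : K →L[ℂ] L := m.φo.R x
/-- `Λ_φ^†` -/
abbrev φL (x : A) : K →L[ℂ] L := m.φo.L' x
/-- `Λ_ψ` -/
abbrev ψR (x : A) : K →L[ℂ] L := m.ψo.R x
/-- `Λ_ψ^†` -/
abbrev ψL (x : A) : K →L[ℂ] L := m.ψo.L' x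
/-- `[π_μ(B)]` -/
abbrev 𝔟 : Submodule ℂ (K →L[ℂ] K) := m.φo.base
/-- `E_φ` -/
abbrev Eφ : Submodule ℂ (K →L[ℂ] L) := m.φo.ER
/-- `E_φ^†` -/
abbrev Eφd : Submodule ℂ (K →L[ℂ] L) := m.φo.EL
/-- `E_ψ` -/
abbrev Eψ : Submodule ℂ (K →L[ℂ] L) := m.ψo.ER
/-- `E_ψ^†` -/
abbrev Eψd : Submodule ℂ (K →L[ℂ] L) := m.ψo.EL

theorem φR_apply (x : A) (b : B) : m.φR x (m.Λμ b) = m.Λν (ract (G.r b) x) := m.φo.R_apply x b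

theorem φL_apply (x : A) (b : B) : m.φL x (m.Λμ b) = m.Λν (lact (G.r b) x) := m.φo.L_apply x b

theorem ψR_apply (x : A) (b : B) : m.ψR x (m.Λμ b) = m.Λν (ract (G.s b) x) := m.ψo.R_apply x b

theorem ψL_apply (x : A) (b : B) : m.ψL x (m.Λμ b) = m.Λν (lact (G.s b) x) := m.ψo.L_apply x b

theorem hB : IsCBase m.𝔟 := m.φo.isCBase

theorem hφR : IsCModule m.𝔟 m.Eφ := m.φo.isCModule_ER

theorem hφL : IsCModule m.𝔟 m.Eφd := m.φo.isCModule_EL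

theorem hψL : IsCModule m.𝔟 m.Eψd := m.ψo.isCModule_EL

theorem rep_φR (b : B) (x : A) : rep m.Eφ (m.φo.π b) (m.Λν x) = m.Λν (ract (G.r b) x) :=
  m.φo.rep_ER b x

theorem rep_φL (b : B) (x : A) : rep m.Eφd (m.φo.π b) (m.Λν x) = m.Λν (lact (G.r b) x) :=
  m.φo.rep_EL b x

theorem rep_ψL (b : B) (x : A) : rep m.Eψd (m.φo.π b) (m.Λν x) = m.Λν (lact (G.s b) x) :=
  m.ψo.rep_EL b x

theorem opK_ext {N : Type*} [NormedAddCommGroup N] [NormedSpace ℂ N] {S T : K →L[ℂ] N}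
    (h : ∀ b, S (m.Λμ b) = T (m.Λμ b)) : S = T := m.total_μ.ext_op h

/-- The three representations of 𝔅 are left multiplication by s(b), left multiplication by r(b) and
right multiplication by r(b). They commute, and each preserves the generators of the other two
modules and acts on them with local units. -/
theorem compatTriple : CompatTriple m.𝔟 m.Eψd m.Eφd m.Eφ where
  base := m.hB
  module_βh := m.hψL
  module_α := m.hφL
  module_β := m.hφR
  compat_βh_α := m.φo.compat_of_apply (T := fun b x => lact (G.s b) x) m.hψL
    (fun x b => m.opK_ext fun b' => by
      rw [ContinuousLinearMap.comp_apply, m.φL_apply, m.φL_apply, m.rep_ψL, G.r_s])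
    fun x => (G.exists_base_unit {x}).imp fun b hb => (hb x (by simp)).2
  compat_α_βh := m.φo.compat_of_apply (T := fun b x => lact (G.r b) x) m.hφL
    (fun x b => m.opK_ext fun b' => by
      rw [ContinuousLinearMap.comp_apply, m.ψL_apply, m.ψL_apply, m.rep_φL, G.r_s])
    fun x => (G.exists_base_unit {x}).imp fun b hb => (hb x (by simp)).1
  compat_βh_β := m.φo.compat_of_apply (T := fun b x => lact (G.s b) x) m.hψL
    (fun x b => m.opK_ext fun b' => by
      rw [ContinuousLinearMap.comp_apply, m.φR_apply, m.φR_apply, m.rep_ψL, G.lact_ract])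
    fun x => (G.exists_base_unit {x}).imp fun b hb => (hb x (by simp)).2
  compat_β_βh := m.φo.compat_of_apply (T := fun b x => ract (G.r b) x) m.hφR
    (fun x b => m.opK_ext fun b' => by
      rw [ContinuousLinearMap.comp_apply, m.ψL_apply, m.ψL_apply, m.rep_φR, G.lact_ract])
    fun x => G.exists_right_base_unit x
  compat_α_β := m.φo.compat_of_apply (T := fun b x => lact (G.r b) x) m.hφL
    (fun x b => m.opK_ext fun b' => by
      rw [ContinuousLinearMap.comp_apply, m.φR_apply, m.φR_apply, m.rep_φL, G.lact_ract])
    fun x => (G.exists_base_unit {x}).imp fun b hb => (hb x (by simp)).1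
  compat_β_α := m.φo.compat_of_apply (T := fun b x => ract (G.r b) x) m.hφR
    (fun x b => m.opK_ext fun b' => by
      rw [ContinuousLinearMap.comp_apply, m.φL_apply, m.φL_apply, m.rep_φR, G.lact_ract])
    fun x => G.exists_right_base_unit x

/-- `Λ_φ(x)` as an element of `E_φ` -/
def φE (x : A) : ↥m.Eφ := ⟨m.φR x, m.φo.R_mem x⟩

/-- `Λ_φ^†(x)` as an element of `E_φ^†` -/
def φd (x : A) : ↥m.Eφd := ⟨m.φL x, m.φo.L_mem x⟩

/-- `Λ_ψ^†(x)` as an element of `E_ψ^†` -/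
def ψd (x : A) : ↥m.Eψd := ⟨m.ψL x, m.ψo.L_mem x⟩

theorem φd_add (x y : A) : m.φd (x + y) = m.φd x + m.φd y := Subtype.ext (m.φo.Ll.map_add x y)

theorem ψd_add (x y : A) : m.ψd (x + y) = m.ψd x + m.ψd y := Subtype.ext (m.ψo.Ll.map_add x y)

theorem φd_smul (z : ℂ) (x : A) : m.φd (z • x) = z • m.φd x := Subtype.ext (m.φo.Ll.map_smul z x)

theorem ψd_smul (z : ℂ) (x : A) : m.ψd (z • x) = z • m.ψd x := Subtype.ext (m.ψo.Ll.map_smul z x)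

/-- The common domain `Λ_φ^†(x) ⊗ Λ_ν(y) = Λ_ν(x) ⊗ Λ_φ(y)` -/
theorem ket₂_φE (x y : A) : (ket₂ (m.φE y) (m.Λν x) : RTP m.Eφd m.Eφ) =
    ket₁ (m.φd x) (m.Λν y) := by
  obtain ⟨b₁, hb₁⟩ := G.exists_base_unit {x}
  obtain ⟨b₂, hb₂⟩ := G.exists_right_base_unit y
  classical
  obtain ⟨b, hb⟩ := c.base_unit {b₁, b₂}
  have h1 : lact (G.r b) x = x := by
    rw [← (hb₁ x (by simp)).1, ← G.r_mul, hb b₁ (by simp)]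
  have h2 : ract (G.r b) y = y := by
    rw [← hb₂, ← G.r_mul', mul_comm, hb b₂ (by simp)]
  have e1 : m.Λν x = (m.φd x).1 (m.Λμ b) := by rw [φd, m.φL_apply, h1]
  have e2 : m.Λν y = (m.φE y).1 (m.Λμ b) := by rw [φE, m.φR_apply, h2]
  conv_lhs => rw [e1, ket₂_apply' m.hB m.hφL m.hφR]
  rw [e2, ket₁_apply m.hB m.hφL m.hφR]

/-- `Λ_ψ^†(x) ⊗ Λ_ν(y) = Λ_ν(x) ⊗ Λ_φ^†(y)` -/
theorem ket₂_φd (x y : A) : (ket₂ (m.φd y) (m.Λν x) : RTP m.Eψd m.Eφd) =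
    ket₁ (m.ψd x) (m.Λν y) := by
  obtain ⟨b₁, hb₁⟩ := G.exists_base_unit {x}
  obtain ⟨b₂, hb₂⟩ := G.exists_base_unit {y}
  classical
  obtain ⟨b, hb⟩ := c.base_unit {b₁, b₂}
  have h1 : lact (G.s b) x = x := by
    rw [← (hb₁ x (by simp)).2, ← G.s_mul, hb b₁ (by simp)]
  have h2 : lact (G.r b) y = y := by
    rw [← (hb₂ y (by simp)).1, ← G.r_mul, hb b₂ (by simp)]
  have e1 : m.Λν x = (m.ψd x).1 (m.Λμ b) := by rw [ψd, m.ψL_apply, h1]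
  have e2 : m.Λν y = (m.φd y).1 (m.Λμ b) := by rw [φd, m.φL_apply, h2]
  conv_lhs => rw [e1, ket₂_apply' m.hB m.hψL m.hφL]
  rw [e2, ket₁_apply m.hB m.hψL m.hφL]

/-- `p ⊗ q ↦ Λ_ψ^†(p) ⊗ Λ_ν(q)` -/
def J : A ⊗[ℂ] A →ₗ[ℂ] RTP m.Eψd m.Eφd :=
  TensorProduct.lift (LinearMap.mk₂ ℂ (fun p q => ket₁ (m.ψd p) (m.Λν q))
    (fun p p' q => by rw [ψd_add, ket₁_add m.hB m.hψL m.hφL, add_apply])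
    (fun z p q => by rw [ψd_smul, ket₁_smul m.hB m.hψL m.hφL, smul_apply])
    (fun p q q' => by rw [map_add, map_add])
    fun z p q => by rw [map_smul, map_smul])

theorem J_tmul (p q : A) : m.J (p ⊗ₜ q) = ket₁ (m.ψd p) (m.Λν q) := rfl

theorem J_relLeft : G.relLeft ≤ LinearMap.ker m.J :=
  G.relLeft_le_ker fun p q b => by
    rw [J_tmul, J_tmul, ← m.rep_φL, ← ContinuousLinearMap.comp_apply,
      ← ket₁_balanced m.hB m.hψL m.hφL _ (m.φo.π_mem b)]
    congr 2
    exact Subtype.ext (m.ψo.L_comp_π p b).symm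

/-- `D^{1/2}` -/
abbrev D : A →ₗ[ℂ] A := G.DHalf m.Dh

/-- `p ⊗ q ↦ Λ_ψ^†(p) ⊗ Λ_ν(D^{1/2}(q))` -/
def JD : A ⊗[ℂ] A →ₗ[ℂ] RTP m.Eψd m.Eφd := m.J ∘ₗ m.D.lTensor A

theorem JD_tmul (p q : A) : m.JD (p ⊗ₜ q) = ket₁ (m.ψd p) (m.Λν (m.D q)) := rfl

theorem JD_relLeft : G.relLeft ≤ LinearMap.ker m.JD :=
  G.relLeft_le_ker fun p q b => by
    rw [JD, LinearMap.comp_apply, LinearMap.comp_apply, LinearMap.lTensor_tmul,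
      LinearMap.lTensor_tmul, G.DHalf_r, ← sub_eq_zero, ← map_sub]
    exact m.J_relLeft (Submodule.subset_span ⟨_, _, _, rfl⟩)

/-- The self-adjoint factor D_{β⁻¹}^{1/2} can be moved from one side of the inner product to the
other, where two of them make D_{β⁻¹}. For different first degrees both sides vanish. -/
theorem φ_D_D {β β' δ δ' : Γ} {q q' : A} (hq : q ∈ G.gr β β') (hq' : q' ∈ G.gr δ δ') :
    c.φ (star (m.D q) * m.D q') = act β⁻¹ (lact (c.D β⁻¹) (act β (c.φ (star q * q')))) := by
  by_cases h : β = δ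
  · subst h
    have key : ∀ y, c.φ (star q * G.rExt (m.Dh β⁻¹) y) =
        act β⁻¹ (lact (m.Dh β⁻¹) (act β (c.φ (star q * y)))) := fun y => by
      have := m.φo.φ_mul_rExt (m.Dh β⁻¹) (G.star_mem hq) y
      rwa [inv_inv] at this
    rw [D, G.DHalf_apply hq, G.DHalf_apply hq', G.star_rExt_mul c.base_unit (m.sqrt.star_eq _),
      key, key, act_act_inv, ← m.sqrt.sq, lact_mult_mul]
  · have h1 : c.φ (star q * q') = 0 := m.φo.φ_deg_eq hq hq' h
    have h2 : c.φ (star (m.D q) * m.D q') = 0 :=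
      m.φo.φ_deg_eq (G.DHalf_mem hq) (G.DHalf_mem hq') h
    rw [h1, h2]
    simp

/-- This is the purpose of D^{1/2}: the factor D_{β⁻¹} produced by `φ_D_D` is absorbed by
quasi-invariance of μ under β⁻¹. The factor D_ζ, which stems from the left module structure on the
first leg, is absorbed under ζ. No derivative remains. -/
theorem inner_JD_tmul {γ ζ β β' δ δ' : Γ} {p q p' q' : A} (hp : p ∈ G.gr γ ζ) (hq : q ∈ G.gr β β')
    (hq' : q' ∈ G.gr δ δ') : inner ℂ (m.JD (p ⊗ₜ q)) (m.JD (p' ⊗ₜ q')) =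
      c.μ (act ζ⁻¹ (act β (c.φ (star q * q'))) * c.ψ (star p * p')) := by
  rw [JD_tmul, JD_tmul, inner_ket₁ m.hB m.hψL m.hφL]
  change inner ℂ _ (rep m.Eφd (adj (m.ψo.L' p) ∘L m.ψo.L' p') _) = _
  rw [m.ψo.adj_L_comp (show p ∈ G.co.gr ζ γ from hp)]
  change inner ℂ _ (rep m.Eφd (m.φo.π (act ζ (ract (c.D ζ) (c.ψ (star p * p'))))) _) = _
  rw [m.rep_φL, m.inner_ν]
  set b := act ζ (ract (c.D ζ) (c.ψ (star p * p'))) with hb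
  have h1 : c.φ (star q * lact (G.r b) q') = act β⁻¹ b * c.φ (star q * q') := by
    rw [← ract_mul, G.r_twist (G.star_mem hq), ← lact_mul, c.φ_left]
  have h2 := m.φ_D_D hq (G.r_mem hq' b)
  rw [h1, map_mul (act β), act_act_inv, G.DHalf_r] at h2
  have h3 : ∀ X, c.μ (act β⁻¹ (lact (c.D β⁻¹) X)) = c.μ X := fun X => by
    rw [← ract_eq_lact c.base_unit, c.μ_quasi_invariant]
  rw [h2, h3, mul_comm, hb]
  exact m.φo.μ_act_mul ζ _ _

/-- For matched p ⊗ q the automorphisms for the degree of q and the second degree of p cancel,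
leaving a twist by the degree of x. This twist is undone by moving s(φ(q^*q')) past x^*. Replacing
μ∘ψ by μ∘φ, the inner product depends on w and w' only through w^*w'. -/
theorem inner_JD {w w' : A ⊗[ℂ] A} (hw : w ∈ G.matchedSpan) (hw' : w' ∈ G.matchedSpan) (x x' : A) :
    inner ℂ (m.JD (mulR1 x w)) (m.JD (mulR1 x' w')) =
      c.μ (c.φ (star x * c.invMap x' (star w * w'))) := by
  refine G.hom_induction (P := fun x => inner ℂ (m.JD (mulR1 x w)) (m.JD (mulR1 x' w')) =
      c.μ (c.φ (star x * c.invMap x' (star w * w')))) (fun ξ ξ' x hx => ?_) (fun x y h h' => ?_) x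
  swap
  · rw [mulR1_add, map_add, inner_add_left, h, h', star_add, add_mul, map_add, map_add]
  refine G.matched_induction (P := fun w => inner ℂ (m.JD (mulR1 x w)) (m.JD (mulR1 x' w')) =
      c.μ (c.φ (star x * c.invMap x' (star w * w')))) (fun γ ζ ζ' p hp q hq => ?_)
      (fun w₁ w₂ h h' => ?_) hw
  swap
  · rw [map_add, map_add, inner_add_left, h, h', star_add, add_mul, map_add, mul_add, map_add,
      map_add]
  refine G.matched_induction (P := fun w' => inner ℂ (m.JD (mulR1 x (p ⊗ₜ q)))
      (m.JD (mulR1 x' w')) = c.μ (c.φ (star x * c.invMap x' (star (p ⊗ₜ q) * w'))))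
      (fun δ θ θ' p' hp' q' hq' => ?_) (fun w₁ w₂ h h' => ?_) hw'
  swap
  · rw [map_add, map_add, inner_add_right, h, h', mul_add, map_add, mul_add, map_add, map_add]
  change inner ℂ (m.JD ((p * x) ⊗ₜ q)) (m.JD ((p' * x') ⊗ₜ q')) = _
  rw [m.inner_JD_tmul (G.mul_mem hp hx) hq hq', TensorProduct.star_tmul,
    Algebra.TensorProduct.tmul_mul_tmul, c.invMap_tmul, ← c.ν_eq, ← lact_mul, ← ract_mul,
    G.s_twist (G.star_mem hx), ← lact_mul, c.ψ_left, mul_inv_rev, star_mul, map_mul act, mul_assoc,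
    mul_assoc]
  change c.μ (act ξ'⁻¹ (act ζ⁻¹ (act ζ _)) * _) = _
  rw [act_inv_act]

theorem inner_ket {x y x' y' : A} : inner ℂ (ket₁ (m.φd x) (m.Λν y) : RTP m.Eφd m.Eφ)
    (ket₁ (m.φd x') (m.Λν y')) = c.μ (c.φ (star x * lact (G.r (c.φ (star y * y'))) x')) := by
  refine G.hom_induction (P := fun x => inner ℂ (ket₁ (m.φd x) (m.Λν y) : RTP m.Eφd m.Eφ)
    (ket₁ (m.φd x') (m.Λν y')) = c.μ (c.φ (star x * lact (G.r (c.φ (star y * y'))) x')))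
    (fun γ γ' x hx => ?_) (fun x₁ x₂ h h' => ?_) x
  swap
  · rw [φd_add, ket₁_add m.hB m.hφL m.hφR, add_apply, inner_add_left, h, h', star_add, add_mul,
      map_add, map_add]
  rw [inner_ket₁ m.hB m.hφL m.hφR]
  change inner ℂ _ (rep m.Eφ (adj (m.φo.L' x) ∘L m.φo.L' x') _) = _
  rw [m.φo.adj_L_comp hx]
  change inner ℂ _ (rep m.Eφ (m.φo.π (act γ (ract (c.D γ) (c.φ (star x * x'))))) _) = _
  rw [m.rep_φR, m.inner_ν, ← mul_ract, c.φ_right, ← ract_mul, G.r_twist (G.star_mem hx),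
    ← lact_mul, c.φ_left]
  exact m.φo.μ_act_mul γ _ _

/-- The isometry property: the product of the adjoint of Δ(y)(v ⊗ 1) with Δ(y')(v' ⊗ 1) is (v^* ⊗
1)Δ(y^*y')(v' ⊗ 1), and left invariance turns the slice by φ into r(φ(y^*y')). -/
theorem inner_JD_d1 {v v' x y x' y' : A} (hv : v ∈ G.gr 1 1) (hv' : v' ∈ G.gr 1 1)
    (hx : v * x = x) (hx' : v' * x' = x') :
    inner ℂ (m.JD (mulR1 x (c.d1 v y))) (m.JD (mulR1 x' (c.d1 v' y'))) =
      inner ℂ (ket₁ (m.φd x) (m.Λν y) : RTP m.Eφd m.Eφ) (ket₁ (m.φd x') (m.Λν y')) := by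
  have h1 : star (c.d1 v y) = c.l1 (star v) (star y) := by rw [c.l1_apply, star_star, star_star]
  rw [m.inner_JD (c.d1_mem v y) (c.d1_mem v' y'), h1,
    SModEq.lift_eq _ (bal_left (c.l1_mul_d1 (G.one_mem_star hv) hv' (star y) y'))
      (c.invMap_relLeft x'), c.invMap_mulL1 (G.one_mem_star hv), c.invMap_d1 hv' hx', inner_ket,
    ← mul_assoc, ← star_mul, hx]

end Model

end Core

end Model

/-! ## Generators of relative tensor products -/

section Generators

variable {K L M : Type*}
  [NormedAddCommGroup K] [InnerProductSpace ℂ K] [CompleteSpace K]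
  [NormedAddCommGroup L] [InnerProductSpace ℂ L] [CompleteSpace L]
  [NormedAddCommGroup M] [InnerProductSpace ℂ M] [CompleteSpace M]
  {𝔅 : Submodule ℂ (K →L[ℂ] K)} {E : Submodule ℂ (K →L[ℂ] L)} {F : Submodule ℂ (K →L[ℂ] M)}
  {ι κ : Type*}

/-- A closed subspace of E is closed in the space of all operators, since E is. So closed linear
conditions on E need only be checked on generators. -/
theorem mem_of_generators (hE : IsClosed (E : Set (K →L[ℂ] L))) {el : ι → ↥E}
    (hel : E ≤ clspan (Set.range fun i => (el i).1)) (S : Submodule ℂ ↥E)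
    (hS : IsClosed (S : Set ↥E)) (h : ∀ i, el i ∈ S) (ξ : ↥E) : ξ ∈ S := by
  have h1 : IsClosed ((S.map E.subtype : Submodule ℂ (K →L[ℂ] L)) : Set (K →L[ℂ] L)) := by
    rw [Submodule.map_coe]
    exact hE.isClosedEmbedding_subtypeVal.isClosedMap _ hS
  have h2 : clspan (Set.range fun i => (el i).1) ≤ S.map E.subtype :=
    clspan_le h1 (by rintro _ ⟨i, rfl⟩; exact ⟨el i, h i, rfl⟩)
  obtain ⟨ξ', h3, h4⟩ := h2 (hel ξ.2)
  rwa [← Subtype.ext h4]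

theorem total_ket₁_of_generators (hB : IsCBase 𝔅) (hE : IsCModule 𝔅 E) (hF : IsCModule 𝔅 F)
    {el : ι → ↥E} (hel : E ≤ clspan (Set.range fun i => (el i).1)) {v : κ → M} (hv : Total v) :
    Total fun p : ι × κ => (ket₁ (el p.1) (v p.2) : RTP E F) := by
  refine Total.of_closed fun S hS h => eq_top_iff.2 fun x _ => ?_
  refine (total_ket₁ hB hE hF).mem_closed S hS (fun p => ?_) x
  refine hv.mem_closed (S.comap (ket₁ p.1 : M →L[ℂ] RTP E F).toLinearMap)
    (hS.preimage (ket₁ p.1 : M →L[ℂ] RTP E F).continuous) (fun j => ?_) p.2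
  refine mem_of_generators hE.closed hel
    (S.comap ((ContinuousLinearMap.apply ℂ (RTP E F) (v j)).toLinearMap ∘ₗ ketLin₁ hB hE hF))
    (hS.preimage ((ContinuousLinearMap.apply ℂ (RTP E F) (v j)).continuous.comp
      (continuous_ket₁ hB hE hF))) (fun i => h (i, j)) p.1

theorem ketSp₁_eq (hB : IsCBase 𝔅) (hE : IsCModule 𝔅 E) (hF : IsCModule 𝔅 F)
    {el : ι → ↥E} (hel : E ≤ clspan (Set.range fun i => (el i).1)) (g : κ → K →L[ℂ] M) :
    ketSp₁ E F (clspan (Set.range g)) =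
      clspan (Set.range fun p : ι × κ => (ket₁ (el p.1) : M →L[ℂ] RTP E F) ∘L g p.2) := by
  refine le_antisymm (clspan_le (isClosed_clspan _) ?_) (clspan_le (isClosed_clspan _) ?_)
  · rintro _ ⟨ξ, t, ht, rfl⟩
    refine CompatTriple.comp_mem_clspan _ ?_ ht
    rintro _ ⟨j, rfl⟩
    let ev : (M →L[ℂ] RTP E F) →L[ℂ] (K →L[ℂ] RTP E F) :=
      (ContinuousLinearMap.compL ℂ K M (RTP E F)).flip (g j)
    refine mem_of_generators hE.closed hel
      (Submodule.comap (ev.toLinearMap ∘ₗ ketLin₁ hB hE hF) (clspan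
        (Set.range fun p : ι × κ => (ket₁ (el p.1) : M →L[ℂ] RTP E F) ∘L g p.2)))
      ((isClosed_clspan _).preimage (ev.continuous.comp (continuous_ket₁ hB hE hF)))
      (fun i => subset_clspan' ⟨(i, j), rfl⟩) ξ
  · rintro _ ⟨p, rfl⟩
    exact subset_clspan' ⟨el p.1, g p.2, subset_clspan' ⟨p.2, rfl⟩, rfl⟩

end Generators

section Generators₂

variable {K L : Type*}
  [NormedAddCommGroup K] [InnerProductSpace ℂ K] [CompleteSpace K]
  [NormedAddCommGroup L] [InnerProductSpace ℂ L] [CompleteSpace L]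
  {𝔅 : Submodule ℂ (K →L[ℂ] K)} {E : Submodule ℂ (K →L[ℂ] L)} {F : Submodule ℂ (K →L[ℂ] L)}
  {ι κ : Type*}

theorem ketSp₂_eq (hB : IsCBase 𝔅) (hE : IsCModule 𝔅 E) (hF : IsCModule 𝔅 F)
    {el : ι → ↥F} (hel : F ≤ clspan (Set.range fun i => (el i).1)) (g : κ → K →L[ℂ] L) :
    ketSp₂ E F (clspan (Set.range g)) =
      clspan (Set.range fun p : ι × κ => (ket₂ (el p.1) : L →L[ℂ] RTP E F) ∘L g p.2) := by
  refine le_antisymm (fun T hT => ?_) (clspan_le (isClosed_clspan _) ?_)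
  · have hT' : T ∈ (ketSp₂ E F (clspan (Set.range g)) : Set (K →L[ℂ] RTP E F)) := hT
    rw [← CompatTriple.imgSp_flip₁ hB hF hE, ketSp₁_eq hB hF hE hel g] at hT'
    obtain ⟨s, hs, rfl⟩ := hT'
    refine CompatTriple.comp_mem_clspan _ ?_ hs
    rintro _ ⟨p, rfl⟩
    refine subset_clspan' ⟨p, ContinuousLinearMap.ext fun x => ?_⟩
    exact (rtpFlip_ket₁ hB hF hE (el p.1) (g p.2 x)).symm
  · rintro _ ⟨p, rfl⟩
    exact subset_clspan' ⟨el p.1, g p.2, subset_clspan' ⟨p.2, rfl⟩, rfl⟩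

end Generators₂

/-! ## The fundamental unitary -/

section Unitary

variable {Γ B : Type*} [Group Γ] [NonUnitalCommRing B] [Module ℂ B] [IsScalarTower ℂ B B]
  [SMulCommClass ℂ B B] [StarRing B] [StarModule ℂ B] {act : Γ →* (B ≃⋆ₐ[ℂ] B)}
  {A : Type*} [NonUnitalRing A] [Module ℂ A] [IsScalarTower ℂ A A] [SMulCommClass ℂ A A]
  [StarRing A] [StarModule ℂ A] {G : EvAlgebra act A}

namespace Core.Model

variable {c : Core G} {K L : Type*}
  [NormedAddCommGroup K] [InnerProductSpace ℂ K] [CompleteSpace K]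
  [NormedAddCommGroup L] [InnerProductSpace ℂ L] [CompleteSpace L] (m : c.Model K L)

theorem φE_gen : m.Eφ ≤ clspan (Set.range fun x => (m.φE x).1) := le_rfl

theorem φd_gen : m.Eφd ≤ clspan (Set.range fun x => (m.φd x).1) := le_rfl

theorem ψd_gen : m.Eψd ≤ clspan (Set.range fun x => (m.ψd x).1) := le_rfl

theorem JD_eq_sum {p q : A} {n : ℕ} {x y : Fin n → A} {u : A}
    (h : (∑ i, mulR1 (x i) (c.d1 u (y i))) ≡ p ⊗ₜ[ℂ] q [SMOD G.relLeft]) (f : A ⊗[ℂ] A →ₗ[ℂ] A ⊗[ℂ] A)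
    (hf : G.relLeft ≤ G.relLeft.comap f) :
    m.JD (f (p ⊗ₜ q)) = ∑ i, m.JD (f (mulR1 (x i) (c.d1 u (y i)))) := by
  rw [← map_sum, ← map_sum]
  exact (SModEq.lift_eq m.JD (SModEq.mapTo f h hf) m.JD_relLeft).symm

theorem exists_unit (x : A) : ∃ v ∈ G.gr 1 1, v * x = x := by
  obtain ⟨v, hv, h⟩ := G.exists_left_unit {x}
  exact ⟨v, hv, h x (Finset.mem_singleton_self x)⟩

/-- The given total family and its image have the same Gram matrix by `inner_JD_d1`. The image is
total by `exists_T4` and surjectivity of D^{1/2}. -/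
theorem exists_U : ∃ U : RTP m.Eφd m.Eφ ≃ₗᵢ[ℂ] RTP m.Eψd m.Eφd, ∀ {v x} (_ : v ∈ G.gr 1 1)
    (_ : v * x = x) (y : A), U (ket₁ (m.φd x) (m.Λν y)) = m.JD (mulR1 x (c.d1 v y)) := by
  choose w hw hwx using exists_unit (G := G)
  have h1 : Total fun p : A × A => m.JD (mulR1 p.1 (c.d1 (w p.1) p.2)) := by
    refine Total.of_closed fun S hS h => eq_top_iff.2 fun z _ => ?_
    refine (total_ket₁_of_generators m.hB m.hψL m.hφL m.ψd_gen m.total_ν).mem_closed S hS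
      (fun p => ?_) z
    -- The generic vector is written with D^{1/2}(q) in the second leg, so that it is the image
    -- under `JD` of p ⊗ q, which is a sum of elements Δ(y)(x ⊗ 1).
    obtain ⟨q, hq⟩ := G.DHalf_surjective m.sqrt p.2
    obtain ⟨n, x, y, u, hu, hux, hs⟩ := c.exists_T4 p.1 q
    have h2 := m.JD_eq_sum hs LinearMap.id le_rfl
    have h3 : m.JD (p.1 ⊗ₜ q) ∈ S := by
      simp only [LinearMap.id_apply] at h2
      rw [h2]
      refine S.sum_mem fun i _ => ?_
      rw [SModEq.lift_eq m.JD (c.d1_congr hu (hw (x i)) (hux i) (hwx (x i)) (y i)) m.JD_relLeft]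
      exact h (x i, y i)
    rw [m.JD_tmul] at h3
    rwa [← hq]
  obtain ⟨U, hU⟩ := Total.exists_unitary
    (total_ket₁_of_generators m.hB m.hφL m.hφR m.φd_gen m.total_ν) h1 fun p q =>
      m.inner_JD_d1 (hw p.1) (hw q.1) (hwx p.1) (hwx q.1)
  refine ⟨U, fun {v x} hv hx y => ?_⟩
  rw [hU (x, y)]
  exact SModEq.lift_eq m.JD (c.d1_congr (hw x) hv (hwx x) hx y) m.JD_relLeft

/-- The inverse of the fundamental unitary, `Λ_ν(x) ⊗ Λ_ν(y) ↦ ∑ Λ_ν(y₁ x) ⊗ Λ_ν(D^{1/2}(y₂))`. -/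
def U : RTP m.Eφd m.Eφ ≃ₗᵢ[ℂ] RTP m.Eψd m.Eφd := m.exists_U.choose

theorem U_apply {v x : A} (hv : v ∈ G.gr 1 1) (hx : v * x = x) (y : A) :
    m.U (ket₁ (m.φd x) (m.Λν y)) = m.JD (mulR1 x (c.d1 v y)) :=
  m.exists_U.choose_spec hv hx y

/-- The common form of the six relations. A generator depends on b through multiplications X, Y on
the two factors of the domain and P, Q on those of the range, and `key` says Δ(Y_b y)(X_b x ⊗ 1) =
(P_b ⊗ Q_b)(Δ(y)(x ⊗ 1)). As P and Q do not interfere with D^{1/2}, a generator is mapped to a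
finite sum of generators, and `exists_T4` gives the same for the inverse. -/
theorem imgSp_U {X Y P Q : B → A →ₗ[ℂ] A} {T : A × A → K →L[ℂ] RTP m.Eφd m.Eφ}
    {T' : A × A → K →L[ℂ] RTP m.Eψd m.Eφd}
    (hT : ∀ x y b, T (x, y) (m.Λμ b) = ket₁ (m.φd (X b x)) (m.Λν (Y b y)))
    (hT' : ∀ p q b, T' (p, q) (m.Λμ b) = m.J (P b p ⊗ₜ Q b q))
    (hD : ∀ b q, m.D (Q b q) = Q b (m.D q))
    (hP : ∀ b b' p, P b (lact (G.s b') p) = lact (G.s b') (P b p))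
    (hQ : ∀ b b' q, Q b (lact (G.r b') q) = lact (G.r b') (Q b q))
    (hX : ∀ v ∈ G.gr 1 1, ∀ b x, v * X b x = X b (v * x))
    (key : ∀ v ∈ G.gr 1 1, ∀ b x y, mulR1 (X b x) (c.d1 v (Y b y)) ≡
      TensorProduct.map (P b) (Q b) (mulR1 x (c.d1 v y)) [SMOD G.relLeft]) :
    imgSp m.U (clspan (Set.range T)) = clspan (Set.range T') := by
  have hU : ∀ v ∈ G.gr 1 1, ∀ x, v * x = x → ∀ y b, m.U (T (x, y) (m.Λμ b)) =
      m.JD (TensorProduct.map (P b) (Q b) (mulR1 x (c.d1 v y))) := fun v hv x hx y b => by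
    rw [hT, m.U_apply hv (by rw [hX v hv, hx]),
      SModEq.lift_eq m.JD (key v hv b x y) m.JD_relLeft]
  have hmap : ∀ b, G.relLeft ≤ G.relLeft.comap (TensorProduct.map (P b) (Q b)) := fun b =>
    G.relLeft_le fun x y b' => Submodule.subset_span ⟨P b x, Q b y, b', by
      rw [map_sub, TensorProduct.map_tmul, TensorProduct.map_tmul, hP, hQ]⟩
  refine CompatTriple.imgSp_clspan ?_ ?_
  · rintro _ ⟨⟨x, y⟩, rfl⟩
    obtain ⟨v, hv, hx⟩ := exists_unit (G := G) x
    obtain ⟨n, p, q, hpq⟩ := exists_fin_sum (mulR1 x (c.d1 v y))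
    have : m.U.toContinuousLinearEquiv.toContinuousLinearMap ∘L T (x, y) =
        ∑ i, T' (p i, m.D (q i)) := m.opK_ext fun b => by
      rw [sum_apply]
      change m.U (T (x, y) (m.Λμ b)) = _
      rw [hU v hv x hx, hpq, map_sum, map_sum]
      refine Finset.sum_congr rfl fun i _ => ?_
      rw [hT', TensorProduct.map_tmul, JD_tmul, hD, J_tmul]
    rw [this]
    exact Submodule.sum_mem _ fun i _ => subset_clspan' ⟨_, rfl⟩
  · rintro _ ⟨⟨p, q⟩, rfl⟩
    obtain ⟨q₀, rfl⟩ := G.DHalf_surjective m.sqrt q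
    obtain ⟨n, x, y, u, hu, hux, hs⟩ := c.exists_T4 p q₀
    have : m.U.symm.toContinuousLinearEquiv.toContinuousLinearMap ∘L T' (p, m.D q₀) =
        ∑ i, T (x i, y i) := m.opK_ext fun b => by
      rw [sum_apply]
      change m.U.symm (T' (p, m.D q₀) (m.Λμ b)) = _
      rw [LinearIsometryEquiv.symm_apply_eq, map_sum, hT', ← hD, J_tmul, ← JD_tmul,
        ← TensorProduct.map_tmul, m.JD_eq_sum hs _ (hmap b)]
      exact Finset.sum_congr rfl fun i _ => (hU u hu (x i) (hux i) (y i) b).symm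
    rw [this]
    exact Submodule.sum_mem _ fun i _ => subset_clspan' ⟨_, rfl⟩

theorem map_mulR1 {P Q : A →ₗ[ℂ] A} {x : A} (hP : ∀ p, P (p * x) = P p * x) (w : A ⊗[ℂ] A) :
    TensorProduct.map P Q (mulR1 x w) = mulR1 x (TensorProduct.map P Q w) := by
  induction w with
  | zero => simp
  | add p q hp hq => simp only [map_add, hp, hq]
  | tmul p q => simp [mulR1, hP]

theorem map_mulR1' {P : A →ₗ[ℂ] A} {x : A} (hP : ∀ p, P (p * x) = p * P x) (w : A ⊗[ℂ] A) :
    TensorProduct.map P LinearMap.id (mulR1 x w) = mulR1 (P x) w := by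
  induction w with
  | zero => simp
  | add p q hp hq => simp only [map_add, hp, hq]
  | tmul p q => simp [mulR1, hP]

/-- The element s(b) to the left of x stands between Δ(y) and x in the first leg; balancing for
right multiplication moves it to r(b) on the right of the second leg. -/
theorem imgSp_βh_β : imgSp m.U (ketSp₂ m.Eφd m.Eφ m.Eψd) = ketSp₁ m.Eψd m.Eφd m.Eφ := by
  refine (congrArg (imgSp m.U ·) (ketSp₂_eq m.hB m.hφL m.hφR m.φE_gen m.ψL)).trans
    (Eq.trans ?_ (congrArg (fun S : Submodule ℂ _ => (S : Set (K →L[ℂ] RTP m.Eψd m.Eφd)))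
      (ketSp₁_eq m.hB m.hψL m.hφL m.ψd_gen m.φR).symm))
  have := (Equiv.prodComm A A).surjective.range_comp
    (fun p : A × A => (ket₂ (m.φE p.1) : L →L[ℂ] RTP m.Eφd m.Eφ) ∘L m.ψL p.2)
  rw [← this]
  refine m.imgSp_U (X := fun b => lact (G.s b)) (Y := fun _ => LinearMap.id)
    (P := fun _ => LinearMap.id) (Q := fun b => ract (G.r b)) (fun x y b => ?_) (fun p q b => ?_)
    (fun b q => G.DHalf_ract_r b q) (fun _ _ _ => rfl) (fun b b' q => (G.lact_ract _ _ q).symm)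
    (fun v hv b x => G.mul_s hv b x) fun v hv b x y => ?_
  · exact (congrArg _ (m.ψL_apply x b)).trans (m.ket₂_φE _ _)
  · exact congrArg _ (m.φR_apply q b)
  · refine G.matched_induction (P := fun w => mulR1 (lact (G.s b) x) w ≡
      TensorProduct.map LinearMap.id (ract (G.r b)) (mulR1 x w) [SMOD G.relLeft])
      (fun γ ζ ζ' p hp q hq => ?_) (fun _ _ h h' => ?_) (c.d1_mem v y)
    · refine SModEq.sub_mem.2 (Submodule.subset_span ⟨p * x, q, act ζ b, ?_⟩)
      simp only [mulR1, LinearMap.rTensor_tmul, LinearMap.mulRight_apply, TensorProduct.map_tmul,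
        LinearMap.id_apply]
      rw [← ract_mul, G.s_twist hp, lact_mul, G.r_twist hq]
    · simpa only [map_add] using h.add h'

theorem imgSp_α_β : imgSp m.U (ketSp₂ m.Eφd m.Eφ m.Eφ) = ketSp₂ m.Eψd m.Eφd m.Eφ := by
  refine (congrArg (imgSp m.U ·) (ketSp₂_eq m.hB m.hφL m.hφR m.φE_gen m.φR)).trans
    (Eq.trans ?_ (congrArg (fun S : Submodule ℂ _ => (S : Set (K →L[ℂ] RTP m.Eψd m.Eφd)))
      (ketSp₂_eq m.hB m.hψL m.hφL m.φd_gen m.φR).symm))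
  rw [← (Equiv.prodComm A A).surjective.range_comp
    (fun p : A × A => (ket₂ (m.φE p.1) : L →L[ℂ] RTP m.Eφd m.Eφ) ∘L m.φR p.2),
    ← (Equiv.prodComm A A).surjective.range_comp
    (fun p : A × A => (ket₂ (m.φd p.1) : L →L[ℂ] RTP m.Eψd m.Eφd) ∘L m.φR p.2)]
  refine m.imgSp_U (X := fun b => ract (G.r b)) (Y := fun _ => LinearMap.id)
    (P := fun b => ract (G.r b)) (Q := fun _ => LinearMap.id) (fun x y b => ?_) (fun p q b => ?_)
    (fun _ _ => rfl) (fun b b' q => (G.lact_ract _ _ q).symm) (fun _ _ _ => rfl)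
    (fun v hv b x => (mul_ract _ _ _).symm) fun v hv b x y => ?_
  · exact (congrArg _ (m.φR_apply x b)).trans (m.ket₂_φE _ _)
  · exact (congrArg _ (m.φR_apply p b)).trans (m.ket₂_φd _ _)
  · rw [map_mulR1' fun p => mul_ract _ _ _]
    rfl

theorem imgSp_α_ψ : imgSp m.U (ketSp₂ m.Eφd m.Eφ m.Eψ) = ketSp₂ m.Eψd m.Eφd m.Eψ := by
  refine (congrArg (imgSp m.U ·) (ketSp₂_eq m.hB m.hφL m.hφR m.φE_gen m.ψR)).trans
    (Eq.trans ?_ (congrArg (fun S : Submodule ℂ _ => (S : Set (K →L[ℂ] RTP m.Eψd m.Eφd)))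
      (ketSp₂_eq m.hB m.hψL m.hφL m.φd_gen m.ψR).symm))
  rw [← (Equiv.prodComm A A).surjective.range_comp
    (fun p : A × A => (ket₂ (m.φE p.1) : L →L[ℂ] RTP m.Eφd m.Eφ) ∘L m.ψR p.2),
    ← (Equiv.prodComm A A).surjective.range_comp
    (fun p : A × A => (ket₂ (m.φd p.1) : L →L[ℂ] RTP m.Eψd m.Eφd) ∘L m.ψR p.2)]
  refine m.imgSp_U (X := fun b => ract (G.s b)) (Y := fun _ => LinearMap.id)
    (P := fun b => ract (G.s b)) (Q := fun _ => LinearMap.id) (fun x y b => ?_) (fun p q b => ?_)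
    (fun _ _ => rfl) (fun b b' q => (G.lact_ract _ _ q).symm) (fun _ _ _ => rfl)
    (fun v hv b x => (mul_ract _ _ _).symm) fun v hv b x y => ?_
  · exact (congrArg _ (m.ψR_apply x b)).trans (m.ket₂_φE _ _)
  · exact (congrArg _ (m.ψR_apply p b)).trans (m.ket₂_φd _ _)
  · rw [map_mulR1' fun p => mul_ract _ _ _]
    rfl

theorem imgSp_α_α : imgSp m.U (ketSp₁ m.Eφd m.Eφ m.Eφd) = ketSp₂ m.Eψd m.Eφd m.Eφd := by
  refine (congrArg (imgSp m.U ·) (ketSp₁_eq m.hB m.hφL m.hφR m.φd_gen m.φL)).trans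
    (Eq.trans ?_ (congrArg (fun S : Submodule ℂ _ => (S : Set (K →L[ℂ] RTP m.Eψd m.Eφd)))
      (ketSp₂_eq m.hB m.hψL m.hφL m.φd_gen m.φL).symm))
  rw [← (Equiv.prodComm A A).surjective.range_comp
    (fun p : A × A => (ket₂ (m.φd p.1) : L →L[ℂ] RTP m.Eψd m.Eφd) ∘L m.φL p.2)]
  refine m.imgSp_U (X := fun _ => LinearMap.id) (Y := fun b => lact (G.r b))
    (P := fun b => lact (G.r b)) (Q := fun _ => LinearMap.id) (fun x y b => ?_) (fun p q b => ?_)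
    (fun _ _ => rfl) (fun b b' q => G.r_s _ _ q) (fun _ _ _ => rfl)
    (fun _ _ _ _ => rfl) fun v hv b x y => ?_
  · exact congrArg _ (m.φL_apply y b)
  · exact (congrArg _ (m.φL_apply p b)).trans (m.ket₂_φd _ _)
  · rw [map_mulR1 fun p => lact_mul _ _ _]
    exact SModEq.mapTo (mulR1 x) (bal_left (c.d1_r hv b y)) (G.relLeft_mulR1 x)

theorem imgSp_βh_βh : imgSp m.U (ketSp₁ m.Eφd m.Eφ m.Eψd) = ketSp₁ m.Eψd m.Eφd m.Eψd := by
  refine (congrArg (imgSp m.U ·) (ketSp₁_eq m.hB m.hφL m.hφR m.φd_gen m.ψL)).trans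
    (Eq.trans ?_ (congrArg (fun S : Submodule ℂ _ => (S : Set (K →L[ℂ] RTP m.Eψd m.Eφd)))
      (ketSp₁_eq m.hB m.hψL m.hφL m.ψd_gen m.ψL).symm))
  refine m.imgSp_U (X := fun _ => LinearMap.id) (Y := fun b => lact (G.s b))
    (P := fun _ => LinearMap.id) (Q := fun b => lact (G.s b)) (fun x y b => ?_) (fun p q b => ?_)
    (fun b q => G.DHalf_s b q) (fun _ _ _ => rfl) (fun b b' q => (G.r_s _ _ q).symm)
    (fun _ _ _ _ => rfl) fun v hv b x y => ?_
  · exact congrArg _ (m.ψL_apply y b)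
  · exact congrArg _ (m.ψL_apply q b)
  · rw [map_mulR1 fun p => rfl]
    exact SModEq.mapTo (mulR1 x) (bal_left (c.d1_s hv b y)) (G.relLeft_mulR1 x)

/-- On second degree γ'' right multiplication by s(b) is left multiplication by s(γ''(b)). Since Δ
preserves this degree, the rule for left multiplication carries over. -/
theorem d1_ract_s {v : A} (hv : v ∈ G.gr 1 1) (b : B) (y : A) :
    c.d1 v (ract (G.s b) y) ≡ (ract (G.s b)).lTensor A (c.d1 v y) [SMOD G.relLeft] := by
  have hrel : ∀ T : Mult A, (∀ b q, lact T (lact (G.r b) q) = lact (G.r b) (lact T q)) →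
      G.relLeft ≤ G.relLeft.comap ((lact T).lTensor A) := fun T h =>
    G.relLeft_le fun p q b' => Submodule.subset_span ⟨p, lact T q, b', by
      rw [map_sub, LinearMap.lTensor_tmul, LinearMap.lTensor_tmul, h]⟩
  have hrel' : G.relLeft ≤ G.relLeft.comap ((ract (G.s b)).lTensor A) :=
    G.relLeft_le fun p q b' => Submodule.subset_span ⟨p, ract (G.s b) q, b', by
      rw [map_sub, LinearMap.lTensor_tmul, LinearMap.lTensor_tmul, ← G.lact_ract]⟩
  refine G.hom_induction (P := fun y => c.d1 v (ract (G.s b) y) ≡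
    (ract (G.s b)).lTensor A (c.d1 v y) [SMOD G.relLeft]) (fun γ γ'' y hy => ?_)
    (fun _ _ h h' => by simpa only [map_add] using h.add h') y
  obtain ⟨t, ht, hyt⟩ := c.d1_deg hv hy
  rw [G.s_twist hy]
  refine (bal_left (c.d1_s hv _ y)).trans
    ((SModEq.mapTo _ (bal_left hyt) (hrel _ fun b q => (G.r_s _ _ q).symm)).trans
      (Eq.trans ?_ (SModEq.mapTo _ (bal_left hyt) hrel').symm))
  congr 1
  refine LinearMap.eqOn_span (f := (lact (G.s (act γ'' b))).lTensor A)
    (g := (ract (G.s b)).lTensor A) ?_ ht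
  rintro _ ⟨γ', p, hp, q, hq, rfl⟩
  rw [LinearMap.lTensor_tmul, LinearMap.lTensor_tmul, G.s_twist hq]

theorem imgSp_βh_ψ : imgSp m.U (ketSp₁ m.Eφd m.Eφ m.Eψ) = ketSp₁ m.Eψd m.Eφd m.Eψ := by
  refine (congrArg (imgSp m.U ·) (ketSp₁_eq m.hB m.hφL m.hφR m.φd_gen m.ψR)).trans
    (Eq.trans ?_ (congrArg (fun S : Submodule ℂ _ => (S : Set (K →L[ℂ] RTP m.Eψd m.Eφd)))
      (ketSp₁_eq m.hB m.hψL m.hφL m.ψd_gen m.ψR).symm))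
  refine m.imgSp_U (X := fun _ => LinearMap.id) (Y := fun b => ract (G.s b))
    (P := fun _ => LinearMap.id) (Q := fun b => ract (G.s b)) (fun x y b => ?_) (fun p q b => ?_)
    (fun b q => G.DHalf_ract_s b q) (fun _ _ _ => rfl) (fun b b' q => (G.lact_ract _ _ q).symm)
    (fun _ _ _ _ => rfl) fun v hv b x y => ?_
  · exact congrArg _ (m.ψR_apply y b)
  · exact congrArg _ (m.ψR_apply q b)
  · rw [map_mulR1 fun p => rfl]
    exact SModEq.mapTo (mulR1 x) (d1_ract_s hv b y) (G.relLeft_mulR1 x)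

theorem intertwines : Intertwines m.U.symm where
  α_α := CompatTriple.imgSp_symm m.imgSp_α_α
  βh_β := CompatTriple.imgSp_symm m.imgSp_βh_β
  βh_βh := CompatTriple.imgSp_symm m.imgSp_βh_βh
  α_β := CompatTriple.imgSp_symm m.imgSp_α_β

end Core.Model

end Unitary

/-! ## Regularity -/

section Slices

variable {K L : Type*}
  [NormedAddCommGroup K] [InnerProductSpace ℂ K] [CompleteSpace K]
  [NormedAddCommGroup L] [InnerProductSpace ℂ L] [CompleteSpace L]
  {𝔅 : Submodule ℂ (K →L[ℂ] K)} {βh α β : Submodule ℂ (K →L[ℂ] L)} {ι : Type*}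

theorem adj_ket₁_comp_mem (hB : IsCBase 𝔅) (hα : IsCModule 𝔅 α) (hβ : IsCModule 𝔅 β)
    {el : ι → ↥α} (hel : α ≤ clspan (Set.range fun i => (el i).1)) {C : Submodule ℂ (L →L[ℂ] L)}
    (hC : IsClosed (C : Set (L →L[ℂ] L))) (T : L →L[ℂ] RTP α β)
    (h : ∀ i, adj (ket₁ (el i)) ∘L T ∈ C) (ξ : ↥α) : adj (ket₁ ξ) ∘L T ∈ C := by
  let S : Submodule ℂ ↥α :=
    { carrier := {ξ | adj (ket₁ ξ) ∘L T ∈ C}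
      add_mem' := fun {ξ ξ'} hξ hξ' => by
        change adj (ket₁ (ξ + ξ')) ∘L T ∈ C
        rw [ket₁_add hB hα hβ, show adj (ket₁ ξ + ket₁ ξ' : L →L[ℂ] RTP α β) =
          adj (ket₁ ξ) + adj (ket₁ ξ') from map_add ContinuousLinearMap.adjoint _ _,
          ContinuousLinearMap.add_comp]
        exact C.add_mem hξ hξ'
      zero_mem' := by
        change adj (ket₁ 0) ∘L T ∈ C
        rw [show (ket₁ (0 : ↥α) : L →L[ℂ] RTP α β) = 0 from map_zero (ketLin₁ hB hα hβ),
          show adj (0 : L →L[ℂ] RTP α β) = 0 from map_zero ContinuousLinearMap.adjoint,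
          ContinuousLinearMap.zero_comp]
        exact C.zero_mem
      smul_mem' := fun z ξ hξ => by
        change adj (ket₁ (z • ξ)) ∘L T ∈ C
        rw [ket₁_smul hB hα hβ, show adj (z • ket₁ ξ : L →L[ℂ] RTP α β) =
          starRingEnd ℂ z • adj (ket₁ ξ) from map_smulₛₗ ContinuousLinearMap.adjoint _ _,
          ContinuousLinearMap.smul_comp]
        exact C.smul_mem _ hξ }
  have hS : IsClosed (S : Set ↥α) := hC.preimage
    ((ContinuousLinearMap.adjoint.continuous.comp (continuous_ket₁ hB hα hβ)).clm_comp
      continuous_const)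
  exact mem_of_generators hα.closed hel S hS h ξ

theorem comp_ket₂_mem (hB : IsCBase 𝔅) (hβh : IsCModule 𝔅 βh) (hα : IsCModule 𝔅 α)
    {el : ι → ↥α} (hel : α ≤ clspan (Set.range fun i => (el i).1)) {C : Submodule ℂ (L →L[ℂ] L)}
    (hC : IsClosed (C : Set (L →L[ℂ] L))) (T : RTP βh α →L[ℂ] L)
    (h : ∀ i, T ∘L ket₂ (el i) ∈ C) (η : ↥α) : T ∘L ket₂ η ∈ C := by
  let F : RTP α βh →L[ℂ] RTP βh α :=
    (rtpFlip hB hα hβh).toContinuousLinearEquiv.toContinuousLinearMap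
  have e : ∀ η : ↥α, T ∘L ket₂ η = (T ∘L F) ∘L ket₁ η := fun η =>
    ContinuousLinearMap.ext fun x => congrArg T (ket₂_eq hB hβh hα η x)
  let S : Submodule ℂ ↥α := C.comap
    ((ContinuousLinearMap.compL ℂ L (RTP α βh) L (T ∘L F)).toLinearMap ∘ₗ ketLin₁ hB hα hβh)
  have hS : IsClosed (S : Set ↥α) := hC.preimage
    ((ContinuousLinearMap.compL ℂ L (RTP α βh) L (T ∘L F)).continuous.comp
      (continuous_ket₁ hB hα hβh))
  rw [e]
  exact mem_of_generators hα.closed hel S hS (fun i => by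
    change (T ∘L F) ∘L ket₁ (el i) ∈ C
    rw [← e]
    exact h i) η

/-- Slices depend continuously and conjugate-linearly on ξ, continuously and linearly on η; each
variable is reduced to generators in turn. -/
theorem slice_mem (hB : IsCBase 𝔅) (hβh : IsCModule 𝔅 βh) (hα : IsCModule 𝔅 α)
    (hβ : IsCModule 𝔅 β) {el : ι → ↥α} (hel : α ≤ clspan (Set.range fun i => (el i).1))
    {X : Set (L →L[ℂ] L)} (V : RTP βh α →L[ℂ] RTP α β)
    (h : ∀ i j, adj (ket₁ (el i)) ∘L V ∘L ket₂ (el j) ∈ clspan X) (ξ η : ↥α) :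
    adj (ket₁ ξ) ∘L V ∘L ket₂ η ∈ clspan X := by
  refine adj_ket₁_comp_mem hB hα hβ hel (isClosed_clspan X) (V ∘L ket₂ η) (fun i => ?_) ξ
  rw [← ContinuousLinearMap.comp_assoc]
  refine comp_ket₂_mem hB hβh hα hel (isClosed_clspan X) _ (fun j => ?_) η
  rw [ContinuousLinearMap.comp_assoc]
  exact h i j

end Slices

section Regular

variable {Γ B : Type*} [Group Γ] [NonUnitalCommRing B] [Module ℂ B] [IsScalarTower ℂ B B]
  [SMulCommClass ℂ B B] [StarRing B] [StarModule ℂ B] {act : Γ →* (B ≃⋆ₐ[ℂ] B)}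
  {A : Type*} [NonUnitalRing A] [Module ℂ A] [IsScalarTower ℂ A A] [SMulCommClass ℂ A A]
  [StarRing A] [StarModule ℂ A] {G : EvAlgebra act A}

namespace Core.Model

variable {c : Core G} {K L : Type*}
  [NormedAddCommGroup K] [InnerProductSpace ℂ K] [CompleteSpace K]
  [NormedAddCommGroup L] [InnerProductSpace ℂ L] [CompleteSpace L] (m : c.Model K L)

theorem adj_φL_apply {γ γ' : Γ} {h : A} (hh : h ∈ G.gr γ γ') (z : A) :
    adj (m.φL h) (m.Λν z) = m.Λμ (act γ (ract (c.D γ) (c.φ (star h * z)))) :=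
  m.total_μ.ext_inner fun b => by
    rw [adj_inner_right, m.φL_apply, m.inner_ν, m.inner_μ, star_lact, ← map_star, ract_mul,
      ← ract_mul, G.r_twist (G.star_mem hh), ← lact_mul, c.φ_left]
    exact (m.φo.μ_act_mul γ _ _).symm

theorem φ_DD_mul {γ γ' : Γ} {h : A} (hh : h ∈ G.gr γ γ') (z : A) :
    c.φ (star (m.D (m.D h)) * z) =
      act γ⁻¹ (lact (c.D γ⁻¹) (act γ (c.φ (star h * z)))) := by
  have key : ∀ y, c.φ (star h * G.rExt (m.Dh γ⁻¹) y) =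
      act γ⁻¹ (lact (m.Dh γ⁻¹) (act γ (c.φ (star h * y)))) := fun y => by
    have := m.φo.φ_mul_rExt (m.Dh γ⁻¹) (G.star_mem hh) y
    rwa [inv_inv] at this
  rw [D, G.DHalf_apply hh, G.DHalf_apply (G.rExt_mem _ hh),
    G.star_rExt_mul c.base_unit (m.sqrt.star_eq _), G.star_rExt_mul c.base_unit (m.sqrt.star_eq _),
    key, key, act_act_inv, ← m.sqrt.sq, lact_mult_mul]

/-- Applying D^{1/2} twice to h compensates the Radon–Nikodym derivative in the adjoint of Λ_φ^†(h).
-/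
theorem adj_φL_DD_apply {γ γ' : Γ} {h : A} (hh : h ∈ G.gr γ γ') (z : A) :
    adj (m.φL (m.D (m.D h))) (m.Λν z) = m.Λμ (act γ (c.φ (star h * z))) := by
  rw [m.adj_φL_apply (G.DHalf_mem (G.DHalf_mem hh)), m.φ_DD_mul hh, ract_eq_lact c.base_unit,
    m.sqrt.inv_sq]

/-- `p ⊗ q ↦ Λ_φ^†(D(q)) Λ_φ^†(S(p^*))^*` -/
def regMap : A ⊗[ℂ] A →ₗ[ℂ] (L →L[ℂ] L) :=
  TensorProduct.lift (LinearMap.mk₂ ℂ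
    (fun p q => m.φL (m.D (m.D q)) ∘L adj (m.φL (c.S (star p))))
    (fun p p' q => by
      rw [star_add, map_add, show m.φL (c.S (star p) + c.S (star p')) = m.φL (c.S (star p)) +
        m.φL (c.S (star p')) from m.φo.Ll.map_add _ _,
        show ∀ a b : K →L[ℂ] L, adj (a + b) = adj a + adj b from
          fun a b => map_add ContinuousLinearMap.adjoint a b, ContinuousLinearMap.comp_add])
    (fun z p q => by
      rw [star_smul, map_smul, show m.φL (star z • c.S (star p)) = star z • m.φL (c.S (star p)) from
        m.φo.Ll.map_smul _ _, show adj (star z • m.φL (c.S (star p))) =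
        starRingEnd ℂ (star z) • adj (m.φL (c.S (star p))) from
          map_smulₛₗ ContinuousLinearMap.adjoint _ _, starRingEnd_apply, star_star,
        ContinuousLinearMap.comp_smul])
    (fun p q q' => by
      rw [map_add, map_add, show ∀ a b, m.φL (a + b) = m.φL a + m.φL b from m.φo.Ll.map_add,
        ContinuousLinearMap.add_comp])
    fun z p q => by
      rw [map_smul, map_smul, show ∀ a, m.φL (z • a) = z • m.φL a from m.φo.Ll.map_smul z,
        ContinuousLinearMap.smul_comp])

theorem regMap_tmul (p q : A) :
    m.regMap (p ⊗ₜ q) = m.φL (m.D (m.D q)) ∘L adj (m.φL (c.S (star p))) := rfl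

theorem regMap_relLeft : G.relLeft ≤ LinearMap.ker m.regMap :=
  G.relLeft_le_ker fun p q b => by
    rw [regMap_tmul, regMap_tmul, star_lact, ← map_star, c.S_s', G.DHalf_r, G.DHalf_r]
    have h1 : ∀ (a : A) (b : B), m.φL (lact (G.r b) a) = m.φL a ∘L m.φo.π b := fun a b =>
      (m.φo.L_comp_π a b).symm
    rw [h1, h1, adj_comp, m.φo.adj_π, star_star, ContinuousLinearMap.comp_assoc]

theorem inner_regMap {w : A ⊗[ℂ] A} (hw : w ∈ G.matchedSpan) (x z t : A) :
    inner ℂ (m.regMap (mulR1 (star (c.S.symm x)) w) (m.Λν t)) (m.Λν z) =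
      c.μ (c.φ (star t * c.invMapS z x (star w))) := by
  refine G.matched_induction (P := fun w =>
    inner ℂ (m.regMap (mulR1 (star (c.S.symm x)) w) (m.Λν t)) (m.Λν z) =
      c.μ (c.φ (star t * c.invMapS z x (star w)))) (fun γ β β' g hg h hh => ?_)
    (fun w w' e e' => ?_) hw
  swap
  · rw [map_add, map_add, add_apply, inner_add_left, e, e', star_add, map_add, mul_add, map_add,
      map_add]
  change inner ℂ (m.regMap ((g * star (c.S.symm x)) ⊗ₜ h) (m.Λν t)) (m.Λν z) = _
  rw [regMap_tmul, ContinuousLinearMap.comp_apply, ← adj_inner_right, m.adj_φL_DD_apply hh,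
    adj_inner_left, m.φL_apply, m.inner_ν, star_mul, star_star, c.S_mul,
    LinearEquiv.apply_symm_apply, TensorProduct.star_tmul, c.invMapS_tmul, lact_mul, ← ract_mul]
  congr 4
  rw [← c.S_s', ← c.S_s, G.s_twist (G.star_mem hg), act_inv_act]

/-- The analogue of `inner_JD` when only the right-hand tensor is matched. The degrees of t and y
are unrelated, and the degree of y survives as a twist of φ(y^*q). -/
theorem inner_JD_left {w : A ⊗[ℂ] A} (hw : w ∈ G.matchedSpan) {β β' : Γ} {y : A}
    (hy : y ∈ G.gr β β') (x t : A) : inner ℂ (m.JD (t ⊗ₜ y)) (m.JD (mulR1 x w)) =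
      c.μ (c.φ (star t * c.invMapT β (star y) x w)) := by
  refine G.hom_induction (P := fun t => inner ℂ (m.JD (t ⊗ₜ y)) (m.JD (mulR1 x w)) =
      c.μ (c.φ (star t * c.invMapT β (star y) x w))) (fun ζ ζ' t ht => ?_) (fun t t' h h' => ?_) t
  swap
  · rw [TensorProduct.add_tmul, map_add, inner_add_left, h, h', star_add, add_mul, map_add, map_add]
  refine G.matched_induction (P := fun w => inner ℂ (m.JD (t ⊗ₜ y)) (m.JD (mulR1 x w)) =
      c.μ (c.φ (star t * c.invMapT β (star y) x w))) (fun δ θ θ' p hp q hq => ?_)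
      (fun w w' h h' => ?_) hw
  swap
  · rw [map_add, map_add, inner_add_right, h, h', map_add, mul_add, map_add, map_add]
  change inner ℂ (m.JD (t ⊗ₜ y)) (m.JD ((p * x) ⊗ₜ q)) = _
  rw [m.inner_JD_tmul ht hy hq, c.invMapT_tmul, ← c.ν_eq, ← lact_mul, ← ract_mul,
    G.s_twist (G.star_mem ht), ← lact_mul, c.ψ_left]

/-- Strong invariance with l = y^* converts the coproduct of z into that of y, so z no longer occurs
under Δ. This allows the slice to be recognized as an operator applied to Λ_ν(t). -/
theorem inner_JD_antipode {u v x : A} (hu : u ∈ G.gr 1 1)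
    (hux : u * star (c.S.symm x) = star (c.S.symm x)) (hv : v ∈ G.gr 1 1) (hvx : v * x = x)
    (y z t : A) : inner ℂ (m.JD (t ⊗ₜ y)) (m.JD (mulR1 x (c.d1 v z))) =
      c.μ (c.φ (star t * c.invMapS z x (star (c.d1 u y)))) := by
  refine G.hom_induction (P := fun y => inner ℂ (m.JD (t ⊗ₜ y)) (m.JD (mulR1 x (c.d1 v z))) =
      c.μ (c.φ (star t * c.invMapS z x (star (c.d1 u y))))) (fun β β' y hy => ?_)
      (fun y y' h h' => ?_) y
  swap
  · rw [TensorProduct.tmul_add, map_add, inner_add_left, h, h', map_add, star_add, map_add, mul_add,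
      map_add, map_add]
  have h1 : star (c.d1 u y) = c.l1 (star u) (star y) := by rw [c.l1_apply, star_star, star_star]
  have h2 : c.S.symm x * star u = c.S.symm x := by
    rw [← star_star (c.S.symm x), ← star_mul, hux]
  rw [m.inner_JD_left (c.d1_mem v z) hy, h1,
    c.strong_invariance (G.star_mem hy) z hv hvx (G.one_mem_star hu) h2]

/-- Slices of the inverse of `U` on generators are values of `regMap`, hence finite sums of
operators ξη^*. It is obtained by comparing matrix coefficients between Λ_ν(t) and Λ_ν(z). -/
theorem slice_U {u x : A} (hu : u ∈ G.gr 1 1) (hux : u * star (c.S.symm x) = star (c.S.symm x))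
    (y : A) : adj (ket₁ (m.φd x)) ∘L toOp m.U.symm ∘L ket₂ (m.φd (m.D y)) =
      m.regMap (mulR1 (star (c.S.symm x)) (c.d1 u y)) := by
  obtain ⟨v, hv, hvx⟩ := exists_unit (G := G) x
  refine m.total_ν.ext_op fun t => ?_
  refine m.total_ν.ext_inner fun z => ?_
  rw [← inner_conj_symm _ (m.regMap _ _), m.inner_regMap (c.d1_mem u y),
    ← m.inner_JD_antipode hu hux hv hvx, inner_conj_symm, ← m.U_apply hv hvx, JD_tmul, ← m.ket₂_φd,
    ContinuousLinearMap.comp_apply, adj_inner_right]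
  change inner ℂ _ (m.U.symm _) = _
  rw [← LinearIsometryEquiv.inner_map_map m.U, LinearIsometryEquiv.apply_symm_apply]
  rfl

theorem D_surjective : Function.Surjective m.D := G.DHalf_surjective m.sqrt

/-- One inclusion is `slice_U`. For the other, every elementary tensor is a sum of elements Δ(y)(x ⊗
1), so every operator Λ_φ^†(a)Λ_φ^†(k)^* is a sum of slices. -/
theorem isRegular : IsRegular m.U.symm := by
  refine le_antisymm (clspan_le (isClosed_clspan _) ?_) (clspan_le (isClosed_clspan _) ?_)
  · rintro _ ⟨ξ, η, rfl⟩
    refine slice_mem m.hB m.hψL m.hφL m.hφR m.φd_gen (toOp m.U.symm) (fun x y => ?_) ξ η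
    obtain ⟨y, rfl⟩ := m.D_surjective y
    obtain ⟨u, hu, hux⟩ := exists_unit (G := G) (star (c.S.symm x))
    rw [m.slice_U hu hux]
    obtain ⟨n, p, q, h⟩ := exists_fin_sum (mulR1 (star (c.S.symm x)) (c.d1 u y))
    rw [h, map_sum]
    exact Submodule.sum_mem _ fun i _ => subset_clspan' ⟨m.φd _, m.φd _, m.regMap_tmul _ _⟩
  · rintro _ ⟨ξ, η, rfl⟩
    set X : Set (L →L[ℂ] L) :=
      {T | ∃ ξ η : ↥m.Eφd, T = adj (ket₁ ξ) ∘L toOp m.U.symm ∘L ket₂ η} with hX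
    refine comp_mem_of_clspan (isClosed_clspan X) (S := Set.range m.φL)
      (T := Set.range fun x => adj (m.φL x)) ?_ ξ.2 (adj_mem_of_clspan (isClosed_clspan _) ?_ η.2)
    · rintro _ ⟨a, rfl⟩ _ ⟨k, rfl⟩
      obtain ⟨q, rfl⟩ := m.D_surjective a
      -- With a = D^{1/2}(D^{1/2}(q)) and k = S(p), the operator at hand is the value of `regMap` at
      -- p^* ⊗ q.
      obtain ⟨q, rfl⟩ := m.D_surjective q
      obtain ⟨p, rfl⟩ := c.S.surjective k
      obtain ⟨n, x, y, u, hu, hux, hs⟩ := c.exists_T4 (star p) q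
      have h1 := SModEq.lift_eq m.regMap hs m.regMap_relLeft
      rw [regMap_tmul, star_star, map_sum] at h1
      change m.φL (m.D (m.D q)) ∘L adj (m.φL (c.S p)) ∈ _
      rw [← h1]
      refine Submodule.sum_mem _ fun i _ => subset_clspan' ⟨m.φd (c.S (star (x i))), m.φd (m.D (y i)), ?_⟩
      have e : star (c.S.symm (c.S (star (x i)))) = x i := by
        rw [LinearEquiv.symm_apply_apply, star_star]
      rw [m.slice_U (x := c.S (star (x i))) hu (by rw [e, hux i]), e]
    · rintro _ ⟨x, rfl⟩
      exact subset_clspan' ⟨x, rfl⟩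

end Core.Model

end Regular

/-! ## The pentagon equation -/

namespace ChData

variable {K L : Type*}
  [NormedAddCommGroup K] [InnerProductSpace ℂ K] [CompleteSpace K]
  [NormedAddCommGroup L] [InnerProductSpace ℂ L] [CompleteSpace L]
  {𝔅 : Submodule ℂ (K →L[ℂ] K)} {E P Q G : Submodule ℂ (K →L[ℂ] L)}

theorem addR₁_add (h : ChData 𝔅 E P Q G) (η η' : ↥G) :
    (addR₁ (η + η') : RTP E P →L[ℂ] Ch E P Q G) = addR₁ η + addR₁ η' :=
  (total_ket₁ h.base h.left h.mid₁).ext_op fun p => by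
    rw [add_apply, h.addR₁_apply, h.addR₁_apply, h.addR₁_apply]
    refine vec_add h.posKer fun u => ?_
    unfold chKer
    have e : adj u.2.2.1 ∘L (η + η').1 = adj u.2.2.1 ∘L η.1 + adj u.2.2.1 ∘L η'.1 :=
      ContinuousLinearMap.comp_add _ _ _
    rw [e, rep_add h.base h.mid₂ (h.right.adj_mem u.2.2.2 η.2) (h.right.adj_mem u.2.2.2 η'.2),
      add_apply, map_add, inner_add_right]

theorem addR₁_smul (h : ChData 𝔅 E P Q G) (z : ℂ) (η : ↥G) :
    (addR₁ (z • η) : RTP E P →L[ℂ] Ch E P Q G) = z • addR₁ η :=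
  (total_ket₁ h.base h.left h.mid₁).ext_op fun p => by
    rw [smul_apply, h.addR₁_apply, h.addR₁_apply]
    refine vec_smul h.posKer z fun u => ?_
    unfold chKer
    have e : adj u.2.2.1 ∘L (z • η).1 = z • (adj u.2.2.1 ∘L η.1) :=
      ContinuousLinearMap.comp_smul _ _ _
    rw [e, rep_smul h.base h.mid₂ (h.right.adj_mem u.2.2.2 η.2), smul_apply, map_smul,
      inner_smul_right]

/-- Density is obtained one variable after the other: `addR₁` handles the first two for fixed η,
then `addL₂` handles η. -/
theorem total_vec_of_generators (h : ChData 𝔅 E P Q G) {ι κ lam : Type*} {e : ι → ↥E}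
    (he : E ≤ clspan (Set.range fun i => (e i).1)) {v : κ → L} (hv : Total v) {g : lam → ↥G}
    (hg : G ≤ clspan (Set.range fun i => (g i).1)) :
    Total fun p : ι × κ × lam => vec (chKer E P Q G) (e p.1, v p.2.1, g p.2.2) := by
  refine Total.of_closed fun S hS hp => eq_top_iff.2 fun x _ => ?_
  refine (total_vec _).mem_closed S hS (fun p => ?_) x
  obtain ⟨ξ, y, η⟩ := p
  rw [← h.addR₁_apply]
  have h1 := total_ket₁_of_generators h.base h.left h.mid₁ he hv
  refine h1.mem_closed (S.comap (addR₁ η : RTP E P →L[ℂ] Ch E P Q G).toLinearMap)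
    (hS.preimage (addR₁ η : RTP E P →L[ℂ] Ch E P Q G).continuous) (fun q => ?_) _
  obtain ⟨i, j⟩ := q
  change addR₁ η (ket₁ (e i) (v j)) ∈ S
  rw [h.addR₁_apply, ← h.addL₂_apply, ket₂_eq h.base h.mid₂ h.right]
  let T : (L →L[ℂ] RTP G Q) →L[ℂ] Ch E P Q G := (addL₂ (e i) ∘L
    (rtpFlip h.base h.right h.mid₂).toContinuousLinearEquiv.toContinuousLinearMap) ∘L
    ContinuousLinearMap.apply ℂ (RTP G Q) (v j)
  refine mem_of_generators h.right.closed hg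
    (S.comap (T.toLinearMap ∘ₗ ketLin₁ h.base h.right h.mid₂))
    (hS.preimage (T.continuous.comp (continuous_ket₁ h.base h.right h.mid₂))) (fun l => ?_) η
  change addL₂ (e i) (rtpFlip h.base h.right h.mid₂ (ket₁ (g l) (v j))) ∈ S
  rw [← ket₂_eq h.base h.mid₂ h.right, h.addL₂_apply]
  exact hp (i, j, l)

end ChData

section Legs

variable {K L : Type*}
  [NormedAddCommGroup K] [InnerProductSpace ℂ K] [CompleteSpace K]
  [NormedAddCommGroup L] [InnerProductSpace ℂ L] [CompleteSpace L]
  {βh α β : Submodule ℂ (K →L[ℂ] L)}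

theorem InvLegs.pentagon_of_total {U : RTP α β ≃ₗᵢ[ℂ] RTP βh α} (l : InvLegs U) {ι : Type*}
    {f : ι → Ch α β α β} (hf : Total f)
    (h : ∀ i, l.U12 (l.U23 (f i)) = l.U23' (l.U13 (l.U12' (f i)))) : l.Pentagon := fun ζ =>
  DFunLike.congr_fun (hf.ext_op
    (S := l.U12.toContinuousLinearEquiv.toContinuousLinearMap ∘L
      l.U23.toContinuousLinearEquiv.toContinuousLinearMap)
    (T := l.U23'.toContinuousLinearEquiv.toContinuousLinearMap ∘L
      l.U13.toContinuousLinearEquiv.toContinuousLinearMap ∘L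
      l.U12'.toContinuousLinearEquiv.toContinuousLinearMap) h) ζ

end Legs

section Pentagon

variable {Γ B : Type*} [Group Γ] [NonUnitalCommRing B] [Module ℂ B] [IsScalarTower ℂ B B]
  [SMulCommClass ℂ B B] [StarRing B] [StarModule ℂ B] {act : Γ →* (B ≃⋆ₐ[ℂ] B)}
  {A : Type*} [NonUnitalRing A] [Module ℂ A] [IsScalarTower ℂ A A] [SMulCommClass ℂ A A]
  [StarRing A] [StarModule ℂ A] {G : EvAlgebra act A}

theorem relT_mulR (x : A) :
    G.relT ≤ G.relT.comap ((LinearMap.mulRight ℂ x).rTensor (A ⊗[ℂ] A)) := by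
  refine G.relT_le (fun p q t b => ?_) fun p q t b => ?_
  · exact Submodule.subset_span (.inl ⟨p * x, q, t, b, by simp [lact_mul]⟩)
  · exact Submodule.subset_span (.inr ⟨p * x, q, t, b, by simp⟩)

theorem mulR₁₂_tmul_tmul (a b f : A) (w : A ⊗[ℂ] A) :
    Core.mulR₁₂ (a ⊗ₜ b) (f ⊗ₜ w) = (f * a) ⊗ₜ[ℂ] mulR1 b w := by
  induction w with
  | zero => simp
  | add p q hp hq => simp only [map_add, TensorProduct.tmul_add, hp, hq]
  | tmul p q => simp [Core.mulR₁₂_tmul, mulR1]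

theorem mulR₁₂_add (Y Y' : A ⊗[ℂ] A) (w : A ⊗[ℂ] (A ⊗[ℂ] A)) :
    Core.mulR₁₂ (Y + Y') w = Core.mulR₁₂ Y w + Core.mulR₁₂ Y' w := by
  have : LinearMap.mulRight ℂ (Y + Y') = LinearMap.mulRight ℂ Y + LinearMap.mulRight ℂ Y' :=
    LinearMap.ext fun z => mul_add z Y Y'
  rw [Core.mulR₁₂, this, LinearMap.rTensor_add, LinearMap.add_comp, LinearMap.comp_add]
  rfl

theorem mulR₁₂_sum {ι : Type*} (s : Finset ι) (Y : ι → A ⊗[ℂ] A) (w : A ⊗[ℂ] (A ⊗[ℂ] A)) :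
    Core.mulR₁₂ (∑ i ∈ s, Y i) w = ∑ i ∈ s, Core.mulR₁₂ (Y i) w := by
  classical
  induction s using Finset.induction_on with
  | empty => simp [Core.mulR₁₂]
  | insert i s hi h => rw [Finset.sum_insert hi, Finset.sum_insert hi, mulR₁₂_add, h]

namespace Core.Model

variable {c : Core G} {K L : Type*}
  [NormedAddCommGroup K] [InnerProductSpace ℂ K] [CompleteSpace K]
  [NormedAddCommGroup L] [InnerProductSpace ℂ L] [CompleteSpace L] (m : c.Model K L)

/-- On first degree γ the map D^{1/2} is left multiplication by r of an element depending only on γ.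
The comultiplication preserves the first degree and sends r(b) to r(b) ⊗ 1. -/
theorem d1_D {v : A} (hv : v ∈ G.gr 1 1) (y : A) :
    c.d1 v (m.D y) ≡ m.D.rTensor A (c.d1 v y) [SMOD G.relLeft] := by
  have hr : ∀ b, G.relLeft ≤ G.relLeft.comap ((lact (G.r b)).rTensor A) := fun b =>
    G.relLeft_le fun p q b' => Submodule.subset_span ⟨lact (G.r b) p, q, b', by
      rw [map_sub, LinearMap.rTensor_tmul, LinearMap.rTensor_tmul, G.r_s]⟩
  have hD : G.relLeft ≤ G.relLeft.comap (m.D.rTensor A) :=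
    G.relLeft_le fun p q b' => Submodule.subset_span ⟨m.D p, q, b', by
      rw [map_sub, LinearMap.rTensor_tmul, LinearMap.rTensor_tmul, G.DHalf_s]⟩
  refine G.hom_induction (P := fun y => c.d1 v (m.D y) ≡ m.D.rTensor A (c.d1 v y)
    [SMOD G.relLeft]) (fun γ γ'' y hy => ?_) (fun _ _ h h' => by
      simpa only [map_add] using h.add h') y
  obtain ⟨t, ht, hyt⟩ := c.d1_deg hv hy
  obtain ⟨b, hb, -⟩ := G.exists_base_unit' y y
  have h1 : m.D y = lact (G.r (lact (m.Dh γ⁻¹) b)) y := by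
    rw [D, G.DHalf_apply hy, G.rExt_apply _ hb]
  have h2 : (lact (G.r (lact (m.Dh γ⁻¹) b))).rTensor A t =
      m.D.rTensor A ((lact (G.r b)).rTensor A t) := by
    refine LinearMap.eqOn_span (f := (lact (G.r (lact (m.Dh γ⁻¹) b))).rTensor A)
      (g := m.D.rTensor A ∘ₗ (lact (G.r b)).rTensor A) ?_ ht
    rintro _ ⟨γ', p, hp, q, hq, rfl⟩
    rw [LinearMap.comp_apply, LinearMap.rTensor_tmul, LinearMap.rTensor_tmul,
      LinearMap.rTensor_tmul, D, G.DHalf_apply (G.r_mem hp b), G.rExt_r]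
  have h3 := c.d1_r hv b y
  rw [hb] at h3
  rw [h1]
  refine (bal_left (c.d1_r hv _ y)).trans ((SModEq.mapTo _ (bal_left hyt) (hr _)).trans ?_)
  rw [h2]
  exact SModEq.mapTo _ ((SModEq.mapTo _ (bal_left hyt) (hr b)).symm.trans (bal_left h3).symm) hD

/-- `a ⊗ (b ⊗ q) ↦ Λ_ν(a) ⊗ Λ_ν(D(b)) ⊗ Λ_ν(D(q))` -/
def JT : A ⊗[ℂ] (A ⊗[ℂ] A) →ₗ[ℂ] Ch m.Eψd m.Eφd m.Eψd m.Eφd :=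
  TensorProduct.lift (LinearMap.mk₂ ℂ (fun w q => addR₁ (m.φd (m.D q)) (m.JD w))
    (fun w w' q => by rw [map_add, map_add])
    (fun z w q => by rw [map_smul, map_smul])
    (fun w q q' => by rw [map_add, φd_add, m.compatTriple.ch₁.addR₁_add, add_apply])
    (fun z w q => by rw [map_smul, φd_smul, m.compatTriple.ch₁.addR₁_smul, smul_apply])) ∘ₗ
      (TensorProduct.assoc ℂ A A A).symm.toLinearMap

theorem JT_assoc (w : A ⊗[ℂ] A) (q : A) :
    m.JT (TensorProduct.assoc ℂ A A A (w ⊗ₜ q)) = addR₁ (m.φd (m.D q)) (m.JD w) := by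
  simp only [JT, LinearMap.comp_apply, LinearEquiv.coe_coe, LinearEquiv.symm_apply_apply,
    TensorProduct.lift.tmul, LinearMap.mk₂_apply]

theorem JT_tmul (a b q : A) : m.JT (a ⊗ₜ (b ⊗ₜ q)) =
    vec (chKer m.Eψd m.Eφd m.Eψd m.Eφd) (m.ψd a, m.Λν (m.D b), m.φd (m.D q)) := by
  rw [← TensorProduct.assoc_tmul, m.JT_assoc, m.JD_tmul, m.compatTriple.ch₁.addR₁_apply]

theorem JT_tmul' (a : A) (w : A ⊗[ℂ] A) : m.JT (a ⊗ₜ w) =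
    addL₂ (m.ψd a) (m.JD (m.D.rTensor A w)) := by
  induction w with
  | zero => simp
  | add p q hp hq => simp only [map_add, TensorProduct.tmul_add, hp, hq]
  | tmul b q =>
    rw [LinearMap.rTensor_tmul, JT_tmul, JD_tmul, ← m.ket₂_φd, m.compatTriple.ch₁.addL₂_apply]

theorem JT_relT : G.relT ≤ LinearMap.ker m.JT := by
  refine G.relT_le_ker (fun x y z b => ?_) fun x y z b => ?_
  · rw [← TensorProduct.assoc_tmul, ← TensorProduct.assoc_tmul, JT_assoc, JT_assoc]
    congr 1
    rw [← sub_eq_zero, ← map_sub]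
    exact m.JD_relLeft (Submodule.subset_span ⟨_, _, _, rfl⟩)
  · rw [JT_tmul', JT_tmul', LinearMap.rTensor_tmul, LinearMap.rTensor_tmul, G.DHalf_s]
    congr 1
    rw [← sub_eq_zero, ← map_sub]
    exact m.JD_relLeft (Submodule.subset_span ⟨_, _, _, rfl⟩)

variable (l : InvLegs m.U)

/-- In Sweedler notation this composite is Σ (z₁y)₁x ⊗ D^{1/2}((z₁y)₂) ⊗ D^{1/2}(z₂). -/
theorem U12_U23 {u v x y : A} (hu : u ∈ G.gr 1 1) (huy : u * y = y) (hv : v ∈ G.gr 1 1)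
    (hvx : v * x = x) (z : A) :
    l.U12 (l.U23 (vec (chKer m.Eφd m.Eφ m.Eφd m.Eφ) (m.φd x, m.Λν y, m.φE z))) =
      m.JT ((LinearMap.mulRight ℂ x).rTensor (A ⊗[ℂ] A)
        (TensorProduct.assoc ℂ A A A ((c.d1 v).rTensor A (mulR1 y (c.d1 u z))))) := by
  rw [← m.compatTriple.ch₃.addL₂_apply, l.h23, m.ket₂_φE, m.U_apply hu huy]
  induction mulR1 y (c.d1 u z) with
  | zero => simp
  | add p q hp hq => simp only [map_add, hp, hq]
  | tmul p q =>
    rw [JD_tmul, ← m.ket₂_φd, m.compatTriple.ch₂.addL₂_apply, ← m.compatTriple.ch₂.addR₁_apply,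
      l.h12, m.U_apply hv hvx, LinearMap.rTensor_tmul, ← m.JT_assoc]
    congr 1
    generalize c.d1 v p = w
    induction w with
    | zero => simp
    | add p q hp hq => simp only [map_add, TensorProduct.add_tmul, hp, hq]
    | tmul p q => simp [mulR1]

/-- Here Δ is applied to D^{1/2}(g) and multiplied by D^{1/2}(b). By `d1_D` and multiplicativity of
D^{1/2} the result is D^{1/2}(g₁b) ⊗ D^{1/2}(g₂), to which `JT` already applies the maps D^{1/2}. -/
theorem U23'_U13 {u a b : A} (hu : u ∈ G.gr 1 1) (hub : u * b = b) (x : A) (w : A ⊗[ℂ] A) :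
    l.U23' (addR₁ (m.φd (m.D b)) (m.JD (mulR1 (a * x) w))) =
      m.JT ((LinearMap.mulRight ℂ x).rTensor (A ⊗[ℂ] A)
        (mulR₁₂ (a ⊗ₜ b) ((c.d1 u).lTensor A w))) := by
  induction w with
  | zero => simp
  | add p q hp hq => simp only [map_add, hp, hq]
  | tmul f g =>
    rw [LinearMap.lTensor_tmul, mulR₁₂_tmul_tmul, LinearMap.rTensor_tmul, JT_tmul']
    change l.U23' (addR₁ (m.φd (m.D b)) (ket₁ (m.ψd (f * (a * x))) (m.Λν (m.D g)))) =
      addL₂ (m.ψd (f * a * x)) _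
    rw [m.compatTriple.ch₄.addR₁_apply, ← m.compatTriple.ch₄.addL₁_apply, l.h23',
      m.U_apply hu (by rw [← G.DHalf_unit_mul hu, hub]), mul_assoc]
    congr 1
    rw [SModEq.lift_eq m.JD (SModEq.mapTo (mulR1 (m.D b)) (m.d1_D hu g) (G.relLeft_mulR1 _))
      m.JD_relLeft]
    congr 1
    generalize c.d1 u g = w
    induction w with
    | zero => simp
    | add p q hp hq => simp only [map_add, hp, hq]
    | tmul p q => simp [mulR1, G.DHalf_mul m.sqrt]

-- Both composites are values of `JT`, and `coassoc_mul` identifies their arguments modulo `relT`.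
-- The units v, u, w and u' only serve to make sense of the products; w and u' have to be units for
-- the legs of Δ(y)(v ⊗ 1).
set_option maxHeartbeats 2000000 in
theorem pentagon_vec (x y z : A) :
    l.U12 (l.U23 (vec (chKer m.Eφd m.Eφ m.Eφd m.Eφ) (m.φd x, m.Λν y, m.φE z))) =
      l.U23' (l.U13 (l.U12' (vec (chKer m.Eφd m.Eφ m.Eφd m.Eφ) (m.φd x, m.Λν y, m.φE z)))) := by
  obtain ⟨v, hv, hvx⟩ := exists_unit (G := G) x
  obtain ⟨u, hu, huy⟩ := exists_unit (G := G) y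
  obtain ⟨n, a, b, hab⟩ := exists_fin_sum (c.d1 v y)
  obtain ⟨w, hw, hwa⟩ := (G.units_mem.and (Filter.eventually_all.2 fun i => G.units_mul (a i))).exists
  obtain ⟨u', hu', hub⟩ :=
    (G.units_mem.and (Filter.eventually_all.2 fun i => G.units_mul (b i))).exists
  have hwy : mulL1 w (c.d1 v y) = c.d1 v y := by
    rw [hab, map_sum]
    exact Finset.sum_congr rfl fun i _ => by simp [mulL1, hwa i]
  have huy' : mulL2 u' (c.d1 v y) = c.d1 v y := by
    rw [hab, map_sum]
    exact Finset.sum_congr rfl fun i _ => by simp [mulL2, hub i]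
  rw [m.U12_U23 l hu huy hv hvx z, SModEq.lift_eq m.JT (SModEq.mapTo _
    (c.coassoc_mul hu huy hv hw hwy hu' huy' z) (relT_mulR x)) m.JT_relT,
    ← m.compatTriple.ch₃.addR₁_apply, l.h12', m.U_apply hv hvx, hab]
  rw [mulR₁₂_sum]
  simp only [map_sum]
  refine Finset.sum_congr rfl fun i _ => ?_
  change _ = l.U23' (l.U13 (addR₂ (m.φE z) (m.JD ((a i * x) ⊗ₜ b i))))
  rw [JD_tmul, ← m.ket₂_φd, m.compatTriple.ch₅.addR₂_apply, ← m.compatTriple.ch₅.addL₂_apply,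
    l.h13, m.ket₂_φE, m.U_apply hw (by rw [← mul_assoc, hwa i]), m.U23'_U13 l hu' (hub i)]

theorem pentagon : l.Pentagon :=
  l.pentagon_of_total (m.compatTriple.ch₃.total_vec_of_generators m.φd_gen m.total_ν m.φE_gen)
    fun p => m.pentagon_vec l p.1 p.2.1 p.2.2

theorem exists_invLegs : Nonempty (InvLegs m.U) :=
  m.compatTriple.exists_invLegs m.U m.intertwines

theorem isCPMU : IsCPMU m.𝔟 m.U.symm := by
  obtain ⟨l⟩ := m.exists_invLegs
  exact isCPMU_of_pentagon m.compatTriple m.intertwines (m.pentagon l).symm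

theorem isCPMU_flipU : IsCPMU m.𝔟 (m.compatTriple.flipU m.U) := by
  obtain ⟨l⟩ := m.exists_invLegs
  exact isCPMU_of_pentagon m.compatTriple.flip
    (m.compatTriple.intertwines_flipU m.intertwines) (m.compatTriple.pentagon_flipU (m.pentagon l))

theorem isRegular_flipU : IsRegular (m.compatTriple.flipU m.U) :=
  m.compatTriple.isRegular_flipU m.isRegular

theorem U_apply_eq {v x y : A} (hv : v ∈ G.gr 1 1) (hvx : v * x = x) {k : ℕ} {p q q' : Fin k → A}
    (h : ∑ i, p i ⊗ₜ[ℂ] q i ≡ mulR1 x (c.d1 v y) [SMOD G.relLeft])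
    (hq : ∀ i, m.D (q i) = q' i) :
    m.U (ket₁ (m.φd x) (m.Λν y)) = ∑ i, ket₁ (m.ψd (p i)) (m.Λν (q' i)) := by
  rw [m.U_apply hv hvx, ← SModEq.lift_eq m.JD h m.JD_relLeft, map_sum]
  exact Finset.sum_congr rfl fun i _ => by rw [JD_tmul, hq]

theorem flipU_apply_eq {v x y : A} (hv : v ∈ G.gr 1 1) (hvx : v * x = x) {k : ℕ}
    {p q q' : Fin k → A} (h : ∑ i, p i ⊗ₜ[ℂ] q i ≡ mulR1 x (c.d1 v y) [SMOD G.relLeft])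
    (hq : ∀ i, m.D (q i) = q' i) :
    m.compatTriple.flipU m.U (ket₁ (m.φE y) (m.Λν x)) =
      ∑ i, ket₁ (m.φd (q' i)) (m.Λν (p i)) := by
  rw [CompatTriple.flipU_apply, rtpFlip_ket₁, m.ket₂_φE, m.U_apply_eq hv hvx h hq, map_sum]
  exact Finset.sum_congr rfl fun i _ => by rw [← m.ket₂_φd, rtpFlip_ket₂]

end Core.Model

end Pentagon

/-! ## The fundamental unitaries -/

section PositiveFunctional

variable {C : Type*} [NonUnitalRing C] [Module ℂ C] [IsScalarTower ℂ C C] [SMulCommClass ℂ C C]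
  [StarRing C] [StarModule ℂ C]

theorem posKer_of_functional (ω : C →ₗ[ℂ] ℂ) (h : ∀ x, 0 ≤ ω (star x * x)) :
    PosKer fun x y : C => ω (star x * y) := by
  refine posKer_of_finite (fun s f => ?_) fun x y => ?_
  · have := h (∑ i ∈ s, f i • i)
    simp only [star_sum, star_smul, Finset.sum_mul, Finset.mul_sum, map_sum, smul_mul_smul_comm,
      map_smul, smul_eq_mul] at this
    rwa [Finset.sum_comm] at this
  -- Hermitian symmetry is not assumed for ω. It follows by polarization from the values at x + y
  -- and x + iy being real.
  · have key : ∀ x, (ω (star x * x)).im = 0 := fun x => (Complex.le_def.1 (h x)).2.symm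
    have hx := key x
    have hy := key y
    have h1 := key (x + y)
    have h2 := key (x + Complex.I • y)
    simp only [star_add, star_smul, add_mul, mul_add, smul_mul_assoc, mul_smul_comm, map_add,
      map_smul, smul_eq_mul, Complex.add_im, Complex.mul_im, Complex.star_def, Complex.conj_I,
      Complex.I_re, Complex.I_im, Complex.neg_re, Complex.neg_im, Complex.mul_re] at h1 h2
    apply Complex.ext
    · simp only [Complex.star_def, Complex.conj_re]
      linarith
    · simp only [Complex.star_def, Complex.conj_im]
      linarith

variable {ω : C →ₗ[ℂ] ℂ} {k : C → C → ℂ}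

/-- The canonical map into the completion with respect to a positive functional. -/
def gnsMap (hk : PosKer k) (h : ∀ x y, k x y = ω (star x * y)) : C →ₗ[ℂ] KerHilb k where
  toFun := vec k
  map_add' x y := vec_add hk fun z => by rw [h, h, h, mul_add, map_add]
  map_smul' z x := vec_smul hk z fun y => by rw [h, h, mul_smul_comm, map_smul, smul_eq_mul]

end PositiveFunctional

namespace EvAlgebra

variable {Γ B : Type*} [Group Γ] [NonUnitalCommRing B] [Module ℂ B] [IsScalarTower ℂ B B]
  [SMulCommClass ℂ B B] [StarRing B] [StarModule ℂ B] {act : Γ →* (B ≃⋆ₐ[ℂ] B)}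
  {A : Type*} [NonUnitalRing A] [Module ℂ A] [IsScalarTower ℂ A A] [SMulCommClass ℂ A A]
  [StarRing A] [StarModule ℂ A] (G : EvAlgebra act A)

theorem τ_relLeft : G.relLeft ≤ G.co.relLeft.comap (τ : A ⊗[ℂ] A →ₗ[ℂ] A ⊗[ℂ] A) :=
  G.relLeft_le fun x y b => by
    rw [← neg_mem_iff]
    exact Submodule.subset_span ⟨y, x, b, by simp [co]⟩

end EvAlgebra

namespace MeasuredHopf

variable {Γ B : Type*} [Group Γ] [NonUnitalCommRing B] [Module ℂ B] [IsScalarTower ℂ B B]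
  [SMulCommClass ℂ B B] [StarRing B] [StarModule ℂ B] {act : Γ →* (B ≃⋆ₐ[ℂ] B)}
  {A : Type*} [NonUnitalRing A] [Module ℂ A] [IsScalarTower ℂ A A] [SMulCommClass ℂ A A]
  [StarRing A] [StarModule ℂ A] {G : EvAlgebra act A} (H : MeasuredHopf G)
  (hB : ∀ F : Finset B, ∃ u : B, ∀ b ∈ F, u * b = b) (hGNS : H.BoundedGNS)
  {Dh : Γ → Mult B} (hDh : H.IsSqrtCocycle Dh)

theorem posKer_kerK : PosKer H.kerK := posKer_of_functional H.μ H.μ_pos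

theorem posKer_kerH : PosKer H.kerH := posKer_of_functional (H.μ ∘ₗ H.φ) H.ν_pos

/-- The model that defines the inverse of `W`. -/
def model : (H.core hB).Model H.HilbK H.HilbH where
  Λμ := gnsMap (ω := H.μ) H.posKer_kerK fun _ _ => rfl
  Λν := gnsMap (ω := H.μ ∘ₗ H.φ) H.posKer_kerH fun _ _ => rfl
  inner_μ := inner_vec H.posKer_kerK
  inner_ν := inner_vec H.posKer_kerH
  total_μ := total_vec _
  total_ν := total_vec _
  bounded := hGNS
  Dh := Dh
  sqrt := ⟨hDh.one, hDh.star_eq, hDh.sq, hDh.mul⟩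

/-- The model that defines `V`, up to flips. -/
def coModel : (H.coCore hB).Model H.HilbK H.HilbH where
  Λμ := gnsMap (ω := H.μ) H.posKer_kerK fun _ _ => rfl
  Λν := gnsMap (ω := H.μ ∘ₗ H.φ) H.posKer_kerH fun _ _ => rfl
  inner_μ := inner_vec H.posKer_kerK
  inner_ν x y := (inner_vec H.posKer_kerH x y).trans (H.ν_eq _).symm
  total_μ := total_vec _
  total_ν := total_vec _
  bounded := hGNS
  Dh := Dh
  sqrt := ⟨hDh.one, hDh.star_eq, hDh.sq, hDh.mul⟩

/-- The fundamental unitary `W`. -/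
def W : RTP H.Eψd H.Eφd ≃ₗᵢ[ℂ] RTP H.Eφd H.Eφ := (H.model hB hGNS hDh).U.symm

/-- The fundamental unitary `V`. -/
def V : RTP H.Eψ H.Eψd ≃ₗᵢ[ℂ] RTP H.Eψd H.Eφd :=
  (H.coModel hB hGNS hDh).compatTriple.flipU (H.coModel hB hGNS hDh).U

theorem isCPMU_W : IsCPMU H.base (H.W hB hGNS hDh) := (H.model hB hGNS hDh).isCPMU

theorem isRegular_W : IsRegular (H.W hB hGNS hDh) := (H.model hB hGNS hDh).isRegular

theorem isCPMU_V : IsCPMU H.base (H.V hB hGNS hDh) := (H.coModel hB hGNS hDh).isCPMU_flipU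

theorem isRegular_V : IsRegular (H.V hB hGNS hDh) := (H.coModel hB hGNS hDh).isRegular_flipU

theorem isW : H.IsW Dh (H.W hB hGNS hDh) := by
  rintro x y k p q q' ⟨v, hv, hvx, z, hz, hpq⟩ hq
  refine (H.model hB hGNS hDh).U_apply_eq (q := q) hv hvx ?_ fun i => ?_
  · exact (SModEq.sub_mem.2 hpq).trans
      (SModEq.mapTo _ (Core.bal_left (H.rep₁.eq hv hz)) (G.relLeft_mulR1 x))
  · obtain ⟨γ, γ', b, h1, h2, h3⟩ := hq i
    rw [h3]
    exact (G.DHalf_apply h1).trans (G.rExt_apply _ h2)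

/-- After a flip, Δ(x)(1 ⊗ y) is the co-opposite coproduct of x times y ⊗ 1. The arguments x and y
thus exchange their roles, which accounts for the flips in the definition of `V`. -/
theorem isV : H.IsV Dh (H.V hB hGNS hDh) := by
  rintro x y k p p' q ⟨v, hv, hvy, z, hz, hpq⟩ hp
  refine (H.coModel hB hGNS hDh).flipU_apply_eq (q := p) hv hvy ?_ fun i => ?_
  · have := SModEq.mapTo EvAlgebra.τ ((SModEq.sub_mem.2 hpq).trans
      (SModEq.mapTo _ (Core.bal_left (H.rep₂.eq hv hz)) (G.relLeft_mulR2 y))) G.τ_relLeft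
    rw [map_sum, mulR2, EvAlgebra.τ_lTensor] at this
    exact this
  · obtain ⟨γ, γ', b, h1, h2, h3⟩ := hp i
    rw [h3]
    exact (G.co.DHalf_apply (show p i ∈ G.co.gr γ' γ from h1)).trans (G.co.rExt_apply _ h2)

end MeasuredHopf

end DynQG

end

theorem mainTheorem6 {Γ B A : Type*} [Group Γ] [NonUnitalCommRing B] [Module ℂ B]
    [IsScalarTower ℂ B B] [SMulCommClass ℂ B B] [StarRing B] [StarModule ℂ B]
    (hB : ∀ F : Finset B, ∃ u : B, ∀ b ∈ F, u * b = b)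
    (act : Γ →* (B ≃⋆ₐ[ℂ] B))
    [NonUnitalRing A] [Module ℂ A] [IsScalarTower ℂ A A] [SMulCommClass ℂ A A] [StarRing A]
    [StarModule ℂ A]
    (G : DynQG.EvAlgebra act A) (H : DynQG.MeasuredHopf G) (hGNS : H.BoundedGNS)
    (Dh : Γ → DynQG.Mult B) (hDh : H.IsSqrtCocycle Dh) :
    ∃ (W : DynQG.RTP H.Eψd H.Eφd ≃ₗᵢ[ℂ] DynQG.RTP H.Eφd H.Eφ)
      (V : DynQG.RTP H.Eψ H.Eψd ≃ₗᵢ[ℂ] DynQG.RTP H.Eψd H.Eφd),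
      H.IsW Dh W ∧ H.IsV Dh V ∧
      DynQG.IsCPMU H.base W ∧ DynQG.IsCPMU H.base V ∧
      DynQG.imgSp W (DynQG.ketSp₂ H.Eψd H.Eφd H.Eψ) = DynQG.ketSp₂ H.Eφd H.Eφ H.Eψ ∧
      DynQG.imgSp W (DynQG.ketSp₁ H.Eψd H.Eφd H.Eψ) = DynQG.ketSp₁ H.Eφd H.Eφ H.Eψ ∧
      DynQG.IsRegular W ∧ DynQG.IsRegular V := by
  exact ⟨H.W hB hGNS hDh, H.V hB hGNS hDh, H.isW hB hGNS hDh, H.isV hB hGNS hDh,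
    H.isCPMU_W hB hGNS hDh, H.isCPMU_V hB hGNS hDh,
    DynQG.CompatTriple.imgSp_symm (H.model hB hGNS hDh).imgSp_α_ψ,
    DynQG.CompatTriple.imgSp_symm (H.model hB hGNS hDh).imgSp_βh_ψ,
    H.isRegular_W hB hGNS hDh, H.isRegular_V hB hGNS hDh⟩
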